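/- **Setting.** Let $g:[0,\infty)\to\mathbb R$, $G(s)=\int_0^s g$, and assume $(H_1)$: $g\in C^5((0,\infty))\cap C^1([0,\infty))$, $g^{(k)}(s)=o(s^{1-k})$ as $s\to0^+$ for $0\le k\le 4$, $g^{(5)}(s)=O(s^{-4})$, and $g\not\equiv0$ near $0$. For small $\omega>0$ let $\phi_\omega$ be the unique positive even $H^1(\mathbb R)$ solution of $\phi''=\omega\phi-\phi^3-\phi g(\phi^2)$, and put $\varepsilon_\omega=\max_{0\le k\le4}\sup_{0<s\le3\omega}|s^{k-1}g^{(k)}(s)|$. Assume $(H_2)$: $\displaystyle\lim_{\omega\to0^+}\frac1{\varepsilon_\omega^2\sqrt\omega}\int_{\mathbb R}\mathfrak B(\phi_\omega^2)\,dx=+\infty$, where $\mathfrak B(s)=-3g(s)+sg'(s)+4G(s)/s$. Define $Q_\omega$ by $\phi_\omega(x)=\sqrt\omega\,Q_\omega(\sqrt\omega x)$, let $Q(y)=\sqrt2/\cosh y$, and set $$a_\omega^+=\frac{g(\omega Q_\omega^2)}\omega-2\frac{G(\omega Q_\omega^2)}{\omega^2Q_\omega^2},\qquad a_\omega^-=5\frac{g(\omega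 Q_\omega^2)}\omega-6\frac{G(\omega Q_\omega^2)}{\omega^2Q_\omega^2}-2Q_\omega^2g'(\omega Q_\omega^2),$$ $M_\pm=-\partial_y^2+1+a_\omega^\pm$, $L_+=-\partial_y^2+1-3Q_\omega^2-\frac{g(\omega Q_\omega^2)}\omega-2Q_\omega^2g'(\omega Q_\omega^2)$, $L_-=-\partial_y^2+1-Q_\omega^2-\frac{g(\omega Q_\omega^2)}\omega$, $S^*f=-\frac1{Q_\omega}(Q_\omega f)'$, $I_\omega=-\int_{\mathbb R}(a_\omega^++a_\omega^-)\,dy$, $\varrho_\omega=\varepsilon_\omega^2/I_\omega$. Call an integer $N\ge4$ *admissible* if $g\in C^N((0,\infty))$ and, for each $5\le k\le N$, there is a constant $C$ with $|s^{k-1}g^{(k)}(s)|\le C\varepsilon_\omega$ for all small $\omega>0$ and all $0<s\le3\omega$. ($N=4$ is always admissible; for $g(s)=s^\sigma$, $\sigma>1$, every $N$ is.) **Statement.** Under $(H_1)$ and $(H_2)$ there are $\omega_1>0$, a $C^1$ function $\alpha:(0,\omega_1)\to(0,1)$ and real-valued functions $W_1,W_2$ of $y\in\mathbb R$, depending on $\omega\in(0,\omega_1)$,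 such that, with $\lambda=1-\alpha^2$, $\kappa=\sqrt{2-\alpha^2}$, $V_1=(S^*)^2W_1$ and $V_2=\lambda^{-1}L_+V_1$, the following hold for all $\omega\in(0,\omega_1)$, $j\in\{1,2\}$ and $y\in\mathbb R$. The constants $C$ do not depend on $\omega$ and $y$; in the bounds that involve $N$ they may depend on $N$. For every integer $n$ with $g\in C^n((0,\infty))$, the functions $W_j$ are of class $C^{n+1}$ in $y$ (so they are at least $C^6$, and smooth if $g$ is smooth on $(0,\infty)$) and $\partial_\omega W_j$ exists and is of class $C^n$ in $y$. The functions $V_j$ are of class $C^2$ in $y$, $\partial_\omega V_j$ exists and is of class $C^1$ in $y$, and $\omega\mapsto I_\omega$ is differentiable. * *Eigenvalue.* $\alpha(\omega)=\frac{I_\omega}4(1+O(\varrho_\omega))$. * *Spectral problems.* $M_+W_1=\lambda W_2$, $M_-W_2=\lambda W_1$, and $L_+V_1=\lambda V_2$, $L_-V_2=\lambda V_1$. * *Expansions.* $W_j=1+S_j+\widetilde W_j$, $V_1=1-Q^2+R_1+\widetilde V_1$, $V_2=1+R_2+\widetilde V_2$, where $S_j,\widetilde W_j$ have the same regularity as $W_j$,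 $R_j\in C^4$, $\widetilde V_j\in C^2$, $|R_j^{(k)}|\le C\varepsilon_\omega(1+|y|)$ for $0\le k\le4$, $|\widetilde V_j^{(k)}|\le C\varepsilon_\omega^2(1+y^2)$ for $0\le k\le2$, and, for every admissible $N$ and $0\le k\le N+1$, $|S_j^{(k)}|\le C\varepsilon_\omega(1+|y|)$ and $|\widetilde W_j^{(k)}|\le C\varepsilon_\omega^2(1+y^2)$. * *Decay.* $|W_j|+|V_j|\le Ce^{-\alpha|y|}$; $|V_j^{(k)}|\le C(\varepsilon_\omega I_\omega^{k-1}e^{-\alpha|y|}+e^{-|y|})$ for $k\in\{1,2\}$; and, for every admissible $N$, $|W_j^{(k)}|\le C(\varepsilon_\omega I_\omega^{k-1}e^{-\alpha|y|}+\varepsilon_\omega e^{-\kappa|y|})$ for $1\le k\le N+1$ and $|(W_1-W_2)^{(k)}|\le C\varepsilon_\omega e^{-\kappa|y|}$ for $0\le k\le N+1$. * *Asymptotics.* $|W_j-e^{-\alpha|y|}|+|V_1-(1-Q^2)e^{-\alpha|y|}|+|V_2-e^{-\alpha|y|}|\le C\varrho_\omega e^{-\alpha|y|}$; for $y>0$,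 $|W_j'(y)+\alpha e^{-\alpha y}|\le C\varrho_\omega I_\omega e^{-\alpha y}+C\varepsilon_\omega e^{-\kappa y}$; the products $W_1W_2$ and $V_1V_2$ are integrable and $\left|\int_{\mathbb R} W_1W_2\,dy-\frac1\alpha\right|+\left|\int_{\mathbb R} V_1V_2\,dy-\frac1\alpha\right|\le C\frac{\varrho_\omega}{I_\omega}$. * *Derivatives in $\omega$.* $|\omega\alpha'(\omega)|\le C\varepsilon_\omega$ and $\omega|\alpha'(\omega)-\frac14\partial_\omega I_\omega|\le C\varepsilon_\omega^2$. Moreover $|\partial_\omega W_j|\le\frac{C\varepsilon_\omega\varrho_\omega}{\omega I_\omega}(1+|y|)e^{-\alpha|y|}+\frac{C\varepsilon_\omega}\omega(1+|y|)e^{-\kappa|y|}$ and $|\partial_\omega W_j|\le\frac{C\varepsilon_\omega\varrho_\omega}{\omega I_\omega}(1+|y|)e^{-\alpha|y|}$. For every admissible $N$ and $1\le k\le N$, $|\partial_y^k\partial_\omega W_j|\le\frac{C\varepsilon_\omega^k}\omega(1+|y|)e^{-\alpha|y|}+\frac{C\varepsilon_\omega}\omega(1+|y|)e^{-\kappa|y|}$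 and $|\partial_y^k\partial_\omega W_j|\le\frac{C\varepsilon_\omega}\omega(1+|y|)e^{-\alpha|y|}$. Finally $|\partial_\omega V_j|+|\partial_y\partial_\omega V_j|\le\frac C\omega\left(\frac{\varepsilon_\omega\varrho_\omega}{I_\omega}+1\right)(1+|y|)e^{-\alpha|y|}$. -/

import Mathlib

open Set Filter Topology MeasureTheory Asymptotics

namespace InternalMode

noncomputable section

/-- The primitive `G(s) = ∫₀ˢ g`. -/
def primitive (g : ℝ → ℝ) (s : ℝ) : ℝ := ∫ t in (0 : ℝ)..s, g t

/-- Hypothesis `(H₁)`. Only the values of `g` on `[0, ∞)` matter. -/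
structure HypH1 (g : ℝ → ℝ) : Prop where
  contDiffOn_pos : ContDiffOn ℝ 5 g (Ioi 0)
  contDiffOn_nonneg : ContDiffOn ℝ 1 g (Ici 0)
  isLittleO : ∀ k : ℕ, k ≤ 4 →
    (iteratedDeriv k g) =o[𝓝[>] (0 : ℝ)] (fun s : ℝ => s ^ (1 - (k : ℤ)))
  isBigO : (iteratedDeriv 5 g) =O[𝓝[>] (0 : ℝ)] (fun s : ℝ => s ^ (-4 : ℤ))
  not_zero_near_zero : ∃ᶠ s in 𝓝[>] (0 : ℝ), g s ≠ 0

/-- `ε_ω = max_{0 ≤ k ≤ 4} sup_{0 < s ≤ 3ω} |s^{k-1} g^{(k)}(s)|`. Under `(H₁)` the expressions tend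
to `0` as `s → 0⁺`, so that the point `s = 0` does not contribute to the supremum. -/
def eps (g : ℝ → ℝ) (ω : ℝ) : ℝ :=
  ⨆ k : Fin 5, sSup ((fun s : ℝ => |s ^ (((k : ℕ) : ℤ) - 1) * iteratedDeriv (k : ℕ) g s|) ''
    Ioc 0 (3 * ω))

/-- `φ` is a positive even `H¹` solution of `φ'' = ω φ - φ³ - φ g(φ²)`. -/
structure IsSoliton (g : ℝ → ℝ) (ω : ℝ) (φ : ℝ → ℝ) : Prop where
  contDiff : ContDiff ℝ 2 φ
  eqn : ∀ x, iteratedDeriv 2 φ x = ω * φ x - φ x ^ 3 - φ x * g (φ x ^ 2)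
  memLp : MemLp φ 2 volume
  memLp_deriv : MemLp (deriv φ) 2 volume
  pos : ∀ x, 0 < φ x
  even : ∀ x, φ (-x) = φ x

/-- The solitary wave profile `φ_ω`: the positive even `H¹` solution (it is unique for
small `ω > 0`). -/
def soliton (g : ℝ → ℝ) (ω : ℝ) : ℝ → ℝ := Classical.epsilon (IsSoliton g ω)

/-- `𝔅(s) = -3 g(s) + s g'(s) + 4 G(s)/s`. -/
def frakB (g : ℝ → ℝ) (s : ℝ) : ℝ := -3 * g s + s * deriv g s + 4 * (primitive g s / s)

/-- Hypothesis `(H₂)`. -/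
def HypH2 (g : ℝ → ℝ) : Prop :=
  Tendsto (fun ω : ℝ => 1 / (eps g ω ^ 2 * √ω) * ∫ x : ℝ, frakB g (soliton g ω x ^ 2))
    (𝓝[>] 0) atTop

/-- The rescaled soliton `Q_ω`, with `φ_ω(x) = √ω Q_ω(√ω x)`. -/
def solQ (g : ℝ → ℝ) (ω : ℝ) (y : ℝ) : ℝ := soliton g ω (y / √ω) / √ω

/-- `Q = Q₀ = √2 / cosh`, the positive even `H¹` solution of `Q'' = Q - Q³`. -/
def cubicQ (y : ℝ) : ℝ := √2 / Real.cosh y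

/-- `a_ω⁺ = g(ωQ_ω²)/ω - 2 G(ωQ_ω²)/(ω²Q_ω²)`. -/
def aPlus (g : ℝ → ℝ) (ω y : ℝ) : ℝ :=
  g (ω * solQ g ω y ^ 2) / ω
    - 2 * (primitive g (ω * solQ g ω y ^ 2) / (ω ^ 2 * solQ g ω y ^ 2))

/-- `a_ω⁻ = 5 g(ωQ_ω²)/ω - 6 G(ωQ_ω²)/(ω²Q_ω²) - 2 Q_ω² g'(ωQ_ω²)`. -/
def aMinus (g : ℝ → ℝ) (ω y : ℝ) : ℝ :=
  5 * (g (ω * solQ g ω y ^ 2) / ω)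
    - 6 * (primitive g (ω * solQ g ω y ^ 2) / (ω ^ 2 * solQ g ω y ^ 2))
    - 2 * solQ g ω y ^ 2 * deriv g (ω * solQ g ω y ^ 2)

/-- `M₊ = -∂_y² + 1 + a_ω⁺`. -/
def opMPlus (g : ℝ → ℝ) (ω : ℝ) (f : ℝ → ℝ) (y : ℝ) : ℝ :=
  -iteratedDeriv 2 f y + f y + aPlus g ω y * f y

/-- `M₋ = -∂_y² + 1 + a_ω⁻`. -/
def opMMinus (g : ℝ → ℝ) (ω : ℝ) (f : ℝ → ℝ) (y : ℝ) : ℝ :=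
  -iteratedDeriv 2 f y + f y + aMinus g ω y * f y

/-- `L₊ = -∂_y² + 1 - 3Q_ω² - g(ωQ_ω²)/ω - 2Q_ω² g'(ωQ_ω²)`. -/
def opLPlus (g : ℝ → ℝ) (ω : ℝ) (f : ℝ → ℝ) (y : ℝ) : ℝ :=
  -iteratedDeriv 2 f y + f y - 3 * solQ g ω y ^ 2 * f y
    - g (ω * solQ g ω y ^ 2) / ω * f y
    - 2 * solQ g ω y ^ 2 * deriv g (ω * solQ g ω y ^ 2) * f y

/-- `L₋ = -∂_y² + 1 - Q_ω² - g(ωQ_ω²)/ω`. -/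
def opLMinus (g : ℝ → ℝ) (ω : ℝ) (f : ℝ → ℝ) (y : ℝ) : ℝ :=
  -iteratedDeriv 2 f y + f y - solQ g ω y ^ 2 * f y - g (ω * solQ g ω y ^ 2) / ω * f y

/-- `S* = -(1/Q_ω) ∂_y Q_ω`. -/
def opSStar (g : ℝ → ℝ) (ω : ℝ) (f : ℝ → ℝ) (y : ℝ) : ℝ :=
  -(1 / solQ g ω y) * deriv (fun z => solQ g ω z * f z) y

/-- `I_ω = -∫ (a_ω⁺ + a_ω⁻)`. -/
def intI (g : ℝ → ℝ) (ω : ℝ) : ℝ := -∫ y : ℝ, (aPlus g ω y + aMinus g ω y)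

/-- `ϱ_ω = ε_ω² / I_ω`. -/
def rho (g : ℝ → ℝ) (ω : ℝ) : ℝ := eps g ω ^ 2 / intI g ω

/-- `κ = √(2 - α²)`. -/
def kappa (a : ℝ) : ℝ := √(2 - a ^ 2)

/-- `∂_ω F (ω, ·)` for a family `F` of functions of `y` indexed by `ω`. -/
def dOmega (F : ℝ → ℝ → ℝ) (ω : ℝ) (y : ℝ) : ℝ := deriv (fun w => F w y) ω

/-- `g` is of class `C^N` on `(0, ∞)`, and its derivatives of order `5, …, N` are controlled by
`ε_ω` in the same way as those of order `0, …, 4` are by the definition of `ε_ω`. -/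
def ControlledUpTo (g : ℝ → ℝ) (N : ℕ) : Prop :=
  ContDiffOn ℝ N g (Ioi 0) ∧
    ∀ k : ℕ, 5 ≤ k → k ≤ N → ∃ C : ℝ, ∀ᶠ ω in 𝓝[>] (0 : ℝ), ∀ s ∈ Ioc 0 (3 * ω),
      |s ^ ((k : ℤ) - 1) * iteratedDeriv k g s| ≤ C * eps g ω

/-- Order `4` is always available under `(H₁)`. -/
theorem HypH1.controlledUpTo_four {g : ℝ → ℝ} (h : HypH1 g) : ControlledUpTo g 4 :=
  ⟨h.contDiffOn_pos.of_le (by norm_num), fun k h5 h4 => by omega⟩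

end

end InternalMode

open InternalMode

/-!
Write `h = Q_ω'/Q_ω` and `s = ωQ_ω²`. The soliton equation has the first integral `ω(1 - h²) = Γ(s)`
with `Γ(s) = s/2 + G(s)/s`, and `Γ` is invertible near `0`. Hence, with `h = -tanh z`, the function
`s` is `Γ⁻¹(ω/cosh² z)`, and `z` is the inverse function of an explicit primitive `y = Y(ω, z)`. This
identifies the soliton (`sq_eq_sf`), and makes `s` and `h` functions of `(ω, y)` whose derivatives in
both variables are known: `s' = 2hs`, and `ω∂_ω s` is `s` times a function of size `O(1 + |y|)`.

For `P = (W₁ + W₂)/2` and `D = (W₁ - W₂)/2` the spectral problem of `M₊, M₋` is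
`P'' = α²P + bP + cD`, `D'' = κ²D + cP + bD`, where the potentials `b = (a⁺ + a⁻)/2` and
`c = (a⁺ - a⁻)/2` are even and `O(ε e^{-15|y|/8})`. On the half-line the ansatz `P = e^{-αy}p`,
`D = e^{-κy}q` turns the search for even decaying solutions into an equation `Φ(β, u) = 0` (`bifMap`)
between Banach spaces, where `β` is the pair `(b, c)` with a weight and `u` consists of weighted
derivatives of `p` and `q`. The condition `P'(0) = 0` reads `α = p'(0)`, so that `α` is not a separate
unknown. The linearization in `u` at the origin is the identity, and the implicit function theorem
gives a `C²` solution `u = U(β)` (`exists_branch`). The derivative of `α` at the origin is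
`β ↦ -∫₀^∞ b`, that is `I/4`; hence `α = I/4 + O(ε²)`. By `(H₂)` the integral `I` dominates `ε²`,
so that `α > 0` and the solutions do decay (`exists_eigenBranch`). Since `ω ↦ β_ω` is `C¹` with a
derivative of size `O(ε/ω)`, the chain rule gives the derivatives in `ω` with their bounds.

Derivatives in `y` of higher order are estimated through the differential equations, by induction on
the order, in the calculus of uniform bounds `UnifBdd`. Since `P'' = α²P` up to terms that decay like
`e^{-κ|y|}`, each pair of derivatives of the slow component gains a factor `α² = O(I²)`.

The pair `V` is obtained by the identities `V₁ = 2h²W₁ + 2hW₁' - λW₂` and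
`V₂ = 2(1 + a⁺)W₂ + 2hW₂' - λW₁`. They contain no second derivatives, and follow from
`h' = h² - 1 - a⁺` and `(a⁺)' = h(a⁺ - a⁻)`; all statements on `V` follow from those on `W`. Since
`I = O(ε)`, one has `ε = O(ϱ)` and `1 = O(ϱ/I)`, so first-order bounds suffice: in the expansions the
second-order remainders can be taken equal to zero.
-/

namespace InternalMode

noncomputable section

/-! ### The nonlinearity near the origin -/

/-- The scale-invariant derivatives `γ_k(s) = s^{k-1} g^{(k)}(s)`, of which `ε_ω` controls the
first five. -/
def gam (g : ℝ → ℝ) (k : ℕ) (s : ℝ) : ℝ := s ^ ((k : ℤ) - 1) * iteratedDeriv k g s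

/-- The companion `γ_{-1}(s) = G(s)/s²` of the functions `gam g k`. -/
def gamI (g : ℝ → ℝ) (s : ℝ) : ℝ := primitive g s / s ^ 2

theorem hasDerivAt_iteratedDeriv {g : ℝ → ℝ} {k : ℕ} (hg : ContDiffOn ℝ (k + 1 : ℕ) g (Ioi 0))
    {s : ℝ} (hs : 0 < s) : HasDerivAt (iteratedDeriv k g) (iteratedDeriv (k + 1) g s) s := by
  have h1 : DifferentiableOn ℝ (iteratedDerivWithin k g (Ioi 0)) (Ioi 0) :=
    hg.differentiableOn_iteratedDerivWithin (by exact_mod_cast Nat.lt_succ_self k)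
      (uniqueDiffOn_Ioi 0)
  have h2 : DifferentiableOn ℝ (iteratedDeriv k g) (Ioi 0) :=
    h1.congr fun x hx => (iteratedDerivWithin_of_isOpen isOpen_Ioi hx).symm
  rw [iteratedDeriv_succ]
  exact (h2.differentiableAt (Ioi_mem_nhds hs)).hasDerivAt

theorem continuousOn_iteratedDeriv_of_contDiffOn {g : ℝ → ℝ} {k : ℕ}
    (hg : ContDiffOn ℝ k g (Ioi 0)) : ContinuousOn (iteratedDeriv k g) (Ioi 0) :=
  (hg.continuousOn_iteratedDerivWithin le_rfl (uniqueDiffOn_Ioi 0)).congr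
    fun _ hx => (iteratedDerivWithin_of_isOpen isOpen_Ioi hx).symm

theorem continuousOn_gam {g : ℝ → ℝ} {k : ℕ} (hg : ContDiffOn ℝ k g (Ioi 0)) :
    ContinuousOn (gam g k) (Ioi 0) := by
  refine ContinuousOn.mul ?_ (continuousOn_iteratedDeriv_of_contDiffOn hg)
  exact fun x hx => (continuousAt_zpow₀ _ _ (Or.inl (ne_of_gt hx))).continuousWithinAt

theorem hasDerivAt_gam {g : ℝ → ℝ} {k : ℕ} (hg : ContDiffOn ℝ (k + 1 : ℕ) g (Ioi 0))
    {s : ℝ} (hs : 0 < s) :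
    HasDerivAt (gam g k) ((((k : ℝ) - 1) * gam g k s + gam g (k + 1) s) / s) s := by
  have h := (hasDerivAt_zpow ((k : ℤ) - 1) s (Or.inl hs.ne')).mul (hasDerivAt_iteratedDeriv hg hs)
  refine h.congr_deriv ?_
  have e1 : s ^ ((k : ℤ) - 1 - 1) = s ^ ((k : ℤ) - 1) / s := zpow_sub_one₀ hs.ne' _
  have e2 : s ^ (((k + 1 : ℕ) : ℤ) - 1) = s ^ ((k : ℤ) - 1) * s := by
    rw [← zpow_add_one₀ hs.ne']; congr 1; push_cast; ring
  simp only [gam, e2, e1]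
  push_cast
  field_simp

theorem gam_zero (g : ℝ → ℝ) (s : ℝ) : gam g 0 s = g s / s := by
  simp [gam, div_eq_inv_mul]

theorem gam_one (g : ℝ → ℝ) (s : ℝ) : gam g 1 s = deriv g s := by
  simp [gam]

variable {g : ℝ → ℝ}

theorem HypH1.tendsto_gam (h1 : HypH1 g) {k : ℕ} (hk : k ≤ 4) :
    Tendsto (gam g k) (𝓝[>] 0) (𝓝 0) := by
  have h := (h1.isLittleO k hk).tendsto_div_nhds_zero
  refine h.congr' ?_
  filter_upwards [self_mem_nhdsWithin] with s hs
  have hs : (0 : ℝ) < s := hs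
  have : ((k : ℤ) - 1) = -(1 - (k : ℤ)) := by ring
  rw [gam, this, zpow_neg, div_eq_inv_mul]

theorem HypH1.contDiffOn_le (h1 : HypH1 g) {k : ℕ} (hk : k ≤ 5) : ContDiffOn ℝ k g (Ioi 0) :=
  h1.contDiffOn_pos.of_le (by exact_mod_cast hk)

theorem HypH1.bddAbove_gam (h1 : HypH1 g) {k : ℕ} (hk : k ≤ 4) (a : ℝ) :
    BddAbove ((fun s : ℝ => |gam g k s|) '' Ioc 0 a) := by
  have h := (h1.tendsto_gam hk).abs
  rw [abs_zero] at h
  have h := h.eventually (gt_mem_nhds (zero_lt_one))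
  obtain ⟨u, hu, hu'⟩ := mem_nhdsGT_iff_exists_Ioo_subset.1 h
  have hu0 : (0 : ℝ) < u := hu
  have hc : ContinuousOn (fun s => |gam g k s|) (Icc u a) :=
    ((continuousOn_gam (h1.contDiffOn_le (by omega))).mono
      fun x hx => lt_of_lt_of_le hu0 hx.1).abs
  obtain ⟨M, hM⟩ := isCompact_Icc.bddAbove_image hc
  refine ⟨max 1 M, ?_⟩
  rintro _ ⟨s, hs, rfl⟩
  rcases lt_or_ge s u with h | h
  · exact le_max_of_le_left (le_of_lt (hu' ⟨hs.1, h⟩))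
  · exact le_max_of_le_right (hM ⟨s, ⟨h, hs.2⟩, rfl⟩)

theorem eps_eq (g : ℝ → ℝ) (ω : ℝ) :
    eps g ω = ⨆ k : Fin 5, sSup ((fun s : ℝ => |gam g k s|) '' Ioc 0 (3 * ω)) := rfl

theorem HypH1.abs_gam_le (h1 : HypH1 g) {k : ℕ} (hk : k ≤ 4) {ω s : ℝ} (hs : 0 < s)
    (hs' : s ≤ 3 * ω) : |gam g k s| ≤ eps g ω := by
  have h := le_csSup (h1.bddAbove_gam hk (3 * ω)) ⟨s, ⟨hs, hs'⟩, rfl⟩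
  refine h.trans ?_
  rw [eps_eq]
  exact le_ciSup (f := fun k : Fin 5 => sSup ((fun s : ℝ => |gam g k s|) '' Ioc 0 (3 * ω)))
    (Set.finite_range _).bddAbove (⟨k, by omega⟩ : Fin 5)

theorem HypH1.eps_nonneg (h1 : HypH1 g) {ω : ℝ} (hω : 0 < ω) : 0 ≤ eps g ω :=
  (abs_nonneg _).trans (h1.abs_gam_le (k := 0) (by norm_num) hω (by linarith))

theorem HypH1.eps_mono (h1 : HypH1 g) {ω ω' : ℝ} (hω : 0 < ω) (h : ω ≤ ω') :
    eps g ω ≤ eps g ω' := by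
  rw [eps_eq g ω]
  refine ciSup_le fun k => csSup_le ⟨_, ω, ⟨hω, by linarith⟩, rfl⟩ ?_
  rintro _ ⟨s, hs, rfl⟩
  exact h1.abs_gam_le (by omega) hs.1 (hs.2.trans (by linarith))

theorem HypH1.tendsto_eps (h1 : HypH1 g) : Tendsto (eps g) (𝓝[>] 0) (𝓝 0) := by
  rw [Metric.tendsto_nhds]
  intro e he
  have h : ∀ k : Fin 5, ∀ᶠ s in 𝓝[>] (0 : ℝ), |gam g k s| < e / 2 := by
    intro k
    have := (h1.tendsto_gam (k := k) (by omega)).abs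
    rw [abs_zero] at this
    exact this.eventually (gt_mem_nhds (by linarith))
  obtain ⟨u, hu, hu'⟩ := mem_nhdsGT_iff_exists_Ioo_subset.1 (eventually_all.2 h)
  have hu0 : (0 : ℝ) < u := hu
  filter_upwards [Ioo_mem_nhdsGT (show (0 : ℝ) < u / 3 by linarith)] with ω hω
  rw [Real.dist_0_eq_abs, abs_of_nonneg (h1.eps_nonneg hω.1)]
  refine lt_of_le_of_lt ?_ (show e / 2 < e by linarith)
  rw [eps_eq]
  refine ciSup_le fun k => csSup_le ⟨_, ω, ⟨hω.1, by linarith [hω.1]⟩, rfl⟩ ?_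
  rintro _ ⟨s, hs, rfl⟩
  exact (hu' ⟨hs.1, lt_of_le_of_lt hs.2 (by linarith [hω.2])⟩ k).le

theorem HypH1.eps_pos (h1 : HypH1 g) {ω : ℝ} (hω : 0 < ω) : 0 < eps g ω := by
  have h := h1.not_zero_near_zero.and_eventually
    (Ioo_mem_nhdsGT (show (0 : ℝ) < 3 * ω by linarith))
  obtain ⟨s, hs, hs'⟩ := h.exists
  refine lt_of_lt_of_le ?_ (h1.abs_gam_le (k := 0) (by norm_num) hs'.1 hs'.2.le)
  rw [gam_zero, abs_pos]
  exact div_ne_zero hs hs'.1.ne'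

/-- The control of the derivatives of order up to `N` extends from small `ω` to every bounded range
of `ω`, by compactness and because `ε_ω` is positive and nondecreasing. -/
theorem HypH1.exists_abs_gam_le (h1 : HypH1 g) {N : ℕ} (hN : ControlledUpTo g N) (ω₀ : ℝ) :
    ∃ C > 0, ∀ k ≤ N, ∀ ω ∈ Ioo 0 ω₀, ∀ s ∈ Ioc 0 (3 * ω), |gam g k s| ≤ C * eps g ω := by
  have key : ∀ k ≤ N, ∃ C > 0, ∀ ω ∈ Ioo 0 ω₀, ∀ s ∈ Ioc 0 (3 * ω),
      |gam g k s| ≤ C * eps g ω := by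
    intro k hk
    rcases Nat.lt_or_ge k 5 with h5 | h5
    · exact ⟨1, one_pos, fun ω hω s hs => by
        rw [one_mul]; exact h1.abs_gam_le (by omega) hs.1 hs.2⟩
    obtain ⟨C, hC⟩ := hN.2 k h5 hk
    obtain ⟨u, hu, hu'⟩ := mem_nhdsGT_iff_exists_Ioo_subset.1 hC
    have hu0 : (0 : ℝ) < u := hu
    have hg : ContDiffOn ℝ k g (Ioi 0) := hN.1.of_le (by exact_mod_cast hk)
    have hc : ContinuousOn (fun s => |gam g k s|) (Icc (u / 2) (3 * ω₀)) :=
      ((continuousOn_gam hg).mono fun x hx => lt_of_lt_of_le (by positivity) hx.1).abs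
    obtain ⟨M, hM⟩ := isCompact_Icc.bddAbove_image hc
    have he := h1.eps_pos (show 0 < u / 2 by linarith)
    refine ⟨max 1 (max C (|M| / eps g (u / 2))), by positivity, fun ω hω s hs => ?_⟩
    have hew := h1.eps_nonneg hω.1
    rcases lt_or_ge ω u with h | h
    · refine (hu' ⟨hω.1, h⟩ s hs).trans ?_
      exact mul_le_mul_of_nonneg_right ((le_max_left _ _).trans (le_max_right _ _)) hew
    · rcases lt_or_ge s (u / 2) with h' | h'
      · have := hu' (show u / 2 ∈ Ioo 0 u from ⟨by linarith, by linarith⟩) s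
          ⟨hs.1, by linarith⟩
        have hCm : C ≤ max 1 (max C (|M| / eps g (u / 2))) :=
          (le_max_left _ _).trans (le_max_right _ _)
        refine this.trans ((mul_le_mul_of_nonneg_right hCm he.le).trans ?_)
        exact mul_le_mul_of_nonneg_left (h1.eps_mono (by linarith) (by linarith)) (by positivity)
      · have h3 := hM ⟨s, ⟨h', hs.2.trans (by linarith [hω.2])⟩, rfl⟩
        have h4 : eps g (u / 2) ≤ eps g ω := h1.eps_mono (by linarith) (by linarith)
        calc |gam g k s| ≤ |M| := h3.trans (le_abs_self _)
          _ = |M| / eps g (u / 2) * eps g (u / 2) := by field_simp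
          _ ≤ max 1 (max C (|M| / eps g (u / 2))) * eps g ω := by
            refine mul_le_mul ((le_max_right _ _).trans (le_max_right _ _)) h4 he.le
              (by positivity)
  choose! C hC using key
  refine ⟨∑ k ∈ Finset.range (N + 1), C k, ?_, fun k hk ω hω s hs => ?_⟩
  · exact Finset.sum_pos (fun i hi => (hC i (by simpa [Nat.lt_succ_iff] using hi)).1)
      ⟨0, by simp⟩
  · refine ((hC k hk).2 ω hω s hs).trans (mul_le_mul_of_nonneg_right ?_ (h1.eps_nonneg hω.1))
    exact Finset.single_le_sum (f := C)
      (fun i hi => (hC i (by simpa [Nat.lt_succ_iff] using hi)).1.le) (by simp; omega)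

theorem HypH1.continuousOn (h1 : HypH1 g) : ContinuousOn g (Ici 0) :=
  h1.contDiffOn_nonneg.continuousOn

theorem HypH1.intervalIntegrable (h1 : HypH1 g) {a b : ℝ} (ha : 0 ≤ a) (hb : 0 ≤ b) :
    IntervalIntegrable g volume a b :=
  (h1.continuousOn.mono fun _ hx => (le_min ha hb).trans hx.1).intervalIntegrable

theorem HypH1.hasDerivAt_primitive (h1 : HypH1 g) {s : ℝ} (hs : 0 < s) :
    HasDerivAt (primitive g) (g s) s := by
  have hc : ContinuousAt g s := h1.continuousOn.continuousAt (Ici_mem_nhds hs)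
  refine intervalIntegral.integral_hasDerivAt_right (h1.intervalIntegrable le_rfl hs.le) ?_ hc
  exact ContinuousOn.stronglyMeasurableAtFilter isOpen_Ioi
    (h1.continuousOn.mono Ioi_subset_Ici_self) s hs

theorem HypH1.hasDerivAt_gamI (h1 : HypH1 g) {s : ℝ} (hs : 0 < s) :
    HasDerivAt (gamI g) ((gam g 0 s - 2 * gamI g s) / s) s := by
  have h := (h1.hasDerivAt_primitive hs).div (hasDerivAt_pow 2 s) (by positivity)
  refine h.congr_deriv ?_
  rw [gam_zero, gamI]
  field_simp
  push_cast
  ring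

theorem HypH1.abs_gamI_le (h1 : HypH1 g) {ω s : ℝ} (hs : 0 < s) (hs' : s ≤ 3 * ω) :
    |gamI g s| ≤ eps g ω / 2 := by
  have hb : ∀ t ∈ Ioc 0 s, ‖g t‖ ≤ eps g ω * t := by
    intro t ht
    have := h1.abs_gam_le (k := 0) (ω := ω) (by norm_num) ht.1 (ht.2.trans hs')
    rw [gam_zero, abs_div, abs_of_pos ht.1, div_le_iff₀ ht.1] at this
    exact this
  have h2 : |primitive g s| ≤ ∫ t in (0 : ℝ)..s, eps g ω * t := by
    rw [primitive, ← Real.norm_eq_abs]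
    refine intervalIntegral.norm_integral_le_of_norm_le (g := fun t => eps g ω * t) hs.le ?_ ?_
    · exact Filter.Eventually.of_forall fun t ht => hb t ht
    · exact (continuous_const.mul continuous_id :
        Continuous fun t : ℝ => eps g ω * t).intervalIntegrable _ _
  rw [intervalIntegral.integral_const_mul, integral_id] at h2
  rw [gamI, abs_div, abs_of_pos (pow_pos hs 2), div_le_iff₀ (pow_pos hs 2)]
  linarith

/-! ### The change of variable `Γ` -/

/-- `Γ(s) = s/2 + G(s)/s`; along the rescaled soliton, `Q_ω'² = Q_ω² (1 - Γ(ωQ_ω²)/ω)`. -/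
def bigGam (g : ℝ → ℝ) (s : ℝ) : ℝ := s * (1 / 2 + gamI g s)

/-- `Γ'`. -/
def bigGam' (g : ℝ → ℝ) (s : ℝ) : ℝ := 1 / 2 + gam g 0 s - gamI g s

/-- `m = Γ/(sΓ')`, which is close to `1`; the inverse function `ψ` of `Γ` satisfies
`σψ'(σ) = m(ψ)ψ`. -/
def mfun (g : ℝ → ℝ) (s : ℝ) : ℝ := (1 / 2 + gamI g s) / bigGam' g s

/-- `s m'(s)`. -/
def mth (g : ℝ → ℝ) (s : ℝ) : ℝ :=
  ((gam g 0 s - 2 * gamI g s) * bigGam' g s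
    - (1 / 2 + gamI g s) * (gam g 1 s - 2 * gam g 0 s + 2 * gamI g s)) / bigGam' g s ^ 2

/-- The inverse function of `Γ`, with the values in `[σ, 3σ]`; it is meaningful for small `σ > 0`. -/
def psi (g : ℝ → ℝ) (σ : ℝ) : ℝ :=
  Classical.epsilon fun s => s ∈ Icc σ (3 * σ) ∧ bigGam g s = σ

/-- A frequency below which `ε_ω` is small in a fixed quantitative way. -/
structure SmallFreq (g : ℝ → ℝ) (ω₀ : ℝ) : Prop where
  h1 : HypH1 g
  pos : 0 < ω₀
  eps_le : eps g ω₀ ≤ 1 / 128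

theorem HypH1.exists_smallFreq {g : ℝ → ℝ} (h1 : HypH1 g) : ∃ ω₀, SmallFreq g ω₀ := by
  have := (h1.tendsto_eps.eventually (Iic_mem_nhds (show (0 : ℝ) < 1 / 128 by norm_num))).and
    self_mem_nhdsWithin
  obtain ⟨ω, hω, h⟩ := this.exists
  exact ⟨ω, h1, h, hω⟩

namespace SmallFreq

variable {g : ℝ → ℝ} {ω₀ : ℝ}

theorem eps_le' (H : SmallFreq g ω₀) {ω : ℝ} (hω : ω ∈ Ioc 0 ω₀) : eps g ω ≤ 1 / 128 :=
  (H.h1.eps_mono hω.1 hω.2).trans H.eps_le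

theorem gam_le (H : SmallFreq g ω₀) {s : ℝ} (hs : s ∈ Ioc 0 (3 * ω₀)) :
    |gam g 0 s| ≤ 1 / 128 :=
  (H.h1.abs_gam_le (by norm_num) hs.1 hs.2).trans H.eps_le

theorem gamI_le (H : SmallFreq g ω₀) {s : ℝ} (hs : s ∈ Ioc 0 (3 * ω₀)) :
    |gamI g s| ≤ 1 / 256 :=
  (H.h1.abs_gamI_le hs.1 hs.2).trans (by linarith [H.eps_le])

theorem bigGam'_bounds (H : SmallFreq g ω₀) {s : ℝ} (hs : s ∈ Ioc 0 (3 * ω₀)) :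
    48 / 100 ≤ bigGam' g s ∧ bigGam' g s ≤ 52 / 100 := by
  have h1 := abs_le.1 (H.gam_le hs)
  have h2 := abs_le.1 (H.gamI_le hs)
  constructor <;> unfold bigGam' <;> linarith

theorem hasDerivAt_bigGam (H : SmallFreq g ω₀) {s : ℝ} (hs : 0 < s) :
    HasDerivAt (bigGam g) (bigGam' g s) s := by
  refine ((hasDerivAt_id s).mul ((H.h1.hasDerivAt_gamI hs).const_add (1 / 2))).congr_deriv ?_
  simp only [bigGam', id]
  field_simp
  ring

theorem hasDerivAt_bigGam' (H : SmallFreq g ω₀) {s : ℝ} (hs : 0 < s) :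
    HasDerivAt (bigGam' g) ((gam g 1 s - 2 * gam g 0 s + 2 * gamI g s) / s) s := by
  have := ((hasDerivAt_gam (k := 0) (H.h1.contDiffOn_le (by norm_num)) hs).const_add
    (1 / 2)).sub (H.h1.hasDerivAt_gamI hs)
  refine this.congr_deriv ?_
  push_cast
  field_simp
  ring

theorem hasDerivAt_mfun (H : SmallFreq g ω₀) {s : ℝ} (hs : s ∈ Ioc 0 (3 * ω₀)) :
    HasDerivAt (mfun g) (mth g s / s) s := by
  have hB : bigGam' g s ≠ 0 := by linarith [(H.bigGam'_bounds hs).1]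
  have := ((H.h1.hasDerivAt_gamI hs.1).const_add (1 / 2)).div (H.hasDerivAt_bigGam' hs.1) hB
  refine this.congr_deriv ?_
  have := hs.1.ne'
  simp only [mth]
  field_simp

theorem continuousOn_gamI (h1 : HypH1 g) : ContinuousOn (gamI g) (Ioi 0) :=
  fun _ hs => (h1.hasDerivAt_gamI hs).continuousAt.continuousWithinAt

theorem continuousOn_mth (H : SmallFreq g ω₀) : ContinuousOn (mth g) (Ioo 0 (3 * ω₀)) := by
  have c0 := (continuousOn_gam (k := 0) (H.h1.contDiffOn_le (by norm_num))).mono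
    (fun s (h : s ∈ Ioo 0 (3 * ω₀)) => h.1)
  have c1 := (continuousOn_gam (k := 1) (H.h1.contDiffOn_le (by norm_num))).mono
    (fun s (h : s ∈ Ioo 0 (3 * ω₀)) => h.1)
  have cI := (continuousOn_gamI H.h1).mono (fun s (h : s ∈ Ioo 0 (3 * ω₀)) => h.1)
  have cB : ContinuousOn (bigGam' g) (Ioo 0 (3 * ω₀)) := by unfold bigGam'; fun_prop
  unfold mth
  refine ContinuousOn.div (by fun_prop) (by fun_prop) fun s hs => ?_
  have := (H.bigGam'_bounds ⟨hs.1, hs.2.le⟩).1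
  positivity

theorem mfun_sub_one (H : SmallFreq g ω₀) {ω s : ℝ} (hω : ω ≤ ω₀) (hs : s ∈ Ioc 0 (3 * ω)) :
    |mfun g s - 1| ≤ 5 * eps g ω := by
  have hs' : s ∈ Ioc 0 (3 * ω₀) := ⟨hs.1, hs.2.trans (by linarith)⟩
  have hB := H.bigGam'_bounds hs'
  have h1 := H.h1.abs_gam_le (k := 0) (by norm_num) hs.1 hs.2
  have h2 := H.h1.abs_gamI_le hs.1 hs.2
  have e : mfun g s - 1 = (2 * gamI g s - gam g 0 s) / bigGam' g s := by
    have : bigGam' g s ≠ 0 := by linarith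
    rw [mfun]; field_simp; rw [bigGam']; ring
  rw [e, abs_div, abs_of_pos (show 0 < bigGam' g s by linarith), div_le_iff₀ (by linarith)]
  have h3 : |2 * gamI g s - gam g 0 s| ≤ 2 * eps g ω := by
    rw [abs_le] at *; constructor <;> linarith [h1.1, h2.1, h1.2, h2.2]
  have : 0 ≤ eps g ω := (abs_nonneg _).trans h1
  nlinarith

theorem mfun_bounds (H : SmallFreq g ω₀) {s : ℝ} (hs : s ∈ Ioc 0 (3 * ω₀)) :
    96 / 100 ≤ mfun g s ∧ mfun g s ≤ 104 / 100 := by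
  have := abs_le.1 (H.mfun_sub_one le_rfl hs)
  have h := H.eps_le
  constructor <;> linarith

theorem abs_mth_le (H : SmallFreq g ω₀) {ω s : ℝ} (hω : ω ≤ ω₀) (hs : s ∈ Ioc 0 (3 * ω)) :
    |mth g s| ≤ 16 * eps g ω := by
  have hs' : s ∈ Ioc 0 (3 * ω₀) := ⟨hs.1, hs.2.trans (by linarith)⟩
  have hB := H.bigGam'_bounds hs'
  have h0 := H.h1.abs_gam_le (k := 0) (by norm_num) hs.1 hs.2
  have h1 := H.h1.abs_gam_le (k := 1) (by norm_num) hs.1 hs.2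
  have h2 := H.h1.abs_gamI_le hs.1 hs.2
  have hI := abs_le.1 (H.gamI_le hs')
  have he : 0 ≤ eps g ω := (abs_nonneg _).trans h0
  rw [mth, abs_div, abs_of_pos (show 0 < bigGam' g s ^ 2 by nlinarith),
    div_le_iff₀ (by nlinarith)]
  have a1 : |gam g 0 s - 2 * gamI g s| ≤ 2 * eps g ω := by
    rw [abs_le] at *; constructor <;> linarith [h0.1, h2.1, h0.2, h2.2]
  have a2 : |gam g 1 s - 2 * gam g 0 s + 2 * gamI g s| ≤ 4 * eps g ω := by
    rw [abs_le] at *; constructor <;> linarith [h0.1, h2.1, h0.2, h2.2, h1.1, h1.2]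
  have b1 : |(gam g 0 s - 2 * gamI g s) * bigGam' g s| ≤ 2 * eps g ω * (52 / 100) := by
    rw [abs_mul, abs_of_pos (show 0 < bigGam' g s by linarith)]
    exact mul_le_mul a1 hB.2 (by linarith) (by positivity)
  have b2 : |(1 / 2 + gamI g s) * (gam g 1 s - 2 * gam g 0 s + 2 * gamI g s)|
      ≤ (51 / 100) * (4 * eps g ω) := by
    rw [abs_mul, abs_of_pos (show 0 < 1 / 2 + gamI g s by linarith)]
    exact mul_le_mul (by linarith) a2 (abs_nonneg _) (by norm_num)
  have := abs_sub ((gam g 0 s - 2 * gamI g s) * bigGam' g s)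
    ((1 / 2 + gamI g s) * (gam g 1 s - 2 * gam g 0 s + 2 * gamI g s))
  have hsq : (48 / 100 : ℝ) ^ 2 ≤ bigGam' g s ^ 2 := by gcongr; exact hB.1
  nlinarith

theorem bigGam_gap (H : SmallFreq g ω₀) {a b : ℝ} (ha : a ∈ Ioc 0 (3 * ω₀))
    (hb : b ∈ Ioc 0 (3 * ω₀)) (hab : a ≤ b) : (b - a) / 4 ≤ bigGam g b - bigGam g a := by
  have hm : MonotoneOn (fun s => bigGam g s - s / 4) (Ioc 0 (3 * ω₀)) := by
    have hd : ∀ s ∈ Ioc 0 (3 * ω₀), HasDerivAt (fun s => bigGam g s - s / 4)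
        (bigGam' g s - 1 / 4) s := fun s hs =>
      (H.hasDerivAt_bigGam hs.1).sub ((hasDerivAt_id s).div_const 4)
    refine monotoneOn_of_deriv_nonneg (convex_Ioc _ _)
      (fun s hs => (hd s hs).continuousAt.continuousWithinAt)
      (fun s hs => (hd s (interior_subset hs)).differentiableAt.differentiableWithinAt)
      fun s hs => ?_
    rw [(hd s (interior_subset hs)).deriv]
    linarith [(H.bigGam'_bounds (interior_subset hs)).1]
  have := hm ha hb hab
  simp only at this
  linarith

theorem bigGam_injOn (H : SmallFreq g ω₀) : InjOn (bigGam g) (Ioc 0 (3 * ω₀)) := by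
  intro a ha b hb h
  rcases le_total a b with h' | h'
  · linarith [H.bigGam_gap ha hb h']
  · linarith [H.bigGam_gap hb ha h']

theorem psi_spec (H : SmallFreq g ω₀) {σ : ℝ} (hσ : σ ∈ Ioc 0 ω₀) :
    psi g σ ∈ Icc σ (3 * σ) ∧ bigGam g (psi g σ) = σ := by
  refine Classical.epsilon_spec (p := fun s => s ∈ Icc σ (3 * σ) ∧ bigGam g s = σ) ?_
  have hc : ContinuousOn (bigGam g) (Icc σ (3 * σ)) := fun s hs =>
    (H.hasDerivAt_bigGam (hσ.1.trans_le hs.1)).continuousAt.continuousWithinAt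
  have hI1 := abs_le.1 (H.gamI_le (s := σ) ⟨hσ.1, by linarith [hσ.1, hσ.2]⟩)
  have hI3 := abs_le.1 (H.gamI_le (s := 3 * σ) ⟨by linarith [hσ.1], by linarith [hσ.2]⟩)
  have hp := hσ.1
  obtain ⟨s, hs, h⟩ := intermediate_value_Icc (by linarith) hc
    (show σ ∈ Icc (bigGam g σ) (bigGam g (3 * σ)) by
      constructor <;> unfold bigGam <;> nlinarith)
  exact ⟨s, hs, h⟩

theorem psi_mem (H : SmallFreq g ω₀) {σ : ℝ} (hσ : σ ∈ Ioc 0 ω₀) : psi g σ ∈ Ioc 0 (3 * σ) :=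
  ⟨hσ.1.trans_le (H.psi_spec hσ).1.1, (H.psi_spec hσ).1.2⟩

theorem psi_mem' (H : SmallFreq g ω₀) {σ : ℝ} (hσ : σ ∈ Ioc 0 ω₀) : psi g σ ∈ Ioc 0 (3 * ω₀) :=
  ⟨(H.psi_mem hσ).1, (H.psi_mem hσ).2.trans (by linarith [hσ.2])⟩

theorem psi_eq (H : SmallFreq g ω₀) {σ s : ℝ} (hσ : σ ∈ Ioc 0 ω₀) (hs : s ∈ Ioc 0 (3 * ω₀))
    (h : bigGam g s = σ) : psi g σ = s :=
  H.bigGam_injOn (H.psi_mem' hσ) hs ((H.psi_spec hσ).2.trans h.symm)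

theorem continuousOn_psi (H : SmallFreq g ω₀) : ContinuousOn (psi g) (Ioc 0 ω₀) := by
  have : LipschitzOnWith 4 (psi g) (Ioc 0 ω₀) := by
    refine LipschitzOnWith.of_dist_le_mul fun a ha b hb => ?_
    rw [Real.dist_eq, Real.dist_eq]
    have ea := (H.psi_spec ha).2
    have eb := (H.psi_spec hb).2
    push_cast
    rcases le_total (psi g a) (psi g b) with h | h
    · have := H.bigGam_gap (H.psi_mem' ha) (H.psi_mem' hb) h
      rw [abs_of_nonpos (by linarith), abs_of_nonpos (by linarith)]
      linarith
    · have := H.bigGam_gap (H.psi_mem' hb) (H.psi_mem' ha) h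
      rw [abs_of_nonneg (by linarith), abs_of_nonneg (by linarith)]
      linarith
  exact this.continuousOn

theorem hasDerivAt_psi (H : SmallFreq g ω₀) {σ : ℝ} (hσ : σ ∈ Ioo 0 ω₀) :
    HasDerivAt (psi g) (mfun g (psi g σ) * psi g σ / σ) σ := by
  have hσ' : σ ∈ Ioc 0 ω₀ := ⟨hσ.1, hσ.2.le⟩
  have hm := H.psi_mem' hσ'
  have hB := (H.bigGam'_bounds hm).1
  have h := HasDerivAt.of_local_left_inverse (f := bigGam g) (g := psi g) (a := σ)
    ((H.continuousOn_psi).continuousAt (Ioc_mem_nhds hσ.1 hσ.2)) (H.hasDerivAt_bigGam hm.1)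
    (by linarith) (by
      filter_upwards [Ioo_mem_nhds hσ.1 hσ.2] with t ht
      exact (H.psi_spec ⟨ht.1, ht.2.le⟩).2)
  refine h.congr_deriv ?_
  have e := (H.psi_spec hσ').2
  rw [bigGam] at e
  have := hσ.1.ne'
  have : bigGam' g (psi g σ) ≠ 0 := by linarith
  rw [mfun]
  field_simp
  linarith

end SmallFreq

/-! ### Integrals depending on a parameter -/

theorem continuousOn_parametric_primitive {U : Set ℝ} {F : ℝ → ℝ → ℝ}
    (hF : ContinuousOn (fun p : ℝ × ℝ => F p.1 p.2) (U ×ˢ univ)) :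
    ContinuousOn (fun p : ℝ × ℝ => ∫ t in (0 : ℝ)..p.2, F p.1 t) (U ×ˢ univ) := by
  have h1 : Continuous (fun q : U × ℝ => F q.1 q.2) := by
    refine hF.comp_continuous (f := fun q : U × ℝ => ((q.1 : ℝ), q.2)) (by fun_prop) ?_
    exact fun q => ⟨q.1.2, mem_univ _⟩
  have h2 : Continuous fun q : U × ℝ => ∫ t in (0 : ℝ)..q.2, F q.1 t :=
    intervalIntegral.continuous_parametric_intervalIntegral_of_continuous
      (f := fun (q : U × ℝ) t => F q.1 t)
      (h1.comp (f := fun q : (U × ℝ) × ℝ => (q.1.1, q.2)) (by fun_prop)) continuous_snd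
  rw [continuousOn_iff_continuous_domRestrict]
  exact h2.comp (f := fun x : (U ×ˢ (univ : Set ℝ) : Set (ℝ × ℝ)) =>
    ((⟨x.1.1, x.2.1⟩ : U), x.1.2)) (by fun_prop)

theorem continuous_section {U : Set ℝ} {F : ℝ → ℝ → ℝ}
    (hF : ContinuousOn (fun p : ℝ × ℝ => F p.1 p.2) (U ×ˢ univ)) {w : ℝ} (hw : w ∈ U) :
    Continuous (F w) :=
  hF.comp_continuous (f := fun y => (w, y)) (by fun_prop) fun _ => ⟨hw, mem_univ _⟩

theorem hasDerivAt_parametric_primitive {U : Set ℝ} (hU : IsOpen U) {F F' : ℝ → ℝ → ℝ}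
    (hF : ContinuousOn (fun p : ℝ × ℝ => F p.1 p.2) (U ×ˢ univ))
    (hF' : ContinuousOn (fun p : ℝ × ℝ => F' p.1 p.2) (U ×ˢ univ))
    (hd : ∀ w ∈ U, ∀ t, HasDerivAt (fun w => F w t) (F' w t) w) {w : ℝ} (hw : w ∈ U) (z : ℝ) :
    HasDerivAt (fun w => ∫ t in (0 : ℝ)..z, F w t) (∫ t in (0 : ℝ)..z, F' w t) w := by
  obtain ⟨δ, hδ, hδU⟩ := Metric.nhds_basis_closedBall.mem_iff.1 (hU.mem_nhds hw)
  have hK : IsCompact (Metric.closedBall w δ ×ˢ uIcc 0 z) :=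
    (isCompact_closedBall w δ).prod isCompact_uIcc
  obtain ⟨M, hM⟩ := hK.exists_bound_of_continuousOn
    (hF'.mono (prod_mono hδU (subset_univ _)))
  refine (intervalIntegral.hasDerivAt_integral_of_dominated_loc_of_deriv_le
    (μ := volume) (bound := fun _ => M) (s := Metric.closedBall w δ)
    (Metric.closedBall_mem_nhds w hδ) ?_ ?_ ?_ ?_ ?_ ?_).2
  · filter_upwards [hU.mem_nhds hw] with v hv
    exact (continuous_section hF hv).aestronglyMeasurable
  · exact (continuous_section hF hw).intervalIntegrable _ _
  · exact (continuous_section hF' hw).aestronglyMeasurable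
  · exact Filter.Eventually.of_forall fun t ht v hv => hM (v, t) ⟨hv, uIoc_subset_uIcc ht⟩
  · exact intervalIntegrable_const
  · exact Filter.Eventually.of_forall fun t _ v hv => hd v (hδU hv) t

/-- Equality of mixed partial derivatives: if `∂_y u = u₁`, `∂_ω u = v`, `∂_ω u₁ = v₁` and `u₁`, `v₁`
are jointly continuous, then `∂_y v = v₁`. -/
theorem hasDerivAt_swap {U : Set ℝ} (hU : IsOpen U) {u u₁ v v₁ : ℝ → ℝ → ℝ}
    (hu : ∀ w ∈ U, ∀ y, HasDerivAt (u w) (u₁ w y) y)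
    (hv : ∀ w ∈ U, ∀ y, HasDerivAt (fun w => u w y) (v w y) w)
    (hv₁ : ∀ w ∈ U, ∀ y, HasDerivAt (fun w => u₁ w y) (v₁ w y) w)
    (hc : ContinuousOn (fun p : ℝ × ℝ => u₁ p.1 p.2) (U ×ˢ univ))
    (hc' : ContinuousOn (fun p : ℝ × ℝ => v₁ p.1 p.2) (U ×ˢ univ)) {w : ℝ} (hw : w ∈ U) (y : ℝ) :
    HasDerivAt (v w) (v₁ w y) y := by
  have key : ∀ z, v w z = v w 0 + ∫ t in (0 : ℝ)..z, v₁ w t := by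
    intro z
    have h1 := (hv w hw 0).add (hasDerivAt_parametric_primitive hU hc hc' hv₁ hw z)
    have h2 : (fun x => u x z) =ᶠ[𝓝 w] ((fun x => u x 0) + fun x => ∫ t in (0 : ℝ)..z, u₁ x t) := by
      filter_upwards [hU.mem_nhds hw] with x hx
      have := intervalIntegral.integral_eq_sub_of_hasDerivAt (a := 0) (b := z)
        (fun t _ => hu x hx t) ((continuous_section hc hx).intervalIntegrable _ _)
      simp only [Pi.add_apply]
      linarith
    exact (hv w hw z).unique (h1.congr_of_eventuallyEq h2)
  have hcw := continuous_section hc' hw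
  have : HasDerivAt (fun z => v w 0 + ∫ t in (0 : ℝ)..z, v₁ w t) (v₁ w y) y :=
    (intervalIntegral.integral_hasDerivAt_right (hcw.intervalIntegrable _ _)
      hcw.aestronglyMeasurable.stronglyMeasurableAtFilter hcw.continuousAt).const_add _
  exact this.congr_of_eventuallyEq (Filter.Eventually.of_forall key)

theorem hasDerivAt_tanh (x : ℝ) : HasDerivAt Real.tanh (1 - Real.tanh x ^ 2) x := by
  have h := (Real.hasDerivAt_sinh x).div (Real.hasDerivAt_cosh x) (Real.cosh_pos x).ne'
  have e : Real.tanh = fun x => Real.sinh x / Real.cosh x := by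
    ext; exact Real.tanh_eq_sinh_div_cosh _
  rw [e]
  refine h.congr_deriv ?_
  have := (Real.cosh_pos x).ne'
  field_simp

theorem one_sub_tanh_sq (x : ℝ) : 1 - Real.tanh x ^ 2 = 1 / Real.cosh x ^ 2 := by
  rw [Real.tanh_eq_sinh_div_cosh]
  have := (Real.cosh_pos x).ne'
  have := Real.cosh_sq x
  field_simp
  linarith

theorem one_div_cosh_sq_le (x : ℝ) : 1 / Real.cosh x ^ 2 ≤ 4 * Real.exp (-2 * |x|) := by
  have h1 : Real.exp |x| ≤ 2 * Real.cosh x := by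
    rw [← Real.cosh_abs, Real.cosh_eq]
    linarith [Real.exp_pos (-|x|)]
  have h2 : Real.exp (-2 * |x|) = 1 / Real.exp |x| ^ 2 := by
    rw [← Real.exp_nat_mul, one_div, ← Real.exp_neg]; push_cast; ring_nf
  rw [h2, mul_one_div, div_le_div_iff₀ (by have := Real.cosh_pos x; positivity) (by positivity)]
  have : Real.exp |x| ^ 2 ≤ (2 * Real.cosh x) ^ 2 := by gcongr
  linarith

theorem hasDerivAt_one_div_cosh_sq (x : ℝ) :
    HasDerivAt (fun x => 1 / Real.cosh x ^ 2) (-2 * Real.tanh x * (1 / Real.cosh x ^ 2)) x := by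
  have h := ((hasDerivAt_tanh x).pow 2).const_sub 1
  have e : (fun x => 1 / Real.cosh x ^ 2) = fun x => 1 - Real.tanh x ^ 2 := by
    ext; exact (one_sub_tanh_sq _).symm
  rw [e]
  refine h.congr_deriv ?_
  rw [← one_sub_tanh_sq]
  push_cast
  ring

/-! ### The profile of the rescaled soliton -/

/-- The value `ωQ_ω²` at the point where `-Q_ω'/Q_ω = tanh ζ`. -/
def sOf (g : ℝ → ℝ) (ω ζ : ℝ) : ℝ := psi g (ω * (1 / Real.cosh ζ ^ 2))

/-- The position `y` at which `-Q_ω'/Q_ω = tanh z`. -/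
def posY (g : ℝ → ℝ) (ω z : ℝ) : ℝ := ∫ ζ in (0 : ℝ)..z, mfun g (sOf g ω ζ)

/-- `ω∂_ω posY`. -/
def posK (g : ℝ → ℝ) (ω z : ℝ) : ℝ :=
  ∫ ζ in (0 : ℝ)..z, mfun g (sOf g ω ζ) * mth g (sOf g ω ζ)

/-- The inverse function of `posY g ω`, which is a bijection of the line for small `ω > 0`. -/
def zf (g : ℝ → ℝ) (ω y : ℝ) : ℝ := Classical.epsilon fun z => posY g ω z = y

/-- `ωQ_ω(y)²`. -/
def sf (g : ℝ → ℝ) (ω y : ℝ) : ℝ := sOf g ω (zf g ω y)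

/-- `Q_ω'/Q_ω`. -/
def hf (g : ℝ → ℝ) (ω y : ℝ) : ℝ := -Real.tanh (zf g ω y)

/-- The function `J` with `J(0) = 0`, `J' = s m'(s)` at `s = ωQ_ω²`. It measures the defect of
scaling invariance: `ω∂_ω + J∂_y` acts on functions of `ωQ_ω²` as a multiple of `s∂_s`. -/
def jf (g : ℝ → ℝ) (ω y : ℝ) : ℝ := posK g ω (zf g ω y)

namespace SmallFreq

variable {g : ℝ → ℝ} {ω₀ ω : ℝ}

theorem sigma_mem (hω : ω ∈ Ioo 0 ω₀) (ζ : ℝ) : ω * (1 / Real.cosh ζ ^ 2) ∈ Ioc 0 ω := by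
  have h : (1 : ℝ) ≤ Real.cosh ζ ^ 2 := one_le_pow₀ (Real.one_le_cosh ζ)
  have h2 : 1 / Real.cosh ζ ^ 2 ≤ 1 := by rw [div_le_one (by positivity)]; exact h
  refine ⟨mul_pos hω.1 (by positivity), ?_⟩
  nlinarith [hω.1]

theorem sigma_mem' (hω : ω ∈ Ioo 0 ω₀) (ζ : ℝ) : ω * (1 / Real.cosh ζ ^ 2) ∈ Ioo 0 ω₀ :=
  ⟨(sigma_mem hω ζ).1, (sigma_mem hω ζ).2.trans_lt hω.2⟩

theorem sOf_mem (H : SmallFreq g ω₀) (hω : ω ∈ Ioo 0 ω₀) (ζ : ℝ) :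
    sOf g ω ζ ∈ Ioc 0 (3 * ω) := by
  have h1 := sigma_mem hω ζ
  have := H.psi_mem (Ioo_subset_Ioc_self (sigma_mem' hω ζ))
  exact ⟨this.1, this.2.trans (by linarith [h1.2])⟩

theorem sOf_mem' (H : SmallFreq g ω₀) (hω : ω ∈ Ioo 0 ω₀) (ζ : ℝ) :
    sOf g ω ζ ∈ Ioo 0 (3 * ω₀) :=
  ⟨(H.sOf_mem hω ζ).1, (H.sOf_mem hω ζ).2.trans_lt (by linarith [hω.2])⟩

theorem sOf_mem'' (H : SmallFreq g ω₀) (hω : ω ∈ Ioo 0 ω₀) (ζ : ℝ) :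
    sOf g ω ζ ∈ Ioc 0 (3 * ω₀) := Ioo_subset_Ioc_self (H.sOf_mem' hω ζ)

theorem bigGam_sOf (H : SmallFreq g ω₀) (hω : ω ∈ Ioo 0 ω₀) (ζ : ℝ) :
    bigGam g (sOf g ω ζ) = ω * (1 / Real.cosh ζ ^ 2) :=
  (H.psi_spec (Ioo_subset_Ioc_self (sigma_mem' hω ζ))).2

theorem continuousOn_sOf (H : SmallFreq g ω₀) :
    ContinuousOn (fun p : ℝ × ℝ => sOf g p.1 p.2) (Ioo 0 ω₀ ×ˢ univ) := by
  refine H.continuousOn_psi.comp (f := fun p : ℝ × ℝ => p.1 * (1 / Real.cosh p.2 ^ 2)) ?_ ?_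
  · refine Continuous.continuousOn ?_
    refine continuous_fst.mul (continuous_const.div (by fun_prop) fun p => ?_)
    have := Real.cosh_pos p.2
    positivity
  · exact fun p hp => Ioo_subset_Ioc_self (sigma_mem' hp.1 p.2)

theorem continuousOn_mfun (H : SmallFreq g ω₀) : ContinuousOn (mfun g) (Ioo 0 (3 * ω₀)) :=
  fun _ hs => (H.hasDerivAt_mfun (Ioo_subset_Ioc_self hs)).continuousAt.continuousWithinAt

theorem continuousOn_mfun_sOf (H : SmallFreq g ω₀) :
    ContinuousOn (fun p : ℝ × ℝ => mfun g (sOf g p.1 p.2)) (Ioo 0 ω₀ ×ˢ univ) :=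
  H.continuousOn_mfun.comp H.continuousOn_sOf fun p hp => H.sOf_mem' hp.1 p.2

theorem continuousOn_mth_sOf (H : SmallFreq g ω₀) :
    ContinuousOn (fun p : ℝ × ℝ => mth g (sOf g p.1 p.2)) (Ioo 0 ω₀ ×ˢ univ) :=
  H.continuousOn_mth.comp H.continuousOn_sOf fun p hp => H.sOf_mem' hp.1 p.2

theorem hasDerivAt_sOf_left (H : SmallFreq g ω₀) (hω : ω ∈ Ioo 0 ω₀) (ζ : ℝ) :
    HasDerivAt (fun w => sOf g w ζ) (mfun g (sOf g ω ζ) * sOf g ω ζ / ω) ω := by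
  have h := (H.hasDerivAt_psi (sigma_mem' hω ζ)).comp ω
    ((hasDerivAt_id ω).mul_const (1 / Real.cosh ζ ^ 2))
  refine h.congr_deriv ?_
  have := Real.cosh_pos ζ
  have := hω.1.ne'
  simp only [sOf]
  field_simp

theorem hasDerivAt_sOf_right (H : SmallFreq g ω₀) (hω : ω ∈ Ioo 0 ω₀) (ζ : ℝ) :
    HasDerivAt (sOf g ω) (-2 * Real.tanh ζ * (mfun g (sOf g ω ζ) * sOf g ω ζ)) ζ := by
  have h := (H.hasDerivAt_psi (sigma_mem' hω ζ)).comp ζ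
    ((hasDerivAt_one_div_cosh_sq ζ).const_mul ω)
  refine h.congr_deriv ?_
  have := Real.cosh_pos ζ
  have := hω.1.ne'
  simp only [sOf]
  field_simp

theorem hasDerivAt_posY_left (H : SmallFreq g ω₀) (hω : ω ∈ Ioo 0 ω₀) (z : ℝ) :
    HasDerivAt (fun w => posY g w z) (posK g ω z / ω) ω := by
  have hc : ContinuousOn (fun p : ℝ × ℝ => mfun g (sOf g p.1 p.2) * mth g (sOf g p.1 p.2) / p.1)
      (Ioo 0 ω₀ ×ˢ univ) := by
    refine (H.continuousOn_mfun_sOf.mul H.continuousOn_mth_sOf).div continuousOn_fst ?_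
    exact fun p hp => hp.1.1.ne'
  have h := hasDerivAt_parametric_primitive (F := fun w t => mfun g (sOf g w t))
    (F' := fun w t => mfun g (sOf g w t) * mth g (sOf g w t) / w)
    isOpen_Ioo H.continuousOn_mfun_sOf hc
    (fun w hw t => by
      have := (H.hasDerivAt_mfun (H.sOf_mem'' hw t)).comp w (H.hasDerivAt_sOf_left hw t)
      refine this.congr_deriv ?_
      have h1 := (H.sOf_mem hw t).1.ne'
      have h2 := hw.1.ne'
      field_simp) hω z
  refine h.congr_deriv ?_
  rw [intervalIntegral.integral_div, posK]

theorem hasDerivAt_posY_right (H : SmallFreq g ω₀) (hω : ω ∈ Ioo 0 ω₀) (z : ℝ) :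
    HasDerivAt (posY g ω) (mfun g (sOf g ω z)) z := by
  have hc := continuous_section (F := fun w t => mfun g (sOf g w t))
    H.continuousOn_mfun_sOf hω
  exact intervalIntegral.integral_hasDerivAt_right (hc.intervalIntegrable _ _)
      hc.aestronglyMeasurable.stronglyMeasurableAtFilter hc.continuousAt

theorem hasDerivAt_posK_right (H : SmallFreq g ω₀) (hω : ω ∈ Ioo 0 ω₀) (z : ℝ) :
    HasDerivAt (posK g ω) (mfun g (sOf g ω z) * mth g (sOf g ω z)) z := by
  have hc := continuous_section (F := fun w t => mfun g (sOf g w t) * mth g (sOf g w t))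
    (H.continuousOn_mfun_sOf.mul H.continuousOn_mth_sOf) hω
  exact intervalIntegral.integral_hasDerivAt_right (hc.intervalIntegrable _ _)
      hc.aestronglyMeasurable.stronglyMeasurableAtFilter hc.continuousAt

theorem posY_zero : posY g ω 0 = 0 := by simp [posY]

theorem posY_sub_bounds (H : SmallFreq g ω₀) (hω : ω ∈ Ioo 0 ω₀) (z : ℝ) :
    |posY g ω z - z| ≤ 5 * eps g ω * |z| := by
  have hc := continuous_section (F := fun w t => mfun g (sOf g w t))
    H.continuousOn_mfun_sOf hω
  have : posY g ω z - z = ∫ ζ in (0 : ℝ)..z, (mfun g (sOf g ω ζ) - 1) := by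
    rw [intervalIntegral.integral_sub (hc.intervalIntegrable _ _) intervalIntegrable_const]
    simp [posY]
  rw [this]
  have := intervalIntegral.norm_integral_le_of_norm_le_const (a := 0) (b := z)
    (f := fun ζ => mfun g (sOf g ω ζ) - 1) (C := 5 * eps g ω)
    (fun ζ _ => H.mfun_sub_one hω.2.le (H.sOf_mem hω ζ))
  simpa using this

theorem strictMono_posY (H : SmallFreq g ω₀) (hω : ω ∈ Ioo 0 ω₀) : StrictMono (posY g ω) := by
  refine strictMono_of_deriv_pos fun z => ?_
  rw [(H.hasDerivAt_posY_right hω z).deriv]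
  linarith [(H.mfun_bounds (H.sOf_mem'' hω z)).1]

theorem posY_sub_abs (H : SmallFreq g ω₀) (hω : ω ∈ Ioo 0 ω₀) (z : ℝ) :
    |posY g ω z - z| ≤ 4 / 100 * |z| := by
  refine (H.posY_sub_bounds hω z).trans ?_
  have := H.eps_le' (Ioo_subset_Ioc_self hω)
  nlinarith [abs_nonneg z]

theorem exists_posY (H : SmallFreq g ω₀) (hω : ω ∈ Ioo 0 ω₀) (y : ℝ) : ∃ z, posY g ω z = y := by
  have hc : Continuous (posY g ω) :=
    continuous_iff_continuousAt.2 fun z => (H.hasDerivAt_posY_right hω z).continuousAt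
  have h1 := abs_le.1 (H.posY_sub_abs hω (2 * |y|))
  have h2 := abs_le.1 (H.posY_sub_abs hω (-(2 * |y|)))
  rw [abs_neg] at h2
  rw [abs_of_nonneg (by positivity)] at h1 h2
  obtain ⟨z, -, h⟩ := intermediate_value_Icc (a := -(2 * |y|)) (b := 2 * |y|)
    (by linarith [abs_nonneg y]) hc.continuousOn
    (show y ∈ _ by constructor <;> linarith [neg_abs_le y, le_abs_self y, abs_nonneg y])
  exact ⟨z, h⟩

theorem posY_zf (H : SmallFreq g ω₀) (hω : ω ∈ Ioo 0 ω₀) (y : ℝ) : posY g ω (zf g ω y) = y :=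
  Classical.epsilon_spec (H.exists_posY hω y)

theorem zf_unique (H : SmallFreq g ω₀) (hω : ω ∈ Ioo 0 ω₀) {y z : ℝ} (h : posY g ω z = y) :
    zf g ω y = z :=
  (H.strictMono_posY hω).injective ((H.posY_zf hω y).trans h.symm)

end SmallFreq

namespace SmallFreq

variable {g : ℝ → ℝ} {ω₀ ω : ℝ}

theorem continuousOn_posK (H : SmallFreq g ω₀) :
    ContinuousOn (fun p : ℝ × ℝ => posK g p.1 p.2) (Ioo 0 ω₀ ×ˢ univ) :=
  continuousOn_parametric_primitive (F := fun w t => mfun g (sOf g w t) * mth g (sOf g w t))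
    (H.continuousOn_mfun_sOf.mul H.continuousOn_mth_sOf)

theorem hasStrictFDerivAt_posY (H : SmallFreq g ω₀) (hω : ω ∈ Ioo 0 ω₀) (z : ℝ) :
    HasStrictFDerivAt (fun p : ℝ × ℝ => posY g p.1 p.2)
      ((ContinuousLinearMap.toSpanSingleton ℝ (posK g ω z / ω)).coprod
        (ContinuousLinearMap.toSpanSingleton ℝ (mfun g (sOf g ω z)))) (ω, z) := by
  have ho : IsOpen (Ioo 0 ω₀ ×ˢ (univ : Set ℝ)) := isOpen_Ioo.prod isOpen_univ
  have hmem : Ioo 0 ω₀ ×ˢ (univ : Set ℝ) ∈ 𝓝 (ω, z) := ho.mem_nhds ⟨hω, mem_univ _⟩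
  have hs : ∀ c : ℝ → ℝ → ℝ, ContinuousAt (fun p : ℝ × ℝ => c p.1 p.2) (ω, z) →
      ContinuousAt (fun p : ℝ × ℝ => ContinuousLinearMap.toSpanSingleton ℝ (c p.1 p.2)) (ω, z) :=
    fun c hc => (ContinuousLinearMap.toSpanSingletonCLE (𝕜 := ℝ) (E := ℝ)).continuous.continuousAt.comp
      (f := fun p : ℝ × ℝ => c p.1 p.2) hc
  refine hasStrictFDerivAt_uncurry_coprod (𝕜 := ℝ) (f := posY g) (u := (ω, z))
    (f₁ := fun w z => ContinuousLinearMap.toSpanSingleton ℝ (posK g w z / w))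
    (f₂ := fun w z => ContinuousLinearMap.toSpanSingleton ℝ (mfun g (sOf g w z))) ?_ ?_ ?_ ?_
  · filter_upwards [hmem] with v hv
    exact (H.hasDerivAt_posY_left hv.1 v.2).hasFDerivAt
  · filter_upwards [hmem] with v hv
    exact (H.hasDerivAt_posY_right hv.1 v.2).hasFDerivAt
  · refine hs (fun w z => posK g w z / w) ?_
    exact ((H.continuousOn_posK.continuousAt hmem)).div continuousAt_fst hω.1.ne'
  · exact hs (fun w z => mfun g (sOf g w z)) (H.continuousOn_mfun_sOf.continuousAt hmem)

/-- By the implicit function theorem, applied to `posY g w z = y`. -/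
theorem differentiableAt_zf (H : SmallFreq g ω₀) (hω : ω ∈ Ioo 0 ω₀) (y : ℝ) :
    DifferentiableAt ℝ (fun p : ℝ × ℝ => zf g p.1 p.2) (ω, y) := by
  set z := zf g ω y with hz
  have h0 := H.hasStrictFDerivAt_posY hω z
  have h1 : HasStrictFDerivAt (fun q : (ℝ × ℝ) × ℝ => (q.1.1, q.2))
      ((((ContinuousLinearMap.fst ℝ ℝ ℝ).comp (ContinuousLinearMap.fst ℝ (ℝ × ℝ) ℝ)).prod
        (ContinuousLinearMap.snd ℝ (ℝ × ℝ) ℝ))) ((ω, y), z) :=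
    ContinuousLinearMap.hasStrictFDerivAt
      (((ContinuousLinearMap.fst ℝ ℝ ℝ).comp (ContinuousLinearMap.fst ℝ (ℝ × ℝ) ℝ)).prod
        (ContinuousLinearMap.snd ℝ (ℝ × ℝ) ℝ))
  have h2 : HasStrictFDerivAt (fun q : (ℝ × ℝ) × ℝ => q.1.2)
      ((ContinuousLinearMap.snd ℝ ℝ ℝ).comp (ContinuousLinearMap.fst ℝ (ℝ × ℝ) ℝ)) ((ω, y), z) :=
    ContinuousLinearMap.hasStrictFDerivAt
      ((ContinuousLinearMap.snd ℝ ℝ ℝ).comp (ContinuousLinearMap.fst ℝ (ℝ × ℝ) ℝ))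
  have h3 := (HasStrictFDerivAt.comp (x := ((ω, y), z))
    (g := fun p : ℝ × ℝ => posY g p.1 p.2) (f := fun q : (ℝ × ℝ) × ℝ => (q.1.1, q.2)) h0 h1).sub h2
  have hm : mfun g (sOf g ω z) ≠ 0 := by linarith [(H.mfun_bounds (H.sOf_mem'' hω z)).1]
  have hinv : ((((ContinuousLinearMap.toSpanSingleton ℝ (posK g ω z / ω)).coprod
      (ContinuousLinearMap.toSpanSingleton ℝ (mfun g (sOf g ω z)))).comp
      (((ContinuousLinearMap.fst ℝ ℝ ℝ).comp (ContinuousLinearMap.fst ℝ (ℝ × ℝ) ℝ)).prod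
        (ContinuousLinearMap.snd ℝ (ℝ × ℝ) ℝ)) -
      (ContinuousLinearMap.snd ℝ ℝ ℝ).comp (ContinuousLinearMap.fst ℝ (ℝ × ℝ) ℝ)).comp
      (ContinuousLinearMap.inr ℝ (ℝ × ℝ) ℝ)).IsInvertible :=
    ⟨ContinuousLinearEquiv.unitsEquivAut ℝ (Units.mk0 _ hm), by ext; simp⟩
  have h4 := h3.eventually_apply_implicitFunctionOfProdDomain hinv
  have h5 := (h3.hasStrictFDerivAt_implicitFunctionOfProdDomain hinv).hasFDerivAt.differentiableAt
  refine h5.congr_of_eventuallyEq ?_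
  have hmem : Ioo 0 ω₀ ×ˢ (univ : Set ℝ) ∈ 𝓝 (ω, y) :=
    (isOpen_Ioo.prod isOpen_univ).mem_nhds ⟨hω, mem_univ _⟩
  filter_upwards [h4, hmem] with p hp hp'
  refine H.zf_unique hp'.1 ?_
  have h6 : posY g ω z - y = 0 := by rw [hz, H.posY_zf hω, sub_self]
  simp only [Pi.sub_apply] at hp
  rw [h6] at hp
  linarith

theorem hasDerivAt_zf (H : SmallFreq g ω₀) (hω : ω ∈ Ioo 0 ω₀) (y : ℝ) :
    HasDerivAt (zf g ω) (1 / mfun g (sf g ω y)) y := by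
  have hd : DifferentiableAt ℝ (zf g ω) y :=
    (H.differentiableAt_zf hω y).comp (f := fun y => (ω, y)) y (by fun_prop)
  have h1 := (H.hasDerivAt_posY_right hω (zf g ω y)).comp y hd.hasDerivAt
  have h2 : posY g ω ∘ zf g ω = id := by ext y; exact H.posY_zf hω y
  rw [h2] at h1
  have h3 := h1.unique (hasDerivAt_id y)
  have hm : mfun g (sOf g ω (zf g ω y)) ≠ 0 := by
    linarith [(H.mfun_bounds (H.sOf_mem'' hω (zf g ω y))).1]
  refine hd.hasDerivAt.congr_deriv ?_
  rw [sf, eq_div_iff hm]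
  linarith

theorem hasDerivAt_zf_omega (H : SmallFreq g ω₀) (hω : ω ∈ Ioo 0 ω₀) (y : ℝ) :
    HasDerivAt (fun w => zf g w y) (-(jf g ω y / (mfun g (sf g ω y) * ω))) ω := by
  have hd : DifferentiableAt ℝ (fun w => zf g w y) ω :=
    (H.differentiableAt_zf hω y).comp (f := fun w => (w, y)) ω (by fun_prop)
  have h1 := (H.hasStrictFDerivAt_posY hω (zf g ω y)).hasFDerivAt.comp_hasDerivAt
    (f := fun w => (w, zf g w y)) ω ((hasDerivAt_id ω).prodMk hd.hasDerivAt)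
  have h2 : (fun _ => y) =ᶠ[𝓝 ω] ((fun p : ℝ × ℝ => posY g p.1 p.2) ∘ fun w => (w, zf g w y)) := by
    filter_upwards [isOpen_Ioo.mem_nhds hω] with w hw
    exact (H.posY_zf hw y).symm
  have h3 := (h1.congr_of_eventuallyEq h2).unique (hasDerivAt_const ω y)
  have hm : mfun g (sOf g ω (zf g ω y)) ≠ 0 := by
    linarith [(H.mfun_bounds (H.sOf_mem'' hω (zf g ω y))).1]
  have hw := hω.1.ne'
  refine hd.hasDerivAt.congr_deriv ?_
  simp at h3
  rw [sf, jf]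
  field_simp at h3 ⊢
  linarith

theorem continuousOn_zf (H : SmallFreq g ω₀) :
    ContinuousOn (fun p : ℝ × ℝ => zf g p.1 p.2) (Ioo 0 ω₀ ×ˢ univ) :=
  fun p hp => (H.differentiableAt_zf hp.1 p.2).continuousAt.continuousWithinAt

theorem continuousOn_hf (H : SmallFreq g ω₀) :
    ContinuousOn (fun p : ℝ × ℝ => hf g p.1 p.2) (Ioo 0 ω₀ ×ˢ univ) := by
  have : Continuous Real.tanh :=
    continuous_iff_continuousAt.2 fun x => (hasDerivAt_tanh x).continuousAt
  exact (this.comp_continuousOn H.continuousOn_zf).neg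

theorem continuousOn_pair (H : SmallFreq g ω₀) {F : ℝ → ℝ → ℝ}
    (hF : ContinuousOn (fun p : ℝ × ℝ => F p.1 p.2) (Ioo 0 ω₀ ×ˢ univ)) :
    ContinuousOn (fun p : ℝ × ℝ => F p.1 (zf g p.1 p.2)) (Ioo 0 ω₀ ×ˢ univ) :=
  hF.comp (f := fun p : ℝ × ℝ => (p.1, zf g p.1 p.2)) (continuousOn_fst.prodMk H.continuousOn_zf)
    fun _ hp => ⟨hp.1, mem_univ _⟩

theorem continuousOn_sf (H : SmallFreq g ω₀) :
    ContinuousOn (fun p : ℝ × ℝ => sf g p.1 p.2) (Ioo 0 ω₀ ×ˢ univ) :=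
  H.continuousOn_pair (F := sOf g) H.continuousOn_sOf

theorem continuousOn_jf (H : SmallFreq g ω₀) :
    ContinuousOn (fun p : ℝ × ℝ => jf g p.1 p.2) (Ioo 0 ω₀ ×ˢ univ) :=
  H.continuousOn_pair (F := posK g) H.continuousOn_posK

theorem sf_mem (H : SmallFreq g ω₀) (hω : ω ∈ Ioo 0 ω₀) (y : ℝ) : sf g ω y ∈ Ioc 0 (3 * ω) :=
  H.sOf_mem hω _

theorem sf_mem' (H : SmallFreq g ω₀) (hω : ω ∈ Ioo 0 ω₀) (y : ℝ) :
    sf g ω y ∈ Ioo 0 (3 * ω₀) := H.sOf_mem' hω _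

theorem sf_mem'' (H : SmallFreq g ω₀) (hω : ω ∈ Ioo 0 ω₀) (y : ℝ) :
    sf g ω y ∈ Ioc 0 (3 * ω₀) := H.sOf_mem'' hω _

theorem bigGam_sf (H : SmallFreq g ω₀) (hω : ω ∈ Ioo 0 ω₀) (y : ℝ) :
    bigGam g (sf g ω y) = ω * (1 - hf g ω y ^ 2) := by
  rw [sf, H.bigGam_sOf hω, hf, neg_sq, one_sub_tanh_sq]

theorem hf_sq (H : SmallFreq g ω₀) (hω : ω ∈ Ioo 0 ω₀) (y : ℝ) :
    hf g ω y ^ 2 = 1 - sf g ω y / ω * (1 / 2 + gamI g (sf g ω y)) := by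
  have := H.bigGam_sf hω y
  have hw := hω.1.ne'
  rw [bigGam] at this
  field_simp
  linarith

/-- `h' = -ω⁻¹ s Γ'(s)`. -/
theorem hasDerivAt_hf (H : SmallFreq g ω₀) (hω : ω ∈ Ioo 0 ω₀) (y : ℝ) :
    HasDerivAt (hf g ω) (-(sf g ω y / ω * bigGam' g (sf g ω y))) y := by
  have h := ((hasDerivAt_tanh (zf g ω y)).comp y (H.hasDerivAt_zf hω y)).neg
  refine h.congr_deriv ?_
  have hs := H.hf_sq hω y
  rw [hf, neg_sq] at hs
  have hw := hω.1.ne'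
  have hB : bigGam' g (sf g ω y) ≠ 0 := by linarith [(H.bigGam'_bounds (H.sf_mem'' hω y)).1]
  have hI : 1 / 2 + gamI g (sf g ω y) ≠ 0 := by
    linarith [(abs_le.1 (H.gamI_le (H.sf_mem'' hω y))).1]
  rw [hs, mfun]
  generalize 1 / 2 + gamI g (sf g ω y) = I at hI ⊢
  field_simp
  ring

theorem hasDerivAt_sf (H : SmallFreq g ω₀) (hω : ω ∈ Ioo 0 ω₀) (y : ℝ) :
    HasDerivAt (sf g ω) (2 * hf g ω y * sf g ω y) y := by
  have h := (H.hasDerivAt_sOf_right hω (zf g ω y)).comp y (H.hasDerivAt_zf hω y)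
  refine h.congr_deriv ?_
  have hm : mfun g (sOf g ω (zf g ω y)) ≠ 0 := by
    linarith [(H.mfun_bounds (H.sOf_mem'' hω (zf g ω y))).1]
  rw [sf, hf]
  field_simp

theorem hasDerivAt_jf (H : SmallFreq g ω₀) (hω : ω ∈ Ioo 0 ω₀) (y : ℝ) :
    HasDerivAt (jf g ω) (mth g (sf g ω y)) y := by
  have h := (H.hasDerivAt_posK_right hω (zf g ω y)).comp y (H.hasDerivAt_zf hω y)
  refine h.congr_deriv ?_
  have hm : mfun g (sOf g ω (zf g ω y)) ≠ 0 := by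
    linarith [(H.mfun_bounds (H.sOf_mem'' hω (zf g ω y))).1]
  rw [sf]
  field_simp

theorem hasDerivAt_hf_omega (H : SmallFreq g ω₀) (hω : ω ∈ Ioo 0 ω₀) (y : ℝ) :
    HasDerivAt (fun w => hf g w y) (sf g ω y / ω * bigGam' g (sf g ω y) * jf g ω y / ω) ω := by
  have h := ((hasDerivAt_tanh (zf g ω y)).comp ω (H.hasDerivAt_zf_omega hω y)).neg
  refine h.congr_deriv ?_
  have hs := H.hf_sq hω y
  rw [hf, neg_sq] at hs
  have hw := hω.1.ne'
  have hB : bigGam' g (sf g ω y) ≠ 0 := by linarith [(H.bigGam'_bounds (H.sf_mem'' hω y)).1]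
  have hI : 1 / 2 + gamI g (sf g ω y) ≠ 0 := by
    linarith [(abs_le.1 (H.gamI_le (H.sf_mem'' hω y))).1]
  rw [hs, mfun]
  generalize 1 / 2 + gamI g (sf g ω y) = I at hI ⊢
  field_simp
  ring

theorem hasFDerivAt_sOf (H : SmallFreq g ω₀) (hω : ω ∈ Ioo 0 ω₀) (z : ℝ) :
    HasFDerivAt (fun p : ℝ × ℝ => sOf g p.1 p.2)
      ((ContinuousLinearMap.toSpanSingleton ℝ (mfun g (sOf g ω z) * sOf g ω z / ω)).coprod
        (ContinuousLinearMap.toSpanSingleton ℝ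
          (-2 * Real.tanh z * (mfun g (sOf g ω z) * sOf g ω z)))) (ω, z) := by
  have hsnd : HasFDerivAt (Prod.snd : ℝ × ℝ → ℝ) (ContinuousLinearMap.snd ℝ ℝ ℝ) (ω, z) :=
    hasFDerivAt_snd
  have h1 : HasFDerivAt (fun p : ℝ × ℝ => p.1 * (1 / Real.cosh p.2 ^ 2)) _ (ω, z) :=
    (hasFDerivAt_fst (p := (ω, z))).mul
    (HasDerivAt.comp_hasFDerivAt (h₂ := fun x => 1 / Real.cosh x ^ 2) (f := Prod.snd) (ω, z)
      (hasDerivAt_one_div_cosh_sq z) hsnd)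
  refine ((H.hasDerivAt_psi (sigma_mem' hω z)).comp_hasFDerivAt (ω, z) h1).congr_fderiv ?_
  have := Real.cosh_pos z
  have := hω.1.ne'
  ext <;> simp [sOf] <;> field_simp

theorem hasDerivAt_sf_omega (H : SmallFreq g ω₀) (hω : ω ∈ Ioo 0 ω₀) (y : ℝ) :
    HasDerivAt (fun w => sf g w y)
      ((mfun g (sf g ω y) - 2 * hf g ω y * jf g ω y) * sf g ω y / ω) ω := by
  have h := (H.hasFDerivAt_sOf hω (zf g ω y)).comp_hasDerivAt (f := fun w => (w, zf g w y)) ω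
    ((hasDerivAt_id ω).prodMk (H.hasDerivAt_zf_omega hω y))
  refine h.congr_deriv ?_
  have hm : mfun g (sOf g ω (zf g ω y)) ≠ 0 := by
    linarith [(H.mfun_bounds (H.sOf_mem'' hω (zf g ω y))).1]
  have hw := hω.1.ne'
  simp only [sf, hf]
  simp
  field_simp

/-! ### Parity and size of the profile -/

theorem sOf_neg (g : ℝ → ℝ) (ω ζ : ℝ) : sOf g ω (-ζ) = sOf g ω ζ := by simp [sOf]

theorem posY_neg (g : ℝ → ℝ) (ω z : ℝ) : posY g ω (-z) = -posY g ω z := by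
  have := intervalIntegral.integral_comp_neg (a := 0) (b := z) (fun ζ => mfun g (sOf g ω ζ))
  simp only [sOf_neg, neg_zero] at this
  rw [posY, posY, intervalIntegral.integral_symm, ← this]

theorem zf_neg (H : SmallFreq g ω₀) (hω : ω ∈ Ioo 0 ω₀) (y : ℝ) : zf g ω (-y) = -zf g ω y :=
  H.zf_unique hω (by rw [posY_neg, H.posY_zf hω])

theorem sf_neg (H : SmallFreq g ω₀) (hω : ω ∈ Ioo 0 ω₀) (y : ℝ) : sf g ω (-y) = sf g ω y := by
  rw [sf, H.zf_neg hω, sOf_neg, sf]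

theorem hf_neg (H : SmallFreq g ω₀) (hω : ω ∈ Ioo 0 ω₀) (y : ℝ) : hf g ω (-y) = -hf g ω y := by
  rw [hf, H.zf_neg hω, Real.tanh_neg, hf]

theorem abs_hf_le (g : ℝ → ℝ) (ω y : ℝ) : |hf g ω y| ≤ 1 := by
  rw [hf, abs_neg]; exact (Real.abs_tanh_lt_one _).le

theorem zf_bounds (H : SmallFreq g ω₀) (hω : ω ∈ Ioo 0 ω₀) (y : ℝ) :
    |y| ≤ 104 / 100 * |zf g ω y| ∧ |zf g ω y| ≤ 105 / 100 * |y| := by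
  have h := H.posY_sub_abs hω (zf g ω y)
  rw [H.posY_zf hω] at h
  have h1 := abs_sub_abs_le_abs_sub y (zf g ω y)
  have h2 := abs_sub_abs_le_abs_sub (zf g ω y) y
  rw [abs_sub_comm] at h2
  have := abs_nonneg y
  constructor <;> linarith

theorem zf_sub_le (H : SmallFreq g ω₀) (hω : ω ∈ Ioo 0 ω₀) (y : ℝ) :
    |zf g ω y - y| ≤ 6 * eps g ω * |y| := by
  have h := H.posY_sub_bounds hω (zf g ω y)
  rw [H.posY_zf hω, abs_sub_comm] at h
  have h2 := (H.zf_bounds hω y).2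
  have he := H.h1.eps_nonneg hω.1
  have : 5 * eps g ω * |zf g ω y| ≤ 5 * eps g ω * (105 / 100 * |y|) := by gcongr
  nlinarith [mul_nonneg he (abs_nonneg y)]

theorem sf_le (H : SmallFreq g ω₀) (hω : ω ∈ Ioo 0 ω₀) (y : ℝ) :
    sf g ω y / ω ≤ 12 * Real.exp (-(15 / 8) * |y|) := by
  have h1 := H.psi_mem (Ioo_subset_Ioc_self (sigma_mem' hω (zf g ω y)))
  have h2 := one_div_cosh_sq_le (zf g ω y)
  have h3 : Real.exp (-2 * |zf g ω y|) ≤ Real.exp (-(15 / 8) * |y|) := by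
    apply Real.exp_le_exp.2
    have := (H.zf_bounds hω y).1
    linarith [abs_nonneg (zf g ω y)]
  rw [div_le_iff₀ hω.1]
  have h4 : sf g ω y ≤ 3 * (ω * (1 / Real.cosh (zf g ω y) ^ 2)) := h1.2
  have h5 : ω * (1 / Real.cosh (zf g ω y) ^ 2) ≤ ω * (4 * Real.exp (-(15 / 8) * |y|)) :=
    mul_le_mul_of_nonneg_left (by linarith) hω.1.le
  linarith

theorem abs_jf_le (H : SmallFreq g ω₀) (hω : ω ∈ Ioo 0 ω₀) (y : ℝ) :
    |jf g ω y| ≤ 18 * eps g ω * |y| := by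
  have he := H.h1.eps_nonneg hω.1
  have h := intervalIntegral.norm_integral_le_of_norm_le_const (a := 0) (b := zf g ω y)
    (f := fun ζ => mfun g (sOf g ω ζ) * mth g (sOf g ω ζ))
    (C := 104 / 100 * (16 * eps g ω))
    (fun ζ _ => by
      have hm := H.mfun_bounds (H.sOf_mem'' hω ζ)
      rw [norm_mul, Real.norm_eq_abs, Real.norm_eq_abs, abs_of_pos (by linarith)]
      exact mul_le_mul hm.2 (H.abs_mth_le hω.2.le (H.sOf_mem hω ζ)) (abs_nonneg _) (by norm_num))
  rw [sub_zero, Real.norm_eq_abs] at h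
  refine h.trans ?_
  have h2 := (H.zf_bounds hω y).2
  have : 104 / 100 * (16 * eps g ω) * |zf g ω y|
    ≤ 104 / 100 * (16 * eps g ω) * (105 / 100 * |y|) := by gcongr
  nlinarith [mul_nonneg he (abs_nonneg y)]

theorem abs_hf_add_tanh_le (H : SmallFreq g ω₀) (hω : ω ∈ Ioo 0 ω₀) (y : ℝ) :
    |hf g ω y + Real.tanh y| ≤ 6 * eps g ω * |y| := by
  refine le_trans ?_ (H.zf_sub_le hω y)
  have := Convex.norm_image_sub_le_of_norm_hasDerivWithin_le (f := Real.tanh) (C := 1) (s := univ)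
    (fun x _ => (hasDerivAt_tanh x).hasDerivWithinAt) (fun x _ => by
      rw [one_sub_tanh_sq, Real.norm_eq_abs, abs_of_nonneg (by positivity),
        div_le_one (by have := Real.cosh_pos x; positivity)]
      exact one_le_pow₀ (Real.one_le_cosh x)) convex_univ (mem_univ y) (mem_univ (zf g ω y))
  rw [hf, one_mul, Real.norm_eq_abs, Real.norm_eq_abs] at *
  rw [neg_add_eq_sub, abs_sub_comm]
  exact this

/-- The difference of the squares is uniformly of size `ε_ω`, although the difference itself is only
known to be of size `ε_ω|y|`: both squares approach `1` exponentially fast. -/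
theorem abs_hf_sq_sub_le (H : SmallFreq g ω₀) (hω : ω ∈ Ioo 0 ω₀) (y : ℝ) :
    |hf g ω y ^ 2 - Real.tanh y ^ 2| ≤ 48 * eps g ω := by
  have hz := H.zf_sub_le hω y
  have hzb := H.zf_bounds hω y
  have he := H.h1.eps_nonneg hω.1
  have key : ∀ y z : ℝ, 0 ≤ y → y / 2 ≤ z →
      |Real.tanh z ^ 2 - Real.tanh y ^ 2| ≤ 8 * Real.exp (-y) * |z - y| := by
    intro y z hy hz
    have := Convex.norm_image_sub_le_of_norm_hasDerivWithin_le
      (f := fun x => Real.tanh x ^ 2) (C := 8 * Real.exp (-y)) (s := Ici (y / 2))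
      (fun x _ => ((hasDerivAt_tanh x).pow 2).hasDerivWithinAt) (fun x hx => ?_) (convex_Ici _)
      (show y ∈ Ici (y / 2) by simp; linarith) (show z ∈ Ici (y / 2) from hz)
    · simpa using this
    · have hx : y / 2 ≤ x := hx
      have h1 := one_div_cosh_sq_le x
      have h2 : Real.exp (-2 * |x|) ≤ Real.exp (-y) := by
        apply Real.exp_le_exp.2
        rw [abs_of_nonneg (by linarith)]; linarith
      rw [one_sub_tanh_sq, norm_mul, norm_mul, Real.norm_eq_abs, Real.norm_eq_abs,
        Real.norm_eq_abs, abs_of_nonneg (show 0 ≤ 1 / Real.cosh x ^ 2 by positivity)]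
      have h3 : |Real.tanh x ^ (2 - 1)| ≤ 1 := by
        simpa using (Real.abs_tanh_lt_one x).le
      norm_num at h3 ⊢
      have h4 : (Real.cosh x ^ 2)⁻¹ ≤ 4 * Real.exp (-y) := by rw [← one_div]; linarith
      have h5 : 0 ≤ (Real.cosh x ^ 2)⁻¹ := by positivity
      nlinarith [abs_nonneg (Real.tanh x)]
  have key2 : |hf g ω |y| ^ 2 - Real.tanh |y| ^ 2| ≤ 48 * eps g ω := by
    have hz := H.zf_sub_le hω |y|
    have hz0 : |y| / 2 ≤ zf g ω |y| := by
      have h := H.eps_le' (Ioo_subset_Ioc_self hω)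
      have := (abs_le.1 hz).1
      rw [abs_abs] at this
      nlinarith [abs_nonneg y]
    have h := key |y| (zf g ω |y|) (abs_nonneg y) hz0
    rw [hf, neg_sq]
    refine h.trans ?_
    rw [abs_abs] at hz
    have h1 : Real.exp (-|y|) * |y| ≤ 1 := by
      have := Real.add_one_le_exp |y|
      rw [Real.exp_neg, inv_mul_le_iff₀ (Real.exp_pos _)]
      linarith
    calc 8 * Real.exp (-|y|) * |zf g ω (|y|) - (|y|)|
        ≤ 8 * Real.exp (-|y|) * (6 * eps g ω * |y|) := by gcongr
      _ = 48 * eps g ω * (Real.exp (-|y|) * |y|) := by ring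
      _ ≤ 48 * eps g ω * 1 := by gcongr
      _ = 48 * eps g ω := mul_one _
  rcases abs_choice y with h | h
  · rwa [h] at key2
  · rw [h, H.hf_neg hω, Real.tanh_neg, neg_sq, neg_sq] at key2
    exact key2

end SmallFreq

/-! ### Identification of the soliton -/

theorem contDiff_succ_of_hasDerivAt {n : ℕ} {f f' : ℝ → ℝ} (h : ∀ x, HasDerivAt f (f' x) x)
    (h' : ContDiff ℝ n f') : ContDiff ℝ (n + 1 : ℕ) f := by
  have e : deriv f = f' := funext fun x => (h x).deriv
  have : ContDiff ℝ ((n : WithTop ℕ∞) + 1) f :=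
    contDiff_succ_iff_deriv.2 ⟨fun x => (h x).differentiableAt, by simp, by rwa [e]⟩
  exact_mod_cast this

theorem iteratedDeriv_succ_eq_of_hasDerivAt {n : ℕ} {f f' : ℝ → ℝ}
    (h : ∀ x, HasDerivAt f (f' x) x) : iteratedDeriv (n + 1) f = iteratedDeriv n f' := by
  rw [iteratedDeriv_succ', funext fun x => (h x).deriv]

theorem iteratedDeriv_two_of_hasDerivAt {f f' f'' : ℝ → ℝ} (h : ∀ x, HasDerivAt f (f' x) x)
    (h' : ∀ x, HasDerivAt f' (f'' x) x) : iteratedDeriv 2 f = f'' := by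
  rw [iteratedDeriv_succ_eq_of_hasDerivAt h, iteratedDeriv_one, funext fun x => (h' x).deriv]

theorem integrable_exp_neg_mul_abs {c : ℝ} (hc : 0 < c) :
    Integrable fun x : ℝ => Real.exp (-c * |x|) := by
  have h1 : IntegrableOn (fun x : ℝ => Real.exp (-c * |x|)) (Ioi 0) := by
    refine (integrableOn_exp_mul_Ioi (neg_lt_zero.2 hc) 0).congr_fun ?_ measurableSet_Ioi
    intro x hx
    simp only [abs_of_pos (show 0 < x from hx)]
  have h2 : IntegrableOn (fun x : ℝ => Real.exp (-c * |x|)) (Iic 0) := by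
    refine (integrableOn_exp_mul_Iic hc 0).congr_fun ?_ measurableSet_Iic
    intro x hx
    simp only [abs_of_nonpos (show x ≤ 0 from hx)]
    ring_nf
  rw [← integrableOn_univ, ← Iic_union_Ioi (a := (0 : ℝ))]
  exact h2.union h1

theorem mul_gam_zero {g : ℝ → ℝ} {s : ℝ} (hs : s ≠ 0) : s * gam g 0 s = g s := by
  rw [gam_zero]; field_simp

namespace SmallFreq

variable {g : ℝ → ℝ} {ω₀ ω : ℝ}

theorem mul_bigGam' {s : ℝ} (hs : s ≠ 0) : s * bigGam' g s = s + g s - bigGam g s := by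
  rw [bigGam', bigGam, ← mul_gam_zero (g := g) hs]; ring

/-- Existence of the soliton. -/
theorem isSoliton_sqrt_sf (H : SmallFreq g ω₀) (hω : ω ∈ Ioo 0 ω₀) :
    IsSoliton g ω (fun x => √(sf g ω (√ω * x))) := by
  have hw : 0 < √ω := Real.sqrt_pos.2 hω.1
  have hww : √ω * √ω = ω := Real.mul_self_sqrt hω.1.le
  set S : ℝ → ℝ := fun x => sf g ω (√ω * x) with hS
  set h : ℝ → ℝ := fun x => hf g ω (√ω * x) with hh
  have hSpos : ∀ x, 0 < S x := fun x => (H.sf_mem hω _).1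
  have hlin : ∀ x : ℝ, HasDerivAt (fun x => √ω * x) √ω x := fun x => by
    simpa using (hasDerivAt_id x).const_mul √ω
  have hdS : ∀ x, HasDerivAt S (2 * h x * S x * √ω) x := fun x =>
    (H.hasDerivAt_sf hω (√ω * x)).comp x (hlin x)
  have hdh : ∀ x, HasDerivAt h (-(S x / ω * bigGam' g (S x)) * √ω) x := fun x =>
    (H.hasDerivAt_hf hω (√ω * x)).comp x (hlin x)
  have hsq : ∀ x, √(S x) * √(S x) = S x := fun x => Real.mul_self_sqrt (hSpos x).le
  have hd1 : ∀ x, HasDerivAt (fun x => √(S x)) (√ω * h x * √(S x)) x := fun x => by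
    refine ((hdS x).sqrt (hSpos x).ne').congr_deriv ?_
    have := Real.sqrt_pos.2 (hSpos x)
    rw [div_eq_iff (by positivity)]
    linear_combination (-2 * √ω * h x) * hsq x
  have hd2 : ∀ x, HasDerivAt (fun x => √ω * h x * √(S x))
      (ω * √(S x) - √(S x) ^ 3 - √(S x) * g (√(S x) ^ 2)) x := fun x => by
    refine (((hdh x).const_mul √ω).mul (hd1 x)).congr_deriv ?_
    have e1 := mul_bigGam' (g := g) (hSpos x).ne'
    have e2 : bigGam g (S x) = ω * (1 - h x ^ 2) := H.bigGam_sf hω _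
    have e3 : S x / ω * bigGam' g (S x) = (S x + g (S x) - ω * (1 - h x ^ 2)) / ω := by
      rw [← e2, ← e1]; ring
    have e4 : √(S x) ^ 2 = S x := by rw [sq, hsq]
    have e5 : √(S x) ^ 3 = S x * √(S x) := by rw [pow_succ, e4]
    rw [e3, e4, e5]
    have := hω.1.ne'
    have hw2 : √ω ^ 2 = ω := by rw [sq, hww]
    field_simp
    linear_combination (√(S x) * (ω * (1 - h x ^ 2) - S x - g (S x)) + h x ^ 2 * √(S x) * ω ) * hw2
  have hcS : Continuous S := continuous_iff_continuousAt.2 fun x => (hdS x).continuousAt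
  have hch : Continuous h := continuous_iff_continuousAt.2 fun x => (hdh x).continuousAt
  have hcg : Continuous fun x => g (√(S x) ^ 2) := by
    have : (fun x => g (√(S x) ^ 2)) = fun x => g (S x) := by ext x; rw [sq, hsq]
    rw [this]
    exact H.h1.continuousOn.comp_continuous hcS fun x => (hSpos x).le
  have hint : Integrable S := by
    have hi : Integrable fun x : ℝ => ω * (12 * Real.exp (-(15 / 8 * √ω) * |x|)) :=
      ((integrable_exp_neg_mul_abs (by positivity)).const_mul _).const_mul _
    refine hi.mono' hcS.aestronglyMeasurable (Filter.Eventually.of_forall fun x => ?_)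
    have := H.sf_le hω (√ω * x)
    rw [div_le_iff₀ hω.1, abs_mul, abs_of_pos hw] at this
    rw [Real.norm_eq_abs, abs_of_pos (hSpos x)]
    calc S x ≤ _ := this
      _ = _ := by ring_nf
  have hde : deriv (fun x => √(S x)) = fun x => √ω * h x * √(S x) :=
    funext fun x => (hd1 x).deriv
  refine ⟨?_, ?_, ?_, ?_, ?_, ?_⟩
  · have h2 : ContDiff ℝ (0 : ℕ) fun x => ω * √(S x) - √(S x) ^ 3 - √(S x) * g (√(S x) ^ 2) := by
      refine contDiff_zero.2 ?_
      have := hcS.sqrt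
      exact ((continuous_const.mul this).sub (this.pow 3)).sub (this.mul hcg)
    exact contDiff_succ_of_hasDerivAt hd1 (contDiff_succ_of_hasDerivAt hd2 h2)
  · intro x
    rw [iteratedDeriv_two_of_hasDerivAt hd1 hd2]
  · rw [memLp_two_iff_integrable_sq hcS.sqrt.aestronglyMeasurable]
    refine hint.congr (Filter.Eventually.of_forall fun x => ?_)
    simp only; rw [sq, hsq]
  · rw [hde, memLp_two_iff_integrable_sq]
    · refine (hint.const_mul ω).mono' ?_ (Filter.Eventually.of_forall fun x => ?_)
      · have := hcS.sqrt
        exact Continuous.aestronglyMeasurable (by fun_prop)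
      · have e : (√ω * h x * √(S x)) ^ 2 = ω * (h x ^ 2 * S x) := by
          rw [mul_pow, mul_pow, sq √ω, hww, sq √(S x), hsq]; ring
        rw [e, Real.norm_eq_abs, abs_of_nonneg
          (mul_nonneg hω.1.le (mul_nonneg (sq_nonneg _) (hSpos x).le))]
        have : h x ^ 2 ≤ 1 := (sq_le_one_iff_abs_le_one _).2 (abs_hf_le g ω _)
        have := mul_le_mul_of_nonneg_right this (hSpos x).le
        exact mul_le_mul_of_nonneg_left (by linarith) hω.1.le
    · have := hcS.sqrt
      exact Continuous.aestronglyMeasurable (by fun_prop)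
  · exact fun x => Real.sqrt_pos.2 (hSpos x)
  · intro x
    simp only [mul_neg, H.sf_neg hω]

/-- The derivative of a soliton satisfies `φ'² = φ² (ω - Γ(φ²))`: the energy of the trajectory
vanishes, because the trajectory belongs to `H¹`. -/
theorem soliton_energy (H : SmallFreq g ω₀) {φ : ℝ → ℝ} (hφ : IsSoliton g ω φ) :
    Tendsto (fun x => φ x ^ 2) atTop (𝓝 0) ∧
      ∀ x, deriv φ x ^ 2 = φ x ^ 2 * (ω - bigGam g (φ x ^ 2)) := by
  have hd1 : ∀ x, HasDerivAt φ (deriv φ x) x := fun x =>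
    ((hφ.contDiff.differentiable (by norm_num)) x).hasDerivAt
  have hC1 : ContDiff ℝ 1 (deriv φ) := by
    have : ContDiff ℝ (1 + 1) φ := by
      have := hφ.contDiff
      norm_num
      exact this
    exact ((contDiff_succ_iff_deriv (n := 1)).1 this).2.2
  have hd2 : ∀ x, HasDerivAt (deriv φ) (ω * φ x - φ x ^ 3 - φ x * g (φ x ^ 2)) x := fun x => by
    have h := ((hC1.differentiable (by norm_num)) x).hasDerivAt
    have e := hφ.eqn x
    rw [iteratedDeriv_succ, iteratedDeriv_one] at e
    rwa [e] at h
  have hsqd : ∀ x, HasDerivAt (fun x => φ x ^ 2) (2 * (φ x * deriv φ x)) x := fun x =>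
    ((hd1 x).pow 2).congr_deriv (by push_cast; ring)
  have hpos : ∀ x, 0 < φ x ^ 2 := fun x => pow_pos (hφ.pos x) 2
  have hi1 : Integrable fun x => φ x ^ 2 := hφ.memLp.integrable_sq
  have hi2 : Integrable fun x => deriv φ x ^ 2 := hφ.memLp_deriv.integrable_sq
  have hi3 : Integrable fun x => 2 * (φ x * deriv φ x) :=
    (hφ.memLp.integrable_mul hφ.memLp_deriv).const_mul 2
  have ht : Tendsto (fun x => φ x ^ 2) atTop (𝓝 0) :=
    tendsto_zero_of_hasDerivAt_of_integrableOn_Ioi (a := 0) (fun x _ => hsqd x)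
      hi3.integrableOn hi1.integrableOn
  refine ⟨ht, ?_⟩
  set E : ℝ → ℝ := fun x => deriv φ x ^ 2 - φ x ^ 2 * (ω - bigGam g (φ x ^ 2)) with hE
  have hdE : ∀ x, HasDerivAt E 0 x := fun x => by
    have h := ((hd2 x).pow 2).sub ((hsqd x).mul
      ((H.hasDerivAt_bigGam (hpos x)).comp x (hsqd x) |>.const_sub ω))
    refine h.congr_deriv ?_
    have e := mul_bigGam' (g := g) (hpos x).ne'
    simp only [Function.comp_apply]
    push_cast
    linear_combination (2 * (φ x * deriv φ x)) * e
  have hconst : ∀ x, E x = E 0 := fun x =>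
    is_const_of_deriv_eq_zero (fun x => (hdE x).differentiableAt) (fun x => (hdE x).deriv) x 0
  have hG : Tendsto (fun x => φ x ^ 2 * (ω - bigGam g (φ x ^ 2))) atTop (𝓝 0) := by
    have hb : Tendsto (fun x => bigGam g (φ x ^ 2)) atTop (𝓝 0) := by
      refine squeeze_zero_norm' ?_ ht
      filter_upwards [ht.eventually (gt_mem_nhds (show (0 : ℝ) < 3 * ω₀ by linarith [H.pos]))]
        with x hx
      have := abs_le.1 (H.gamI_le ⟨hpos x, hx.le⟩)
      rw [bigGam, norm_mul, Real.norm_eq_abs, Real.norm_eq_abs, abs_of_pos (hpos x)]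
      have : |1 / 2 + gamI g (φ x ^ 2)| ≤ 1 := abs_le.2 ⟨by linarith, by linarith⟩
      nlinarith [hpos x]
    simpa using ht.mul (hb.const_sub ω)
  have ht2 : Tendsto (fun x => deriv φ x ^ 2) atTop (𝓝 (E 0)) := by
    have : (fun x => deriv φ x ^ 2) = fun x => E 0 + φ x ^ 2 * (ω - bigGam g (φ x ^ 2)) := by
      ext x; rw [← hconst x, hE]; ring
    rw [this]
    simpa using hG.const_add (E 0)
  -- `φ'²` tends to the constant energy, and it is integrable
  have hE0 : E 0 = 0 := by
    refine IntegrableAtFilter.eq_zero_of_tendsto (hi2.integrableAtFilter atTop) ?_ ht2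
    intro s hs
    obtain ⟨a, ha⟩ := mem_atTop_sets.1 hs
    exact top_le_iff.1 ((Real.volume_Ici (a := a)).symm.le.trans (measure_mono fun x hx => ha x hx))
  intro x
  have := hconst x
  rw [hE0] at this
  simp only [hE] at this
  linarith

/-- Uniqueness of the soliton, in the form of an explicit formula. -/
theorem sq_eq_sf (H : SmallFreq g ω₀) (hω : ω ∈ Ioo 0 ω₀) {φ : ℝ → ℝ} (hφ : IsSoliton g ω φ)
    (x : ℝ) : φ x ^ 2 = sf g ω (√ω * x) := by
  obtain ⟨ht, hen⟩ := H.soliton_energy hφ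
  have hw : 0 < √ω := Real.sqrt_pos.2 hω.1
  have hww : √ω ^ 2 = ω := Real.sq_sqrt hω.1.le
  have hpos : ∀ x, 0 < φ x ^ 2 := fun x => pow_pos (hφ.pos x) 2
  have hle : ∀ x, bigGam g (φ x ^ 2) ≤ ω := fun x => by
    by_contra! h
    nlinarith [hen x, hpos x, sq_nonneg (deriv φ x)]
  have hC : Continuous φ := hφ.contDiff.continuous
  -- otherwise `φ²`, which tends to `0`, takes the value `3ω₀`, where `Γ > ω`
  have hlt : ∀ x, φ x ^ 2 < 3 * ω₀ := fun x => by
    by_contra! h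
    have h1 := ht.eventually (gt_mem_nhds (show (0 : ℝ) < 3 * ω₀ by linarith [H.pos]))
    obtain ⟨x', hx'⟩ := h1.exists
    have h2 := mem_range_of_exists_le_of_exists_ge (hC.pow 2) ⟨x', hx'.le⟩ ⟨x, h⟩
    obtain ⟨t, ht⟩ := h2
    have h3 := hle t
    have hp := H.pos
    have h4 := abs_le.1 (H.gamI_le (s := 3 * ω₀) ⟨by linarith, le_rfl⟩)
    rw [show φ t ^ 2 = 3 * ω₀ from ht, bigGam] at h3
    nlinarith [hω.2]
  have hmem : ∀ x, φ x ^ 2 ∈ Ioc 0 (3 * ω₀) := fun x => ⟨hpos x, (hlt x).le⟩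
  have hGpos : ∀ x, 0 < bigGam g (φ x ^ 2) := fun x => by
    have h4 := abs_le.1 (H.gamI_le (hmem x))
    exact mul_pos (hpos x) (by linarith)
  have hd1 : ∀ x, HasDerivAt φ (deriv φ x) x := fun x =>
    ((hφ.contDiff.differentiable (by norm_num)) x).hasDerivAt
  have hC1 : ContDiff ℝ 1 (deriv φ) := by
    have : ContDiff ℝ (1 + 1) φ := by
      have := hφ.contDiff
      norm_num
      exact this
    exact ((contDiff_succ_iff_deriv (n := 1)).1 this).2.2
  have hd2 : ∀ x, HasDerivAt (deriv φ) (ω * φ x - φ x ^ 3 - φ x * g (φ x ^ 2)) x := fun x => by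
    have h := ((hC1.differentiable (by norm_num)) x).hasDerivAt
    have e := hφ.eqn x
    rw [iteratedDeriv_succ, iteratedDeriv_one] at e
    rwa [e] at h
  have hd0 : deriv φ 0 = 0 := by
    have h1 := (hd1 (-0)).comp (0 : ℝ) (hasDerivAt_neg (0 : ℝ))
    have h2 : φ ∘ Neg.neg = φ := funext hφ.even
    rw [h2, neg_zero] at h1
    have := h1.unique (hd1 0)
    linarith
  -- `η = φ'/(√ω φ)` takes values in `(-1, 1)`, and `posY g ω (artanh (-η))` grows at the rate `√ω`
  set η : ℝ → ℝ := fun x => deriv φ x / (√ω * φ x) with hη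
  have hη2 : ∀ x, 1 - η x ^ 2 = bigGam g (φ x ^ 2) / ω := fun x => by
    have h1 := (hφ.pos x).ne'
    have h2 := hω.1.ne'
    simp only [hη]
    rw [div_pow, mul_pow, hww, hen x]
    field_simp
    ring
  have hηd : ∀ x, HasDerivAt η (-(φ x ^ 2 * bigGam' g (φ x ^ 2)) / √ω) x := fun x => by
    have h1 := (hφ.pos x).ne'
    refine ((hd2 x).div ((hd1 x).const_mul √ω) (by positivity)).congr_deriv ?_
    have e := mul_bigGam' (g := g) (hpos x).ne'
    rw [e]
    have e2 := hen x
    have hw' := hw.ne'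
    rw [div_eq_div_iff (by positivity) hw']
    linear_combination (-√ω ^ 2) * e2
  have hηlt : ∀ x, |η x| < 1 := fun x => by
    have := hη2 x
    have h2 : 0 < bigGam g (φ x ^ 2) / ω := div_pos (hGpos x) hω.1
    rw [← sq_lt_one_iff_abs_lt_one]
    linarith
  set ζ : ℝ → ℝ := fun x => (Real.log (1 - η x) - Real.log (1 + η x)) / 2 with hζ
  have hζt : ∀ x, Real.tanh (ζ x) = -η x := fun x => by
    have h := abs_lt.1 (hηlt x)
    have h1 : ζ x = Real.artanh (-η x) := by
      rw [Real.artanh_eq_half_log ⟨by linarith, by linarith⟩, hζ]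
      simp only
      rw [Real.log_div (by linarith) (by linarith), sub_neg_eq_add]
      ring_nf
    rw [h1, Real.tanh_artanh ⟨by linarith, by linarith⟩]
  have hs : ∀ x, sOf g ω (ζ x) = φ x ^ 2 := fun x => by
    have e : ω * (1 / Real.cosh (ζ x) ^ 2) = bigGam g (φ x ^ 2) := by
      rw [← one_sub_tanh_sq, hζt, neg_sq, hη2]
      have := hω.1.ne'
      field_simp
    rw [sOf, e]
    exact H.psi_eq ⟨hGpos x, (hle x).trans hω.2.le⟩ (hmem x) rfl
  have hζd : ∀ x, HasDerivAt ζ (√ω / mfun g (φ x ^ 2)) x := fun x => by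
    have h := abs_lt.1 (hηlt x)
    have h1 := (((hηd x).const_sub 1).log (by linarith)).sub
      (((hηd x).const_add 1).log (by linarith)) |>.div_const 2
    refine h1.congr_deriv ?_
    have hB : bigGam' g (φ x ^ 2) ≠ 0 := by linarith [(H.bigGam'_bounds (hmem x)).1]
    have hI : 1 / 2 + gamI g (φ x ^ 2) ≠ 0 := by
      linarith [(abs_le.1 (H.gamI_le (hmem x))).1]
    have e := hη2 x
    rw [bigGam] at e
    rw [mfun]
    have a1 : 1 - η x ≠ 0 := by linarith
    have a2 : 1 + η x ≠ 0 := by linarith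
    have a3 := hω.1.ne'
    have a4 := hw.ne'
    have a5 := (hφ.pos x).ne'
    generalize 1 / 2 + gamI g (φ x ^ 2) = I at hI e ⊢
    rw [eq_div_iff a3] at e
    field_simp
    linear_combination (-2 : ℝ) * e - 2 * (1 - η x ^ 2) * hww
  have hconst : ∀ x, posY g ω (ζ x) - √ω * x = posY g ω (ζ 0) - √ω * 0 := fun x => by
    have hd : ∀ x, HasDerivAt (fun x => posY g ω (ζ x) - √ω * x) 0 x := fun x => by
      have h := ((H.hasDerivAt_posY_right hω (ζ x)).comp x (hζd x)).sub
        ((hasDerivAt_id x).const_mul √ω)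
      refine h.congr_deriv ?_
      have : mfun g (φ x ^ 2) ≠ 0 := by linarith [(H.mfun_bounds (hmem x)).1]
      rw [hs x]
      field_simp
      ring
    exact is_const_of_deriv_eq_zero (fun x => (hd x).differentiableAt) (fun x => (hd x).deriv) x 0
  have hζ0 : ζ 0 = 0 := by simp [hζ, hη, hd0]
  have hfin : zf g ω (√ω * x) = ζ x := by
    refine H.zf_unique hω ?_
    have := hconst x
    rw [hζ0, posY_zero] at this
    linarith
  rw [sf, hfin, hs]

theorem isSoliton_soliton (H : SmallFreq g ω₀) (hω : ω ∈ Ioo 0 ω₀) :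
    IsSoliton g ω (soliton g ω) :=
  Classical.epsilon_spec ⟨_, H.isSoliton_sqrt_sf hω⟩

theorem solQ_pos (H : SmallFreq g ω₀) (hω : ω ∈ Ioo 0 ω₀) (y : ℝ) : 0 < solQ g ω y :=
  div_pos ((H.isSoliton_soliton hω).pos _) (Real.sqrt_pos.2 hω.1)

theorem solQ_sq (H : SmallFreq g ω₀) (hω : ω ∈ Ioo 0 ω₀) (y : ℝ) :
    solQ g ω y ^ 2 = sf g ω y / ω := by
  have hw : √ω ≠ 0 := (Real.sqrt_pos.2 hω.1).ne'
  rw [solQ, div_pow, Real.sq_sqrt hω.1.le, H.sq_eq_sf hω (H.isSoliton_soliton hω),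
    mul_div_cancel₀ _ hw]

theorem mul_solQ_sq (H : SmallFreq g ω₀) (hω : ω ∈ Ioo 0 ω₀) (y : ℝ) :
    ω * solQ g ω y ^ 2 = sf g ω y := by
  have := hω.1.ne'
  rw [H.solQ_sq hω]; field_simp

theorem hasDerivAt_solQ (H : SmallFreq g ω₀) (hω : ω ∈ Ioo 0 ω₀) (y : ℝ) :
    HasDerivAt (solQ g ω) (hf g ω y * solQ g ω y) y := by
  have e : solQ g ω = fun y => √(sf g ω y / ω) := by
    ext y
    rw [← H.solQ_sq hω, Real.sqrt_sq (H.solQ_pos hω y).le]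
  have hp : 0 < sf g ω y / ω := div_pos (H.sf_mem hω y).1 hω.1
  rw [e]
  refine (((H.hasDerivAt_sf hω y).div_const ω).sqrt hp.ne').congr_deriv ?_
  have h2 := Real.sqrt_pos.2 hp
  rw [div_eq_iff (by positivity)]
  have h3 := Real.mul_self_sqrt hp.le
  simp only
  linear_combination (-2 * hf g ω y) * h3

end SmallFreq

/-! ### Integral operators on bounded continuous functions -/

open BoundedContinuousFunction

/-- The Banach algebra of bounded continuous functions on the line. -/
abbrev CB := BoundedContinuousFunction ℝ ℝ

theorem integrableOn_exp_mul_CB {ν : ℝ} (hν : 0 < ν) (f : CB) (a : ℝ) :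
    IntegrableOn (fun z => Real.exp (-ν * z) * f z) (Ioi a) := by
  refine ((integrableOn_exp_mul_Ioi (neg_lt_zero.2 hν) a).mul_const ‖f‖).mono'
    (Continuous.aestronglyMeasurable (by fun_prop)) (Filter.Eventually.of_forall fun z => ?_)
  rw [norm_mul, Real.norm_eq_abs, abs_of_pos (Real.exp_pos _)]
  exact mul_le_mul_of_nonneg_left (f.norm_coe_le_norm z) (Real.exp_pos _).le

/-- The bounded solution of `u' = νu - f`. -/
def opAFun (ν : ℝ) (f : CB) (y : ℝ) : ℝ :=
  Real.exp (ν * y) * ∫ z in Ioi y, Real.exp (-ν * z) * f z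

theorem abs_opAFun_le {ν : ℝ} (hν : 0 < ν) (f : CB) (y : ℝ) : ‖opAFun ν f y‖ ≤ ν⁻¹ * ‖f‖ := by
  have h : ‖∫ z in Ioi y, Real.exp (-ν * z) * f z‖ ≤ ∫ z in Ioi y, Real.exp (-ν * z) * ‖f‖ := by
    refine norm_integral_le_of_norm_le
      ((integrableOn_exp_mul_Ioi (neg_lt_zero.2 hν) y).mul_const ‖f‖)
      (Filter.Eventually.of_forall fun z => ?_)
    rw [norm_mul, Real.norm_eq_abs, abs_of_pos (Real.exp_pos _)]
    exact mul_le_mul_of_nonneg_left (f.norm_coe_le_norm z) (Real.exp_pos _).le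
  rw [integral_mul_const, integral_exp_mul_Ioi (neg_lt_zero.2 hν)] at h
  rw [opAFun, norm_mul, Real.norm_eq_abs, abs_of_pos (Real.exp_pos _)]
  calc _ ≤ Real.exp (ν * y) * (-Real.exp (-ν * y) / -ν * ‖f‖) := by gcongr
    _ = (Real.exp (ν * y) * Real.exp (-ν * y)) * (ν⁻¹ * ‖f‖) := by
      rw [neg_div_neg_eq]; ring
    _ = ν⁻¹ * ‖f‖ := by rw [← Real.exp_add]; simp

theorem hasDerivAt_opAFun {ν : ℝ} (hν : 0 < ν) (f : CB) (y : ℝ) :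
    HasDerivAt (opAFun ν f) (ν * opAFun ν f y - f y) y := by
  have hc : Continuous fun z => Real.exp (-ν * z) * f z := by fun_prop
  have e : (fun y => ∫ z in Ioi y, Real.exp (-ν * z) * f z) = fun y =>
      (∫ z in Ioi (0 : ℝ), Real.exp (-ν * z) * f z)
        - ∫ z in (0 : ℝ)..y, Real.exp (-ν * z) * f z := by
    ext y
    have := intervalIntegral.integral_interval_add_Ioi (μ := volume) (a := 0) (b := y)
      (integrableOn_exp_mul_CB hν f 0) (integrableOn_exp_mul_CB hν f y)
    linarith
  have h1 : HasDerivAt (fun y => ∫ z in Ioi y, Real.exp (-ν * z) * f z)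
      (-(Real.exp (-ν * y) * f y)) y := by
    rw [e]
    exact (intervalIntegral.integral_hasDerivAt_right (hc.intervalIntegrable _ _)
      hc.aestronglyMeasurable.stronglyMeasurableAtFilter hc.continuousAt).const_sub _
  have h2 : HasDerivAt (fun y => Real.exp (ν * y)) (Real.exp (ν * y) * ν) y := by
    simpa using ((hasDerivAt_id y).const_mul ν).exp
  refine (h2.mul h1).congr_deriv ?_
  have : Real.exp (ν * y) * Real.exp (-ν * y) = 1 := by rw [← Real.exp_add]; simp
  rw [opAFun]
  linear_combination (-f y) * this

/-- The operator `-(∂_y - ν)⁻¹` on bounded functions. -/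
def opA (ν : ℝ) (hν : 0 < ν) : CB →L[ℝ] CB :=
  LinearMap.mkContinuous
    { toFun := fun f => BoundedContinuousFunction.ofNormedAddCommGroup (opAFun ν f)
        (continuous_iff_continuousAt.2 fun y => (hasDerivAt_opAFun hν f y).continuousAt)
        (ν⁻¹ * ‖f‖) (abs_opAFun_le hν f)
      map_add' := fun f h => by
        ext y
        simp only [coe_ofNormedAddCommGroup, BoundedContinuousFunction.coe_add, Pi.add_apply,
          opAFun]
        rw [← mul_add, ← integral_add (integrableOn_exp_mul_CB hν f y)
          (integrableOn_exp_mul_CB hν h y)]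
        simp only [mul_add]
      map_smul' := fun c f => by
        ext y
        simp only [coe_ofNormedAddCommGroup, BoundedContinuousFunction.coe_smul, opAFun,
          smul_eq_mul, RingHom.id_apply]
        have e : (fun z => Real.exp (-ν * z) * (c * f z))
            = fun z => c * (Real.exp (-ν * z) * f z) := by ext z; ring
        rw [e, integral_const_mul]
        ring }
    ν⁻¹ fun f => by
      refine (norm_le (by positivity)).2 fun y => ?_
      exact abs_opAFun_le hν f y

theorem opA_apply {ν : ℝ} (hν : 0 < ν) (f : CB) (y : ℝ) : opA ν hν f y = opAFun ν f y := rfl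

theorem hasDerivAt_opA {ν : ℝ} (hν : 0 < ν) (f : CB) (y : ℝ) :
    HasDerivAt (opA ν hν f) (ν * opA ν hν f y - f y) y := hasDerivAt_opAFun hν f y

/-- The primitive, vanishing at `0`, of `e^{-δ|z|} f(z)`. -/
def opLFun (δ : ℝ) (f : CB) (y : ℝ) : ℝ := ∫ z in (0 : ℝ)..y, Real.exp (-δ * |z|) * f z

theorem abs_opLFun_le {δ : ℝ} (hδ : 0 < δ) (f : CB) (y : ℝ) :
    ‖opLFun δ f y‖ ≤ (∫ z : ℝ, Real.exp (-δ * |z|)) * ‖f‖ := by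
  rw [opLFun, ← integral_mul_const]
  refine (intervalIntegral.norm_integral_le_integral_norm_uIoc).trans ?_
  have hi := (integrable_exp_neg_mul_abs hδ).mul_const ‖f‖
  have hle : ∀ z, ‖Real.exp (-δ * |z|) * f z‖ ≤ Real.exp (-δ * |z|) * ‖f‖ := fun z => by
    rw [norm_mul, Real.norm_eq_abs, abs_of_pos (Real.exp_pos _)]
    exact mul_le_mul_of_nonneg_left (f.norm_coe_le_norm z) (Real.exp_pos _).le
  have hm : Continuous fun z => Real.exp (-δ * |z|) * f z := by fun_prop
  refine (setIntegral_le_integral (hi.mono' hm.norm.aestronglyMeasurable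
    (Filter.Eventually.of_forall fun z => ?_)) (Filter.Eventually.of_forall fun z =>
      norm_nonneg _)).trans
    (integral_mono (hi.mono' hm.norm.aestronglyMeasurable
      (Filter.Eventually.of_forall fun z => ?_)) hi hle)
  · rw [norm_norm]; exact hle z
  · rw [norm_norm]; exact hle z

theorem hasDerivAt_opLFun (δ : ℝ) (f : CB) (y : ℝ) :
    HasDerivAt (opLFun δ f) (Real.exp (-δ * |y|) * f y) y := by
  have hc : Continuous fun z => Real.exp (-δ * |z|) * f z := by fun_prop
  exact intervalIntegral.integral_hasDerivAt_right (hc.intervalIntegrable _ _)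
      hc.aestronglyMeasurable.stronglyMeasurableAtFilter hc.continuousAt

/-- `opLFun` as a bounded operator. -/
def opL (δ : ℝ) (hδ : 0 < δ) : CB →L[ℝ] CB :=
  LinearMap.mkContinuous
    { toFun := fun f => BoundedContinuousFunction.ofNormedAddCommGroup (opLFun δ f)
        (continuous_iff_continuousAt.2 fun y => (hasDerivAt_opLFun δ f y).continuousAt)
        ((∫ z : ℝ, Real.exp (-δ * |z|)) * ‖f‖) (abs_opLFun_le hδ f)
      map_add' := fun f h => by
        ext y
        simp only [coe_ofNormedAddCommGroup, BoundedContinuousFunction.coe_add, Pi.add_apply,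
          opLFun, mul_add]
        exact intervalIntegral.integral_add (Continuous.intervalIntegrable (by fun_prop) _ _)
          (Continuous.intervalIntegrable (by fun_prop) _ _)
      map_smul' := fun c f => by
        ext y
        simp only [coe_ofNormedAddCommGroup, BoundedContinuousFunction.coe_smul, opLFun,
          smul_eq_mul, RingHom.id_apply]
        rw [← intervalIntegral.integral_const_mul]
        congr 1
        ext z
        ring }
    (∫ z : ℝ, Real.exp (-δ * |z|)) fun f => by
      refine (norm_le (mul_nonneg (integral_nonneg fun z => (Real.exp_pos _).le)
        (norm_nonneg _))).2 fun y => ?_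
      exact abs_opLFun_le hδ f y

theorem opL_apply {δ : ℝ} (hδ : 0 < δ) (f : CB) (y : ℝ) : opL δ hδ f y = opLFun δ f y := rfl

theorem hasDerivAt_opL {δ : ℝ} (hδ : 0 < δ) (f : CB) (y : ℝ) :
    HasDerivAt (opL δ hδ f) (Real.exp (-δ * |y|) * f y) y := hasDerivAt_opLFun δ f y

theorem opL_zero {δ : ℝ} (hδ : 0 < δ) (f : CB) : opL δ hδ f 0 = 0 := by
  simp [opL_apply, opLFun]

/-! ### Exponential weights -/

/-- A bounded continuous function, or `0` if the given function is not so. -/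
def toCB (f : ℝ → ℝ) : CB := by
  classical
  exact if h : Continuous f ∧ ∃ C, ∀ y, ‖f y‖ ≤ C then
    BoundedContinuousFunction.ofNormedAddCommGroup f h.1 h.2.choose h.2.choose_spec else 0

theorem toCB_apply {f : ℝ → ℝ} (hf : Continuous f) {C : ℝ} (hC : ∀ y, ‖f y‖ ≤ C) (y : ℝ) :
    toCB f y = f y := by
  have : Continuous f ∧ ∃ C, ∀ y, ‖f y‖ ≤ C := ⟨hf, C, hC⟩
  rw [toCB, dif_pos this]
  rfl

theorem pow_mul_exp_neg_le {τ : ℝ} (hτ : 0 < τ) (n : ℕ) :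
    ∃ C, 0 ≤ C ∧ ∀ x : ℝ, 0 ≤ x → x ^ n * Real.exp (-τ * x) ≤ C := by
  refine ⟨n.factorial / τ ^ n, by positivity, fun x hx => ?_⟩
  have h := Real.pow_div_factorial_le_exp (τ * x) (by positivity) n
  rw [div_le_iff₀ (by positivity), mul_pow] at h
  have he : Real.exp (-τ * x) = (Real.exp (τ * x))⁻¹ := by rw [← Real.exp_neg]; ring_nf
  rw [he, ← div_eq_mul_inv, div_le_div_iff₀ (Real.exp_pos _) (by positivity)]
  linarith

/-- The weight `|y|^n e^{-τ|y|}`. -/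
def wexp (n : ℕ) (τ : ℝ) : CB := toCB fun y => |y| ^ n * Real.exp (-τ * |y|)

theorem wexp_apply (n : ℕ) {τ : ℝ} (hτ : 0 < τ) (y : ℝ) :
    wexp n τ y = |y| ^ n * Real.exp (-τ * |y|) := by
  obtain ⟨C, -, hC⟩ := pow_mul_exp_neg_le hτ n
  refine toCB_apply (C := C) (by fun_prop) (fun y => ?_) y
  rw [Real.norm_eq_abs, abs_of_nonneg (by positivity)]
  exact hC _ (abs_nonneg y)

theorem abs_exp_sub_one_add_le (x : ℝ) : |Real.exp x - 1 - x| ≤ x ^ 2 * Real.exp |x| := by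
  rcases le_or_gt 0 x with h | h
  · rw [abs_of_nonneg h]
    have h1 := Real.add_one_le_exp x
    rw [abs_of_nonneg (by linarith)]
    have h2 := Real.add_one_le_exp (-x)
    have h3 : Real.exp x * Real.exp (-x) = 1 := by rw [← Real.exp_add]; simp
    have h4 := Real.exp_pos x
    have h5 : Real.exp x - 1 ≤ x * Real.exp x := by nlinarith
    nlinarith [mul_le_mul_of_nonneg_left h5 h]
  · rw [abs_of_neg h]
    have h1 := Real.add_one_le_exp x
    rw [abs_of_nonneg (by linarith)]
    have h2 := Real.add_one_le_exp (-x)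
    have h3 : Real.exp x * Real.exp (-x) = 1 := by rw [← Real.exp_add]; simp
    have h5 : 1 ≤ Real.exp (-x) := Real.one_le_exp (by linarith)
    have h6 : Real.exp x * (1 - x) ≤ 1 := by
      rw [← h3]; exact mul_le_mul_of_nonneg_left (by linarith) (Real.exp_pos x).le
    have h7 : Real.exp x ≤ 1 + x + x ^ 2 := by
      by_contra! h8
      nlinarith [mul_pos_of_neg_of_neg h h]
    nlinarith [sq_nonneg x]

theorem hasDerivAt_wexp (n : ℕ) {τ : ℝ} (hτ : 0 < τ) :
    HasDerivAt (wexp n) (-wexp (n + 1) τ) τ := by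
  obtain ⟨C, hC0, hC⟩ := pow_mul_exp_neg_le (half_pos hτ) (n + 2)
  rw [hasDerivAt_iff_isLittleO]
  have hO : (fun x' => wexp n x' - wexp n τ - (x' - τ) • -wexp (n + 1) τ) =O[𝓝 τ]
      fun x' => (x' - τ) ^ 2 := by
    refine IsBigO.of_bound C ?_
    filter_upwards [Metric.ball_mem_nhds τ (half_pos hτ)] with t ht
    rw [Metric.mem_ball, Real.dist_eq] at ht
    have ht0 : 0 < t := by linarith [(abs_lt.1 ht).1]
    refine (norm_le (by positivity)).2 fun y => ?_
    simp only [BoundedContinuousFunction.coe_sub, Pi.sub_apply, BoundedContinuousFunction.coe_smul,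
      BoundedContinuousFunction.coe_neg, Pi.neg_apply, smul_eq_mul, wexp_apply _ hτ,
      wexp_apply _ ht0]
    set x := |y|
    have hx : 0 ≤ x := abs_nonneg y
    have e : x ^ n * Real.exp (-t * x) - x ^ n * Real.exp (-τ * x)
        - (t - τ) * -(x ^ (n + 1) * Real.exp (-τ * x))
        = x ^ n * Real.exp (-τ * x)
          * (Real.exp (-(t - τ) * x) - 1 - (-(t - τ) * x)) := by
      have : Real.exp (-t * x) = Real.exp (-τ * x) * Real.exp (-(t - τ) * x) := by
        rw [← Real.exp_add]; ring_nf
      rw [this]; ring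
    rw [e, norm_mul, Real.norm_eq_abs, Real.norm_eq_abs, Real.norm_eq_abs,
      abs_of_nonneg (by positivity)]
    have h1 := abs_exp_sub_one_add_le (-(t - τ) * x)
    have h2 : Real.exp |(-(t - τ) * x)| ≤ Real.exp (τ / 2 * x) := by
      apply Real.exp_le_exp.2
      rw [abs_mul, abs_neg, abs_of_nonneg hx]
      exact mul_le_mul_of_nonneg_right ht.le hx
    calc x ^ n * Real.exp (-τ * x) * |Real.exp (-(t - τ) * x) - 1 - (-(t - τ) * x)|
        ≤ x ^ n * Real.exp (-τ * x) * ((-(t - τ) * x) ^ 2 * Real.exp (τ / 2 * x)) := by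
          refine mul_le_mul_of_nonneg_left (h1.trans ?_) (by positivity)
          exact mul_le_mul_of_nonneg_left h2 (sq_nonneg _)
      _ = (x ^ (n + 2) * (Real.exp (-τ * x) * Real.exp (τ / 2 * x))) * (t - τ) ^ 2 := by ring
      _ = (x ^ (n + 2) * Real.exp (-(τ / 2) * x)) * (t - τ) ^ 2 := by
          rw [← Real.exp_add]; ring_nf
      _ ≤ C * (t - τ) ^ 2 := by gcongr; exact hC x hx
      _ = C * |(t - τ) ^ 2| := by rw [abs_of_nonneg (sq_nonneg _)]
  refine hO.trans_isLittleO ?_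
  have := (isLittleO_pow_id (𝕜 := ℝ) (n := 2) (by norm_num)).comp_tendsto
    (show Tendsto (fun x' => x' - τ) (𝓝 τ) (𝓝 0) by
      have : Tendsto (fun x' : ℝ => x' - τ) (𝓝 τ) (𝓝 (τ - τ)) := tendsto_id.sub_const τ
      rwa [sub_self] at this)
  exact this

/-- The weight is smooth in the rate with values in `CB`, as `∂_τ` only produces a factor `-|y|`. -/
theorem contDiffOn_wexp (k : ℕ) : ∀ n : ℕ, ContDiffOn ℝ k (wexp n) (Ioi 0) := by
  induction k with
  | zero =>
    intro n
    refine contDiffOn_zero.2 fun τ hτ => ?_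
    exact (hasDerivAt_wexp n hτ).continuousAt.continuousWithinAt
  | succ k ih =>
    intro n
    have := (contDiffOn_succ_iff_deriv_of_isOpen (𝕜 := ℝ) (n := (k : WithTop ℕ∞)) (f := wexp n)
      (isOpen_Ioi (a := (0 : ℝ)))).2 ⟨fun τ hτ =>
        (hasDerivAt_wexp n hτ).differentiableAt.differentiableWithinAt, by simp,
        ((ih (n + 1)).neg).congr fun τ hτ => (hasDerivAt_wexp n hτ).deriv⟩
    exact_mod_cast this

theorem contDiffAt_wexp (n : ℕ) {τ : ℝ} (hτ : 0 < τ) : ContDiffAt ℝ 2 (wexp n) τ :=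
  (contDiffOn_wexp 2 n).contDiffAt (Ioi_mem_nhds hτ)

/-! ### The bifurcation equation -/

open BoundedContinuousFunction

/-- The resolvent for the slow component: `r = e^{3y/2} p'` satisfies `r' = 3r/2 + ⋯`. -/
def opA₁ : CB →L[ℝ] CB := opA (3 / 2) (by norm_num)

theorem nu_pos : (0 : ℝ) < 1 / 8 + 2 * √2 := by positivity

/-- The resolvent for the fast component: `t = e^{y/8} q'` satisfies `t' = (1/8 + 2κ)t + ⋯`. The
variable rate `κ` is replaced by its value `√2` at `α = 0`; the difference is part of `src₂`. -/
def opA₂ : CB →L[ℝ] CB := opA (1 / 8 + 2 * √2) nu_pos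

/-- Integration from `0` against the weight `e^{-3|y|/2}`. -/
def opL₁ : CB →L[ℝ] CB := opL (3 / 2) (by norm_num)

/-- Integration from `0` against the weight `e^{-|y|/8}`. -/
def opL₂ : CB →L[ℝ] CB := opL (1 / 8) (by norm_num)

/-- The amplitude `p = e^{αy} P` on `[0, ∞)`, normalized by `p(0) = 1`, in terms of the unknown
`r = e^{3y/2} p'`. The rate `3/2` exceeds `κ`, so that `p'` is negligible with respect to `e^{-κy}`,
and it is less than the rate `7/4` of the potentials. -/
def pOf (u : CB × CB) : CB := 1 + opL₁ u.1

/-- The amplitude `q = e^{κy} D` on `[0, ∞)` in terms of the unknown `t = e^{y/8} q'`; the constant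
encodes the condition `D'(0) = 0`. -/
def qOf (u : CB × CB) : CB := (u.2 0 / kappa (u.1 0)) • (1 : CB) + opL₂ u.2

/-- The right-hand side of the equation for `r`, where `x = ((b, c), (r, t))` contains the
potentials multiplied by `e^{7|y|/4}`, and `α = r(0)`. -/
def src₁ (x : (CB × CB) × (CB × CB)) : CB :=
  (2 * x.2.1 0) • x.2.1 + wexp 0 (1 / 4) * x.1.1 * pOf x.2
    + wexp 0 (1 / 4 + kappa (x.2.1 0) - x.2.1 0) * x.1.2 * qOf x.2

/-- The right-hand side of the equation for `t`, in the same variables. -/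
def src₂ (x : (CB × CB) × (CB × CB)) : CB :=
  (2 * (kappa (x.2.1 0) - √2)) • x.2.2
    + wexp 0 (13 / 8 - kappa (x.2.1 0) + x.2.1 0) * x.1.2 * pOf x.2
    + wexp 0 (13 / 8) * x.1.1 * qOf x.2

/-- The zeros of this map near the origin are the even solutions of the eigenvalue problem in the
form `P = e^{-αy}p`, `D = e^{-κy}q`, with `α = r(0)`. The latter is the condition `P'(0) = 0`. -/
def bifMap (x : (CB × CB) × (CB × CB)) : CB × CB :=
  (x.2.1 + opA₁ (src₁ x), x.2.2 + opA₂ (src₂ x))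

theorem kappa_zero : kappa 0 = √2 := by simp [kappa]

theorem contDiffAt_kappa {a : ℝ} (ha : a ^ 2 < 2) {n : WithTop ℕ∞} : ContDiffAt ℝ n kappa a := by
  unfold kappa
  exact ContDiffAt.sqrt (by fun_prop) (by linarith)

theorem contDiff_eval (y : ℝ) {n : WithTop ℕ∞} : ContDiff ℝ n fun f : CB => f y :=
  (BoundedContinuousFunction.evalCLM ℝ y : CB →L[ℝ] ℝ).contDiff

theorem sqrt_two_lt : √2 < 13 / 8 - 1 / 8 := by
  rw [Real.sqrt_lt' (by norm_num)]; norm_num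

theorem contDiffAt_bifMap : ContDiffAt ℝ 2 bifMap 0 := by
  have hα : ContDiff ℝ 2 fun x : (CB × CB) × (CB × CB) => x.2.1 0 :=
    (contDiff_eval 0).comp (contDiff_fst.comp contDiff_snd)
  have hκ : ContDiffAt ℝ 2 (fun x : (CB × CB) × (CB × CB) => kappa (x.2.1 0)) 0 :=
    (contDiffAt_kappa (by simp)).comp (x := (0 : (CB × CB) × (CB × CB)))
      (f := fun x : (CB × CB) × (CB × CB) => x.2.1 0) hα.contDiffAt
  have hk0 : kappa (((0 : (CB × CB) × (CB × CB)).2.1 : CB) 0) = √2 := by simp [kappa_zero]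
  have ht0 : ContDiff ℝ 2 fun x : (CB × CB) × (CB × CB) => x.2.2 0 :=
    (contDiff_eval 0).comp (contDiff_snd.comp contDiff_snd)
  have hp : ContDiff ℝ 2 fun x : (CB × CB) × (CB × CB) => pOf x.2 := by
    unfold pOf
    exact contDiff_const.add (opL₁.contDiff.comp (contDiff_fst.comp contDiff_snd))
  have hq : ContDiffAt ℝ 2 (fun x : (CB × CB) × (CB × CB) => qOf x.2) 0 := by
    unfold qOf
    refine ContDiffAt.add (ContDiffAt.smul (ht0.contDiffAt.div hκ ?_) contDiffAt_const)
      (opL₂.contDiff.comp (contDiff_snd.comp contDiff_snd)).contDiffAt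
    rw [hk0]; positivity
  have hE : ∀ f : (CB × CB) × (CB × CB) → ℝ, ContDiffAt ℝ 2 f 0 → 0 < f 0 →
      ContDiffAt ℝ 2 (fun x => wexp 0 (f x)) 0 := fun f hf h0 => (contDiffAt_wexp 0 h0).comp 0 hf
  have h2 := sqrt_two_lt
  have h2' : 0 ≤ √2 := Real.sqrt_nonneg 2
  have hE1 := hE (fun x => 1 / 4 + kappa (x.2.1 0) - x.2.1 0)
    ((contDiffAt_const.add hκ).sub hα.contDiffAt) (by simp only [hk0]; simp; linarith)
  have hE2 := hE (fun x => 13 / 8 - kappa (x.2.1 0) + x.2.1 0)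
    ((contDiffAt_const.sub hκ).add hα.contDiffAt) (by simp only [hk0]; simp; linarith)
  have hb : ContDiff ℝ 2 fun x : (CB × CB) × (CB × CB) => x.1.1 := contDiff_fst.comp contDiff_fst
  have hc : ContDiff ℝ 2 fun x : (CB × CB) × (CB × CB) => x.1.2 := contDiff_snd.comp contDiff_fst
  have hr : ContDiff ℝ 2 fun x : (CB × CB) × (CB × CB) => x.2.1 := contDiff_fst.comp contDiff_snd
  have ht : ContDiff ℝ 2 fun x : (CB × CB) × (CB × CB) => x.2.2 := contDiff_snd.comp contDiff_snd
  have hs1 : ContDiffAt ℝ 2 src₁ 0 := by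
    unfold src₁
    exact (((contDiff_const.mul hα).smul hr).contDiffAt.add
      ((contDiffAt_const.mul hb.contDiffAt).mul hp.contDiffAt)).add
      ((hE1.mul hc.contDiffAt).mul hq)
  have hs2 : ContDiffAt ℝ 2 src₂ 0 := by
    unfold src₂
    exact (((contDiffAt_const.mul (hκ.sub contDiffAt_const)).smul ht.contDiffAt).add
      ((hE2.mul hc.contDiffAt).mul hp.contDiffAt)).add
      ((contDiffAt_const.mul hb.contDiffAt).mul hq)
  exact (hr.contDiffAt.add (opA₁.contDiff.contDiffAt.comp 0 hs1)).prodMk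
    (ht.contDiffAt.add (opA₂.contDiff.contDiffAt.comp 0 hs2))

theorem bifMap_zero_left (u : CB × CB) : bifMap (0, u) =
    (u.1 + opA₁ ((2 * u.1 0) • u.1), u.2 + opA₂ ((2 * (kappa (u.1 0) - √2)) • u.2)) := by
  simp [bifMap, src₁, src₂]

theorem bifMap_zero_right (β : CB × CB) : bifMap (β, 0) =
    (opA₁ (wexp 0 (1 / 4) * β.1), opA₂ (wexp 0 (13 / 8 - √2) * β.2)) := by
  simp [bifMap, src₁, src₂, pOf, qOf, kappa_zero]

/-- The derivative of the bifurcation map in the potentials, which is, up to sign, the linearization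
of the solution map at the origin. -/
def bifLin : CB × CB →L[ℝ] CB × CB :=
  ((opA₁.comp (ContinuousLinearMap.mul ℝ CB (wexp 0 (1 / 4)))).comp
    (ContinuousLinearMap.fst ℝ CB CB)).prod
  ((opA₂.comp (ContinuousLinearMap.mul ℝ CB (wexp 0 (13 / 8 - √2)))).comp
    (ContinuousLinearMap.snd ℝ CB CB))

/-- The derivative in the unknown is the identity: the remaining terms of `src₁` and `src₂` contain a
product of two small quantities. -/
theorem fderiv_bifMap_inr :
    (fderiv ℝ bifMap 0).comp (ContinuousLinearMap.inr ℝ (CB × CB) (CB × CB)) =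
      ContinuousLinearMap.id ℝ (CB × CB) := by
  have hd : HasFDerivAt bifMap (fderiv ℝ bifMap 0) (0 : (CB × CB) × (CB × CB)) :=
    (contDiffAt_bifMap.differentiableAt (by norm_num)).hasFDerivAt
  have h1 : HasFDerivAt (fun u : CB × CB => bifMap (0, u))
      ((fderiv ℝ bifMap 0).comp (ContinuousLinearMap.inr ℝ (CB × CB) (CB × CB))) 0 :=
    HasFDerivAt.comp (f := fun u : CB × CB => ((0 : CB × CB), u)) (0 : CB × CB) hd
      (ContinuousLinearMap.inr ℝ (CB × CB) (CB × CB)).hasFDerivAt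
  have hz : ∀ (c : CB × CB → ℝ) (f : CB × CB →L[ℝ] CB), DifferentiableAt ℝ c 0 → c 0 = 0 →
      HasFDerivAt (fun u => c u • f u) (0 : CB × CB →L[ℝ] CB) 0 := by
    intro c f hc h0
    refine (hc.hasFDerivAt.smul f.hasFDerivAt).congr_fderiv ?_
    refine ContinuousLinearMap.ext fun x => ?_
    change c 0 • f x + (fderiv ℝ c 0 x) • f 0 = 0
    rw [h0, map_zero, zero_smul, smul_zero, add_zero]
  have hα : Differentiable ℝ fun u : CB × CB => u.1 0 :=
    (((contDiff_eval 0).comp contDiff_fst : ContDiff ℝ 1 fun u : CB × CB => u.1 0)).differentiable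
      (by norm_num)
  have hκ : DifferentiableAt ℝ (fun u : CB × CB => kappa (u.1 0)) 0 :=
    ((contDiffAt_kappa (n := 1) (by simp)).differentiableAt (by norm_num)).comp (0 : CB × CB)
      (f := fun u : CB × CB => u.1 0) hα.differentiableAt
  have h2 : HasFDerivAt (fun u : CB × CB => bifMap (0, u)) (ContinuousLinearMap.id ℝ (CB × CB))
      0 := by
    have e : (fun u : CB × CB => bifMap (0, u)) = fun u : CB × CB =>
      (u.1 + opA₁ ((2 * u.1 0) • u.1), u.2 + opA₂ ((2 * (kappa (u.1 0) - √2)) • u.2)) :=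
        funext bifMap_zero_left
    rw [e]
    have h3 := opA₁.hasFDerivAt.comp (0 : CB × CB) (hz (fun u => 2 * u.1 0)
      (ContinuousLinearMap.fst ℝ CB CB) (hα.differentiableAt.const_mul 2) (by simp))
    have h4 := opA₂.hasFDerivAt.comp (0 : CB × CB) (hz (fun u => 2 * (kappa (u.1 0) - √2))
      (ContinuousLinearMap.snd ℝ CB CB) ((hκ.sub_const _).const_mul 2) (by simp [kappa_zero]))
    refine ((hasFDerivAt_fst.add h3).prodMk (hasFDerivAt_snd.add h4)).congr_fderiv ?_
    ext <;> simp
  exact h1.unique h2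

theorem fderiv_bifMap_inl :
    (fderiv ℝ bifMap 0).comp (ContinuousLinearMap.inl ℝ (CB × CB) (CB × CB)) = bifLin := by
  have hd : HasFDerivAt bifMap (fderiv ℝ bifMap 0) (0 : (CB × CB) × (CB × CB)) :=
    (contDiffAt_bifMap.differentiableAt (by norm_num)).hasFDerivAt
  have h1 : HasFDerivAt (fun u : CB × CB => bifMap (u, 0))
      ((fderiv ℝ bifMap 0).comp (ContinuousLinearMap.inl ℝ (CB × CB) (CB × CB))) 0 :=
    HasFDerivAt.comp (f := fun u : CB × CB => (u, (0 : CB × CB))) (0 : CB × CB) hd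
      (ContinuousLinearMap.inl ℝ (CB × CB) (CB × CB)).hasFDerivAt
  have h2 : HasFDerivAt (fun u : CB × CB => bifMap (u, 0)) bifLin 0 := by
    have e : (fun u : CB × CB => bifMap (u, 0)) = bifLin := by
      ext1 u
      rw [bifMap_zero_right]
      rfl
    rw [e]
    exact bifLin.hasFDerivAt
  exact h1.unique h2

/-- Quantitative first-order expansion of a `C²` map near a zero. -/
theorem exists_ball_expansion {E F : Type*} [NormedAddCommGroup E] [NormedSpace ℝ E]
    [NormedAddCommGroup F] [NormedSpace ℝ F] {U : E → F} {Λ : E →L[ℝ] F}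
    (hUc : ContDiffAt ℝ 2 U 0) (hU0 : U 0 = 0) (hfd : fderiv ℝ U 0 = Λ) {q : E → Prop}
    (hq : ∀ᶠ β in 𝓝 (0 : E), q β) :
    ∃ η K : ℝ, 0 < η ∧ 0 < K ∧ ContDiffOn ℝ 1 U (Metric.ball 0 η) ∧
    ∀ β ∈ Metric.ball (0 : E) η, q β ∧ ‖U β‖ ≤ K * ‖β‖ ∧
      ‖U β‖ ≤ 1 / 16 ∧ ‖fderiv ℝ U β‖ ≤ K ∧ ‖fderiv ℝ U β - Λ‖ ≤ K * ‖β‖ ∧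
      ‖U β - Λ β‖ ≤ K * ‖β‖ ^ 2 := by
  have hUe : ∀ᶠ β in 𝓝 (0 : E), ContDiffAt ℝ 2 U β := hUc.eventually (by simp)
  have hfdc : ContDiffAt ℝ 1 (fderiv ℝ U) 0 := hUc.fderiv_right (by norm_num)
  have hfdO := (hfdc.differentiableAt (by norm_num)).isBigO_sub
  obtain ⟨K₁, hK₁, hO⟩ := hfdO.exists_pos
  have hO := hO.bound
  obtain ⟨η, hη, hball⟩ := Metric.eventually_nhds_iff_ball.1 ((hUe.and hO).and hq)
  set K := K₁ * η + K₁ + ‖Λ‖ with hK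
  have hKpos : 0 < K := by positivity
  have hUdiff : ∀ β ∈ Metric.ball (0 : E) η, HasFDerivAt U (fderiv ℝ U β) β := fun β hβ =>
    ((hball β hβ).1.1.differentiableAt (by norm_num)).hasFDerivAt
  have hb1 : ∀ β ∈ Metric.ball (0 : E) η, ‖fderiv ℝ U β - Λ‖ ≤ K₁ * ‖β‖ := by
    intro β hβ
    have := (hball β hβ).1.2
    rwa [hfd, sub_zero] at this
  have hb2 : ∀ β ∈ Metric.ball (0 : E) η, ‖U β - Λ β‖ ≤ K₁ * ‖β‖ ^ 2 := by
    intro β hβ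
    have hsub : Metric.closedBall (0 : E) ‖β‖ ⊆ Metric.ball 0 η :=
      Metric.closedBall_subset_ball (by simpa using hβ)
    have := Convex.norm_image_sub_le_of_norm_hasFDerivWithin_le' (f := U) (φ := Λ)
      (C := K₁ * ‖β‖) (s := Metric.closedBall (0 : E) ‖β‖) (x := 0) (y := β)
      (fun x hx => (hUdiff x (hsub hx)).hasFDerivWithinAt) (fun x hx => by
        refine (hb1 x (hsub hx)).trans ?_
        gcongr
        simpa using hx) (convex_closedBall _ _) (by simp) (by simp)
    rw [hU0, sub_zero, sub_zero] at this
    calc _ ≤ _ := this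
      _ = _ := by ring
  have hb3 : ∀ β ∈ Metric.ball (0 : E) η, ‖U β‖ ≤ K * ‖β‖ := by
    intro β hβ
    have h1 := hb2 β hβ
    have h2 : ‖β‖ ≤ η := by simpa using (Metric.mem_ball.1 hβ).le
    calc ‖U β‖ = ‖(U β - Λ β) + Λ β‖ := by rw [sub_add_cancel]
      _ ≤ ‖U β - Λ β‖ + ‖Λ β‖ := norm_add_le _ _
      _ ≤ K₁ * ‖β‖ ^ 2 + ‖Λ‖ * ‖β‖ := add_le_add h1 (Λ.le_opNorm β)
      _ = (K₁ * ‖β‖ + ‖Λ‖) * ‖β‖ := by ring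
      _ ≤ K * ‖β‖ := by
        refine mul_le_mul_of_nonneg_right ?_ (norm_nonneg _)
        have : K₁ * ‖β‖ ≤ K₁ * η := by gcongr
        linarith
  refine ⟨min η (1 / (16 * K)), K, by positivity, hKpos, fun β hβ => ?_, fun β hβ => ?_⟩
  · have hβ' := Metric.ball_subset_ball (min_le_left _ _) hβ
    exact ((hball β hβ').1.1.of_le (by norm_num)).contDiffWithinAt
  · have hβ' := Metric.ball_subset_ball (min_le_left _ _) hβ
    have hβn : ‖β‖ ≤ 1 / (16 * K) := by
      have := Metric.ball_subset_ball (min_le_right _ _) hβ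
      simpa using (Metric.mem_ball.1 this).le
    have hK₁K : K₁ ≤ K := by
      have : 0 ≤ K₁ * η := by positivity
      have := norm_nonneg Λ
      linarith
    have hβη : ‖β‖ ≤ η := by simpa using (Metric.mem_ball.1 hβ').le
    refine ⟨(hball β hβ').2, hb3 β hβ', ?_, ?_, ?_, ?_⟩
    · calc ‖U β‖ ≤ K * ‖β‖ := hb3 β hβ'
        _ ≤ K * (1 / (16 * K)) := by gcongr
        _ = 1 / 16 := by field_simp
    · calc ‖fderiv ℝ U β‖ = ‖(fderiv ℝ U β - Λ) + Λ‖ := by rw [sub_add_cancel]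
        _ ≤ ‖fderiv ℝ U β - Λ‖ + ‖Λ‖ := norm_add_le _ _
        _ ≤ K₁ * ‖β‖ + ‖Λ‖ := add_le_add (hb1 β hβ') le_rfl
        _ ≤ K := by
          have : K₁ * ‖β‖ ≤ K₁ * η := by gcongr
          linarith
    · exact (hb1 β hβ').trans (by gcongr)
    · exact (hb2 β hβ').trans (by gcongr)

/-- The branch of solutions of the eigenvalue problem, as a function of the potentials. -/
theorem exists_branch : ∃ (U : CB × CB → CB × CB) (η K : ℝ), 0 < η ∧ 0 < K ∧
    ContDiffOn ℝ 1 U (Metric.ball 0 η) ∧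
    ∀ β ∈ Metric.ball (0 : CB × CB) η, bifMap (β, U β) = 0 ∧ ‖U β‖ ≤ K * ‖β‖ ∧
      ‖U β‖ ≤ 1 / 16 ∧ ‖fderiv ℝ U β‖ ≤ K ∧ ‖fderiv ℝ U β - -bifLin‖ ≤ K * ‖β‖ ∧
      ‖U β - (-bifLin) β‖ ≤ K * ‖β‖ ^ 2 := by
  have hinv : (fderiv ℝ bifMap 0 ∘L ContinuousLinearMap.inr ℝ (CB × CB) (CB × CB)).IsInvertible :=
    ⟨ContinuousLinearEquiv.refl ℝ _, by rw [fderiv_bifMap_inr]; rfl⟩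
  set U := contDiffAt_bifMap.implicitFunction (by norm_num) hinv with hU
  have hU0 : U 0 = 0 := contDiffAt_bifMap.implicitFunction_apply_self (by norm_num) hinv
  have hUeq := contDiffAt_bifMap.eventually_apply_implicitFunction (by norm_num) hinv
  have hUd := (contDiffAt_bifMap.hasStrictFDerivAt_implicitFunction (by norm_num) hinv).hasFDerivAt
  have hUc : ContDiffAt ℝ 2 U 0 := contDiffAt_bifMap.contDiffAt_implicitFunction (by norm_num) hinv
  have hfd : fderiv ℝ U 0 = -bifLin := by
    have h := hUd.fderiv
    rw [← hU] at h
    rw [show (0 : CB × CB) = (0 : (CB × CB) × (CB × CB)).1 from rfl, h, fderiv_bifMap_inr,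
      fderiv_bifMap_inl]
    simp
  have hb0 : bifMap 0 = 0 := by
    have := bifMap_zero_right 0
    rw [Prod.fst_zero, Prod.snd_zero, mul_zero, mul_zero, map_zero, map_zero] at this
    exact this
  obtain ⟨η, K, hη, hK, h1, h2⟩ := exists_ball_expansion hUc hU0 hfd hUeq
  exact ⟨U, η, K, hη, hK, h1, fun β hβ => ⟨(h2 β hβ).1.trans hb0, (h2 β hβ).2⟩⟩

/-! ### Differentiable curves of bounded continuous functions -/

/-- A jointly continuous, locally uniformly decaying family is a continuous curve in `CB`. -/
theorem continuousOn_toCB {U : Set ℝ} (hU : IsOpen U) {f : ℝ → ℝ → ℝ} {τ : ℝ} (hτ : 0 < τ)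
    (hf : ContinuousOn (fun p : ℝ × ℝ => f p.1 p.2) (U ×ˢ univ))
    (hb : ∀ w ∈ U, ∃ C, ∀ᶠ v in 𝓝 w, ∀ y, |f v y| ≤ C * Real.exp (-τ * |y|)) :
    ContinuousOn (fun w => toCB (f w)) U := by
  intro w hw
  refine ContinuousAt.continuousWithinAt ?_
  obtain ⟨C, hC⟩ := hb w hw
  rw [Metric.continuousAt_iff']
  intro e he
  have hlim : Tendsto (fun R : ℝ => C * Real.exp (-τ * R)) atTop (𝓝 (C * 0)) := by
    refine (Real.tendsto_exp_atBot.comp ?_).const_mul C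
    exact tendsto_id.const_mul_atTop_of_neg (neg_lt_zero.2 hτ)
  rw [mul_zero] at hlim
  obtain ⟨R, hR0, hR⟩ := ((eventually_gt_atTop (0 : ℝ)).and
    (hlim.eventually (gt_mem_nhds (show (0 : ℝ) < e / 4 by linarith)))).exists
  obtain ⟨δ, hδ, hδU⟩ := Metric.nhds_basis_closedBall.mem_iff.1 (hU.mem_nhds hw)
  have hK : IsCompact (Metric.closedBall w δ ×ˢ Icc (-R) R) :=
    (isCompact_closedBall w δ).prod isCompact_Icc
  have huc := hK.uniformContinuousOn_of_continuous (hf.mono (prod_mono hδU (subset_univ _)))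
  obtain ⟨d, hd, hud⟩ := Metric.uniformContinuousOn_iff.1 huc (e / 2) (by linarith)
  have hC0 : ∀ y, |f w y| ≤ C * Real.exp (-τ * |y|) := hC.self_of_nhds
  have hCnn : 0 ≤ C := by
    have := (abs_nonneg _).trans (hC0 0)
    simpa using this
  have hexp : ∀ y : ℝ, Real.exp (-τ * |y|) ≤ 1 := fun y =>
    Real.exp_le_one_iff.2 (by nlinarith [abs_nonneg y])
  have hbn : ∀ v : ℝ, (∀ y, |f v y| ≤ C * Real.exp (-τ * |y|)) → ∀ y, ‖f v y‖ ≤ C :=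
    fun v hv y => (hv y).trans (by nlinarith [hexp y])
  filter_upwards [hC, Metric.ball_mem_nhds w (lt_min hd hδ)] with v hv hvd
  have hvd1 : dist v w < d := hvd.trans_le (min_le_left _ _)
  have hvd2 : dist v w < δ := hvd.trans_le (min_le_right _ _)
  refine lt_of_le_of_lt ?_ (show e / 2 < e by linarith)
  rw [dist_eq_norm]
  refine (BoundedContinuousFunction.norm_le (by linarith)).2 fun y => ?_
  rw [BoundedContinuousFunction.coe_sub, Pi.sub_apply,
    toCB_apply (continuous_section hf (hδU (Metric.mem_closedBall.2 hvd2.le))) (hbn v hv),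
    toCB_apply (continuous_section hf hw) (hbn w hC0)]
  rcases le_or_gt |y| R with h | h
  · have h2 := hud (v, y) ⟨Metric.mem_closedBall.2 hvd2.le, abs_le.1 h⟩ (w, y)
      ⟨Metric.mem_closedBall_self hδ.le, abs_le.1 h⟩
      (by rw [Prod.dist_eq, dist_self]; exact max_lt hvd1 hd)
    rw [Real.dist_eq] at h2
    exact h2.le
  · have h3 : C * Real.exp (-τ * |y|) ≤ e / 4 := by
      refine le_trans ?_ hR.le
      exact mul_le_mul_of_nonneg_left (Real.exp_le_exp.2 (by nlinarith)) hCnn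
    rw [Real.norm_eq_abs]
    have := abs_sub (f v y) (f w y)
    linarith [hv y, hC0 y]

theorem hasDerivAt_toCB {U : Set ℝ} (hU : IsOpen U) {f f' : ℝ → ℝ → ℝ} {τ : ℝ} (hτ : 0 < τ)
    (hf : ContinuousOn (fun p : ℝ × ℝ => f p.1 p.2) (U ×ˢ univ))
    (hf' : ContinuousOn (fun p : ℝ × ℝ => f' p.1 p.2) (U ×ˢ univ))
    (hd : ∀ w ∈ U, ∀ y, HasDerivAt (fun w => f w y) (f' w y) w)
    (hb : ∀ w ∈ U, ∃ C, ∀ᶠ v in 𝓝 w, ∀ y, |f v y| ≤ C * Real.exp (-τ * |y|))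
    (hb' : ∀ w ∈ U, ∃ C, ∀ᶠ v in 𝓝 w, ∀ y, |f' v y| ≤ C * Real.exp (-τ * |y|))
    {w : ℝ} (hw : w ∈ U) :
    HasDerivAt (fun w => toCB (f w)) (toCB (f' w)) w := by
  have hval : ∀ F : ℝ → ℝ → ℝ, ContinuousOn (fun p : ℝ × ℝ => F p.1 p.2) (U ×ˢ univ) →
      (∀ w ∈ U, ∃ C, ∀ᶠ v in 𝓝 w, ∀ y, |F v y| ≤ C * Real.exp (-τ * |y|)) →
      ∀ v ∈ U, ∀ y, toCB (F v) y = F v y := by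
    intro F hF hb v hv
    obtain ⟨C, hC⟩ := hb v hv
    have h := hC.self_of_nhds
    have hC0 : 0 ≤ C := by
      have := (abs_nonneg _).trans (h 0)
      simpa using this
    refine toCB_apply (continuous_section hF hv) (C := C) fun y => (h y).trans ?_
    have : Real.exp (-τ * |y|) ≤ 1 := Real.exp_le_one_iff.2 (by nlinarith [abs_nonneg y])
    nlinarith
  have hc := (continuousOn_toCB hU hτ hf' hb').continuousAt (hU.mem_nhds hw)
  rw [hasDerivAt_iff_isLittleO, isLittleO_iff]
  intro e he
  obtain ⟨d, hd0, hdc⟩ := Metric.continuousAt_iff.1 hc e he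
  obtain ⟨δ, hδ, hδU⟩ := Metric.nhds_basis_ball.mem_iff.1 (hU.mem_nhds hw)
  filter_upwards [Metric.ball_mem_nhds w (lt_min hd0 hδ)] with v hv
  refine (BoundedContinuousFunction.norm_le (by positivity)).2 fun y => ?_
  have hsub : Metric.ball w (min d δ) ⊆ U := (Metric.ball_subset_ball (min_le_right _ _)).trans hδU
  simp only [BoundedContinuousFunction.coe_sub, Pi.sub_apply, BoundedContinuousFunction.coe_smul,
    smul_eq_mul]
  rw [hval f hf hb v (hsub hv), hval f hf hb w hw, hval f' hf' hb' w hw]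
  have hmv := Convex.norm_image_sub_le_of_norm_hasDerivWithin_le
    (f := fun x => f x y - x * f' w y) (f' := fun x => f' x y - f' w y) (C := e)
    (s := Metric.ball w (min d δ)) (x := w) (y := v)
    (fun x hx => ((hd x (hsub hx) y).sub (by
      simpa using (hasDerivAt_id x).mul_const (f' w y))).hasDerivWithinAt)
    (fun x hx => by
      have h1 := hdc (Metric.ball_subset_ball (min_le_left _ _) hx)
      rw [dist_eq_norm] at h1
      have h2 := (toCB (f' x) - toCB (f' w)).norm_coe_le_norm y
      rw [BoundedContinuousFunction.coe_sub, Pi.sub_apply, hval f' hf' hb' x (hsub hx),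
        hval f' hf' hb' w hw] at h2
      exact h2.trans h1.le) (convex_ball _ _) (Metric.mem_ball_self (by positivity)) hv
  refine le_trans (le_of_eq ?_) hmv
  congr 1
  ring

/-! ### The potentials -/

/-- `(a⁺ + a⁻)/(2Q²)` as a function of `s = ωQ²`. -/
def bfun (g : ℝ → ℝ) (s : ℝ) : ℝ := 3 * gam g 0 s - 4 * gamI g s - gam g 1 s

/-- `(a⁺ - a⁻)/(2Q²)` as a function of `s = ωQ²`. -/
def cfun (g : ℝ → ℝ) (s : ℝ) : ℝ := -2 * gam g 0 s + 2 * gamI g s + gam g 1 s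

/-- `s ∂_s bfun`. -/
def bth (g : ℝ → ℝ) (s : ℝ) : ℝ :=
  3 * (gam g 1 s - gam g 0 s) - 4 * (gam g 0 s - 2 * gamI g s) - gam g 2 s

/-- `s ∂_s cfun`. -/
def cth (g : ℝ → ℝ) (s : ℝ) : ℝ :=
  -2 * (gam g 1 s - gam g 0 s) + 2 * (gam g 0 s - 2 * gamI g s) + gam g 2 s

/-- A potential `Q² φ(ωQ²)`. -/
def pot (g : ℝ → ℝ) (φ : ℝ → ℝ) (ω y : ℝ) : ℝ := sf g ω y / ω * φ (sf g ω y)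

/-- The multiple of `s` given by `ω∂_ω s`, at `s = ωQ²`. -/
def lf (g : ℝ → ℝ) (ω y : ℝ) : ℝ := mfun g (sf g ω y) - 2 * hf g ω y * jf g ω y

/-- `ω∂_ω` of a potential `Q² φ(ωQ²)`, where `φθ = s φ'`. -/
def potD (g : ℝ → ℝ) (φ φθ : ℝ → ℝ) (ω y : ℝ) : ℝ :=
  sf g ω y / ω * ((lf g ω y - 1) * φ (sf g ω y) + lf g ω y * φθ (sf g ω y))

theorem hasDerivAt_bfun {g : ℝ → ℝ} (h1 : HypH1 g) {s : ℝ} (hs : 0 < s) :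
    HasDerivAt (bfun g) (bth g s / s) s := by
  have a0 := hasDerivAt_gam (k := 0) (h1.contDiffOn_le (by norm_num)) hs
  have a1 := hasDerivAt_gam (k := 1) (h1.contDiffOn_le (by norm_num)) hs
  refine (((a0.const_mul 3).sub ((h1.hasDerivAt_gamI hs).const_mul 4)).sub a1).congr_deriv ?_
  rw [bth]; push_cast; field_simp; ring

theorem hasDerivAt_cfun {g : ℝ → ℝ} (h1 : HypH1 g) {s : ℝ} (hs : 0 < s) :
    HasDerivAt (cfun g) (cth g s / s) s := by
  have a0 := hasDerivAt_gam (k := 0) (h1.contDiffOn_le (by norm_num)) hs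
  have a1 := hasDerivAt_gam (k := 1) (h1.contDiffOn_le (by norm_num)) hs
  refine (((a0.const_mul (-2)).add ((h1.hasDerivAt_gamI hs).const_mul 2)).add a1).congr_deriv ?_
  rw [cth]; push_cast; field_simp; ring

/-- What the two potentials have in common: `φ` and `φθ = s φ'` are continuous and of size `ε_ω`. -/
structure IsCoef (g φ φθ : ℝ → ℝ) : Prop where
  hasDerivAt : ∀ s, 0 < s → HasDerivAt φ (φθ s / s) s
  continuousOn : ContinuousOn φθ (Ioi 0)
  abs_le : ∀ ω s, s ∈ Ioc 0 (3 * ω) → |φ s| ≤ 6 * eps g ω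
  abs_le' : ∀ ω s, s ∈ Ioc 0 (3 * ω) → |φθ s| ≤ 20 * eps g ω

theorem isCoef_bfun {g : ℝ → ℝ} (h1 : HypH1 g) : IsCoef g (bfun g) (bth g) := by
  have c0 := continuousOn_gam (k := 0) (h1.contDiffOn_le (by norm_num))
  have c1 := continuousOn_gam (k := 1) (h1.contDiffOn_le (by norm_num))
  have c2 := continuousOn_gam (k := 2) (h1.contDiffOn_le (by norm_num))
  have cI := SmallFreq.continuousOn_gamI h1
  refine ⟨fun s hs => hasDerivAt_bfun h1 hs, by unfold bth; fun_prop, fun ω s hs => ?_,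
    fun ω s hs => ?_⟩
  all_goals
    have h0 := abs_le.1 (h1.abs_gam_le (k := 0) (by norm_num) hs.1 hs.2)
    have h1' := abs_le.1 (h1.abs_gam_le (k := 1) (by norm_num) hs.1 hs.2)
    have h2 := abs_le.1 (h1.abs_gam_le (k := 2) (by norm_num) hs.1 hs.2)
    have hI := abs_le.1 (h1.abs_gamI_le hs.1 hs.2)
    rw [abs_le]
  · constructor <;> unfold bfun <;> linarith
  · constructor <;> unfold bth <;> linarith

theorem isCoef_cfun {g : ℝ → ℝ} (h1 : HypH1 g) : IsCoef g (cfun g) (cth g) := by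
  have c0 := continuousOn_gam (k := 0) (h1.contDiffOn_le (by norm_num))
  have c1 := continuousOn_gam (k := 1) (h1.contDiffOn_le (by norm_num))
  have c2 := continuousOn_gam (k := 2) (h1.contDiffOn_le (by norm_num))
  have cI := SmallFreq.continuousOn_gamI h1
  refine ⟨fun s hs => hasDerivAt_cfun h1 hs, by unfold cth; fun_prop, fun ω s hs => ?_,
    fun ω s hs => ?_⟩
  all_goals
    have h0 := abs_le.1 (h1.abs_gam_le (k := 0) (by norm_num) hs.1 hs.2)
    have h1' := abs_le.1 (h1.abs_gam_le (k := 1) (by norm_num) hs.1 hs.2)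
    have h2 := abs_le.1 (h1.abs_gam_le (k := 2) (by norm_num) hs.1 hs.2)
    have hI := abs_le.1 (h1.abs_gamI_le hs.1 hs.2)
    rw [abs_le]
  · constructor <;> unfold cfun <;> linarith
  · constructor <;> unfold cth <;> linarith

namespace SmallFreq

variable {g : ℝ → ℝ} {ω₀ ω : ℝ} {φ φθ : ℝ → ℝ}

theorem continuousOn_comp_sf (H : SmallFreq g ω₀) {f : ℝ → ℝ} (hf : ContinuousOn f (Ioi 0)) :
    ContinuousOn (fun p : ℝ × ℝ => f (sf g p.1 p.2)) (Ioo 0 ω₀ ×ˢ univ) :=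
  hf.comp H.continuousOn_sf fun p hp => (H.sf_mem hp.1 p.2).1

theorem continuousOn_lf (H : SmallFreq g ω₀) :
    ContinuousOn (fun p : ℝ × ℝ => lf g p.1 p.2) (Ioo 0 ω₀ ×ˢ univ) := by
  have h1 : ContinuousOn (fun p : ℝ × ℝ => mfun g (sf g p.1 p.2)) (Ioo 0 ω₀ ×ˢ univ) :=
    H.continuousOn_mfun.comp H.continuousOn_sf fun p hp => H.sf_mem' hp.1 p.2
  have h2 := H.continuousOn_hf
  have h3 := H.continuousOn_jf
  unfold lf
  fun_prop

theorem continuousOn_sf_div (H : SmallFreq g ω₀) :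
    ContinuousOn (fun p : ℝ × ℝ => sf g p.1 p.2 / p.1) (Ioo 0 ω₀ ×ˢ univ) :=
  H.continuousOn_sf.div continuousOn_fst fun _ hp => hp.1.1.ne'

theorem _root_.InternalMode.IsCoef.continuousOn' (hφ : IsCoef g φ φθ) : ContinuousOn φ (Ioi 0) :=
  fun s hs => (hφ.hasDerivAt s hs).continuousAt.continuousWithinAt

theorem continuousOn_pot (H : SmallFreq g ω₀) (hφ : ContinuousOn φ (Ioi 0)) :
    ContinuousOn (fun p : ℝ × ℝ => pot g φ p.1 p.2) (Ioo 0 ω₀ ×ˢ univ) :=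
  H.continuousOn_sf_div.mul (H.continuousOn_comp_sf hφ)

theorem continuousOn_potD (H : SmallFreq g ω₀) (hφ : IsCoef g φ φθ) :
    ContinuousOn (fun p : ℝ × ℝ => potD g φ φθ p.1 p.2) (Ioo 0 ω₀ ×ˢ univ) := by
  have h1 := H.continuousOn_sf_div
  have h2 := H.continuousOn_comp_sf hφ.continuousOn'
  have h3 := H.continuousOn_comp_sf hφ.continuousOn
  have h4 := H.continuousOn_lf
  exact h1.mul (((h4.sub continuousOn_const).mul h2).add (h4.mul h3))

theorem hasDerivAt_pot_omega (H : SmallFreq g ω₀) (hω : ω ∈ Ioo 0 ω₀)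
    (hφ : ∀ s, 0 < s → HasDerivAt φ (φθ s / s) s) (y : ℝ) :
    HasDerivAt (fun w => pot g φ w y) (potD g φ φθ ω y / ω) ω := by
  have hs := H.hasDerivAt_sf_omega hω y
  have hp := (H.sf_mem hω y).1
  have hw := hω.1.ne'
  refine ((hs.div (hasDerivAt_id ω) hw).mul ((hφ _ hp).comp ω hs)).congr_deriv ?_
  simp only [potD, lf, id, Function.comp_apply, Pi.div_apply]
  field_simp

theorem hasDerivAt_pot (H : SmallFreq g ω₀) (hω : ω ∈ Ioo 0 ω₀)
    (hφ : ∀ s, 0 < s → HasDerivAt φ (φθ s / s) s) (y : ℝ) :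
    HasDerivAt (pot g φ ω) (2 * hf g ω y * pot g (fun s => φ s + φθ s) ω y) y := by
  have hs := H.hasDerivAt_sf hω y
  have hp := (H.sf_mem hω y).1
  have hw := hω.1.ne'
  refine ((hs.div_const ω).mul ((hφ _ hp).comp y hs)).congr_deriv ?_
  simp only [pot, Function.comp_apply]
  field_simp

theorem abs_pot_le (H : SmallFreq g ω₀) (hω : ω ∈ Ioo 0 ω₀) (hφ : IsCoef g φ φθ) (y : ℝ) :
    |pot g φ ω y| ≤ 72 * eps g ω * Real.exp (-(15 / 8) * |y|) := by
  have h1 := H.sf_le hω y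
  have h2 := hφ.abs_le ω _ (H.sf_mem hω y)
  have h3 : 0 < sf g ω y / ω := div_pos (H.sf_mem hω y).1 hω.1
  rw [pot, abs_mul, abs_of_pos h3]
  calc _ ≤ 12 * Real.exp (-(15 / 8) * |y|) * (6 * eps g ω) :=
        mul_le_mul h1 h2 (abs_nonneg _) (by positivity)
    _ = _ := by ring

theorem abs_lf_le (H : SmallFreq g ω₀) (hω : ω ∈ Ioo 0 ω₀) (y : ℝ) :
    |lf g ω y| ≤ 2 * (1 + |y|) := by
  have h1 := H.mfun_bounds (H.sf_mem'' hω y)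
  have h2 := H.abs_jf_le hω y
  have h3 := H.eps_le' (Ioo_subset_Ioc_self hω)
  have h4 := abs_hf_le g ω y
  have h5 : |hf g ω y * jf g ω y| ≤ 1 * (18 * eps g ω * |y|) := by
    rw [abs_mul]; exact mul_le_mul h4 h2 (abs_nonneg _) (by norm_num)
  have h6 : 18 * eps g ω * |y| ≤ 18 / 128 * |y| :=
    mul_le_mul_of_nonneg_right (by linarith) (abs_nonneg y)
  have h7 := abs_le.1 h5
  rw [abs_le, lf]
  constructor <;> linarith [abs_nonneg y]

theorem abs_potD_le (H : SmallFreq g ω₀) (hω : ω ∈ Ioo 0 ω₀) (hφ : IsCoef g φ φθ) (y : ℝ) :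
    |potD g φ φθ ω y| ≤ 800 * eps g ω * (1 + |y|) * Real.exp (-(15 / 8) * |y|) := by
  have h1 := H.sf_le hω y
  have h2 := hφ.abs_le ω _ (H.sf_mem hω y)
  have h2' := hφ.abs_le' ω _ (H.sf_mem hω y)
  have h3 : 0 < sf g ω y / ω := div_pos (H.sf_mem hω y).1 hω.1
  have h4 := H.abs_lf_le hω y
  have he := H.h1.eps_nonneg hω.1
  have hy := abs_nonneg y
  have h5 : |lf g ω y - 1| ≤ 3 * (1 + |y|) := by
    rw [abs_le] at *; constructor <;> linarith [h4.1, h4.2]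
  have h6 : |(lf g ω y - 1) * φ (sf g ω y) + lf g ω y * φθ (sf g ω y)|
      ≤ 3 * (1 + |y|) * (6 * eps g ω) + 2 * (1 + |y|) * (20 * eps g ω) := by
    refine (abs_add_le _ _).trans (add_le_add ?_ ?_) <;> rw [abs_mul]
    · exact mul_le_mul h5 h2 (abs_nonneg _) (by positivity)
    · exact mul_le_mul h4 h2' (abs_nonneg _) (by positivity)
  rw [potD, abs_mul, abs_of_pos h3]
  calc _ ≤ 12 * Real.exp (-(15 / 8) * |y|) *
        (3 * (1 + |y|) * (6 * eps g ω) + 2 * (1 + |y|) * (20 * eps g ω)) :=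
        mul_le_mul h1 h6 (abs_nonneg _) (by positivity)
    _ = 696 * (eps g ω * (1 + |y|) * Real.exp (-(15 / 8) * |y|)) := by ring
    _ ≤ 800 * (eps g ω * (1 + |y|) * Real.exp (-(15 / 8) * |y|)) := by gcongr; norm_num
    _ = _ := by ring

/-- The potential multiplied by the weight `e^{7|y|/4}`, as an element of the Banach space. -/
def _root_.InternalMode.potCB (g φ : ℝ → ℝ) (ω : ℝ) : CB :=
  toCB fun y => Real.exp (7 / 4 * |y|) * pot g φ ω y

/-- The derivative of `potCB` with respect to `ω`. -/
def _root_.InternalMode.potCB' (g φ φθ : ℝ → ℝ) (ω : ℝ) : CB :=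
  toCB fun y => Real.exp (7 / 4 * |y|) * (potD g φ φθ ω y / ω)

theorem abs_weight_pot_le (H : SmallFreq g ω₀) (hω : ω ∈ Ioo 0 ω₀) (hφ : IsCoef g φ φθ) (y : ℝ) :
    |Real.exp (7 / 4 * |y|) * pot g φ ω y| ≤ 72 * eps g ω * Real.exp (-(1 / 16) * |y|) := by
  have he := H.h1.eps_nonneg hω.1
  rw [abs_mul, abs_of_pos (Real.exp_pos _)]
  calc _ ≤ Real.exp (7 / 4 * |y|) * (72 * eps g ω * Real.exp (-(15 / 8) * |y|)) := by
        gcongr; exact H.abs_pot_le hω hφ y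
    _ = 72 * eps g ω * (Real.exp (7 / 4 * |y|) * Real.exp (-(15 / 8) * |y|)) := by ring
    _ = 72 * eps g ω * Real.exp (-(1 / 8) * |y|) := by rw [← Real.exp_add]; ring_nf
    _ ≤ _ := by gcongr; linarith

theorem abs_weight_potD_le (H : SmallFreq g ω₀) (hω : ω ∈ Ioo 0 ω₀) (hφ : IsCoef g φ φθ) (y : ℝ) :
    |Real.exp (7 / 4 * |y|) * (potD g φ φθ ω y / ω)|
      ≤ 12800 * (eps g ω / ω) * Real.exp (-(1 / 16) * |y|) := by
  have he := H.h1.eps_nonneg hω.1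
  have hw := hω.1
  rw [abs_mul, abs_of_pos (Real.exp_pos _), abs_div, abs_of_pos hw]
  have h1 : 1 + |y| ≤ 16 * Real.exp (1 / 16 * |y|) := by
    have := Real.add_one_le_exp (1 / 16 * |y|)
    linarith [abs_nonneg y]
  calc _ ≤ Real.exp (7 / 4 * |y|) *
        (800 * eps g ω * (1 + |y|) * Real.exp (-(15 / 8) * |y|) / ω) := by
        gcongr; exact H.abs_potD_le hω hφ y
    _ ≤ Real.exp (7 / 4 * |y|) *
        (800 * eps g ω * (16 * Real.exp (1 / 16 * |y|)) * Real.exp (-(15 / 8) * |y|) / ω) := by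
        gcongr
    _ = 12800 * (eps g ω / ω) * (Real.exp (7 / 4 * |y|) * Real.exp (1 / 16 * |y|)
        * Real.exp (-(15 / 8) * |y|)) := by ring
    _ = _ := by rw [← Real.exp_add, ← Real.exp_add]; ring_nf

/-- A bound in terms of `ε_ω/ω`, which is locally bounded in `ω`, gives a locally uniform one. -/
theorem eps_loc (H : SmallFreq g ω₀) {K : ℝ} (hK : 0 ≤ K) {F : ℝ → ℝ → ℝ} {τ : ℝ}
    (hF : ∀ w ∈ Ioo 0 ω₀, ∀ y, |F w y| ≤ K * (eps g w / w) * Real.exp (-τ * |y|)) :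
    ∀ w ∈ Ioo 0 ω₀, ∃ C, ∀ᶠ v in 𝓝 w, ∀ y, |F v y| ≤ C * Real.exp (-τ * |y|) := by
  intro w hw
  have hw2 : 0 < w / 2 := half_pos hw.1
  refine ⟨K * (1 / (w / 2)), ?_⟩
  filter_upwards [Ioo_mem_nhds (show w / 2 < w by linarith) hw.2] with v hv y
  have hv0 : v ∈ Ioo 0 ω₀ := ⟨hw2.trans hv.1, hv.2⟩
  refine (hF v hv0 y).trans ?_
  gcongr
  · linarith [H.eps_le' (Ioo_subset_Ioc_self hv0)]
  · exact hv.1.le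

theorem continuousOn_weight {F : ℝ → ℝ → ℝ}
    (hF : ContinuousOn (fun p : ℝ × ℝ => F p.1 p.2) (Ioo 0 ω₀ ×ˢ univ)) :
    ContinuousOn (fun p : ℝ × ℝ => Real.exp (7 / 4 * |p.2|) * F p.1 p.2) (Ioo 0 ω₀ ×ˢ univ) := by
  fun_prop

theorem weight_pot_loc (H : SmallFreq g ω₀) (hφ : IsCoef g φ φθ) : ∀ w ∈ Ioo 0 ω₀,
    ∃ C, ∀ᶠ v in 𝓝 w, ∀ y, |Real.exp (7 / 4 * |y|) * pot g φ v y|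
      ≤ C * Real.exp (-(1 / 16) * |y|) := by
  intro w hw
  refine ⟨72, ?_⟩
  filter_upwards [isOpen_Ioo.mem_nhds hw] with v hv y
  refine (H.abs_weight_pot_le hv hφ y).trans ?_
  have := H.eps_le' (Ioo_subset_Ioc_self hv)
  gcongr
  linarith

theorem weight_potD_loc (H : SmallFreq g ω₀) (hφ : IsCoef g φ φθ) : ∀ w ∈ Ioo 0 ω₀,
    ∃ C, ∀ᶠ v in 𝓝 w, ∀ y, |Real.exp (7 / 4 * |y|) * (potD g φ φθ v y / v)|
      ≤ C * Real.exp (-(1 / 16) * |y|) :=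
  H.eps_loc (F := fun v y => Real.exp (7 / 4 * |y|) * (potD g φ φθ v y / v)) (K := 12800)
    (by norm_num) fun _ hw y => H.abs_weight_potD_le hw hφ y

theorem continuousOn_weight_potD (H : SmallFreq g ω₀) (hφ : IsCoef g φ φθ) :
    ContinuousOn (fun p : ℝ × ℝ => Real.exp (7 / 4 * |p.2|) * (potD g φ φθ p.1 p.2 / p.1))
      (Ioo 0 ω₀ ×ˢ univ) :=
  continuousOn_weight (F := fun w y => potD g φ φθ w y / w)
    ((H.continuousOn_potD hφ).div continuousOn_fst fun _ hp => hp.1.1.ne')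

theorem continuousOn_weight_pot (H : SmallFreq g ω₀) (hφ : IsCoef g φ φθ) :
    ContinuousOn (fun p : ℝ × ℝ => Real.exp (7 / 4 * |p.2|) * pot g φ p.1 p.2)
      (Ioo 0 ω₀ ×ˢ univ) :=
  continuousOn_weight (F := pot g φ) (H.continuousOn_pot hφ.continuousOn')

theorem hasDerivAt_potCB (H : SmallFreq g ω₀) (hφ : IsCoef g φ φθ) (hω : ω ∈ Ioo 0 ω₀) :
    HasDerivAt (potCB g φ) (potCB' g φ φθ ω) ω :=
  hasDerivAt_toCB (f := fun w y => Real.exp (7 / 4 * |y|) * pot g φ w y)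
    (f' := fun w y => Real.exp (7 / 4 * |y|) * (potD g φ φθ w y / w)) isOpen_Ioo
    (show (0 : ℝ) < 1 / 16 by norm_num) (H.continuousOn_weight_pot hφ)
    (H.continuousOn_weight_potD hφ)
    (fun w hw y => (H.hasDerivAt_pot_omega hw hφ.hasDerivAt y).const_mul _)
    (H.weight_pot_loc hφ) (H.weight_potD_loc hφ) hω

theorem continuousOn_potCB' (H : SmallFreq g ω₀) (hφ : IsCoef g φ φθ) :
    ContinuousOn (potCB' g φ φθ) (Ioo 0 ω₀) :=
  continuousOn_toCB isOpen_Ioo (f := fun w y => Real.exp (7 / 4 * |y|) * (potD g φ φθ w y / w))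
    (show (0 : ℝ) < 1 / 16 by norm_num) (H.continuousOn_weight_potD hφ) (H.weight_potD_loc hφ)

theorem exp_neg_abs_le_one (y : ℝ) : Real.exp (-(1 / 16) * |y|) ≤ 1 :=
  Real.exp_le_one_iff.2 (by nlinarith [abs_nonneg y])

theorem potCB_apply (H : SmallFreq g ω₀) (hφ : IsCoef g φ φθ) (hω : ω ∈ Ioo 0 ω₀) (y : ℝ) :
    potCB g φ ω y = Real.exp (7 / 4 * |y|) * pot g φ ω y := by
  refine toCB_apply (C := 72 * eps g ω) ?_ (fun y => ?_) y
  · exact continuous_section (F := fun w y => Real.exp (7 / 4 * |y|) * pot g φ w y)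
      (H.continuousOn_weight_pot hφ) hω
  · have he := H.h1.eps_nonneg hω.1
    refine (H.abs_weight_pot_le hω hφ y).trans ?_
    exact mul_le_of_le_one_right (by positivity) (exp_neg_abs_le_one y)

theorem norm_potCB_le (H : SmallFreq g ω₀) (hφ : IsCoef g φ φθ) (hω : ω ∈ Ioo 0 ω₀) :
    ‖potCB g φ ω‖ ≤ 72 * eps g ω := by
  have he := H.h1.eps_nonneg hω.1
  refine (BoundedContinuousFunction.norm_le (by positivity)).2 fun y => ?_
  rw [H.potCB_apply hφ hω]
  refine (H.abs_weight_pot_le hω hφ y).trans ?_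
  exact mul_le_of_le_one_right (by positivity) (exp_neg_abs_le_one y)

theorem norm_potCB'_le (H : SmallFreq g ω₀) (hφ : IsCoef g φ φθ) (hω : ω ∈ Ioo 0 ω₀) :
    ‖potCB' g φ φθ ω‖ ≤ 12800 * (eps g ω / ω) := by
  have he := H.h1.eps_nonneg hω.1
  have hw := hω.1
  have hb : ∀ y : ℝ, ‖Real.exp (7 / 4 * |y|) * (potD g φ φθ ω y / ω)‖ ≤ 12800 * (eps g ω / ω) :=
    fun y => (H.abs_weight_potD_le hω hφ y).trans
      (mul_le_of_le_one_right (by positivity) (exp_neg_abs_le_one y))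
  refine (BoundedContinuousFunction.norm_le (by positivity)).2 fun y => ?_
  rw [potCB', toCB_apply (continuous_section
    (F := fun w y => Real.exp (7 / 4 * |y|) * (potD g φ φθ w y / w))
      (H.continuousOn_weight_potD hφ) hω) hb]
  exact hb y

end SmallFreq

/-! ### Even and odd extensions -/

/-- The odd extension of a function given on `[0, ∞)` and vanishing at `0`. -/
def oddExt (f : ℝ → ℝ) (y : ℝ) : ℝ := f (max y 0) - f (max (-y) 0)

theorem oddExt_of_nonneg {f : ℝ → ℝ} (h0 : f 0 = 0) {y : ℝ} (hy : 0 ≤ y) : oddExt f y = f y := by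
  rw [oddExt, max_eq_left hy, max_eq_right (by linarith), h0, sub_zero]

theorem oddExt_of_nonpos {f : ℝ → ℝ} (h0 : f 0 = 0) {y : ℝ} (hy : y ≤ 0) :
    oddExt f y = -f (-y) := by
  rw [oddExt, max_eq_right hy, max_eq_left (by linarith), h0, zero_sub]

theorem abs_oddExt {f : ℝ → ℝ} (h0 : f 0 = 0) (y : ℝ) : |oddExt f y| = |f (|y|)| := by
  rcases le_total 0 y with hy | hy
  · rw [oddExt_of_nonneg h0 hy, abs_of_nonneg hy]
  · rw [oddExt_of_nonpos h0 hy, abs_neg, abs_of_nonpos hy]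

theorem hasDerivAt_of_halves {F f₁ f₂ : ℝ → ℝ} {a : ℝ} (h₁ : HasDerivAt f₁ a 0)
    (h₂ : HasDerivAt f₂ a 0) (e₁ : ∀ y, 0 ≤ y → F y = f₁ y) (e₂ : ∀ y, y ≤ 0 → F y = f₂ y) :
    HasDerivAt F a 0 := by
  have h := (h₁.hasDerivWithinAt (s := Ici 0)).congr e₁ (e₁ 0 le_rfl)
  have h' := (h₂.hasDerivWithinAt (s := Iic 0)).congr e₂ (e₂ 0 le_rfl)
  have := h.union h'
  rwa [union_comm, Iic_union_Ici, hasDerivWithinAt_univ] at this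

theorem hasDerivAt_evenExt {f f₁ : ℝ → ℝ} (h : ∀ y, 0 ≤ y → HasDerivAt f (f₁ y) y)
    (h0 : f₁ 0 = 0) (y : ℝ) : HasDerivAt (fun y => f |y|) (oddExt f₁ y) y := by
  have hn : ∀ y : ℝ, y ≤ 0 → HasDerivAt (fun y => f (-y)) (-f₁ (-y)) y := fun y hy => 
    ((h (-y) (by linarith)).comp y (hasDerivAt_neg y)).congr_deriv (by ring)
  rcases lt_trichotomy y 0 with hy | rfl | hy
  · rw [oddExt_of_nonpos h0 hy.le]
    refine (hn y hy.le).congr_of_eventuallyEq ?_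
    filter_upwards [Iio_mem_nhds hy] with z hz
    rw [abs_of_neg hz]
  · have h1 := h 0 le_rfl
    have h2 := hn 0 le_rfl
    rw [neg_zero, h0, neg_zero] at h2
    rw [h0] at h1
    rw [oddExt_of_nonneg h0 le_rfl, h0]
    exact hasDerivAt_of_halves h1 h2 (fun y hy => by rw [abs_of_nonneg hy])
      fun y hy => by rw [abs_of_nonpos hy]
  · rw [oddExt_of_nonneg h0 hy.le]
    refine (h y hy.le).congr_of_eventuallyEq ?_
    filter_upwards [Ioi_mem_nhds hy] with z hz
    rw [abs_of_pos hz]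

theorem hasDerivAt_oddExt {f f₁ : ℝ → ℝ} (h : ∀ y, 0 ≤ y → HasDerivAt f (f₁ y) y)
    (h0 : f 0 = 0) (y : ℝ) : HasDerivAt (oddExt f) (f₁ |y|) y := by
  have hn : ∀ y : ℝ, y ≤ 0 → HasDerivAt (fun y => -f (-y)) (f₁ (-y)) y := fun y hy => 
    (((h (-y) (by linarith)).comp y (hasDerivAt_neg y)).neg).congr_deriv (by ring)
  rcases lt_trichotomy y 0 with hy | rfl | hy
  · rw [abs_of_neg hy]
    refine (hn y hy.le).congr_of_eventuallyEq ?_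
    filter_upwards [Iio_mem_nhds hy] with z hz
    rw [oddExt_of_nonpos h0 (le_of_lt hz)]
  · have h2 := hn 0 le_rfl
    rw [neg_zero] at h2
    rw [abs_zero]
    exact hasDerivAt_of_halves (h 0 le_rfl) h2 (fun y hy => oddExt_of_nonneg h0 hy)
      fun y hy => oddExt_of_nonpos h0 hy
  · rw [abs_of_pos hy]
    refine (h y hy.le).congr_of_eventuallyEq ?_
    filter_upwards [Ioi_mem_nhds hy] with z hz
    rw [oddExt_of_nonneg h0 (le_of_lt hz)]

theorem continuousOn_evenExt {U : Set ℝ} {F : ℝ → ℝ → ℝ}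
    (hF : ContinuousOn (fun p : ℝ × ℝ => F p.1 p.2) (U ×ˢ univ)) :
    ContinuousOn (fun p : ℝ × ℝ => F p.1 |p.2|) (U ×ˢ univ) :=
  hF.comp (f := fun p : ℝ × ℝ => (p.1, |p.2|)) (by fun_prop) fun _ hp => ⟨hp.1, mem_univ _⟩

theorem continuousOn_oddExt {U : Set ℝ} {F : ℝ → ℝ → ℝ}
    (hF : ContinuousOn (fun p : ℝ × ℝ => F p.1 p.2) (U ×ˢ univ)) :
    ContinuousOn (fun p : ℝ × ℝ => oddExt (F p.1) p.2) (U ×ˢ univ) :=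
  (hF.comp (f := fun p : ℝ × ℝ => (p.1, max p.2 0)) (by fun_prop)
    fun _ hp => ⟨hp.1, mem_univ _⟩).sub
    (hF.comp (f := fun p : ℝ × ℝ => (p.1, max (-p.2) 0)) (by fun_prop)
      fun _ hp => ⟨hp.1, mem_univ _⟩)

/-! ### The eigenfunctions on the half-line -/

/-- The component `P = (W₁ + W₂)/2` on `[0, ∞)` in terms of the unknown `u = (r, t)` of the
bifurcation equation. -/
def halfP (u : CB × CB) (y : ℝ) : ℝ := Real.exp (-u.1 0 * y) * pOf u y

/-- The derivative of `halfP` on `[0, ∞)`. -/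
def halfP₁ (u : CB × CB) (y : ℝ) : ℝ :=
  Real.exp (-u.1 0 * y) * (Real.exp (-(3 / 2) * y) * u.1 y - u.1 0 * pOf u y)

/-- The component `D = (W₁ - W₂)/2` on `[0, ∞)`. -/
def halfD (u : CB × CB) (y : ℝ) : ℝ := Real.exp (-kappa (u.1 0) * y) * qOf u y

/-- The derivative of `halfD` on `[0, ∞)`. -/
def halfD₁ (u : CB × CB) (y : ℝ) : ℝ :=
  Real.exp (-kappa (u.1 0) * y) *
    (Real.exp (-(1 / 8) * y) * u.2 y - kappa (u.1 0) * qOf u y)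

/-- The variation of `κ` in the direction `v`. -/
def kapDot (u v : CB × CB) : ℝ := -(u.1 0 * v.1 0) / kappa (u.1 0)

/-- The variation of `q` in the direction `v`. -/
def qDot (u v : CB × CB) : CB :=
  (v.2 0 / kappa (u.1 0) - u.2 0 * kapDot u v / kappa (u.1 0) ^ 2) • (1 : CB) + opL₂ v.2

/-- The variation of `halfP` in the direction `v`. -/
def varP (u v : CB × CB) (y : ℝ) : ℝ :=
  Real.exp (-u.1 0 * y) * opL₁ v.1 y - v.1 0 * y * halfP u y

/-- The variation of `halfP₁` in the direction `v`. -/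
def varP₁ (u v : CB × CB) (y : ℝ) : ℝ :=
  Real.exp (-u.1 0 * y) *
    (Real.exp (-(3 / 2) * y) * v.1 y - v.1 0 * pOf u y - u.1 0 * opL₁ v.1 y)
    - v.1 0 * y * halfP₁ u y

/-- The variation of `halfD` in the direction `v`. -/
def varD (u v : CB × CB) (y : ℝ) : ℝ :=
  Real.exp (-kappa (u.1 0) * y) * qDot u v y - kapDot u v * y * halfD u y

/-- The variation of `halfD₁` in the direction `v`. -/
def varD₁ (u v : CB × CB) (y : ℝ) : ℝ :=
  Real.exp (-kappa (u.1 0) * y) *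
    (Real.exp (-(1 / 8) * y) * v.2 y - kapDot u v * qOf u y - kappa (u.1 0) * qDot u v y)
    - kapDot u v * y * halfD₁ u y

theorem pOf_apply (u : CB × CB) (y : ℝ) : pOf u y = 1 + opL₁ u.1 y := rfl

theorem qOf_apply (u : CB × CB) (y : ℝ) : qOf u y = u.2 0 / kappa (u.1 0) + opL₂ u.2 y := by
  simp [qOf]

theorem qDot_apply (u v : CB × CB) (y : ℝ) : qDot u v y =
    v.2 0 / kappa (u.1 0) - u.2 0 * kapDot u v / kappa (u.1 0) ^ 2 + opL₂ v.2 y := by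
  simp [qDot]

theorem hasDerivAt_exp_mul (a y : ℝ) :
    HasDerivAt (fun y => Real.exp (-a * y)) (-a * Real.exp (-a * y)) y := by
  simpa [mul_comm] using ((hasDerivAt_id y).const_mul (-a)).exp

theorem hasDerivAt_pOf (u : CB × CB) (y : ℝ) :
    HasDerivAt (pOf u) (Real.exp (-(3 / 2) * |y|) * u.1 y) y :=
  (hasDerivAt_opL (by norm_num) u.1 y).const_add 1

theorem hasDerivAt_qOf (u : CB × CB) (y : ℝ) :
    HasDerivAt (qOf u) (Real.exp (-(1 / 8) * |y|) * u.2 y) y := by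
  have e : (qOf u : ℝ → ℝ) = fun y => u.2 0 / kappa (u.1 0) + opL₂ u.2 y := by
    ext y; exact qOf_apply u y
  rw [e]
  exact (hasDerivAt_opL (by norm_num) u.2 y).const_add _

theorem hasDerivAt_halfP (u : CB × CB) {y : ℝ} (hy : 0 ≤ y) :
    HasDerivAt (halfP u) (halfP₁ u y) y := by
  refine ((hasDerivAt_exp_mul (u.1 0) y).mul (hasDerivAt_pOf u y)).congr_deriv ?_
  rw [halfP₁, abs_of_nonneg hy]; ring

theorem hasDerivAt_halfD (u : CB × CB) {y : ℝ} (hy : 0 ≤ y) :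
    HasDerivAt (halfD u) (halfD₁ u y) y := by
  refine ((hasDerivAt_exp_mul (kappa (u.1 0)) y).mul (hasDerivAt_qOf u y)).congr_deriv ?_
  rw [halfD₁, abs_of_nonneg hy]; ring

theorem halfP₁_zero (u : CB × CB) : halfP₁ u 0 = 0 := by
  have : opL₁ u.1 0 = 0 := opL_zero _ _
  simp [halfP₁, pOf_apply, this]

theorem halfD₁_zero (u : CB × CB) (hk : kappa (u.1 0) ≠ 0) : halfD₁ u 0 = 0 := by
  have : opL₂ u.2 0 = 0 := opL_zero _ _
  simp only [halfD₁, qOf_apply, this, mul_zero, Real.exp_zero, one_mul, add_zero]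
  field_simp
  ring

theorem varP₁_zero (u v : CB × CB) : varP₁ u v 0 = 0 := by
  have h1 : opL₁ u.1 0 = 0 := opL_zero _ _
  have h2 : opL₁ v.1 0 = 0 := opL_zero _ _
  simp [varP₁, pOf_apply, h1, h2]

theorem varD₁_zero (u v : CB × CB) (hk : kappa (u.1 0) ≠ 0) : varD₁ u v 0 = 0 := by
  have h1 : opL₂ u.2 0 = 0 := opL_zero _ _
  have h2 : opL₂ v.2 0 = 0 := opL_zero _ _
  simp only [varD₁, qOf_apply, qDot_apply, h1, h2, mul_zero, Real.exp_zero, one_mul, add_zero,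
    zero_mul, sub_zero]
  field_simp
  ring

theorem kappa_mem {a : ℝ} (ha : |a| ≤ 1 / 16) : kappa a ∈ Icc (11 / 8) √2 := by
  have h := abs_le.1 ha
  refine ⟨Real.le_sqrt_of_sq_le ?_, Real.sqrt_le_sqrt ?_⟩ <;> nlinarith

section Zeros

variable {β u : CB × CB} (h0 : bifMap (β, u) = 0)

include h0

theorem hasDerivAt_fst_of_zero (y : ℝ) :
    HasDerivAt u.1 (3 / 2 * u.1 y + src₁ (β, u) y) y := by
  have h : u.1 = -opA₁ (src₁ (β, u)) := eq_neg_of_add_eq_zero_left (congrArg Prod.fst h0)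
  have h' : ∀ z, u.1 z = -opA₁ (src₁ (β, u)) z := fun z => by
    conv_lhs => rw [h]
    rfl
  have e : (u.1 : ℝ → ℝ) = fun z => -opA₁ (src₁ (β, u)) z := funext h'
  have hd := (hasDerivAt_opA (ν := 3 / 2) (by norm_num) (src₁ (β, u)) y).neg
  rw [h' y, e]
  refine hd.congr_deriv ?_
  change -(3 / 2 * opA₁ (src₁ (β, u)) y - src₁ (β, u) y) = _
  ring

theorem hasDerivAt_snd_of_zero (y : ℝ) :
    HasDerivAt u.2 ((1 / 8 + 2 * √2) * u.2 y + src₂ (β, u) y) y := by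
  have h : u.2 = -opA₂ (src₂ (β, u)) := eq_neg_of_add_eq_zero_left (congrArg Prod.snd h0)
  have h' : ∀ z, u.2 z = -opA₂ (src₂ (β, u)) z := fun z => by
    conv_lhs => rw [h]
    rfl
  have e : (u.2 : ℝ → ℝ) = fun z => -opA₂ (src₂ (β, u)) z := funext h'
  have hd := (hasDerivAt_opA (ν := 1 / 8 + 2 * √2) nu_pos (src₂ (β, u)) y).neg
  rw [h' y, e]
  refine hd.congr_deriv ?_
  change -((1 / 8 + 2 * √2) * opA₂ (src₂ (β, u)) y - src₂ (β, u) y) = _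
  ring

variable (hα : |u.1 0| ≤ 1 / 16)

include hα

omit h0 in
theorem exp_rates_pos : 0 < 1 / 4 + kappa (u.1 0) - u.1 0 ∧
    0 < 13 / 8 - kappa (u.1 0) + u.1 0 := by
  have h := abs_le.1 hα
  have h1 := kappa_mem hα
  have h2 := sqrt_two_lt
  constructor <;> linarith [h1.1, h1.2, h.1, h.2]

theorem hasDerivAt_halfP₁ {y : ℝ} (hy : 0 ≤ y) :
    HasDerivAt (halfP₁ u) ((u.1 0 ^ 2 + Real.exp (-(7 / 4) * y) * β.1 y) * halfP u y
      + Real.exp (-(7 / 4) * y) * β.2 y * halfD u y) y := by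
  have hd := (hasDerivAt_exp_mul (u.1 0) y).mul
    (((hasDerivAt_exp_mul (3 / 2) y).mul (hasDerivAt_fst_of_zero h0 y)).sub
      ((hasDerivAt_pOf u y).const_mul (u.1 0)))
  refine hd.congr_deriv ?_
  simp only [Pi.sub_apply, Pi.mul_apply]
  have hs : src₁ (β, u) y = 2 * u.1 0 * u.1 y + Real.exp (-(1 / 4) * y) * β.1 y * pOf u y
      + Real.exp (-(1 / 4 + kappa (u.1 0) - u.1 0) * y) * β.2 y * qOf u y := by
    have e1 := wexp_apply 0 (show (0 : ℝ) < 1 / 4 by norm_num) y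
    have e2 := wexp_apply 0 (exp_rates_pos hα).1 y
    rw [pow_zero, one_mul, abs_of_nonneg hy] at e1 e2
    rw [← e1, ← e2]
    rfl
  have e1 : Real.exp (-(7 / 4) * y) = Real.exp (-(3 / 2) * y) * Real.exp (-(1 / 4) * y) := by
    rw [← Real.exp_add]; ring_nf
  have e2 : Real.exp (-u.1 0 * y) * Real.exp (-(1 / 4 + kappa (u.1 0) - u.1 0) * y) =
      Real.exp (-(1 / 4) * y) * Real.exp (-kappa (u.1 0) * y) := by
    rw [← Real.exp_add, ← Real.exp_add]; ring_nf
  rw [abs_of_nonneg hy, hs, halfP, halfD, e1]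
  linear_combination (Real.exp (-(3 / 2) * y) * β.2 y * qOf u y) * e2

theorem hasDerivAt_halfD₁ {y : ℝ} (hy : 0 ≤ y) :
    HasDerivAt (halfD₁ u)
      ((kappa (u.1 0) ^ 2 + Real.exp (-(7 / 4) * y) * β.1 y) * halfD u y
      + Real.exp (-(7 / 4) * y) * β.2 y * halfP u y) y := by
  have hd := (hasDerivAt_exp_mul (kappa (u.1 0)) y).mul
    (((hasDerivAt_exp_mul (1 / 8) y).mul (hasDerivAt_snd_of_zero h0 y)).sub
      ((hasDerivAt_qOf u y).const_mul (kappa (u.1 0))))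
  refine hd.congr_deriv ?_
  simp only [Pi.sub_apply, Pi.mul_apply]
  have hs : src₂ (β, u) y = 2 * (kappa (u.1 0) - √2) * u.2 y
      + Real.exp (-(13 / 8 - kappa (u.1 0) + u.1 0) * y) * β.2 y * pOf u y
      + Real.exp (-(13 / 8) * y) * β.1 y * qOf u y := by
    have e1 := wexp_apply 0 (show (0 : ℝ) < 13 / 8 by norm_num) y
    have e2 := wexp_apply 0 (exp_rates_pos hα).2 y
    rw [pow_zero, one_mul, abs_of_nonneg hy] at e1 e2
    rw [← e1, ← e2]
    rfl
  have e1 : Real.exp (-(7 / 4) * y) = Real.exp (-(1 / 8) * y) * Real.exp (-(13 / 8) * y) := by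
    rw [← Real.exp_add]; ring_nf
  have e2 : Real.exp (-kappa (u.1 0) * y) * Real.exp (-(13 / 8 - kappa (u.1 0) + u.1 0) * y) =
      Real.exp (-(13 / 8) * y) * Real.exp (-u.1 0 * y) := by
    rw [← Real.exp_add, ← Real.exp_add]; ring_nf
  rw [abs_of_nonneg hy, hs, halfP, halfD, e1]
  linear_combination (Real.exp (-(1 / 8) * y) * β.2 y * pOf u y) * e2

end Zeros

/-! ### Bounds on the half-line -/

/-- A common bound, at least `1`, for the norms of the integration operators. -/
def opLBound : ℝ := ‖opL₁‖ + ‖opL₂‖ + 1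

theorem one_le_opLBound : 1 ≤ opLBound := by
  have := norm_nonneg opL₁
  have := norm_nonneg opL₂
  rw [opLBound]; linarith

theorem abs_opL₁_le (f : CB) (y : ℝ) : |opL₁ f y| ≤ opLBound * ‖f‖ := by
  refine ((opL₁ f).norm_coe_le_norm y).trans ((opL₁.le_opNorm f).trans ?_)
  gcongr
  rw [opLBound]; linarith [norm_nonneg opL₂]

theorem abs_opL₂_le (f : CB) (y : ℝ) : |opL₂ f y| ≤ opLBound * ‖f‖ := by
  refine ((opL₂ f).norm_coe_le_norm y).trans ((opL₂.le_opNorm f).trans ?_)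
  gcongr
  rw [opLBound]; linarith [norm_nonneg opL₁]

theorem abs_fst_apply_le (u : CB × CB) (y : ℝ) : |u.1 y| ≤ ‖u‖ :=
  (u.1.norm_coe_le_norm y).trans (norm_fst_le u)

theorem abs_snd_apply_le (u : CB × CB) (y : ℝ) : |u.2 y| ≤ ‖u‖ :=
  (u.2.norm_coe_le_norm y).trans (norm_snd_le u)

theorem abs_mul_le_of_le {a b A B : ℝ} (ha : |a| ≤ A) (hb : |b| ≤ B) : |a * b| ≤ A * B := by
  rw [abs_mul]
  exact mul_le_mul ha hb (abs_nonneg _) ((abs_nonneg _).trans ha)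

theorem abs_div_kappa_le {a A k : ℝ} (hk : 1 ≤ k) (ha : |a| ≤ A) : |a / k| ≤ A := by
  have h0 : 0 < k := by linarith
  rw [abs_div, abs_of_pos h0, div_le_iff₀ h0]
  nlinarith [abs_nonneg a]

section Bounds

variable {u v : CB × CB} (hu : ‖u‖ ≤ 1 / 16)

include hu

theorem one_le_kappa : 1 ≤ kappa (u.1 0) := by
  have := (kappa_mem ((abs_fst_apply_le u 0).trans hu)).1
  linarith

theorem kappa_le : kappa (u.1 0) ≤ 23 / 16 := by
  have := (kappa_mem ((abs_fst_apply_le u 0).trans hu)).2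
  refine this.trans ?_
  rw [Real.sqrt_le_left (by norm_num)]; norm_num

theorem exp_kappa_le {y : ℝ} (hy : 0 ≤ y) :
    Real.exp (-kappa (u.1 0) * y) ≤ Real.exp (-u.1 0 * y) := by
  have h1 := one_le_kappa hu
  have h2 := (abs_le.1 ((abs_fst_apply_le u 0).trans hu)).2
  exact Real.exp_le_exp.2 (by nlinarith)

theorem exp_mul_exp_le {y : ℝ} (hy : 0 ≤ y) :
    Real.exp (-u.1 0 * y) * Real.exp (-(3 / 2) * y) ≤ Real.exp (-kappa (u.1 0) * y) := by
  have h1 := kappa_le hu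
  have h2 := (abs_le.1 ((abs_fst_apply_le u 0).trans hu)).1
  rw [← Real.exp_add]
  exact Real.exp_le_exp.2 (by nlinarith)

omit hu in
theorem abs_halfP_sub_le (y : ℝ) :
    |halfP u y - Real.exp (-u.1 0 * y)| ≤ opLBound * ‖u‖ * Real.exp (-u.1 0 * y) := by
  have e : halfP u y - Real.exp (-u.1 0 * y) = opL₁ u.1 y * Real.exp (-u.1 0 * y) := by
    rw [halfP, pOf_apply]; ring
  rw [e, abs_mul, abs_of_pos (Real.exp_pos _)]
  gcongr
  refine (abs_opL₁_le _ _).trans ?_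
  have := one_le_opLBound
  gcongr
  exact norm_fst_le u

omit hu in
theorem abs_opL₁_fst_le (y : ℝ) : |opL₁ u.1 y| ≤ opLBound * ‖u‖ := by
  have := one_le_opLBound
  refine (abs_opL₁_le _ _).trans ?_
  gcongr
  exact norm_fst_le u

omit hu in
theorem abs_opL₂_snd_le (y : ℝ) : |opL₂ u.2 y| ≤ opLBound * ‖u‖ := by
  have := one_le_opLBound
  refine (abs_opL₂_le _ _).trans ?_
  gcongr
  exact norm_snd_le u

theorem abs_halfP_le (y : ℝ) : |halfP u y| ≤ 2 * opLBound * Real.exp (-u.1 0 * y) := by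
  have h := abs_le.1 (abs_halfP_sub_le (u := u) y)
  have hL := one_le_opLBound
  have hE := Real.exp_pos (-u.1 0 * y)
  have h2 : opLBound * ‖u‖ * Real.exp (-u.1 0 * y) ≤ opLBound * 1 * Real.exp (-u.1 0 * y) := by
    gcongr; linarith
  have h3 : 1 * Real.exp (-u.1 0 * y) ≤ opLBound * Real.exp (-u.1 0 * y) := by gcongr
  rw [abs_le]
  constructor <;> linarith

theorem abs_halfP₁_add_le {y : ℝ} (hy : 0 ≤ y) :
    |halfP₁ u y + u.1 0 * Real.exp (-u.1 0 * y)|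
      ≤ opLBound * ‖u‖ ^ 2 * Real.exp (-u.1 0 * y) + ‖u‖ * Real.exp (-kappa (u.1 0) * y) := by
  have e : halfP₁ u y + u.1 0 * Real.exp (-u.1 0 * y) =
      u.1 y * (Real.exp (-u.1 0 * y) * Real.exp (-(3 / 2) * y))
        - u.1 0 * opL₁ u.1 y * Real.exp (-u.1 0 * y) := by
    rw [halfP₁, pOf_apply]; ring
  have h1 := abs_mul_le_of_le (abs_fst_apply_le u y)
    ((abs_of_pos (mul_pos (Real.exp_pos (-u.1 0 * y)) (Real.exp_pos (-(3 / 2) * y)))).trans_le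
      (exp_mul_exp_le hu hy))
  have h2 := abs_mul_le_of_le (abs_mul_le_of_le (abs_fst_apply_le u 0) (abs_opL₁_fst_le (u := u) y))
    (abs_of_pos (Real.exp_pos (-u.1 0 * y))).le
  rw [e]
  refine (abs_sub _ _).trans ?_
  linarith

theorem abs_qOf_le (y : ℝ) : |qOf u y| ≤ 2 * opLBound * ‖u‖ := by
  have h1 := abs_div_kappa_le (one_le_kappa hu) (abs_snd_apply_le u 0)
  have h2 := abs_opL₂_snd_le (u := u) y
  have hL := one_le_opLBound
  have h3 : 1 * ‖u‖ ≤ opLBound * ‖u‖ := by gcongr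
  rw [qOf_apply]
  refine (abs_add_le _ _).trans ?_
  linarith

theorem abs_halfD_le (y : ℝ) :
    |halfD u y| ≤ 2 * opLBound * ‖u‖ * Real.exp (-kappa (u.1 0) * y) := by
  rw [halfD, mul_comm]
  exact abs_mul_le_of_le (abs_qOf_le hu y) (abs_of_pos (Real.exp_pos _)).le

theorem abs_halfD₁_le {y : ℝ} (hy : 0 ≤ y) :
    |halfD₁ u y| ≤ 4 * opLBound * ‖u‖ * Real.exp (-kappa (u.1 0) * y) := by
  have hL := one_le_opLBound
  have h3 : 1 * ‖u‖ ≤ opLBound * ‖u‖ := by gcongr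
  have hk := kappa_le hu
  have hk1 := one_le_kappa hu
  have h1 : |Real.exp (-(1 / 8) * y) * u.2 y| ≤ 1 * ‖u‖ := by
    refine abs_mul_le_of_le ?_ (abs_snd_apply_le u y)
    rw [abs_of_pos (Real.exp_pos _)]
    exact Real.exp_le_one_iff.2 (by linarith)
  have h2 := abs_mul_le_of_le (show |kappa (u.1 0)| ≤ 3 / 2 by
    rw [abs_of_pos (by linarith)]; linarith) (abs_qOf_le hu y)
  rw [halfD₁, mul_comm]
  refine abs_mul_le_of_le ?_ (abs_of_pos (Real.exp_pos _)).le
  refine (abs_sub _ _).trans ?_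
  linarith

theorem abs_varP_le {y : ℝ} (hy : 0 ≤ y) :
    |varP u v y| ≤ 3 * opLBound * ‖v‖ * (1 + y) * Real.exp (-u.1 0 * y) := by
  have hL := one_le_opLBound
  have hE := Real.exp_pos (-u.1 0 * y)
  have h1 := abs_mul_le_of_le (abs_of_pos hE).le (abs_opL₁_fst_le (u := v) y)
  have h2 := abs_mul_le_of_le (abs_mul_le_of_le (abs_fst_apply_le v 0) (abs_of_nonneg hy).le)
    (abs_halfP_le hu y)
  rw [varP]
  refine (abs_sub _ _).trans ?_
  have h3 : 0 ≤ opLBound * ‖v‖ * Real.exp (-u.1 0 * y) := by positivity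
  have h4 : 0 ≤ opLBound * ‖v‖ * Real.exp (-u.1 0 * y) * y := by positivity
  linarith

theorem abs_halfP₁_le {y : ℝ} (hy : 0 ≤ y) :
    |halfP₁ u y| ≤ 2 * opLBound * Real.exp (-u.1 0 * y) := by
  have h := abs_halfP₁_add_le hu hy
  have hL := one_le_opLBound
  have hE := Real.exp_pos (-u.1 0 * y)
  have hk := exp_kappa_le hu hy
  have h1 := abs_mul_le_of_le ((abs_fst_apply_le u 0).trans hu) (abs_of_pos hE).le
  have hn := norm_nonneg u
  have h2 : opLBound * ‖u‖ ^ 2 * Real.exp (-u.1 0 * y) ≤ opLBound * 1 * Real.exp (-u.1 0 * y) := by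
    gcongr; nlinarith
  have h3 : ‖u‖ * Real.exp (-kappa (u.1 0) * y) ≤ 1 / 16 * Real.exp (-u.1 0 * y) := by gcongr
  have h4 : 1 * Real.exp (-u.1 0 * y) ≤ opLBound * Real.exp (-u.1 0 * y) := by gcongr
  have h5 := abs_le.1 h
  have h6 := abs_le.1 h1
  rw [abs_le]
  constructor <;> linarith

theorem abs_varP₁_le {y : ℝ} (hy : 0 ≤ y) :
    |varP₁ u v y| ≤ 5 * opLBound * ‖v‖ * (1 + y) * Real.exp (-u.1 0 * y) := by
  have hL := one_le_opLBound
  have hE := Real.exp_pos (-u.1 0 * y)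
  have hn := norm_nonneg v
  have h0 : ‖v‖ ≤ opLBound * ‖v‖ := by nlinarith
  have h1 : |Real.exp (-(3 / 2) * y) * v.1 y| ≤ 1 * ‖v‖ := by
    refine abs_mul_le_of_le ?_ (abs_fst_apply_le v y)
    rw [abs_of_pos (Real.exp_pos _)]
    exact Real.exp_le_one_iff.2 (by linarith)
  have h2 : |v.1 0 * pOf u y| ≤ ‖v‖ * (2 * opLBound) := by
    refine abs_mul_le_of_le (abs_fst_apply_le v 0) ?_
    have := abs_opL₁_fst_le (u := u) y
    have h5 : opLBound * ‖u‖ ≤ opLBound * 1 := by gcongr; linarith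
    rw [pOf_apply]
    refine (abs_add_le _ _).trans ?_
    rw [abs_one]; linarith
  have h3 := abs_mul_le_of_le ((abs_fst_apply_le u 0).trans hu) (abs_opL₁_fst_le (u := v) y)
  have h4 := abs_mul_le_of_le (abs_mul_le_of_le (abs_fst_apply_le v 0) (abs_of_nonneg hy).le)
    (abs_halfP₁_le hu hy)
  have h5 : |Real.exp (-(3 / 2) * y) * v.1 y - v.1 0 * pOf u y - u.1 0 * opL₁ v.1 y|
      ≤ 5 * opLBound * ‖v‖ := by
    refine (abs_sub _ _).trans ((add_le_add (abs_sub _ _) le_rfl).trans ?_)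
    linarith
  have h6 := abs_mul_le_of_le (abs_of_pos hE).le h5
  rw [varP₁]
  refine (abs_sub _ _).trans ?_
  have h3 : 0 ≤ opLBound * ‖v‖ * Real.exp (-u.1 0 * y) := by positivity
  have h4 : 0 ≤ opLBound * ‖v‖ * Real.exp (-u.1 0 * y) * y := by positivity
  linarith

theorem abs_kapDot_le : |kapDot u v| ≤ ‖v‖ := by
  refine abs_div_kappa_le (one_le_kappa hu) ?_
  rw [abs_neg]
  refine (abs_mul_le_of_le ((abs_fst_apply_le u 0).trans hu) (abs_fst_apply_le v 0)).trans ?_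
  linarith [norm_nonneg v]

theorem abs_qDot_le (y : ℝ) : |qDot u v y| ≤ 3 * opLBound * ‖v‖ := by
  have hL := one_le_opLBound
  have hn := norm_nonneg v
  have hk := one_le_kappa hu
  have h0 : ‖v‖ ≤ opLBound * ‖v‖ := by nlinarith
  have h1 := abs_div_kappa_le hk (abs_snd_apply_le v 0)
  have h2 := abs_div_kappa_le (one_le_pow₀ hk (n := 2))
    (abs_mul_le_of_le ((abs_snd_apply_le u 0).trans hu) (abs_kapDot_le hu (v := v)))
  have h3 := abs_opL₂_snd_le (u := v) y
  rw [qDot_apply]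
  refine (abs_add_le _ _).trans ((add_le_add (abs_sub _ _) le_rfl).trans ?_)
  linarith

theorem abs_varD_le {y : ℝ} (hy : 0 ≤ y) :
    |varD u v y| ≤ 3 * opLBound * ‖v‖ * (1 + y) * Real.exp (-kappa (u.1 0) * y) := by
  have hL := one_le_opLBound
  have hE := Real.exp_pos (-kappa (u.1 0) * y)
  have h1 := abs_mul_le_of_le (abs_of_pos hE).le (abs_qDot_le hu (v := v) y)
  have h2 := abs_mul_le_of_le (abs_mul_le_of_le (abs_kapDot_le hu (v := v)) (abs_of_nonneg hy).le)
    (abs_halfD_le hu y)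
  have h5 : ‖v‖ * y * (2 * opLBound * ‖u‖ * Real.exp (-kappa (u.1 0) * y)) ≤
    ‖v‖ * y * (2 * opLBound * (1 / 16) * Real.exp (-kappa (u.1 0) * y)) := by gcongr
  rw [varD]
  refine (abs_sub _ _).trans ?_
  have h4 : 0 ≤ opLBound * ‖v‖ * Real.exp (-kappa (u.1 0) * y) * y := by positivity
  linarith

theorem abs_varD₁_le {y : ℝ} (hy : 0 ≤ y) :
    |varD₁ u v y| ≤ 9 * opLBound * ‖v‖ * (1 + y) * Real.exp (-kappa (u.1 0) * y) := by
  have hL := one_le_opLBound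
  have hE := Real.exp_pos (-kappa (u.1 0) * y)
  have hn := norm_nonneg v
  have hk := one_le_kappa hu
  have hk2 := kappa_le hu
  have h0 : ‖v‖ ≤ opLBound * ‖v‖ := by nlinarith
  have h1 : |Real.exp (-(1 / 8) * y) * v.2 y| ≤ 1 * ‖v‖ := by
    refine abs_mul_le_of_le ?_ (abs_snd_apply_le v y)
    rw [abs_of_pos (Real.exp_pos _)]
    exact Real.exp_le_one_iff.2 (by linarith)
  have h2 : |kapDot u v * qOf u y| ≤ ‖v‖ * (2 * opLBound * (1 / 16)) :=
    abs_mul_le_of_le (abs_kapDot_le hu) ((abs_qOf_le hu y).trans (by gcongr))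
  have h3 := abs_mul_le_of_le (show |kappa (u.1 0)| ≤ 3 / 2 by
    rw [abs_of_pos (by linarith)]; linarith) (abs_qDot_le hu (v := v) y)
  have h4 := abs_mul_le_of_le (abs_mul_le_of_le (abs_kapDot_le hu (v := v)) (abs_of_nonneg hy).le)
    ((abs_halfD₁_le hu hy).trans (show _ ≤ 4 * opLBound * (1 / 16) *
      Real.exp (-kappa (u.1 0) * y) by gcongr))
  have h5 : |Real.exp (-(1 / 8) * y) * v.2 y - kapDot u v * qOf u y - kappa (u.1 0) * qDot u v y|
      ≤ 9 * opLBound * ‖v‖ := by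
    refine (abs_sub _ _).trans ((add_le_add (abs_sub _ _) le_rfl).trans ?_)
    nlinarith
  have h6 := abs_mul_le_of_le (abs_of_pos hE).le h5
  rw [varD₁]
  refine (abs_sub _ _).trans ?_
  have h3 : 0 ≤ opLBound * ‖v‖ * Real.exp (-kappa (u.1 0) * y) := by positivity
  have h4 : 0 ≤ opLBound * ‖v‖ * Real.exp (-kappa (u.1 0) * y) * y := by positivity
  linarith

end Bounds

/-! ### Dependence on the frequency -/

section Curve

variable {u : ℝ → CB × CB} {v : CB × CB} {ω : ℝ} (hu : HasDerivAt u v ω)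

include hu

theorem hasDerivAt_fst_apply (y : ℝ) : HasDerivAt (fun w => (u w).1 y) (v.1 y) ω :=
  (((BoundedContinuousFunction.evalCLM ℝ y).comp
    (ContinuousLinearMap.fst ℝ CB CB)).hasFDerivAt.comp_hasDerivAt ω hu)

theorem hasDerivAt_snd_apply (y : ℝ) : HasDerivAt (fun w => (u w).2 y) (v.2 y) ω :=
  (((BoundedContinuousFunction.evalCLM ℝ y).comp
    (ContinuousLinearMap.snd ℝ CB CB)).hasFDerivAt.comp_hasDerivAt ω hu)

theorem hasDerivAt_pOf_curve (y : ℝ) : HasDerivAt (fun w => pOf (u w) y) (opL₁ v.1 y) ω :=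
  ((((BoundedContinuousFunction.evalCLM ℝ y).comp opL₁).comp
    (ContinuousLinearMap.fst ℝ CB CB)).hasFDerivAt.comp_hasDerivAt ω hu).const_add 1

theorem hasDerivAt_kappa_curve (h : ‖u ω‖ ≤ 1 / 16) :
    HasDerivAt (fun w => kappa ((u w).1 0)) (kapDot (u ω) v) ω := by
  have hk := one_le_kappa h
  have h0 : 2 - (u ω).1 0 ^ 2 ≠ 0 := by
    intro h0
    rw [kappa, h0, Real.sqrt_zero] at hk
    linarith
  refine ((((hasDerivAt_fst_apply hu 0).pow 2).const_sub 2).sqrt h0).congr_deriv ?_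
  have : kappa ((u ω).1 0) = √(2 - (u ω).1 0 ^ 2) := rfl
  simp only [Pi.pow_apply]
  rw [kapDot, ← this]
  field_simp
  push_cast
  ring

theorem hasDerivAt_qOf_curve (h : ‖u ω‖ ≤ 1 / 16) (y : ℝ) :
    HasDerivAt (fun w => qOf (u w) y) (qDot (u ω) v y) ω := by
  have hk := one_le_kappa h
  have h1 := ((hasDerivAt_snd_apply hu 0).div (hasDerivAt_kappa_curve hu h) (by linarith)).add
    ((((BoundedContinuousFunction.evalCLM ℝ y).comp opL₂).comp
    (ContinuousLinearMap.snd ℝ CB CB)).hasFDerivAt.comp_hasDerivAt ω hu)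
  have e : (fun w => qOf (u w) y) = fun w => (u w).2 0 / kappa ((u w).1 0) + opL₂ (u w).2 y :=
    funext fun w => qOf_apply _ _
  rw [e]
  refine h1.congr_deriv ?_
  rw [qDot_apply]
  change _ + opL₂ v.2 y = _
  field_simp

omit hu in
theorem hasDerivAt_exp_curve {f : ℝ → ℝ} {f' : ℝ} (hf : HasDerivAt f f' ω) (y : ℝ) :
    HasDerivAt (fun w => Real.exp (-f w * y)) (-f' * y * Real.exp (-f ω * y)) ω := by
  refine ((hf.neg.mul_const y).exp).congr_deriv ?_
  simp only [Pi.neg_apply]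
  ring

theorem hasDerivAt_halfP_curve (y : ℝ) :
    HasDerivAt (fun w => halfP (u w) y) (varP (u ω) v y) ω := by
  refine ((hasDerivAt_exp_curve (hasDerivAt_fst_apply hu 0) y).mul
    (hasDerivAt_pOf_curve hu y)).congr_deriv ?_
  rw [varP, halfP]; ring

theorem hasDerivAt_halfP₁_curve (y : ℝ) :
    HasDerivAt (fun w => halfP₁ (u w) y) (varP₁ (u ω) v y) ω := by
  refine ((hasDerivAt_exp_curve (hasDerivAt_fst_apply hu 0) y).mul
    (((hasDerivAt_fst_apply hu y).const_mul _).sub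
      ((hasDerivAt_fst_apply hu 0).mul (hasDerivAt_pOf_curve hu y)))).congr_deriv ?_
  simp only [Pi.sub_apply, Pi.mul_apply]
  rw [varP₁, halfP₁]; ring

theorem hasDerivAt_halfD_curve (h : ‖u ω‖ ≤ 1 / 16) (y : ℝ) :
    HasDerivAt (fun w => halfD (u w) y) (varD (u ω) v y) ω := by
  refine ((hasDerivAt_exp_curve (hasDerivAt_kappa_curve hu h) y).mul
    (hasDerivAt_qOf_curve hu h y)).congr_deriv ?_
  rw [varD, halfD]; ring

theorem hasDerivAt_halfD₁_curve (h : ‖u ω‖ ≤ 1 / 16) (y : ℝ) :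
    HasDerivAt (fun w => halfD₁ (u w) y) (varD₁ (u ω) v y) ω := by
  refine ((hasDerivAt_exp_curve (hasDerivAt_kappa_curve hu h) y).mul
    (((hasDerivAt_snd_apply hu y).const_mul _).sub
      ((hasDerivAt_kappa_curve hu h).mul (hasDerivAt_qOf_curve hu h y)))).congr_deriv ?_
  simp only [Pi.sub_apply, Pi.mul_apply]
  rw [varD₁, halfD₁]; ring

end Curve

section Continuity

variable {u v : ℝ → CB × CB} {Ω : Set ℝ} (hu : ContinuousOn u Ω) (hv : ContinuousOn v Ω)

omit hu hv in
theorem continuousOn_apply {f : ℝ → CB} (hf : ContinuousOn f Ω) :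
    ContinuousOn (fun p : ℝ × ℝ => f p.1 p.2) (Ω ×ˢ univ) :=
  continuous_eval.comp_continuousOn
    (f := fun p : ℝ × ℝ => (f p.1, p.2))
    ((hf.comp continuousOn_fst fun _ hp => hp.1).prodMk continuousOn_snd)

include hu

theorem continuousOn_alpha : ContinuousOn (fun w => (u w).1 0) Ω :=
  (contDiff_eval 0 (n := 0)).continuous.comp_continuousOn (continuous_fst.comp_continuousOn hu)

theorem continuousOn_kappa : ContinuousOn (fun w => kappa ((u w).1 0)) Ω := by
  have := continuousOn_alpha hu
  unfold kappa
  fun_prop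

omit hu in
theorem continuousOn_comp_fst {f : ℝ → ℝ} (hf : ContinuousOn f Ω) :
    ContinuousOn (fun p : ℝ × ℝ => f p.1) (Ω ×ˢ (univ : Set ℝ)) :=
  hf.comp continuousOn_fst fun _ hp => hp.1

theorem continuousOn_halfP : ContinuousOn (fun p : ℝ × ℝ => halfP (u p.1) p.2) (Ω ×ˢ univ) := by
  have ha := continuousOn_comp_fst (continuousOn_alpha hu)
  have hp := continuousOn_apply (f := fun w => pOf (u w)) (Ω := Ω)
    (continuousOn_const.add
      (opL₁.continuous.comp_continuousOn (continuous_fst.comp_continuousOn hu)))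
  unfold halfP
  fun_prop

theorem continuousOn_halfP₁ :
    ContinuousOn (fun p : ℝ × ℝ => halfP₁ (u p.1) p.2) (Ω ×ˢ univ) := by
  have ha := continuousOn_comp_fst (continuousOn_alpha hu)
  have hp := continuousOn_apply (f := fun w => pOf (u w)) (Ω := Ω)
    (continuousOn_const.add
      (opL₁.continuous.comp_continuousOn (continuous_fst.comp_continuousOn hu)))
  have hr := continuousOn_apply (f := fun w => (u w).1) (continuous_fst.comp_continuousOn hu)
  unfold halfP₁
  fun_prop

theorem continuousOn_qOf (h : ∀ w ∈ Ω, ‖u w‖ ≤ 1 / 16) : ContinuousOn (fun w => qOf (u w)) Ω := by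
  suffices hc : ContinuousOn (fun w => (u w).2 0 / kappa ((u w).1 0)) Ω by
    exact (hc.smul (continuousOn_const (c := (1 : CB)))).add
      (opL₂.continuous.comp_continuousOn (continuous_snd.comp_continuousOn hu))
  refine ContinuousOn.div ?_ (continuousOn_kappa hu) fun w hw => ?_
  · exact (contDiff_eval 0 (n := 0)).continuous.comp_continuousOn
      (continuous_snd.comp_continuousOn hu)
  · have := one_le_kappa (h w hw)
    linarith

theorem continuousOn_halfD (h : ∀ w ∈ Ω, ‖u w‖ ≤ 1 / 16) :
    ContinuousOn (fun p : ℝ × ℝ => halfD (u p.1) p.2) (Ω ×ˢ univ) := by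
  have ha := continuousOn_comp_fst (continuousOn_kappa hu)
  have hp := continuousOn_apply (continuousOn_qOf hu h)
  unfold halfD
  fun_prop

theorem continuousOn_halfD₁ (h : ∀ w ∈ Ω, ‖u w‖ ≤ 1 / 16) :
    ContinuousOn (fun p : ℝ × ℝ => halfD₁ (u p.1) p.2) (Ω ×ˢ univ) := by
  have ha := continuousOn_comp_fst (continuousOn_kappa hu)
  have hp := continuousOn_apply (continuousOn_qOf hu h)
  have hr := continuousOn_apply (f := fun w => (u w).2) (continuous_snd.comp_continuousOn hu)
  unfold halfD₁
  fun_prop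

include hv

theorem continuousOn_varP :
    ContinuousOn (fun p : ℝ × ℝ => varP (u p.1) (v p.1) p.2) (Ω ×ˢ univ) := by
  have ha := continuousOn_comp_fst (continuousOn_alpha hu)
  have hb := continuousOn_comp_fst (continuousOn_alpha hv)
  have h1 := continuousOn_halfP hu
  have h2 := continuousOn_apply (f := fun w => opL₁ (v w).1) (Ω := Ω)
    (opL₁.continuous.comp_continuousOn (continuous_fst.comp_continuousOn hv))
  unfold varP
  fun_prop

theorem continuousOn_varP₁ :
    ContinuousOn (fun p : ℝ × ℝ => varP₁ (u p.1) (v p.1) p.2) (Ω ×ˢ univ) := by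
  have ha := continuousOn_comp_fst (continuousOn_alpha hu)
  have hb := continuousOn_comp_fst (continuousOn_alpha hv)
  have h1 := continuousOn_halfP₁ hu
  have h2 := continuousOn_apply (f := fun w => opL₁ (v w).1) (Ω := Ω)
    (opL₁.continuous.comp_continuousOn (continuous_fst.comp_continuousOn hv))
  have hp := continuousOn_apply (f := fun w => pOf (u w)) (Ω := Ω)
    (continuousOn_const.add
      (opL₁.continuous.comp_continuousOn (continuous_fst.comp_continuousOn hu)))
  have hr := continuousOn_apply (f := fun w => (v w).1) (continuous_fst.comp_continuousOn hv)
  unfold varP₁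
  fun_prop

variable (h : ∀ w ∈ Ω, ‖u w‖ ≤ 1 / 16)

include h

theorem continuousOn_kapDot : ContinuousOn (fun w => kapDot (u w) (v w)) Ω := by
  refine ContinuousOn.div ((continuousOn_alpha hu).mul (continuousOn_alpha hv)).neg
    (continuousOn_kappa hu) fun w hw => ?_
  have := one_le_kappa (h w hw)
  linarith

theorem continuousOn_qDot : ContinuousOn (fun w => qDot (u w) (v w)) Ω := by
  have hk0 : ∀ w ∈ Ω, kappa ((u w).1 0) ≠ 0 := fun w hw => by
    have := one_le_kappa (h w hw)
    linarith
  have ev : Continuous fun x : CB × CB => x.2 0 :=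
    (contDiff_eval 0 (n := 0)).continuous.comp continuous_snd
  have hc := (ContinuousOn.div (ev.comp_continuousOn hv) (continuousOn_kappa hu) hk0).sub
    (ContinuousOn.div ((ev.comp_continuousOn hu).mul (continuousOn_kapDot hu hv h))
      ((continuousOn_kappa hu).pow 2) fun w hw => pow_ne_zero 2 (hk0 w hw))
  exact (hc.smul (continuousOn_const (c := (1 : CB)))).add
    (opL₂.continuous.comp_continuousOn (continuous_snd.comp_continuousOn hv))

theorem continuousOn_varD :
    ContinuousOn (fun p : ℝ × ℝ => varD (u p.1) (v p.1) p.2) (Ω ×ˢ univ) := by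
  have ha := continuousOn_comp_fst (continuousOn_kappa hu)
  have hb := continuousOn_comp_fst (continuousOn_kapDot hu hv h)
  have h1 := continuousOn_halfD hu h
  have h2 := continuousOn_apply (continuousOn_qDot hu hv h)
  unfold varD
  fun_prop

theorem continuousOn_varD₁ :
    ContinuousOn (fun p : ℝ × ℝ => varD₁ (u p.1) (v p.1) p.2) (Ω ×ˢ univ) := by
  have ha := continuousOn_comp_fst (continuousOn_kappa hu)
  have hb := continuousOn_comp_fst (continuousOn_kapDot hu hv h)
  have h1 := continuousOn_halfD₁ hu h
  have h2 := continuousOn_apply (continuousOn_qDot hu hv h)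
  have hp := continuousOn_apply (continuousOn_qOf hu h)
  have hr := continuousOn_apply (f := fun w => (v w).2) (continuous_snd.comp_continuousOn hv)
  unfold varD₁
  fun_prop

end Continuity

/-! ### The potentials of the eigenvalue problem -/

/-- The pair of potentials `((a⁺ + a⁻)/2, (a⁺ - a⁻)/2)`, weighted by `e^{7|y|/4}`. -/
def betaOf (g : ℝ → ℝ) (ω : ℝ) : CB × CB := (potCB g (bfun g) ω, potCB g (cfun g) ω)

/-- The derivative of `betaOf` with respect to `ω`. -/
def betaDot (g : ℝ → ℝ) (ω : ℝ) : CB × CB :=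
  (potCB' g (bfun g) (bth g) ω, potCB' g (cfun g) (cth g) ω)

/-- The linearization of `α` at the origin, as a functional of the potentials. -/
def massLin : CB × CB →L[ℝ] ℝ :=
  ((BoundedContinuousFunction.evalCLM ℝ (0 : ℝ)).comp (ContinuousLinearMap.fst ℝ CB CB)).comp
    (-bifLin)

theorem massLin_apply (β : CB × CB) :
    massLin β = -∫ z in Ioi (0 : ℝ), Real.exp (-(7 / 4) * z) * β.1 z := by
  have h : massLin β = -opA₁ (wexp 0 (1 / 4) * β.1) 0 := rfl
  rw [h, opA₁, opA_apply, opAFun, mul_zero, Real.exp_zero, one_mul]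
  congr 1
  refine setIntegral_congr_fun measurableSet_Ioi fun z hz => ?_
  have hz : 0 ≤ z := le_of_lt hz
  simp only [BoundedContinuousFunction.coe_mul, Pi.mul_apply]
  rw [wexp_apply 0 (by norm_num), pow_zero, one_mul, abs_of_nonneg hz, ← mul_assoc,
    ← Real.exp_add]
  ring_nf

namespace SmallFreq

variable {g : ℝ → ℝ} {ω₀ ω : ℝ}

theorem mono (H : SmallFreq g ω₀) {ω₁ : ℝ} (h0 : 0 < ω₁) (h : ω₁ ≤ ω₀) : SmallFreq g ω₁ :=
  ⟨H.h1, h0, (H.h1.eps_mono h0 h).trans H.eps_le⟩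

theorem hasDerivAt_betaOf (H : SmallFreq g ω₀) (hω : ω ∈ Ioo 0 ω₀) :
    HasDerivAt (betaOf g) (betaDot g ω) ω :=
  (H.hasDerivAt_potCB (isCoef_bfun H.h1) hω).prodMk (H.hasDerivAt_potCB (isCoef_cfun H.h1) hω)

theorem continuousOn_betaDot (H : SmallFreq g ω₀) : ContinuousOn (betaDot g) (Ioo 0 ω₀) :=
  (H.continuousOn_potCB' (isCoef_bfun H.h1)).prodMk (H.continuousOn_potCB' (isCoef_cfun H.h1))

theorem norm_betaOf_le (H : SmallFreq g ω₀) (hω : ω ∈ Ioo 0 ω₀) :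
    ‖betaOf g ω‖ ≤ 72 * eps g ω :=
  max_le (H.norm_potCB_le (isCoef_bfun H.h1) hω) (H.norm_potCB_le (isCoef_cfun H.h1) hω)

theorem norm_betaDot_le (H : SmallFreq g ω₀) (hω : ω ∈ Ioo 0 ω₀) :
    ‖betaDot g ω‖ ≤ 12800 * (eps g ω / ω) :=
  max_le (H.norm_potCB'_le (isCoef_bfun H.h1) hω) (H.norm_potCB'_le (isCoef_cfun H.h1) hω)

theorem exp_mul_betaOf_fst (H : SmallFreq g ω₀) (hω : ω ∈ Ioo 0 ω₀) {y : ℝ} (hy : 0 ≤ y) :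
    Real.exp (-(7 / 4) * y) * (betaOf g ω).1 y = pot g (bfun g) ω y := by
  rw [betaOf, H.potCB_apply (isCoef_bfun H.h1) hω, ← mul_assoc, ← Real.exp_add, abs_of_nonneg hy,
    neg_mul, neg_add_cancel, Real.exp_zero, one_mul]

theorem exp_mul_betaOf_snd (H : SmallFreq g ω₀) (hω : ω ∈ Ioo 0 ω₀) {y : ℝ} (hy : 0 ≤ y) :
    Real.exp (-(7 / 4) * y) * (betaOf g ω).2 y = pot g (cfun g) ω y := by
  rw [betaOf, H.potCB_apply (isCoef_cfun H.h1) hω, ← mul_assoc, ← Real.exp_add, abs_of_nonneg hy,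
    neg_mul, neg_add_cancel, Real.exp_zero, one_mul]

theorem pot_abs (H : SmallFreq g ω₀) (hω : ω ∈ Ioo 0 ω₀) (φ : ℝ → ℝ) (y : ℝ) :
    pot g φ ω |y| = pot g φ ω y := by
  rcases abs_choice y with h | h
  · rw [h]
  · rw [h, pot, pot, H.sf_neg hω]

theorem aPlus_eq (H : SmallFreq g ω₀) (hω : ω ∈ Ioo 0 ω₀) (y : ℝ) :
    aPlus g ω y = pot g (fun s => gam g 0 s - 2 * gamI g s) ω y := by
  have hs := (H.sf_mem hω y).1.ne'
  have hw := hω.1.ne'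
  rw [aPlus, H.mul_solQ_sq hω, H.solQ_sq hω, pot, gam_zero, gamI]
  field_simp

theorem aMinus_eq (H : SmallFreq g ω₀) (hω : ω ∈ Ioo 0 ω₀) (y : ℝ) :
    aMinus g ω y = pot g (fun s => 5 * gam g 0 s - 6 * gamI g s - 2 * gam g 1 s) ω y := by
  have hs := (H.sf_mem hω y).1.ne'
  have hw := hω.1.ne'
  rw [aMinus, H.mul_solQ_sq hω, H.solQ_sq hω, pot, gam_zero, gam_one, gamI]
  field_simp

theorem aPlus_add_aMinus (H : SmallFreq g ω₀) (hω : ω ∈ Ioo 0 ω₀) (y : ℝ) :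
    aPlus g ω y + aMinus g ω y = 2 * pot g (bfun g) ω y := by
  rw [H.aPlus_eq hω, H.aMinus_eq hω, pot, pot, pot, bfun]; ring

theorem aPlus_sub_aMinus (H : SmallFreq g ω₀) (hω : ω ∈ Ioo 0 ω₀) (y : ℝ) :
    aPlus g ω y - aMinus g ω y = 2 * pot g (cfun g) ω y := by
  rw [H.aPlus_eq hω, H.aMinus_eq hω, pot, pot, pot, cfun]; ring

theorem intI_eq (H : SmallFreq g ω₀) (hω : ω ∈ Ioo 0 ω₀) :
    intI g ω = -2 * ∫ y, pot g (bfun g) ω y := by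
  rw [intI]
  simp_rw [H.aPlus_add_aMinus hω]
  rw [integral_const_mul]; ring

/-- The linearization of `α` is `I/4`. -/
theorem intI_eq_massLin (H : SmallFreq g ω₀) (hω : ω ∈ Ioo 0 ω₀) :
    intI g ω = 4 * massLin (betaOf g ω) := by
  have h := integral_comp_abs (f := pot g (bfun g) ω)
  simp_rw [H.pot_abs hω] at h
  rw [H.intI_eq hω, h, massLin_apply, setIntegral_congr_fun measurableSet_Ioi
    fun z (hz : 0 < z) => H.exp_mul_betaOf_fst hω hz.le]
  ring

theorem hasDerivAt_intI (H : SmallFreq g ω₀) (hω : ω ∈ Ioo 0 ω₀) :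
    HasDerivAt (intI g) (4 * massLin (betaDot g ω)) ω := by
  refine ((massLin.hasFDerivAt.comp_hasDerivAt ω (H.hasDerivAt_betaOf hω)).const_mul
    4).congr_of_eventuallyEq ?_
  filter_upwards [isOpen_Ioo.mem_nhds hω] with w hw
  exact H.intI_eq_massLin hw

/-- The integral in `(H₂)` is `I_ω`, up to the factor from the scaling: `𝔅(s)/s` is the coefficient
`bfun` with the opposite sign. -/
theorem integral_frakB (H : SmallFreq g ω₀) (hω : ω ∈ Ioo 0 ω₀) :
    ∫ x, frakB g (soliton g ω x ^ 2) = √ω / 2 * intI g ω := by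
  have e : ∀ x, frakB g (soliton g ω x ^ 2) = -ω * pot g (bfun g) ω (√ω * x) := by
    intro x
    have hs := (H.sf_mem hω (√ω * x)).1.ne'
    have hw := hω.1.ne'
    rw [H.sq_eq_sf hω (H.isSoliton_soliton hω), frakB, pot, bfun, gam_zero, gam_one, gamI]
    field_simp
    ring
  simp_rw [e]
  rw [integral_const_mul, Measure.integral_comp_mul_left, H.intI_eq hω, smul_eq_mul,
    abs_of_pos (inv_pos.2 (Real.sqrt_pos.2 hω.1))]
  have h1 := Real.mul_self_sqrt hω.1.le
  have h2 := (Real.sqrt_pos.2 hω.1).ne'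
  have h3 : ω * (√ω)⁻¹ = √ω := by
    rw [← div_eq_mul_inv, div_eq_iff h2, h1]
  linear_combination (-∫ y, pot g (bfun g) ω y) * h3

end SmallFreq

/-- `(H₂)` says that `I_ω` is large with respect to `ε_ω²`. -/
theorem HypH2.eventually_le {g : ℝ → ℝ} (h1 : HypH1 g) (h2 : HypH2 g) (M : ℝ) :
    ∀ᶠ ω in 𝓝[>] 0, M * eps g ω ^ 2 ≤ intI g ω := by
  obtain ⟨ω₀, H⟩ := h1.exists_smallFreq
  filter_upwards [h2.eventually_ge_atTop (M / 2), Ioo_mem_nhdsGT H.pos] with ω hM hω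
  have he := h1.eps_pos hω.1
  have hq := Real.sqrt_pos.2 hω.1
  rw [H.integral_frakB hω] at hM
  have e : 1 / (eps g ω ^ 2 * √ω) * (√ω / 2 * intI g ω) = intI g ω / (2 * eps g ω ^ 2) := by
    field_simp
  rw [e, le_div_iff₀ (by positivity)] at hM
  linarith

/-! ### The branch of eigenfunctions -/

/-- The even decaying solution `(P, D) = ((W₁ + W₂)/2, (W₁ - W₂)/2)` of the eigenvalue problem, its
derivatives `P₁, D₁` in `y`, the derivatives `Pd, P₁d, Dd, D₁d` of all of these in `ω`, and what is
needed of them. -/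
structure EigenBranch (g : ℝ → ℝ) where
  /-- The frequencies are in `(0, ω₁)`. -/
  ω₁ : ℝ
  /-- The constant of all bounds. -/
  K : ℝ
  /-- The rate of decay, with `λ = 1 - α²`. -/
  α : ℝ → ℝ
  /-- The derivative of `α`. -/
  αd : ℝ → ℝ
  /-- The slow component. -/
  P : ℝ → ℝ → ℝ
  /-- The `y`-derivative of `P`. -/
  P₁ : ℝ → ℝ → ℝ
  /-- The fast component. -/
  D : ℝ → ℝ → ℝ
  /-- The `y`-derivative of `D`. -/
  D₁ : ℝ → ℝ → ℝ
  /-- The `ω`-derivative of `P`. -/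
  Pd : ℝ → ℝ → ℝ
  /-- The `ω`-derivative of `P₁`. -/
  P₁d : ℝ → ℝ → ℝ
  /-- The `ω`-derivative of `D`. -/
  Dd : ℝ → ℝ → ℝ
  /-- The `ω`-derivative of `D₁`. -/
  D₁d : ℝ → ℝ → ℝ
  H : SmallFreq g ω₁
  one_le : 1 ≤ K
  sq_eps_le : ∀ ω ∈ Ioo 0 ω₁, eps g ω ^ 2 ≤ intI g ω
  intI_le : ∀ ω ∈ Ioo 0 ω₁, intI g ω ≤ K * eps g ω
  le_alpha : ∀ ω ∈ Ioo 0 ω₁, intI g ω / 8 ≤ α ω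
  alpha_le : ∀ ω ∈ Ioo 0 ω₁, α ω ≤ 1 / 16
  alpha_sub : ∀ ω ∈ Ioo 0 ω₁, |α ω - intI g ω / 4| ≤ K * eps g ω ^ 2
  hasDerivAt_alpha : ∀ ω ∈ Ioo 0 ω₁, HasDerivAt α (αd ω) ω
  continuousOn_alphad : ContinuousOn αd (Ioo 0 ω₁)
  alphad_le : ∀ ω ∈ Ioo 0 ω₁, |αd ω| ≤ K * (eps g ω / ω)
  alphad_sub : ∀ ω ∈ Ioo 0 ω₁, |αd ω - deriv (intI g) ω / 4| ≤ K * (eps g ω ^ 2 / ω)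
  hasDerivAt_P : ∀ ω ∈ Ioo 0 ω₁, ∀ y, HasDerivAt (P ω) (P₁ ω y) y
  hasDerivAt_P₁ : ∀ ω ∈ Ioo 0 ω₁, ∀ y, HasDerivAt (P₁ ω)
    ((α ω ^ 2 + pot g (bfun g) ω y) * P ω y + pot g (cfun g) ω y * D ω y) y
  hasDerivAt_D : ∀ ω ∈ Ioo 0 ω₁, ∀ y, HasDerivAt (D ω) (D₁ ω y) y
  hasDerivAt_D₁ : ∀ ω ∈ Ioo 0 ω₁, ∀ y, HasDerivAt (D₁ ω)
    ((2 - α ω ^ 2 + pot g (bfun g) ω y) * D ω y + pot g (cfun g) ω y * P ω y) y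
  hasDerivAt_P_omega : ∀ ω ∈ Ioo 0 ω₁, ∀ y, HasDerivAt (fun w => P w y) (Pd ω y) ω
  hasDerivAt_P₁_omega : ∀ ω ∈ Ioo 0 ω₁, ∀ y, HasDerivAt (fun w => P₁ w y) (P₁d ω y) ω
  hasDerivAt_D_omega : ∀ ω ∈ Ioo 0 ω₁, ∀ y, HasDerivAt (fun w => D w y) (Dd ω y) ω
  hasDerivAt_D₁_omega : ∀ ω ∈ Ioo 0 ω₁, ∀ y, HasDerivAt (fun w => D₁ w y) (D₁d ω y) ω
  hasDerivAt_Pd : ∀ ω ∈ Ioo 0 ω₁, ∀ y, HasDerivAt (Pd ω) (P₁d ω y) y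
  hasDerivAt_P₁d : ∀ ω ∈ Ioo 0 ω₁, ∀ y, HasDerivAt (P₁d ω)
    ((2 * α ω * αd ω + potD g (bfun g) (bth g) ω y / ω) * P ω y
      + (α ω ^ 2 + pot g (bfun g) ω y) * Pd ω y
      + (potD g (cfun g) (cth g) ω y / ω * D ω y + pot g (cfun g) ω y * Dd ω y)) y
  hasDerivAt_Dd : ∀ ω ∈ Ioo 0 ω₁, ∀ y, HasDerivAt (Dd ω) (D₁d ω y) y
  hasDerivAt_D₁d : ∀ ω ∈ Ioo 0 ω₁, ∀ y, HasDerivAt (D₁d ω)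
    ((-(2 * α ω * αd ω) + potD g (bfun g) (bth g) ω y / ω) * D ω y
      + (2 - α ω ^ 2 + pot g (bfun g) ω y) * Dd ω y
      + (potD g (cfun g) (cth g) ω y / ω * P ω y + pot g (cfun g) ω y * Pd ω y)) y
  P_sub : ∀ ω ∈ Ioo 0 ω₁, ∀ y,
    |P ω y - Real.exp (-α ω * |y|)| ≤ K * eps g ω * Real.exp (-α ω * |y|)
  P₁_add : ∀ ω ∈ Ioo 0 ω₁, ∀ y, 0 ≤ y → |P₁ ω y + α ω * Real.exp (-α ω * y)| ≤
    K * eps g ω ^ 2 * Real.exp (-α ω * y) + K * eps g ω * Real.exp (-kappa (α ω) * y)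
  P₁_odd : ∀ ω ∈ Ioo 0 ω₁, ∀ y, |P₁ ω y| = |P₁ ω (|y|)|
  D_le : ∀ ω ∈ Ioo 0 ω₁, ∀ y, |D ω y| ≤ K * eps g ω * Real.exp (-kappa (α ω) * |y|)
  D₁_le : ∀ ω ∈ Ioo 0 ω₁, ∀ y, |D₁ ω y| ≤ K * eps g ω * Real.exp (-kappa (α ω) * |y|)
  Pd_le : ∀ ω ∈ Ioo 0 ω₁, ∀ y,
    |Pd ω y| ≤ K * (eps g ω / ω) * (1 + |y|) * Real.exp (-α ω * |y|)
  P₁d_le : ∀ ω ∈ Ioo 0 ω₁, ∀ y,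
    |P₁d ω y| ≤ K * (eps g ω / ω) * (1 + |y|) * Real.exp (-α ω * |y|)
  Dd_le : ∀ ω ∈ Ioo 0 ω₁, ∀ y,
    |Dd ω y| ≤ K * (eps g ω / ω) * (1 + |y|) * Real.exp (-kappa (α ω) * |y|)
  D₁d_le : ∀ ω ∈ Ioo 0 ω₁, ∀ y,
    |D₁d ω y| ≤ K * (eps g ω / ω) * (1 + |y|) * Real.exp (-kappa (α ω) * |y|)

theorem hasDerivAt_oddExt_curve {f : ℝ → ℝ → ℝ} {f' : ℝ → ℝ} {ω : ℝ}
    (h : ∀ y, HasDerivAt (fun w => f w y) (f' y) ω) (y : ℝ) :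
    HasDerivAt (fun w => oddExt (f w) y) (oddExt f' y) ω := (h _).sub (h _)

/-- The branch is obtained from the solution map of the bifurcation equation at the potentials `β_ω`,
and from the even extension of the solution on the half-line. The constant `41472` makes `I/8` larger
than the error `5184Kε²` in `α = I/4 + O(ε²)`. -/
theorem exists_eigenBranch {g : ℝ → ℝ} (h1 : HypH1 g) (h2 : HypH2 g) :
    Nonempty (EigenBranch g) := by
  obtain ⟨U, η, K, hη, hK, hU1, hU⟩ := exists_branch
  obtain ⟨ω₀, H₀⟩ := h1.exists_smallFreq
  have hsmall : ∀ᶠ ω in 𝓝[>] 0, 72 * eps g ω < η ∧ (41472 * K + 1) * eps g ω ^ 2 ≤ intI g ω := by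
    have : Tendsto (fun ω => 72 * eps g ω) (𝓝[>] 0) (𝓝 (72 * 0)) := h1.tendsto_eps.const_mul 72
    rw [mul_zero] at this
    exact (this.eventually (gt_mem_nhds hη)).and (h2.eventually_le h1 _)
  obtain ⟨ω', hω'0, hω'⟩ := (mem_nhdsGT_iff_exists_Ioo_subset (a := (0 : ℝ))).1 hsmall
  set ω₁ := min ω' ω₀ with hω₁
  have H : SmallFreq g ω₁ := H₀.mono (lt_min hω'0 H₀.pos) (min_le_right _ _)
  have hsm : ∀ ω ∈ Ioo 0 ω₁, 72 * eps g ω < η ∧ (41472 * K + 1) * eps g ω ^ 2 ≤ intI g ω :=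
    fun ω hω => hω' ⟨hω.1, hω.2.trans_le (min_le_left _ _)⟩
  have he : ∀ ω ∈ Ioo 0 ω₁, 0 < eps g ω := fun ω hω => h1.eps_pos hω.1
  have he1 : ∀ ω ∈ Ioo 0 ω₁, eps g ω ≤ 1 := fun ω hω =>
    (H.eps_le' (Ioo_subset_Ioc_self hω)).trans (by norm_num)
  have hball : ∀ ω ∈ Ioo 0 ω₁, betaOf g ω ∈ Metric.ball (0 : CB × CB) η := fun ω hω => by
    rw [mem_ball_zero_iff]
    exact (H.norm_betaOf_le hω).trans_lt (hsm ω hω).1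
  -- the curve of solutions of the bifurcation equation and its derivative
  set u : ℝ → CB × CB := fun ω => U (betaOf g ω) with hu_def
  set v : ℝ → CB × CB := fun ω => fderiv ℝ U (betaOf g ω) (betaDot g ω) with hv_def
  have hu : ∀ ω ∈ Ioo 0 ω₁, HasDerivAt u (v ω) ω := fun ω hω =>
    ((hU1.differentiableOn one_ne_zero).differentiableAt
      (Metric.isOpen_ball.mem_nhds (hball ω hω))).hasFDerivAt.comp_hasDerivAt ω
      (H.hasDerivAt_betaOf hω)
  have huc : ContinuousOn u (Ioo 0 ω₁) := fun ω hω => (hu ω hω).continuousAt.continuousWithinAt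
  have hβc : ContinuousOn (betaOf g) (Ioo 0 ω₁) := fun ω hω =>
    (H.hasDerivAt_betaOf hω).continuousAt.continuousWithinAt
  have hvc : ContinuousOn v (Ioo 0 ω₁) :=
    ((hU1.continuousOn_fderiv_of_isOpen Metric.isOpen_ball le_rfl).comp hβc hball).clm_apply
      H.continuousOn_betaDot
  have hun : ∀ ω ∈ Ioo 0 ω₁, ‖u ω‖ ≤ 1 / 16 := fun ω hω => (hU _ (hball ω hω)).2.2.1
  set A := 12800 * K with hA
  have hA0 : 0 < A := by positivity
  have huA : ∀ ω ∈ Ioo 0 ω₁, ‖u ω‖ ≤ A * eps g ω := fun ω hω => by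
    have h3 := (hU _ (hball ω hω)).2.1
    have h4 : K * ‖betaOf g ω‖ ≤ K * (72 * eps g ω) := by gcongr; exact H.norm_betaOf_le hω
    have : 0 ≤ K * eps g ω := mul_nonneg hK.le (he ω hω).le
    linarith
  have hvA : ∀ ω ∈ Ioo 0 ω₁, ‖v ω‖ ≤ A * (eps g ω / ω) := fun ω hω => by
    refine (ContinuousLinearMap.le_opNorm _ _).trans ?_
    calc _ ≤ K * (12800 * (eps g ω / ω)) :=
          mul_le_mul (hU _ (hball ω hω)).2.2.2.1 (H.norm_betaDot_le hω) (norm_nonneg _) hK.le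
      _ = _ := by rw [hA]; ring
  set L := opLBound with hL
  have hL1 : 1 ≤ L := one_le_opLBound
  set M := 100 * L * (A + 1) ^ 2 with hM
  have hAM : 100 * L * A ≤ M := by
    rw [hM]; nlinarith [mul_pos (show 0 < L by linarith) hA0, mul_self_nonneg A]
  have hA2M : 100 * L * A ^ 2 ≤ M := by
    rw [hM]; nlinarith [mul_pos (show 0 < L by linarith) hA0]
  have hLA : A ≤ L * A := by nlinarith
  have hM1 : 1 ≤ M := by
    rw [hM]; nlinarith [mul_pos (show 0 < L by linarith) hA0, mul_self_nonneg A]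
  -- the expansion of `α`
  have hαsub : ∀ ω ∈ Ioo 0 ω₁, |(u ω).1 0 - intI g ω / 4| ≤ 5184 * K * eps g ω ^ 2 := by
    intro ω hω
    have h3 := (hU _ (hball ω hω)).2.2.2.2.2
    have e : (u ω).1 0 - intI g ω / 4 = (U (betaOf g ω) - (-bifLin) (betaOf g ω)).1 0 := by
      rw [H.intI_eq_massLin hω, mul_div_cancel_left₀ _ (by norm_num)]
      rfl
    rw [e]
    refine (abs_fst_apply_le _ 0).trans (h3.trans ?_)
    calc K * ‖betaOf g ω‖ ^ 2 ≤ K * (72 * eps g ω) ^ 2 := by gcongr; exact H.norm_betaOf_le hω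
      _ = _ := by ring
  have hle : ∀ ω ∈ Ioo 0 ω₁, intI g ω / 8 ≤ (u ω).1 0 := fun ω hω => by
    have h3 := (abs_le.1 (hαsub ω hω)).1
    have h4 := (hsm ω hω).2
    have h5 := sq_nonneg (eps g ω)
    linarith
  have hαA : ∀ ω ∈ Ioo 0 ω₁, |(u ω).1 0| ≤ A * eps g ω := fun ω hω =>
    (abs_fst_apply_le _ 0).trans (huA ω hω)
  have hk0 : ∀ ω ∈ Ioo 0 ω₁, kappa ((u ω).1 0) ≠ 0 := fun ω hω => by
    have := one_le_kappa (hun ω hω)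
    linarith
  have hksq : ∀ ω ∈ Ioo 0 ω₁, kappa ((u ω).1 0) ^ 2 = 2 - (u ω).1 0 ^ 2 := fun ω hω => by
    have := abs_le.1 ((abs_fst_apply_le (u ω) 0).trans (hun ω hω))
    exact Real.sq_sqrt (by nlinarith)
  -- the equations
  have hP : ∀ ω ∈ Ioo 0 ω₁, ∀ y, HasDerivAt (fun y => halfP (u ω) |y|)
      (oddExt (halfP₁ (u ω)) y) y := fun ω hω y =>
    hasDerivAt_evenExt (fun y hy => hasDerivAt_halfP (u ω) hy) (halfP₁_zero _) y
  have hD : ∀ ω ∈ Ioo 0 ω₁, ∀ y, HasDerivAt (fun y => halfD (u ω) |y|)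
      (oddExt (halfD₁ (u ω)) y) y := fun ω hω y =>
    hasDerivAt_evenExt (fun y hy => hasDerivAt_halfD (u ω) hy) (halfD₁_zero _ (hk0 ω hω)) y
  have hP₁ : ∀ ω ∈ Ioo 0 ω₁, ∀ y, HasDerivAt (oddExt (halfP₁ (u ω)))
      (((u ω).1 0 ^ 2 + pot g (bfun g) ω y) * halfP (u ω) |y|
        + pot g (cfun g) ω y * halfD (u ω) |y|) y := fun ω hω y => by
    have hα := (abs_fst_apply_le (u ω) 0).trans (hun ω hω)
    refine (hasDerivAt_oddExt (fun y hy => hasDerivAt_halfP₁ (hU _ (hball ω hω)).1 hα hy)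
      (halfP₁_zero _) y).congr_deriv ?_
    rw [H.exp_mul_betaOf_fst hω (abs_nonneg y), H.exp_mul_betaOf_snd hω (abs_nonneg y),
      H.pot_abs hω, H.pot_abs hω]
  have hD₁ : ∀ ω ∈ Ioo 0 ω₁, ∀ y, HasDerivAt (oddExt (halfD₁ (u ω)))
      ((2 - (u ω).1 0 ^ 2 + pot g (bfun g) ω y) * halfD (u ω) |y|
        + pot g (cfun g) ω y * halfP (u ω) |y|) y := fun ω hω y => by
    have hα := (abs_fst_apply_le (u ω) 0).trans (hun ω hω)
    refine (hasDerivAt_oddExt (fun y hy => hasDerivAt_halfD₁ (hU _ (hball ω hω)).1 hα hy)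
      (halfD₁_zero _ (hk0 ω hω)) y).congr_deriv ?_
    rw [H.exp_mul_betaOf_fst hω (abs_nonneg y), H.exp_mul_betaOf_snd hω (abs_nonneg y),
      H.pot_abs hω, H.pot_abs hω, ← hksq ω hω]
  have hPo : ∀ ω ∈ Ioo 0 ω₁, ∀ y, HasDerivAt (fun w => halfP (u w) |y|)
      (varP (u ω) (v ω) |y|) ω := fun ω hω y => hasDerivAt_halfP_curve (hu ω hω) _
  have hP₁o : ∀ ω ∈ Ioo 0 ω₁, ∀ y, HasDerivAt (fun w => oddExt (halfP₁ (u w)) y)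
      (oddExt (varP₁ (u ω) (v ω)) y) ω := fun ω hω y =>
    hasDerivAt_oddExt_curve (fun y => hasDerivAt_halfP₁_curve (hu ω hω) y) y
  have hDo : ∀ ω ∈ Ioo 0 ω₁, ∀ y, HasDerivAt (fun w => halfD (u w) |y|)
      (varD (u ω) (v ω) |y|) ω := fun ω hω y => hasDerivAt_halfD_curve (hu ω hω) (hun ω hω) _
  have hD₁o : ∀ ω ∈ Ioo 0 ω₁, ∀ y, HasDerivAt (fun w => oddExt (halfD₁ (u w)) y)
      (oddExt (varD₁ (u ω) (v ω)) y) ω := fun ω hω y =>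
    hasDerivAt_oddExt_curve (fun y => hasDerivAt_halfD₁_curve (hu ω hω) (hun ω hω) y) y
  have hαo : ∀ ω ∈ Ioo 0 ω₁, HasDerivAt (fun w => (u w).1 0) ((v ω).1 0) ω := fun ω hω =>
    hasDerivAt_fst_apply (hu ω hω) 0
  have hb := isCoef_bfun h1
  have hc := isCoef_cfun h1
  have hwc : ContinuousOn (fun p : ℝ × ℝ => p.1) (Ioo 0 ω₁ ×ˢ (univ : Set ℝ)) := continuousOn_fst
  have cα := continuousOn_comp_fst (continuousOn_alpha huc)
  have cαd := continuousOn_comp_fst (continuousOn_alpha hvc)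
  have cb := H.continuousOn_pot hb.continuousOn'
  have cc := H.continuousOn_pot hc.continuousOn'
  have cbd := (H.continuousOn_potD hb).div hwc fun _ hp => hp.1.1.ne'
  have ccd := (H.continuousOn_potD hc).div hwc fun _ hp => hp.1.1.ne'
  have cP := continuousOn_evenExt (F := fun w => halfP (u w)) (continuousOn_halfP huc)
  have cP₁ := continuousOn_oddExt (F := fun w => halfP₁ (u w)) (continuousOn_halfP₁ huc)
  have cD := continuousOn_evenExt (F := fun w => halfD (u w)) (continuousOn_halfD huc hun)
  have cD₁ := continuousOn_oddExt (F := fun w => halfD₁ (u w)) (continuousOn_halfD₁ huc hun)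
  have cPd := continuousOn_evenExt (F := fun w => varP (u w) (v w)) (continuousOn_varP huc hvc)
  have cP₁d := continuousOn_oddExt (F := fun w => varP₁ (u w) (v w)) (continuousOn_varP₁ huc hvc)
  have cDd := continuousOn_evenExt (F := fun w => varD (u w) (v w)) (continuousOn_varD huc hvc hun)
  have cD₁d := continuousOn_oddExt (F := fun w => varD₁ (u w) (v w))
    (continuousOn_varD₁ huc hvc hun)
  refine ⟨⟨ω₁, M, fun ω => (u ω).1 0, fun ω => (v ω).1 0, fun ω y => halfP (u ω) |y|,
    fun ω y => oddExt (halfP₁ (u ω)) y, fun ω y => halfD (u ω) |y|,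
    fun ω y => oddExt (halfD₁ (u ω)) y, fun ω y => varP (u ω) (v ω) |y|,
    fun ω y => oddExt (varP₁ (u ω) (v ω)) y, fun ω y => varD (u ω) (v ω) |y|,
    fun ω y => oddExt (varD₁ (u ω) (v ω)) y, H, hM1, fun ω hω => ?_, fun ω hω => ?_, hle,
    fun ω hω => (abs_le.1 ((abs_fst_apply_le (u ω) 0).trans (hun ω hω))).2, fun ω hω => ?_, hαo,
    continuousOn_alpha hvc, fun ω hω => ?_, fun ω hω => ?_, hP, hP₁, hD, hD₁, hPo, hP₁o, hDo,
    hD₁o, fun ω hω y => ?_, fun ω hω y => ?_, fun ω hω y => ?_, fun ω hω y => ?_,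
    fun ω hω y => ?_, fun ω hω y hy => ?_, fun ω hω y => ?_, fun ω hω y => ?_, fun ω hω y => ?_,
    fun ω hω y => ?_, fun ω hω y => ?_, fun ω hω y => ?_, fun ω hω y => ?_⟩⟩
  · have h4 := (hsm ω hω).2
    nlinarith [mul_nonneg hK.le (sq_nonneg (eps g ω))]
  · have h3 := hle ω hω
    have h4 := (abs_le.1 (hαA ω hω)).2
    have h5 : 8 * A * eps g ω ≤ M * eps g ω :=
      mul_le_mul_of_nonneg_right (by linarith) (he ω hω).le
    linarith
  · refine (hαsub ω hω).trans (mul_le_mul_of_nonneg_right ?_ (sq_nonneg _))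
    linarith
  · refine ((abs_fst_apply_le _ 0).trans (hvA ω hω)).trans
      (mul_le_mul_of_nonneg_right (by linarith) (div_nonneg (he ω hω).le hω.1.le))
  · have h3 := (hU _ (hball ω hω)).2.2.2.2.1
    have e : (v ω).1 0 - deriv (intI g) ω / 4 =
        ((fderiv ℝ U (betaOf g ω) - -bifLin) (betaDot g ω)).1 0 := by
      rw [(H.hasDerivAt_intI hω).deriv, mul_div_cancel_left₀ _ (by norm_num)]
      rfl
    have h4 : ‖(fderiv ℝ U (betaOf g ω) - -bifLin) (betaDot g ω)‖ ≤
        K * (72 * eps g ω) * (12800 * (eps g ω / ω)) := by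
      refine (ContinuousLinearMap.le_opNorm _ _).trans (mul_le_mul (h3.trans ?_)
        (H.norm_betaDot_le hω) (norm_nonneg _) ?_)
      · gcongr; exact H.norm_betaOf_le hω
      · have := (he ω hω).le
        positivity
    simp only [e]
    refine (abs_fst_apply_le _ 0).trans (h4.trans ?_)
    have h5 : K * (72 * eps g ω) * (12800 * (eps g ω / ω)) = 72 * A * (eps g ω ^ 2 / ω) := by
      rw [hA]; ring
    rw [h5]
    refine mul_le_mul_of_nonneg_right (by linarith) (div_nonneg (sq_nonneg _) hω.1.le)
  · exact hasDerivAt_swap isOpen_Ioo (u := fun w y => halfP (u w) |y|)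
      (u₁ := fun w y => oddExt (halfP₁ (u w)) y) (v := fun w y => varP (u w) (v w) |y|)
      (v₁ := fun w y => oddExt (varP₁ (u w) (v w)) y) hP hPo hP₁o cP₁ cP₁d hω y
  · refine hasDerivAt_swap isOpen_Ioo (u := fun w y => oddExt (halfP₁ (u w)) y)
      (u₁ := fun w y => ((u w).1 0 ^ 2 + pot g (bfun g) w y) * halfP (u w) |y|
        + pot g (cfun g) w y * halfD (u w) |y|)
      (v := fun w y => oddExt (varP₁ (u w) (v w)) y)
      (v₁ := fun w y => (2 * (u w).1 0 * (v w).1 0 + potD g (bfun g) (bth g) w y / w)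
        * halfP (u w) |y| + ((u w).1 0 ^ 2 + pot g (bfun g) w y) * varP (u w) (v w) |y|
        + (potD g (cfun g) (cth g) w y / w * halfD (u w) |y|
          + pot g (cfun g) w y * varD (u w) (v w) |y|))
      hP₁ hP₁o (fun w hw y => ?_) ?_ ?_ hω y
    · refine (((((hαo w hw).pow 2).add (H.hasDerivAt_pot_omega hw hb.hasDerivAt y)).mul
        (hPo w hw y)).add ((H.hasDerivAt_pot_omega hw hc.hasDerivAt y).mul
        (hDo w hw y))).congr_deriv ?_
      simp only [Pi.add_apply, Pi.pow_apply]
      push_cast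
      ring
    · fun_prop
    · exact ((((continuousOn_const.mul cα).mul cαd).add cbd).mul cP).add
        (((cα.pow 2).add cb).mul cPd) |>.add ((ccd.mul cD).add (cc.mul cDd))
  · exact hasDerivAt_swap isOpen_Ioo (u := fun w y => halfD (u w) |y|)
      (u₁ := fun w y => oddExt (halfD₁ (u w)) y) (v := fun w y => varD (u w) (v w) |y|)
      (v₁ := fun w y => oddExt (varD₁ (u w) (v w)) y) hD hDo hD₁o cD₁ cD₁d hω y
  · refine hasDerivAt_swap isOpen_Ioo (u := fun w y => oddExt (halfD₁ (u w)) y)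
      (u₁ := fun w y => (2 - (u w).1 0 ^ 2 + pot g (bfun g) w y) * halfD (u w) |y|
        + pot g (cfun g) w y * halfP (u w) |y|)
      (v := fun w y => oddExt (varD₁ (u w) (v w)) y)
      (v₁ := fun w y => (-(2 * (u w).1 0 * (v w).1 0) + potD g (bfun g) (bth g) w y / w)
        * halfD (u w) |y| + (2 - (u w).1 0 ^ 2 + pot g (bfun g) w y) * varD (u w) (v w) |y|
        + (potD g (cfun g) (cth g) w y / w * halfP (u w) |y|
          + pot g (cfun g) w y * varP (u w) (v w) |y|))
      hD₁ hD₁o (fun w hw y => ?_) ?_ ?_ hω y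
    · refine ((((((hαo w hw).pow 2).const_sub 2).add
        (H.hasDerivAt_pot_omega hw hb.hasDerivAt y)).mul
        (hDo w hw y)).add ((H.hasDerivAt_pot_omega hw hc.hasDerivAt y).mul
        (hPo w hw y))).congr_deriv ?_
      simp only [Pi.add_apply, Pi.pow_apply]
      push_cast
      ring
    · fun_prop
    · exact ((((continuousOn_const.mul cα).mul cαd).neg.add cbd).mul cD).add
        (((continuousOn_const.sub (cα.pow 2)).add cb).mul cDd) |>.add
        ((ccd.mul cP).add (cc.mul cPd))
  · have hE := Real.exp_pos (-(u ω).1 0 * |y|)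
    refine (abs_halfP_sub_le (u := u ω) |y|).trans (mul_le_mul_of_nonneg_right ?_ hE.le)
    have h3 : L * ‖u ω‖ ≤ L * (A * eps g ω) := by gcongr; exact huA ω hω
    have h4 : L * A * eps g ω ≤ M * eps g ω :=
      mul_le_mul_of_nonneg_right (by linarith) (he ω hω).le
    linarith
  · have hE := Real.exp_pos (-(u ω).1 0 * y)
    have hE2 := Real.exp_pos (-kappa ((u ω).1 0) * y)
    simp only [oddExt_of_nonneg (halfP₁_zero _) hy]
    refine (abs_halfP₁_add_le (hun ω hω) hy).trans ?_
    have h3 : L * ‖u ω‖ ^ 2 ≤ L * (A * eps g ω) ^ 2 := by gcongr; exact huA ω hω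
    have h4 : L * A ^ 2 * eps g ω ^ 2 ≤ M * eps g ω ^ 2 :=
      mul_le_mul_of_nonneg_right (by linarith [mul_nonneg (show 0 ≤ L by linarith) (sq_nonneg A)])
        (sq_nonneg _)
    have h5 : A * eps g ω ≤ M * eps g ω :=
      mul_le_mul_of_nonneg_right (by linarith) (he ω hω).le
    refine add_le_add (mul_le_mul_of_nonneg_right (by linarith) hE.le)
      (mul_le_mul_of_nonneg_right (by linarith [huA ω hω]) hE2.le)
  · rw [abs_oddExt (halfP₁_zero _), abs_oddExt (halfP₁_zero _), abs_abs]
  · have hE := Real.exp_pos (-kappa ((u ω).1 0) * |y|)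
    refine (abs_halfD_le (hun ω hω) |y|).trans (mul_le_mul_of_nonneg_right ?_ hE.le)
    have h3 : L * ‖u ω‖ ≤ L * (A * eps g ω) := by gcongr; exact huA ω hω
    have h4 : 2 * L * A * eps g ω ≤ M * eps g ω :=
      mul_le_mul_of_nonneg_right (by linarith) (he ω hω).le
    linarith
  · have hE := Real.exp_pos (-kappa ((u ω).1 0) * |y|)
    rw [abs_oddExt (halfD₁_zero _ (hk0 ω hω))]
    refine (abs_halfD₁_le (hun ω hω) (abs_nonneg y)).trans (mul_le_mul_of_nonneg_right ?_ hE.le)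
    have h3 : L * ‖u ω‖ ≤ L * (A * eps g ω) := by gcongr; exact huA ω hω
    have h4 : 4 * L * A * eps g ω ≤ M * eps g ω :=
      mul_le_mul_of_nonneg_right (by linarith) (he ω hω).le
    linarith
  all_goals
    have hew : 0 ≤ eps g ω / ω := div_nonneg (he ω hω).le hω.1.le
    have h3 : L * ‖v ω‖ ≤ L * (A * (eps g ω / ω)) := by gcongr; exact hvA ω hω
    have h4 : 9 * L * A * (eps g ω / ω) ≤ M * (eps g ω / ω) :=
      mul_le_mul_of_nonneg_right (by linarith) hew
    have h5 : 0 ≤ L * A * (eps g ω / ω) := by positivity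
    have hy1 : 0 ≤ 1 + |y| := by positivity
  · refine (abs_varP_le (hun ω hω) (abs_nonneg y)).trans ?_
    refine mul_le_mul_of_nonneg_right (mul_le_mul_of_nonneg_right ?_ hy1) (Real.exp_pos _).le
    linarith
  · rw [abs_oddExt (varP₁_zero _ _)]
    refine (abs_varP₁_le (hun ω hω) (abs_nonneg y)).trans ?_
    refine mul_le_mul_of_nonneg_right (mul_le_mul_of_nonneg_right ?_ hy1) (Real.exp_pos _).le
    linarith
  · refine (abs_varD_le (hun ω hω) (abs_nonneg y)).trans ?_
    refine mul_le_mul_of_nonneg_right (mul_le_mul_of_nonneg_right ?_ hy1) (Real.exp_pos _).le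
    linarith
  · rw [abs_oddExt (varD₁_zero _ _ (hk0 ω hω))]
    refine (abs_varD₁_le (hun ω hω) (abs_nonneg y)).trans ?_
    refine mul_le_mul_of_nonneg_right (mul_le_mul_of_nonneg_right ?_ hy1) (Real.exp_pos _).le
    linarith

/-! ### Uniform bounds of derivatives -/

/-- Each `F ω`, for `ω ∈ Ω`, is of class `C^n`, and, if `p` holds, then its derivatives of order at
most `n` are bounded by a multiple of the weight `M`, uniformly in `ω`. The regularity does not depend
on `p`: it only needs that `g` is of class `C^N`, while the bounds also need the control `p` of the
derivatives of `g` by `ε_ω`. -/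
def UnifBdd (Ω : Set ℝ) (p : Prop) (n : ℕ) (F M : ℝ → ℝ → ℝ) : Prop :=
  (∀ ω ∈ Ω, ContDiff ℝ n (F ω)) ∧
    (p → ∃ C > 0, ∀ ω ∈ Ω, ∀ k ≤ n, ∀ y, |iteratedDeriv k (F ω) y| ≤ C * M ω y)

namespace UnifBdd

variable {Ω : Set ℝ} {p : Prop} {n m : ℕ} {F F' G M M' : ℝ → ℝ → ℝ}

theorem of_le (h : UnifBdd Ω p n F M) (hm : m ≤ n) : UnifBdd Ω p m F M := by
  refine ⟨fun ω hω => (h.1 ω hω).of_le (by exact_mod_cast hm), fun hp => ?_⟩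
  obtain ⟨C, hC, h2⟩ := h.2 hp
  exact ⟨C, hC, fun ω hω k hk => h2 ω hω k (hk.trans hm)⟩

theorem weaken (h : UnifBdd Ω p n F M) (c : ℝ) (hc : 0 < c)
    (hM : ∀ ω ∈ Ω, ∀ y, M ω y ≤ c * M' ω y) : UnifBdd Ω p n F M' := by
  refine ⟨h.1, fun hp => ?_⟩
  obtain ⟨C, hC, h2⟩ := h.2 hp
  refine ⟨C * c, by positivity, fun ω hω k hk y => (h2 ω hω k hk y).trans ?_⟩
  rw [mul_assoc]
  exact mul_le_mul_of_nonneg_left (hM ω hω y) hC.le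

theorem weaken_one (h : UnifBdd Ω p n F M) (hM : ∀ ω ∈ Ω, ∀ y, M ω y ≤ M' ω y) :
    UnifBdd Ω p n F M' :=
  h.weaken 1 one_pos fun ω hω y => by rw [one_mul]; exact hM ω hω y

theorem congr (h : UnifBdd Ω p n F M) (hF : ∀ ω ∈ Ω, ∀ y, F' ω y = F ω y) :
    UnifBdd Ω p n F' M := by
  have e : ∀ ω ∈ Ω, F' ω = F ω := fun ω hω => funext (hF ω hω)
  refine ⟨fun ω hω => by rw [e ω hω]; exact h.1 ω hω, fun hp => ?_⟩
  obtain ⟨C, hC, h2⟩ := h.2 hp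
  exact ⟨C, hC, fun ω hω => by rw [e ω hω]; exact h2 ω hω⟩

theorem zero_of (hF : ∀ ω ∈ Ω, Continuous (F ω))
    (h : p → ∃ C > 0, ∀ ω ∈ Ω, ∀ y, |F ω y| ≤ C * M ω y) : UnifBdd Ω p 0 F M := by
  refine ⟨fun ω hω => contDiff_zero.2 (hF ω hω), fun hp => ?_⟩
  obtain ⟨C, hC, h2⟩ := h hp
  refine ⟨C, hC, fun ω hω k hk y => ?_⟩
  rw [Nat.le_zero.1 hk, iteratedDeriv_zero]
  exact h2 ω hω y

theorem le (h : UnifBdd Ω p n F M) (hp : p) : ∃ C > 0, ∀ ω ∈ Ω, ∀ y, |F ω y| ≤ C * M ω y := by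
  obtain ⟨C, hC, h2⟩ := h.2 hp
  refine ⟨C, hC, fun ω hω y => ?_⟩
  have := h2 ω hω 0 (Nat.zero_le _) y
  rwa [iteratedDeriv_zero] at this

theorem of_deriv (hd : ∀ ω ∈ Ω, ∀ y, HasDerivAt (F ω) (F' ω y) y)
    (h0 : p → ∃ C > 0, ∀ ω ∈ Ω, ∀ y, |F ω y| ≤ C * M ω y) (h : UnifBdd Ω p n F' M) :
    UnifBdd Ω p (n + 1) F M := by
  refine ⟨fun ω hω => contDiff_succ_of_hasDerivAt (hd ω hω) (h.1 ω hω), fun hp => ?_⟩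
  obtain ⟨C, hC, h1⟩ := h0 hp
  obtain ⟨C', hC', h2⟩ := h.2 hp
  refine ⟨max C C', lt_max_of_lt_left hC, fun ω hω k hk y => ?_⟩
  have hM : 0 ≤ M ω y := by
    by_contra! hM
    have := (abs_nonneg _).trans (h1 ω hω y)
    nlinarith
  cases k with
  | zero =>
    rw [iteratedDeriv_zero]
    exact (h1 ω hω y).trans (mul_le_mul_of_nonneg_right (le_max_left _ _) hM)
  | succ k =>
    rw [iteratedDeriv_succ_eq_of_hasDerivAt (hd ω hω)]
    exact (h2 ω hω k (by omega) y).trans (mul_le_mul_of_nonneg_right (le_max_right _ _) hM)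

theorem deriv (h : UnifBdd Ω p (n + 1) F M) (hd : ∀ ω ∈ Ω, ∀ y, HasDerivAt (F ω) (F' ω y) y) :
    UnifBdd Ω p n F' M := by
  refine ⟨fun ω hω => ?_, fun hp => ?_⟩
  · have h1 : ContDiff ℝ ((n : WithTop ℕ∞) + 1) (F ω) := by exact_mod_cast h.1 ω hω
    have := (contDiff_succ_iff_deriv.1 h1).2.2
    rwa [funext fun y => (hd ω hω y).deriv] at this
  · obtain ⟨C, hC, h2⟩ := h.2 hp
    refine ⟨C, hC, fun ω hω k hk y => ?_⟩
    rw [← iteratedDeriv_succ_eq_of_hasDerivAt (hd ω hω)]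
    exact h2 ω hω (k + 1) (by omega) y

theorem add (hF : UnifBdd Ω p n F M) (hG : UnifBdd Ω p n G M) :
    UnifBdd Ω p n (fun ω y => F ω y + G ω y) M := by
  refine ⟨fun ω hω => (hF.1 ω hω).add (hG.1 ω hω), fun hp => ?_⟩
  obtain ⟨C, hC, h1⟩ := hF.2 hp
  obtain ⟨C', hC', h2⟩ := hG.2 hp
  refine ⟨C + C', by positivity, fun ω hω k hk y => ?_⟩
  have hk' : (k : WithTop ℕ∞) ≤ n := by exact_mod_cast hk
  rw [iteratedDeriv_fun_add ((hF.1 ω hω).of_le hk').contDiffAt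
    ((hG.1 ω hω).of_le hk').contDiffAt, add_mul]
  exact (abs_add_le _ _).trans (add_le_add (h1 ω hω k hk y) (h2 ω hω k hk y))

theorem neg (hF : UnifBdd Ω p n F M) : UnifBdd Ω p n (fun ω y => -F ω y) M := by
  refine ⟨fun ω hω => (hF.1 ω hω).neg, fun hp => ?_⟩
  obtain ⟨C, hC, h1⟩ := hF.2 hp
  refine ⟨C, hC, fun ω hω k hk y => ?_⟩
  rw [iteratedDeriv_fun_neg, abs_neg]
  exact h1 ω hω k hk y

theorem sub (hF : UnifBdd Ω p n F M) (hG : UnifBdd Ω p n G M) :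
    UnifBdd Ω p n (fun ω y => F ω y - G ω y) M :=
  (hF.add hG.neg).congr fun _ _ _ => sub_eq_add_neg _ _

theorem hasDerivAt (h : UnifBdd Ω p (n + 1) F M) : ∀ ω ∈ Ω, ∀ y,
    HasDerivAt (F ω) (_root_.deriv (F ω) y) y := fun ω hω y =>
  (((h.1 ω hω).differentiable (by simp)) y).hasDerivAt

theorem mul (hF : UnifBdd Ω p n F M) (hG : UnifBdd Ω p n G M') :
    UnifBdd Ω p n (fun ω y => F ω y * G ω y) (fun ω y => M ω y * M' ω y) := by
  have hb : p → ∃ C > 0, ∀ ω ∈ Ω, ∀ y, |F ω y * G ω y| ≤ C * (M ω y * M' ω y) := by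
    intro hp
    obtain ⟨C, hC, h1⟩ := hF.le hp
    obtain ⟨C', hC', h2⟩ := hG.le hp
    refine ⟨C * C', by positivity, fun ω hω y => ?_⟩
    refine (abs_mul_le_of_le (h1 ω hω y) (h2 ω hω y)).trans (le_of_eq ?_)
    ring
  induction n generalizing F G with
  | zero => exact zero_of (fun ω hω => (hF.1 ω hω).continuous.mul (hG.1 ω hω).continuous) hb
  | succ n ih =>
    have dF := hF.hasDerivAt
    have dG := hG.hasDerivAt
    have hF' := hF.deriv dF
    have hG' := hG.deriv dG
    have hF0 := hF.of_le (Nat.le_succ n)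
    have hG0 := hG.of_le (Nat.le_succ n)
    have aux : ∀ {F G : ℝ → ℝ → ℝ}, UnifBdd Ω p n F M → UnifBdd Ω p n G M' →
        UnifBdd Ω p n (fun ω y => F ω y * G ω y) (fun ω y => M ω y * M' ω y) := by
      intro F G hF hG
      refine ih hF hG fun hp => ?_
      obtain ⟨C, hC, h1⟩ := hF.le hp
      obtain ⟨C', hC', h2⟩ := hG.le hp
      refine ⟨C * C', by positivity, fun ω hω y => ?_⟩
      refine (abs_mul_le_of_le (h1 ω hω y) (h2 ω hω y)).trans (le_of_eq ?_)
      ring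
    exact of_deriv (fun ω hω y => (dF ω hω y).mul (dG ω hω y)) hb
      ((aux hF' hG0).add (aux hF0 hG'))

theorem const {a : ℝ → ℝ} {b : ℝ → ℝ} (h : p → ∃ C > 0, ∀ ω ∈ Ω, |a ω| ≤ C * b ω) :
    UnifBdd Ω p n (fun ω _ => a ω) (fun ω _ => b ω) := by
  refine ⟨fun ω _ => contDiff_const, fun hp => ?_⟩
  obtain ⟨C, hC, h1⟩ := h hp
  refine ⟨C, hC, fun ω hω k _ y => ?_⟩
  rw [iteratedDeriv_const]
  split_ifs
  · exact h1 ω hω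
  · rw [abs_zero]
    exact (abs_nonneg _).trans (h1 ω hω)

theorem const_mul (hF : UnifBdd Ω p n F M) (c : ℝ) : UnifBdd Ω p n (fun ω y => c * F ω y) M := by
  have h1 : UnifBdd Ω p n (fun _ _ => c) (fun _ _ => (1 : ℝ)) :=
    const fun _ => ⟨|c| + 1, by positivity, fun _ _ => by linarith⟩
  exact (h1.mul hF).weaken_one fun _ _ _ => (one_mul _).le

theorem const_one (c : ℝ) : UnifBdd Ω p n (fun _ _ => c) (fun _ _ => (1 : ℝ)) :=
  const fun _ => ⟨|c| + 1, by positivity, fun _ _ => by linarith⟩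

theorem mul_bdd (hF : UnifBdd Ω p n F M) (hG : UnifBdd Ω p n G fun _ _ => 1) :
    UnifBdd Ω p n (fun ω y => F ω y * G ω y) M :=
  (hF.mul hG).weaken_one fun _ _ _ => (mul_one _).le

theorem bdd_mul (hF : UnifBdd Ω p n F fun _ _ => 1) (hG : UnifBdd Ω p n G M) :
    UnifBdd Ω p n (fun ω y => F ω y * G ω y) M :=
  (hF.mul hG).weaken_one fun _ _ _ => (one_mul _).le

end UnifBdd

/-! ### The soliton and the potentials -/

/-- The weight `e^{-15|y|/8}`, which bounds `Q²`. -/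
def wt (y : ℝ) : ℝ := Real.exp (-(15 / 8) * |y|)

theorem wt_pos (y : ℝ) : 0 < wt y := Real.exp_pos _

theorem wt_le_one (y : ℝ) : wt y ≤ 1 := Real.exp_le_one_iff.2 (by nlinarith [abs_nonneg y])

namespace SmallFreq

variable {g : ℝ → ℝ} {ω₀ : ℝ} {N n : ℕ}

theorem eps_le_one (H : SmallFreq g ω₀) {ω : ℝ} (hω : ω ∈ Ioo 0 ω₀) : eps g ω ≤ 1 :=
  (H.eps_le' (Ioo_subset_Ioc_self hω)).trans (by norm_num)

/-- Along the soliton the functions `γ_k` are bounded by `ε_ω`, together with their derivatives. -/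
theorem unifBdd_basic (H : SmallFreq g ω₀) (hN : ContDiffOn ℝ N g (Ioi 0)) (hn : n ≤ N) :
    UnifBdd (Ioo 0 ω₀) (ControlledUpTo g N) n (hf g) (fun _ _ => 1) ∧
    UnifBdd (Ioo 0 ω₀) (ControlledUpTo g N) n (fun ω y => sf g ω y / ω) (fun _ y => wt y) ∧
    UnifBdd (Ioo 0 ω₀) (ControlledUpTo g N) n (fun ω y => gamI g (sf g ω y))
      (fun ω _ => eps g ω) ∧
    ∀ k, n + k ≤ N → UnifBdd (Ioo 0 ω₀) (ControlledUpTo g N) n (fun ω y => gam g k (sf g ω y))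
      (fun ω _ => eps g ω) := by
  have bh : ControlledUpTo g N → ∃ C > 0, ∀ ω ∈ Ioo 0 ω₀, ∀ y, |hf g ω y| ≤ C * 1 := fun _ =>
    ⟨1, one_pos, fun ω _ y => by rw [mul_one]; exact abs_hf_le g ω y⟩
  have bX : ControlledUpTo g N → ∃ C > 0, ∀ ω ∈ Ioo 0 ω₀, ∀ y, |sf g ω y / ω| ≤ C * wt y :=
    fun _ => ⟨12, by norm_num, fun ω hω y => by
      rw [abs_of_pos (div_pos (H.sf_mem hω y).1 hω.1)]
      exact H.sf_le hω y⟩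
  have bI : ControlledUpTo g N → ∃ C > 0, ∀ ω ∈ Ioo 0 ω₀, ∀ y : ℝ,
      |gamI g (sf g ω y)| ≤ C * eps g ω := fun _ => ⟨1, one_pos, fun ω hω y => by
    have := H.h1.abs_gamI_le (H.sf_mem hω y).1 (H.sf_mem hω y).2
    have := H.h1.eps_nonneg hω.1
    linarith⟩
  have bk : ∀ k ≤ N, ControlledUpTo g N → ∃ C > 0, ∀ ω ∈ Ioo 0 ω₀, ∀ y : ℝ,
      |gam g k (sf g ω y)| ≤ C * eps g ω := fun k hk hc => by
    obtain ⟨C, hC, h⟩ := H.h1.exists_abs_gam_le hc ω₀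
    exact ⟨C, hC, fun ω hω y => h k hk ω hω _ (H.sf_mem hω y)⟩
  induction n with
  | zero =>
    refine ⟨UnifBdd.zero_of (fun ω hω => ?_) bh, UnifBdd.zero_of (fun ω hω => ?_) bX,
      UnifBdd.zero_of (fun ω hω => ?_) bI, fun k hk => UnifBdd.zero_of (fun ω hω => ?_)
      (bk k (by omega))⟩
    · exact continuous_section H.continuousOn_hf hω
    · exact (continuous_section H.continuousOn_sf hω).div_const _
    · exact continuous_section (F := fun w y => gamI g (sf g w y))
        (H.continuousOn_comp_sf (continuousOn_gamI H.h1)) hω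
    · exact continuous_section (F := fun w y => gam g k (sf g w y))
        (H.continuousOn_comp_sf (continuousOn_gam (hN.of_le (by exact_mod_cast (by omega))))) hω
  | succ n ih =>
    obtain ⟨h1, h2, h3, h4⟩ := ih (by omega)
    have e : ∀ ω ∈ Ioo 0 ω₀, eps g ω ≤ 1 := fun ω hω => H.eps_le_one hω
    have h3' := h3.weaken_one (M' := fun _ _ => 1) fun ω hω _ => e ω hω
    have h4' := (h4 0 (by omega)).weaken_one (M' := fun _ _ => 1) fun ω hω _ => e ω hω
    refine ⟨UnifBdd.of_deriv (fun ω hω y => H.hasDerivAt_hf hω y) bh ?_,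
      UnifBdd.of_deriv (fun ω hω y => (H.hasDerivAt_sf hω y).div_const ω) bX ?_,
      UnifBdd.of_deriv (fun ω hω y => (H.h1.hasDerivAt_gamI (H.sf_mem hω y).1).comp y
        (H.hasDerivAt_sf hω y)) bI ?_,
      fun k hk => UnifBdd.of_deriv (fun ω hω y => (hasDerivAt_gam (hN.of_le
        (by exact_mod_cast (by omega))) (H.sf_mem hω y).1).comp y (H.hasDerivAt_sf hω y))
        (bk k (by omega)) ?_⟩
    · refine ((h2.weaken_one fun _ _ y => wt_le_one y).mul_bdd
        (((UnifBdd.const_one (1 / 2)).add h4').sub h3')).neg.congr fun ω hω y => ?_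
      rw [bigGam']
    · refine ((h1.const_mul 2).bdd_mul h2).congr fun ω hω y => ?_
      ring
    · refine ((h1.const_mul 2).bdd_mul ((h4 0 (by omega)).sub (h3.const_mul 2))).congr
        fun ω hω y => ?_
      have := (H.sf_mem hω y).1.ne'
      field_simp
    · refine ((h1.const_mul 2).bdd_mul (((h4 k (by omega)).const_mul ((k : ℝ) - 1)).add
        (h4 (k + 1) (by omega)))).congr fun ω hω y => ?_
      have := (H.sf_mem hω y).1.ne'
      field_simp

variable (H : SmallFreq g ω₀) (hN : ContDiffOn ℝ N g (Ioi 0))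

include H hN

theorem unifBdd_gam {k : ℕ} (hn : n + k ≤ N) : UnifBdd (Ioo 0 ω₀) (ControlledUpTo g N) n
    (fun ω y => gam g k (sf g ω y)) (fun ω _ => eps g ω) :=
  (H.unifBdd_basic hN (by omega)).2.2.2 k hn

theorem unifBdd_gamI (hn : n ≤ N) : UnifBdd (Ioo 0 ω₀) (ControlledUpTo g N) n
    (fun ω y => gamI g (sf g ω y)) (fun ω _ => eps g ω) :=
  (H.unifBdd_basic hN hn).2.2.1

theorem unifBdd_sf (hn : n ≤ N) : UnifBdd (Ioo 0 ω₀) (ControlledUpTo g N) n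
    (fun ω y => sf g ω y / ω) (fun _ y => wt y) :=
  (H.unifBdd_basic hN hn).2.1

theorem unifBdd_hf (hn : n ≤ N) : UnifBdd (Ioo 0 ω₀) (ControlledUpTo g N) n
    (hf g) (fun _ _ => 1) :=
  (H.unifBdd_basic hN hn).1

theorem unifBdd_pot {φ : ℝ → ℝ} (hn : n ≤ N)
    (hφ : UnifBdd (Ioo 0 ω₀) (ControlledUpTo g N) n (fun ω y => φ (sf g ω y))
      (fun ω _ => eps g ω)) :
    UnifBdd (Ioo 0 ω₀) (ControlledUpTo g N) n (pot g φ) (fun ω y => eps g ω * wt y) :=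
  ((H.unifBdd_sf hN hn).mul hφ).weaken_one fun _ _ _ => (mul_comm _ _).le

theorem unifBdd_bfun (hn : n + 1 ≤ N) : UnifBdd (Ioo 0 ω₀) (ControlledUpTo g N) n
    (fun ω y => bfun g (sf g ω y)) (fun ω _ => eps g ω) :=
  ((((H.unifBdd_gam hN (k := 0) (by omega)).const_mul 3).sub
    ((H.unifBdd_gamI hN (by omega)).const_mul 4)).sub (H.unifBdd_gam hN (k := 1) hn))

theorem unifBdd_cfun (hn : n + 1 ≤ N) : UnifBdd (Ioo 0 ω₀) (ControlledUpTo g N) n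
    (fun ω y => cfun g (sf g ω y)) (fun ω _ => eps g ω) :=
  ((((H.unifBdd_gam hN (k := 0) (by omega)).const_mul (-2)).add
    ((H.unifBdd_gamI hN (by omega)).const_mul 2)).add (H.unifBdd_gam hN (k := 1) hn))

theorem unifBdd_bth (hn : n + 2 ≤ N) : UnifBdd (Ioo 0 ω₀) (ControlledUpTo g N) n
    (fun ω y => bth g (sf g ω y)) (fun ω _ => eps g ω) :=
  (((((H.unifBdd_gam hN (k := 1) (by omega)).sub (H.unifBdd_gam hN (k := 0) (by omega))).const_mul
    3).sub (((H.unifBdd_gam hN (k := 0) (by omega)).sub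
      ((H.unifBdd_gamI hN (by omega)).const_mul 2)).const_mul 4)).sub
      (H.unifBdd_gam hN (k := 2) hn))

theorem unifBdd_cth (hn : n + 2 ≤ N) : UnifBdd (Ioo 0 ω₀) (ControlledUpTo g N) n
    (fun ω y => cth g (sf g ω y)) (fun ω _ => eps g ω) :=
  (((((H.unifBdd_gam hN (k := 1) (by omega)).sub (H.unifBdd_gam hN (k := 0) (by omega))).const_mul
    (-2)).add (((H.unifBdd_gam hN (k := 0) (by omega)).sub
      ((H.unifBdd_gamI hN (by omega)).const_mul 2)).const_mul 2)).add
      (H.unifBdd_gam hN (k := 2) hn))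

omit hN in
theorem bdd_of_eps {F : ℝ → ℝ → ℝ} {p : Prop}
    (h : UnifBdd (Ioo 0 ω₀) p n F (fun ω _ => eps g ω)) :
    UnifBdd (Ioo 0 ω₀) p n F (fun _ _ => 1) :=
  h.weaken_one fun _ hω _ => H.eps_le_one hω

theorem unifBdd_bigGam' (hn : n ≤ N) : UnifBdd (Ioo 0 ω₀) (ControlledUpTo g N) n
    (fun ω y => bigGam' g (sf g ω y)) (fun _ _ => 1) :=
  ((UnifBdd.const_one (1 / 2)).add (H.bdd_of_eps (H.unifBdd_gam hN (k := 0) hn))).sub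
    (H.bdd_of_eps (H.unifBdd_gamI hN hn))

theorem unifBdd_inv (hn : n ≤ N) : UnifBdd (Ioo 0 ω₀) (ControlledUpTo g N) n
    (fun ω y => (bigGam' g (sf g ω y))⁻¹) (fun _ _ => 1) := by
  have hb : ControlledUpTo g N → ∃ C > 0, ∀ ω ∈ Ioo 0 ω₀, ∀ y,
      |(bigGam' g (sf g ω y))⁻¹| ≤ C * 1 := fun _ => ⟨3, by norm_num, fun ω hω y => by
    have h := (H.bigGam'_bounds (H.sf_mem'' hω y)).1
    rw [abs_of_pos (inv_pos.2 (by linarith)), mul_one]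
    exact inv_le_of_inv_le₀ (by norm_num) (by linarith)⟩
  have h0 : ∀ ω ∈ Ioo 0 ω₀, ∀ y, bigGam' g (sf g ω y) ≠ 0 := fun ω hω y => by
    linarith [(H.bigGam'_bounds (H.sf_mem'' hω y)).1]
  induction n with
  | zero =>
    refine UnifBdd.zero_of (fun ω hω => ?_) hb
    exact ((H.unifBdd_bigGam' hN hn).1 ω hω).continuous.inv₀ (h0 ω hω)
  | succ n ih =>
    have h := H.unifBdd_bigGam' hN hn
    have hd := h.hasDerivAt
    have h' := h.deriv hd
    have hi := ih (by omega)
    exact UnifBdd.of_deriv (fun ω hω y => (hd ω hω y).inv (h0 ω hω y)) hb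
      (((h'.mul_bdd (hi.mul_bdd hi)).neg).congr fun ω hω y => by
        have := h0 ω hω y
        field_simp)

theorem unifBdd_mfun (hn : n ≤ N) : UnifBdd (Ioo 0 ω₀) (ControlledUpTo g N) n
    (fun ω y => mfun g (sf g ω y)) (fun _ _ => 1) :=
  (((UnifBdd.const_one (1 / 2)).add (H.bdd_of_eps (H.unifBdd_gamI hN hn))).mul_bdd
    (H.unifBdd_inv hN hn)).congr fun _ _ _ => div_eq_mul_inv _ _

theorem unifBdd_mth (hn : n + 1 ≤ N) : UnifBdd (Ioo 0 ω₀) (ControlledUpTo g N) n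
    (fun ω y => mth g (sf g ω y)) (fun _ _ => 1) := by
  have h0 := H.bdd_of_eps (H.unifBdd_gam hN (k := 0) (n := n) (by omega))
  have h1 := H.bdd_of_eps (H.unifBdd_gam hN (k := 1) hn)
  have hI := H.bdd_of_eps (H.unifBdd_gamI hN (n := n) (by omega))
  have hB := H.unifBdd_bigGam' hN (n := n) (by omega)
  have hi := H.unifBdd_inv hN (n := n) (by omega)
  refine (((((h0.sub (hI.const_mul 2)).mul_bdd hB).sub
    (((UnifBdd.const_one (1 / 2)).add hI).mul_bdd
      ((h1.sub (h0.const_mul 2)).add (hI.const_mul 2)))).mul_bdd (hi.mul_bdd hi))).congr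
    fun ω hω y => ?_
  rw [mth, div_eq_mul_inv, sq, mul_inv]

theorem unifBdd_jf (hn : n ≤ N) : UnifBdd (Ioo 0 ω₀) (ControlledUpTo g N) n
    (jf g) (fun _ y => 1 + |y|) := by
  have hb : ControlledUpTo g N → ∃ C > 0, ∀ ω ∈ Ioo 0 ω₀, ∀ y, |jf g ω y| ≤ C * (1 + |y|) :=
    fun _ => ⟨18, by norm_num, fun ω hω y => (H.abs_jf_le hω y).trans (by
      have := H.eps_le_one hω
      have := mul_le_mul_of_nonneg_right this (abs_nonneg y)
      linarith)⟩
  cases n with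
  | zero => exact UnifBdd.zero_of (fun ω hω => continuous_section H.continuousOn_jf hω) hb
  | succ n =>
    exact UnifBdd.of_deriv (fun ω hω y => H.hasDerivAt_jf hω y) hb
      ((H.unifBdd_mth hN hn).weaken_one fun _ _ y => by linarith [abs_nonneg y])

theorem unifBdd_lf (hn : n ≤ N) : UnifBdd (Ioo 0 ω₀) (ControlledUpTo g N) n
    (lf g) (fun _ y => 1 + |y|) :=
  ((H.unifBdd_mfun hN hn).weaken_one fun _ _ y => by linarith [abs_nonneg y]).sub
    (((H.unifBdd_hf hN hn).const_mul 2).bdd_mul (H.unifBdd_jf hN hn))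

theorem unifBdd_potD {φ φθ : ℝ → ℝ} (hn : n ≤ N)
    (hφ : UnifBdd (Ioo 0 ω₀) (ControlledUpTo g N) n (fun ω y => φ (sf g ω y))
      (fun ω _ => eps g ω))
    (hφθ : UnifBdd (Ioo 0 ω₀) (ControlledUpTo g N) n (fun ω y => φθ (sf g ω y))
      (fun ω _ => eps g ω)) :
    UnifBdd (Ioo 0 ω₀) (ControlledUpTo g N) n (fun ω y => potD g φ φθ ω y / ω)
      (fun ω y => eps g ω / ω * (1 + |y|) * wt y) := by
  have hw : UnifBdd (Ioo 0 ω₀) (ControlledUpTo g N) n (fun ω _ => ω⁻¹) (fun ω _ => ω⁻¹) :=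
    UnifBdd.const fun _ => ⟨1, one_pos, fun ω hω => by
      rw [abs_of_pos (inv_pos.2 hω.1), one_mul]⟩
  have hl := H.unifBdd_lf hN hn
  have hl1 := hl.sub ((UnifBdd.const_one 1).weaken_one fun _ _ y => by linarith [abs_nonneg y])
  refine ((((H.unifBdd_sf hN hn).mul ((hl1.mul hφ).add (hl.mul hφθ))).mul hw).weaken_one
    fun ω hω y => ?_).congr fun ω hω y => ?_
  · apply le_of_eq; rw [div_eq_mul_inv]; ring
  · rw [potD, div_eq_mul_inv]

end SmallFreq

/-! ### Derivatives of the eigenfunctions -/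

theorem exists_const_forall {q : ℕ → ℝ → Prop} (hq : ∀ k a b, a ≤ b → q k a → q k b) {n : ℕ}
    (h : ∀ k ≤ n, ∃ C > 0, q k C) : ∃ C > 0, ∀ k ≤ n, q k C := by
  induction n with
  | zero =>
    obtain ⟨C, hC, h0⟩ := h 0 le_rfl
    exact ⟨C, hC, fun k hk => by rwa [Nat.le_zero.1 hk]⟩
  | succ n ih =>
    obtain ⟨C, hC, h1⟩ := ih fun k hk => h k (by omega)
    obtain ⟨C', hC', h2⟩ := h (n + 1) le_rfl
    refine ⟨max C C', lt_max_of_lt_left hC, fun k hk => ?_⟩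
    rcases Nat.le_succ_iff.1 hk with hk | rfl
    · exact hq _ _ _ (le_max_left _ _) (h1 k hk)
    · exact hq _ _ _ (le_max_right _ _) h2

namespace EigenBranch

variable {g : ℝ → ℝ} (B : EigenBranch g) {ω : ℝ} {N n : ℕ}

/-- The weight `e^{-α|y|}`. -/
def slow (ω y : ℝ) : ℝ := Real.exp (-B.α ω * |y|)

/-- The weight `e^{-κ|y|}`. -/
def fast (ω y : ℝ) : ℝ := Real.exp (-kappa (B.α ω) * |y|)

/-- Uniform bounds for the frequencies of the branch, under the hypothesis of order `N` on `g`. -/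
abbrev UB (N n : ℕ) (F M : ℝ → ℝ → ℝ) : Prop :=
  UnifBdd (Ioo 0 B.ω₁) (ControlledUpTo g N) n F M

theorem slow_pos (ω y : ℝ) : 0 < B.slow ω y := Real.exp_pos _

theorem fast_pos (ω y : ℝ) : 0 < B.fast ω y := Real.exp_pos _

section

variable (hω : ω ∈ Ioo 0 B.ω₁)

include hω

theorem eps_pos : 0 < eps g ω := B.H.h1.eps_pos hω.1

theorem eps_le_one : eps g ω ≤ 1 := B.H.eps_le_one hω

theorem intI_pos : 0 < intI g ω := (pow_pos (B.eps_pos hω) 2).trans_le (B.sq_eps_le ω hω)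

theorem alpha_pos : 0 < B.α ω := by
  have := B.le_alpha ω hω
  have := B.intI_pos hω
  linarith

theorem alpha_le_intI : B.α ω ≤ 2 * B.K * intI g ω := by
  have h1 := (abs_le.1 (B.alpha_sub ω hω)).2
  have h2 := B.sq_eps_le ω hω
  have h3 := B.intI_pos hω
  nlinarith [B.one_le]

theorem alpha_le_eps : B.α ω ≤ 2 * B.K * eps g ω := by
  have h1 := (abs_le.1 (B.alpha_sub ω hω)).2
  have h2 := B.eps_le_one hω
  have h3 := B.intI_le ω hω
  have h4 := B.eps_pos hω
  have h5 : eps g ω ^ 2 ≤ eps g ω := by nlinarith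
  have h6 : B.K * eps g ω ^ 2 ≤ B.K * eps g ω :=
    mul_le_mul_of_nonneg_left h5 (by linarith [B.one_le])
  have h7 : 0 < B.K * eps g ω := mul_pos (by linarith [B.one_le]) h4
  linarith

theorem kappa_mem' : kappa (B.α ω) ∈ Icc (11 / 8) (3 / 2) := by
  have h := kappa_mem (a := B.α ω) (by
    rw [abs_of_pos (B.alpha_pos hω)]; exact B.alpha_le ω hω)
  exact ⟨h.1, h.2.trans (by linarith [sqrt_two_lt])⟩

theorem fast_le_slow (y : ℝ) : B.fast ω y ≤ B.slow ω y := by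
  have h1 := (B.kappa_mem' hω).1
  have h2 := B.alpha_le ω hω
  exact Real.exp_le_exp.2 (by nlinarith [abs_nonneg y])

theorem slow_le_one (y : ℝ) : B.slow ω y ≤ 1 :=
  Real.exp_le_one_iff.2 (by nlinarith [abs_nonneg y, B.alpha_pos hω])

theorem wt_le_fast (y : ℝ) : wt y ≤ B.fast ω y := by
  have h1 := (B.kappa_mem' hω).2
  exact Real.exp_le_exp.2 (by nlinarith [abs_nonneg y])

theorem fast_le_exp (y : ℝ) : B.fast ω y ≤ Real.exp (-|y|) := by
  have h1 := (B.kappa_mem' hω).1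
  exact Real.exp_le_exp.2 (by nlinarith [abs_nonneg y])

theorem P_le (y : ℝ) : |B.P ω y| ≤ 2 * B.K * B.slow ω y := by
  have h1 := abs_le.1 (B.P_sub ω hω y)
  have h2 : B.K * eps g ω * B.slow ω y ≤ B.K * 1 * B.slow ω y :=
    mul_le_mul_of_nonneg_right (mul_le_mul_of_nonneg_left (B.eps_le_one hω)
      (by linarith [B.one_le])) (B.slow_pos ω y).le
  have h3 := mul_le_mul_of_nonneg_right B.one_le (B.slow_pos ω y).le
  have h4 := B.slow_pos ω y
  rw [slow] at *
  rw [abs_le]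
  constructor <;> linarith [h1.1, h1.2]

theorem P₁_le (y : ℝ) : |B.P₁ ω y| ≤ 4 * B.K * eps g ω * B.slow ω y := by
  rw [B.P₁_odd ω hω]
  have h1 := abs_le.1 (B.P₁_add ω hω |y| (abs_nonneg y))
  have hK := B.one_le
  have he := B.eps_pos hω
  have h2 : B.K * eps g ω ^ 2 * B.slow ω y ≤ B.K * eps g ω * B.slow ω y := by
    refine mul_le_mul_of_nonneg_right (mul_le_mul_of_nonneg_left ?_ (by linarith))
      (B.slow_pos ω y).le
    nlinarith [B.eps_le_one hω]
  have h3 : B.K * eps g ω * B.fast ω y ≤ B.K * eps g ω * B.slow ω y :=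
    mul_le_mul_of_nonneg_left (B.fast_le_slow hω y) (by positivity)
  have h4 := mul_le_mul_of_nonneg_right (B.alpha_le_eps hω) (B.slow_pos ω y).le
  have h5 := mul_pos (B.alpha_pos hω) (B.slow_pos ω y)
  have h6 : 0 ≤ B.K * eps g ω * B.slow ω y :=
    mul_nonneg (mul_nonneg (by linarith) he.le) (B.slow_pos ω y).le
  rw [slow, fast] at *
  rw [abs_le]
  constructor <;> linarith [h1.1, h1.2]

end

section

variable (hN : ContDiffOn ℝ N g (Ioi 0))

include hN

theorem unifBdd_b (hn : n + 1 ≤ N) : B.UB N n (pot g (bfun g)) (fun ω y => eps g ω * wt y) :=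
  B.H.unifBdd_pot hN (by omega) (B.H.unifBdd_bfun hN hn)

theorem unifBdd_c (hn : n + 1 ≤ N) : B.UB N n (pot g (cfun g)) (fun ω y => eps g ω * wt y) :=
  B.H.unifBdd_pot hN (by omega) (B.H.unifBdd_cfun hN hn)

theorem unifBdd_bd (hn : n + 2 ≤ N) : B.UB N n (fun ω y => potD g (bfun g) (bth g) ω y / ω)
    (fun ω y => eps g ω / ω * (1 + |y|) * wt y) :=
  B.H.unifBdd_potD hN (by omega) (B.H.unifBdd_bfun hN (by omega)) (B.H.unifBdd_bth hN hn)

theorem unifBdd_cd (hn : n + 2 ≤ N) : B.UB N n (fun ω y => potD g (cfun g) (cth g) ω y / ω)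
    (fun ω y => eps g ω / ω * (1 + |y|) * wt y) :=
  B.H.unifBdd_potD hN (by omega) (B.H.unifBdd_cfun hN (by omega)) (B.H.unifBdd_cth hN hn)

omit hN in
theorem unifBdd_alpha : B.UB N n (fun ω _ => B.α ω) (fun ω _ => eps g ω) :=
  UnifBdd.const fun _ => ⟨2 * B.K, by linarith [B.one_le], fun ω hω => by
    rw [abs_of_pos (B.alpha_pos hω)]; exact B.alpha_le_eps hω⟩

omit hN in
theorem unifBdd_alphad : B.UB N n (fun ω _ => B.αd ω) (fun ω _ => eps g ω / ω) :=
  UnifBdd.const fun _ => ⟨B.K, by linarith [B.one_le], B.alphad_le⟩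

/-- The second derivatives of `P` and `D` are expressed by the functions themselves; therefore the
bounds propagate from one order to the next. -/
theorem unifBdd_PD (hn : n ≤ N) : B.UB N n B.P B.slow ∧ B.UB N n B.P₁ B.slow ∧
    B.UB N n B.D (fun ω y => eps g ω * B.fast ω y) ∧
    B.UB N n B.D₁ (fun ω y => eps g ω * B.fast ω y) := by
  have hK := B.one_le
  have bP : ControlledUpTo g N → ∃ C > 0, ∀ ω ∈ Ioo 0 B.ω₁, ∀ y, |B.P ω y| ≤ C * B.slow ω y :=
    fun _ => ⟨2 * B.K, by linarith, fun ω hω => B.P_le hω⟩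
  have bP₁ : ControlledUpTo g N → ∃ C > 0, ∀ ω ∈ Ioo 0 B.ω₁, ∀ y, |B.P₁ ω y| ≤ C * B.slow ω y :=
    fun _ => ⟨4 * B.K, by linarith, fun ω hω y => (B.P₁_le hω y).trans (by
      have := mul_le_mul_of_nonneg_left (B.eps_le_one hω) (show 0 ≤ 4 * B.K by linarith)
      exact mul_le_mul_of_nonneg_right (by linarith) (B.slow_pos ω y).le)⟩
  have bD : ControlledUpTo g N → ∃ C > 0, ∀ ω ∈ Ioo 0 B.ω₁, ∀ y,
      |B.D ω y| ≤ C * (eps g ω * B.fast ω y) :=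
    fun _ => ⟨B.K, by linarith, fun ω hω y => (B.D_le ω hω y).trans (mul_assoc _ _ _).le⟩
  have bD₁ : ControlledUpTo g N → ∃ C > 0, ∀ ω ∈ Ioo 0 B.ω₁, ∀ y,
      |B.D₁ ω y| ≤ C * (eps g ω * B.fast ω y) :=
    fun _ => ⟨B.K, by linarith, fun ω hω y => (B.D₁_le ω hω y).trans (mul_assoc _ _ _).le⟩
  induction n with
  | zero =>
    exact ⟨UnifBdd.zero_of (fun ω hω => continuous_iff_continuousAt.2 fun y =>
      (B.hasDerivAt_P ω hω y).continuousAt) bP, UnifBdd.zero_of (fun ω hω =>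
      continuous_iff_continuousAt.2 fun y => (B.hasDerivAt_P₁ ω hω y).continuousAt) bP₁,
      UnifBdd.zero_of (fun ω hω => continuous_iff_continuousAt.2 fun y =>
      (B.hasDerivAt_D ω hω y).continuousAt) bD, UnifBdd.zero_of (fun ω hω =>
      continuous_iff_continuousAt.2 fun y => (B.hasDerivAt_D₁ ω hω y).continuousAt) bD₁⟩
  | succ n ih =>
    obtain ⟨h1, h2, h3, h4⟩ := ih (by omega)
    have hb := B.unifBdd_b hN hn
    have hc := B.unifBdd_c hN hn
    have hw : ∀ ω ∈ Ioo 0 B.ω₁, ∀ y, eps g ω * wt y ≤ 1 := fun ω hω y =>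
      mul_le_one₀ (B.eps_le_one hω) (wt_pos y).le (wt_le_one y)
    have hb1 := hb.weaken_one (M' := fun _ _ => 1) hw
    have hc1 := hc.weaken_one (M' := fun _ _ => 1) hw
    have ha := B.H.bdd_of_eps (B.unifBdd_alpha (N := N) (n := n))
    have ha2 := (ha.mul_bdd ha).congr (F' := fun ω _ => B.α ω ^ 2) fun ω _ _ => sq _
    have h3s := h3.weaken_one (M' := B.slow) fun ω hω y =>
      (mul_le_of_le_one_left (B.fast_pos ω y).le (B.eps_le_one hω)).trans (B.fast_le_slow hω y)
    refine ⟨UnifBdd.of_deriv B.hasDerivAt_P bP h2, UnifBdd.of_deriv B.hasDerivAt_P₁ bP₁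
      (((ha2.add hb1).bdd_mul h1).add (hc1.bdd_mul h3s)), UnifBdd.of_deriv B.hasDerivAt_D bD h4,
      UnifBdd.of_deriv B.hasDerivAt_D₁ bD₁
      (((((UnifBdd.const_one 2).sub ha2).add hb1).bdd_mul h3).add ((hc.mul h1).weaken_one
        fun ω hω y => ?_))⟩
    rw [mul_assoc]
    refine mul_le_mul_of_nonneg_left ?_ (B.eps_pos hω).le
    exact (mul_le_of_le_one_right (wt_pos y).le (B.slow_le_one hω y)).trans (B.wt_le_fast hω y)

theorem unifBdd_P : B.UB N (N + 1) B.P B.slow := by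
  obtain ⟨h1, h2, -, -⟩ := B.unifBdd_PD hN le_rfl
  exact UnifBdd.of_deriv B.hasDerivAt_P h1.le h2

theorem unifBdd_D : B.UB N (N + 1) B.D (fun ω y => eps g ω * B.fast ω y) := by
  obtain ⟨-, -, h1, h2⟩ := B.unifBdd_PD hN le_rfl
  exact UnifBdd.of_deriv B.hasDerivAt_D h1.le h2

/-- In the equations for `P` and for its `ω`-derivative, all the terms except those with a
constant coefficient decay fast. -/
theorem unifBdd_forcing (hn : n + 1 ≤ N) :
    B.UB N n (fun ω y => pot g (bfun g) ω y * B.P ω y + pot g (cfun g) ω y * B.D ω y)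
      (fun ω y => eps g ω * B.fast ω y) := by
  obtain ⟨h1, -, h2, -⟩ := B.unifBdd_PD hN (n := n) (by omega)
  refine (((B.unifBdd_b hN hn).mul h1).weaken_one fun ω hω y => ?_).add
    (((B.unifBdd_c hN hn).mul h2).weaken_one fun ω hω y => ?_)
  · rw [mul_assoc]
    refine mul_le_mul_of_nonneg_left ?_ (B.eps_pos hω).le
    exact (mul_le_of_le_one_right (wt_pos y).le (B.slow_le_one hω y)).trans (B.wt_le_fast hω y)
  · have hf := mul_pos (B.eps_pos hω) (B.fast_pos ω y)
    exact mul_le_of_le_one_left hf.le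
      (mul_le_one₀ (B.eps_le_one hω) (wt_pos y).le (wt_le_one y))

/-- The same propagation of bounds for the derivatives in `ω`. -/
theorem unifBdd_PdDd (hn : n + 1 ≤ N) :
    B.UB N n B.Pd (fun ω y => eps g ω / ω * (1 + |y|) * B.slow ω y) ∧
    B.UB N n B.P₁d (fun ω y => eps g ω / ω * (1 + |y|) * B.slow ω y) ∧
    B.UB N n B.Dd (fun ω y => eps g ω / ω * (1 + |y|) * B.fast ω y) ∧
    B.UB N n B.D₁d (fun ω y => eps g ω / ω * (1 + |y|) * B.fast ω y) := by
  have hK : 0 < B.K := by linarith [B.one_le]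
  have bP : ControlledUpTo g N → ∃ C > 0, ∀ ω ∈ Ioo 0 B.ω₁, ∀ y,
      |B.Pd ω y| ≤ C * (eps g ω / ω * (1 + |y|) * B.slow ω y) :=
    fun _ => ⟨B.K, hK, fun ω hω y => (B.Pd_le ω hω y).trans (by rw [slow]; apply le_of_eq; ring)⟩
  have bP₁ : ControlledUpTo g N → ∃ C > 0, ∀ ω ∈ Ioo 0 B.ω₁, ∀ y,
      |B.P₁d ω y| ≤ C * (eps g ω / ω * (1 + |y|) * B.slow ω y) :=
    fun _ => ⟨B.K, hK, fun ω hω y => (B.P₁d_le ω hω y).trans (by rw [slow]; apply le_of_eq; ring)⟩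
  have bD : ControlledUpTo g N → ∃ C > 0, ∀ ω ∈ Ioo 0 B.ω₁, ∀ y,
      |B.Dd ω y| ≤ C * (eps g ω / ω * (1 + |y|) * B.fast ω y) :=
    fun _ => ⟨B.K, hK, fun ω hω y => (B.Dd_le ω hω y).trans (by rw [fast]; apply le_of_eq; ring)⟩
  have bD₁ : ControlledUpTo g N → ∃ C > 0, ∀ ω ∈ Ioo 0 B.ω₁, ∀ y,
      |B.D₁d ω y| ≤ C * (eps g ω / ω * (1 + |y|) * B.fast ω y) :=
    fun _ => ⟨B.K, hK, fun ω hω y => (B.D₁d_le ω hω y).trans (by rw [fast]; apply le_of_eq; ring)⟩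
  induction n with
  | zero =>
    exact ⟨UnifBdd.zero_of (fun ω hω => continuous_iff_continuousAt.2 fun y =>
      (B.hasDerivAt_Pd ω hω y).continuousAt) bP, UnifBdd.zero_of (fun ω hω =>
      continuous_iff_continuousAt.2 fun y => (B.hasDerivAt_P₁d ω hω y).continuousAt) bP₁,
      UnifBdd.zero_of (fun ω hω => continuous_iff_continuousAt.2 fun y =>
      (B.hasDerivAt_Dd ω hω y).continuousAt) bD, UnifBdd.zero_of (fun ω hω =>
      continuous_iff_continuousAt.2 fun y => (B.hasDerivAt_D₁d ω hω y).continuousAt) bD₁⟩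
  | succ n ih =>
    obtain ⟨h1, h2, h3, h4⟩ := ih (by omega)
    obtain ⟨k1, -, k3, -⟩ := B.unifBdd_PD hN (n := n) (by omega)
    have hb := B.unifBdd_b hN (n := n) (by omega)
    have hc := B.unifBdd_c hN (n := n) (by omega)
    have hbd := B.unifBdd_bd hN (n := n) (by omega)
    have hcd := B.unifBdd_cd hN (n := n) (by omega)
    have hw : ∀ ω ∈ Ioo 0 B.ω₁, ∀ y, eps g ω * wt y ≤ 1 := fun ω hω y =>
      mul_le_one₀ (B.eps_le_one hω) (wt_pos y).le (wt_le_one y)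
    have hb1 := hb.weaken_one (M' := fun _ _ => 1) hw
    have hc1 := hc.weaken_one (M' := fun _ _ => 1) hw
    have ha := B.H.bdd_of_eps (B.unifBdd_alpha (N := N) (n := n))
    have ha2 := (ha.mul_bdd ha).congr (F' := fun ω _ => B.α ω ^ 2) fun ω _ _ => sq _
    have haad := (ha.const_mul 2).bdd_mul (B.unifBdd_alphad (N := N) (n := n))
    have he : ∀ ω ∈ Ioo 0 B.ω₁, 0 ≤ eps g ω / ω := fun ω hω =>
      div_nonneg (B.eps_pos hω).le hω.1.le
    have hy : ∀ y : ℝ, 1 ≤ 1 + |y| := fun y => by linarith [abs_nonneg y]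
    have hwS : ∀ ω ∈ Ioo 0 B.ω₁, ∀ y,
        eps g ω / ω * (1 + |y|) * wt y ≤ eps g ω / ω * (1 + |y|) := fun ω hω y =>
      mul_le_of_le_one_right (mul_nonneg (he ω hω) (by linarith [hy y])) (wt_le_one y)
    have hS : ∀ ω ∈ Ioo 0 B.ω₁, ∀ y, eps g ω / ω ≤ eps g ω / ω * (1 + |y|) := fun ω hω y =>
      le_mul_of_one_le_right (he ω hω) (hy y)
    have hDs := k3.weaken_one (M' := B.slow) fun ω hω y =>
      (mul_le_of_le_one_left (B.fast_pos ω y).le (B.eps_le_one hω)).trans (B.fast_le_slow hω y)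
    have hDf := k3.weaken_one (M' := B.fast) fun ω hω y =>
      mul_le_of_le_one_left (B.fast_pos ω y).le (B.eps_le_one hω)
    have hDds := h3.weaken_one (M' := fun ω y => eps g ω / ω * (1 + |y|) * B.slow ω y)
      fun ω hω y => mul_le_mul_of_nonneg_left (B.fast_le_slow hω y)
        (mul_nonneg (he ω hω) (by linarith [hy y]))
    have hbS := haad.weaken_one hS |>.add (hbd.weaken_one hwS)
    have hbS' := haad.neg.weaken_one hS |>.add (hbd.weaken_one hwS)
    refine ⟨UnifBdd.of_deriv B.hasDerivAt_Pd bP h2, UnifBdd.of_deriv B.hasDerivAt_P₁d bP₁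
      (((hbS.mul k1).add ((ha2.add hb1).bdd_mul h1)).add
        (((hcd.weaken_one hwS).mul hDs).add (hc1.bdd_mul hDds))),
      UnifBdd.of_deriv B.hasDerivAt_Dd bD h4, UnifBdd.of_deriv B.hasDerivAt_D₁d bD₁
      (((hbS'.mul hDf).add ((((UnifBdd.const_one 2).sub ha2).add hb1).bdd_mul h3)).add
        (((hcd.mul k1).weaken_one fun ω hω y => ?_).add
          ((hc.mul h1).weaken_one fun ω hω y => ?_)))⟩
    · rw [mul_assoc]
      refine mul_le_mul_of_nonneg_left ?_ (mul_nonneg (he ω hω) (by linarith [hy y]))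
      exact (mul_le_of_le_one_right (wt_pos y).le (B.slow_le_one hω y)).trans (B.wt_le_fast hω y)
    · have h5 : eps g ω * wt y * (eps g ω / ω * (1 + |y|) * B.slow ω y) =
        eps g ω / ω * (1 + |y|) * (eps g ω * (wt y * B.slow ω y)) := by ring
      rw [h5]
      refine mul_le_mul_of_nonneg_left ?_ (mul_nonneg (he ω hω) (by linarith [hy y]))
      have h6 := mul_pos (wt_pos y) (B.slow_pos ω y)
      exact (mul_le_of_le_one_left h6.le (B.eps_le_one hω)).trans
        ((mul_le_of_le_one_right (wt_pos y).le (B.slow_le_one hω y)).trans (B.wt_le_fast hω y))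

theorem unifBdd_Pd (h1 : 1 ≤ N) :
    B.UB N N B.Pd (fun ω y => eps g ω / ω * (1 + |y|) * B.slow ω y) := by
  obtain ⟨n, rfl⟩ := Nat.exists_eq_add_of_le' h1
  obtain ⟨h1, h2, -, -⟩ := B.unifBdd_PdDd hN (n := n) le_rfl
  exact UnifBdd.of_deriv B.hasDerivAt_Pd h1.le h2

theorem unifBdd_Dd (h1 : 1 ≤ N) :
    B.UB N N B.Dd (fun ω y => eps g ω / ω * (1 + |y|) * B.fast ω y) := by
  obtain ⟨n, rfl⟩ := Nat.exists_eq_add_of_le' h1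
  obtain ⟨-, -, h1, h2⟩ := B.unifBdd_PdDd hN (n := n) le_rfl
  exact UnifBdd.of_deriv B.hasDerivAt_Dd h1.le h2

theorem unifBdd_forcing_d (hn : n + 2 ≤ N) :
    B.UB N n (fun ω y => potD g (bfun g) (bth g) ω y / ω * B.P ω y
        + pot g (bfun g) ω y * B.Pd ω y
        + (potD g (cfun g) (cth g) ω y / ω * B.D ω y + pot g (cfun g) ω y * B.Dd ω y))
      (fun ω y => eps g ω / ω * (1 + |y|) * B.fast ω y) := by
  obtain ⟨k1, -, k3, -⟩ := B.unifBdd_PD hN (n := n) (by omega)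
  obtain ⟨h1, -, h3, -⟩ := B.unifBdd_PdDd hN (n := n) (by omega)
  have he : ∀ ω ∈ Ioo 0 B.ω₁, ∀ y : ℝ, 0 ≤ eps g ω / ω * (1 + |y|) := fun ω hω y =>
    mul_nonneg (div_nonneg (B.eps_pos hω).le hω.1.le) (by linarith [abs_nonneg y])
  have hDs := k3.weaken_one (M' := B.slow) fun ω hω y =>
      (mul_le_of_le_one_left (B.fast_pos ω y).le (B.eps_le_one hω)).trans (B.fast_le_slow hω y)
  have hDds := h3.weaken_one (M' := fun ω y => eps g ω / ω * (1 + |y|) * B.slow ω y)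
      fun ω hω y => mul_le_mul_of_nonneg_left (B.fast_le_slow hω y) (he ω hω y)
  have w1 : ∀ ω ∈ Ioo 0 B.ω₁, ∀ y, wt y * B.slow ω y ≤ B.fast ω y := fun ω hω y =>
    (mul_le_of_le_one_right (wt_pos y).le (B.slow_le_one hω y)).trans (B.wt_le_fast hω y)
  have w2 : ∀ ω ∈ Ioo 0 B.ω₁, ∀ y, eps g ω / ω * (1 + |y|) * wt y * B.slow ω y ≤
      eps g ω / ω * (1 + |y|) * B.fast ω y := fun ω hω y => by
    rw [mul_assoc]
    exact mul_le_mul_of_nonneg_left (w1 ω hω y) (he ω hω y)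
  have w3 : ∀ ω ∈ Ioo 0 B.ω₁, ∀ y, eps g ω * wt y * (eps g ω / ω * (1 + |y|) * B.slow ω y) ≤
      eps g ω / ω * (1 + |y|) * B.fast ω y := fun ω hω y => by
    refine le_trans ?_ (w2 ω hω y)
    have h5 : eps g ω * wt y * (eps g ω / ω * (1 + |y|) * B.slow ω y) =
      eps g ω * (eps g ω / ω * (1 + |y|) * wt y * B.slow ω y) := by ring
    rw [h5]
    exact mul_le_of_le_one_left (mul_nonneg (mul_nonneg (he ω hω y) (wt_pos y).le)
      (B.slow_pos ω y).le) (B.eps_le_one hω)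
  exact ((((B.unifBdd_bd hN hn).mul k1).weaken_one w2).add
    (((B.unifBdd_b hN (by omega)).mul h1).weaken_one w3)).add
    ((((B.unifBdd_cd hN hn).mul hDs).weaken_one w2).add
    (((B.unifBdd_c hN (by omega)).mul hDds).weaken_one w3))

end

/-- Since `P'' = α²P` up to fast terms, a derivative of `P` of order `k ≥ 1` gains a factor
`α^{k-1}` with respect to `P'`, up to fast terms. -/
theorem exists_iteratedDeriv_P_le (hN : ControlledUpTo g N) : ∃ C > 0, ∀ k ≤ N + 1, 1 ≤ k →
    ∀ ω ∈ Ioo 0 B.ω₁, ∀ y, |iteratedDeriv k (B.P ω) y| ≤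
      C * (eps g ω * intI g ω ^ (k - 1) * B.slow ω y + eps g ω * B.fast ω y) := by
  have hK := B.one_le
  have hM : ∀ ω ∈ Ioo 0 B.ω₁, ∀ y, ∀ k : ℕ, 0 ≤ eps g ω * intI g ω ^ k * B.slow ω y :=
    fun ω hω y k => mul_nonneg (mul_nonneg (B.eps_pos hω).le (pow_nonneg (B.intI_pos hω).le k))
      (B.slow_pos ω y).le
  have hM' : ∀ ω ∈ Ioo 0 B.ω₁, ∀ y, 0 ≤ eps g ω * B.fast ω y := fun ω hω y =>
    mul_nonneg (B.eps_pos hω).le (B.fast_pos ω y).le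
  have ha : ∀ ω ∈ Ioo 0 B.ω₁, B.α ω ^ 2 ≤ (2 * B.K * intI g ω) ^ 2 := fun ω hω =>
    pow_le_pow_left₀ (B.alpha_pos hω).le (B.alpha_le_intI hω) 2
  have ha1 : ∀ ω ∈ Ioo 0 B.ω₁, B.α ω ^ 2 ≤ 1 := fun ω hω =>
    pow_le_one₀ (B.alpha_pos hω).le ((B.alpha_le ω hω).trans (by norm_num))
  refine exists_const_forall (fun k a b hab h hk ω hω y => (h hk ω hω y).trans
    (mul_le_mul_of_nonneg_right hab (add_nonneg (hM ω hω y _) (hM' ω hω y)))) fun k hk => ?_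
  induction k using Nat.strong_induction_on with
  | _ k ih =>
    match k, hk, ih with
    | 0, _, _ => exact ⟨1, one_pos, fun h => absurd h (by norm_num)⟩
    | 1, _, _ =>
      refine ⟨4 * B.K, by linarith, fun _ ω hω y => ?_⟩
      rw [iteratedDeriv_one, (B.hasDerivAt_P ω hω y).deriv]
      refine (B.P₁_le hω y).trans ?_
      rw [Nat.sub_self, pow_zero, mul_one, mul_assoc]
      exact mul_le_mul_of_nonneg_left (by linarith [hM' ω hω y]) (by linarith)
    | k + 2, hk, ih =>
      have hkN : k + 1 ≤ N := by omega
      have hG := B.unifBdd_forcing hN.1 hkN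
      have hP := (B.unifBdd_P hN.1).of_le (m := k) (by omega)
      obtain ⟨C, hC, hGb⟩ := hG.2 hN
      have hrec : ∀ ω ∈ Ioo 0 B.ω₁, ∀ y, |iteratedDeriv (k + 2) (B.P ω) y| ≤
          B.α ω ^ 2 * |iteratedDeriv k (B.P ω) y| + C * (eps g ω * B.fast ω y) := by
        intro ω hω y
        have e : (fun y => (B.α ω ^ 2 + pot g (bfun g) ω y) * B.P ω y
            + pot g (cfun g) ω y * B.D ω y) = fun y => B.α ω ^ 2 * B.P ω y
            + (pot g (bfun g) ω y * B.P ω y + pot g (cfun g) ω y * B.D ω y) := by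
          ext y; ring
        rw [iteratedDeriv_succ_eq_of_hasDerivAt (B.hasDerivAt_P ω hω),
          iteratedDeriv_succ_eq_of_hasDerivAt (B.hasDerivAt_P₁ ω hω), e,
          iteratedDeriv_fun_add (contDiff_const.mul (hP.1 ω hω)).contDiffAt (hG.1 ω hω).contDiffAt,
          iteratedDeriv_const_mul_field]
        refine (abs_add_le _ _).trans (add_le_add ?_ (hGb ω hω k le_rfl y))
        rw [abs_mul, abs_of_nonneg (sq_nonneg _)]
      rcases Nat.eq_zero_or_pos k with rfl | hk0
      · refine ⟨8 * B.K ^ 3 + C, by positivity, fun _ ω hω y => (hrec ω hω y).trans ?_⟩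
        rw [iteratedDeriv_zero]
        have h1 := mul_le_mul (mul_le_mul (B.alpha_le_eps hω) (B.alpha_le_intI hω)
          (B.alpha_pos hω).le (by have := B.eps_pos hω; positivity)) (B.P_le hω y) (abs_nonneg _)
          (by have := B.eps_pos hω; have := B.intI_pos hω; positivity)
        rw [← sq] at h1
        have h2 := hM ω hω y 1
        have h3 := hM' ω hω y
        have h4 := mul_nonneg hC.le h2
        have h5 := mul_nonneg (show 0 ≤ B.K ^ 3 by positivity) h3
        simp only [pow_one, zero_add] at *
        rw [show 2 - 1 = 1 from rfl, pow_one]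
        linarith
      · obtain ⟨C', hC', h⟩ := ih k (by omega) (by omega)
        refine ⟨4 * B.K ^ 2 * C' + C' + C, by positivity, fun _ ω hω y => (hrec ω hω y).trans ?_⟩
        have h1 := mul_le_mul_of_nonneg_left (h hk0 ω hω y) (sq_nonneg (B.α ω))
        have h2 := mul_le_mul_of_nonneg_right (ha ω hω) (mul_nonneg hC'.le (hM ω hω y (k - 1)))
        have h3 := mul_le_mul_of_nonneg_right (ha1 ω hω) (mul_nonneg hC'.le (hM' ω hω y))
        have e : intI g ω ^ (k + 2 - 1) = intI g ω ^ (k - 1) * intI g ω ^ 2 := by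
          rw [← pow_add]; congr 1; omega
        have h4 := hM ω hω y (k + 2 - 1)
        have h5 := mul_nonneg hC.le h4
        have h6 := mul_nonneg hC'.le h4
        have h7 := mul_nonneg (show 0 ≤ B.K ^ 2 * C' by positivity) (hM' ω hω y)
        rw [e] at *
        linarith

/-- The form of the previous bound that is used for the derivative in `ω`. -/
theorem exists_iteratedDeriv_P_le' (hN : ControlledUpTo g N) : ∃ C > 0, ∀ k ≤ N + 1, 1 ≤ k →
    ∀ ω ∈ Ioo 0 B.ω₁, ∀ y, |iteratedDeriv k (B.P ω) y| ≤
      C * (eps g ω ^ k * B.slow ω y + eps g ω * B.fast ω y) := by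
  obtain ⟨C, hC, h⟩ := B.exists_iteratedDeriv_P_le hN
  have hK := B.one_le
  refine ⟨C * B.K ^ N, by positivity, fun k hk h1 ω hω y => (h k hk h1 ω hω y).trans ?_⟩
  have he := B.eps_pos hω
  have h2 : intI g ω ^ (k - 1) ≤ B.K ^ N * eps g ω ^ (k - 1) :=
    calc _ ≤ (B.K * eps g ω) ^ (k - 1) :=
          pow_le_pow_left₀ (B.intI_pos hω).le (B.intI_le ω hω) _
      _ = B.K ^ (k - 1) * eps g ω ^ (k - 1) := mul_pow _ _ _
      _ ≤ _ := mul_le_mul_of_nonneg_right (pow_le_pow_right₀ hK (by omega)) (by positivity)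
  have h3 : eps g ω * intI g ω ^ (k - 1) ≤ B.K ^ N * eps g ω ^ k := by
    have e : eps g ω ^ k = eps g ω * eps g ω ^ (k - 1) := by
      rw [← pow_succ']; congr 1; omega
    rw [e]
    have := mul_le_mul_of_nonneg_left h2 he.le
    linarith
  have h4 : 1 ≤ B.K ^ N := one_le_pow₀ hK
  have h5 := mul_le_mul_of_nonneg_right h3 (B.slow_pos ω y).le
  have h6 := mul_le_mul_of_nonneg_right h4 (mul_nonneg he.le (B.fast_pos ω y).le)
  rw [mul_assoc C]
  refine mul_le_mul_of_nonneg_left ?_ hC.le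
  linarith

/-- In the differentiated equation `∂_ωP'' = α²∂_ωP + 2αα'P + ⋯` both slow terms carry a factor of
size `ε²`. -/
theorem exists_iteratedDeriv_Pd_le (hN : ControlledUpTo g N) : ∃ C > 0, ∀ k ≤ N, 1 ≤ k →
    ∀ ω ∈ Ioo 0 B.ω₁, ∀ y, |iteratedDeriv k (B.Pd ω) y| ≤
      C * (eps g ω ^ k / ω * (1 + |y|) * B.slow ω y
        + eps g ω / ω * (1 + |y|) * B.fast ω y) := by
  have hK := B.one_le
  have hM : ∀ ω ∈ Ioo 0 B.ω₁, ∀ y : ℝ, ∀ k : ℕ, 0 ≤ eps g ω ^ k / ω * (1 + |y|) :=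
    fun ω hω y k => mul_nonneg (div_nonneg (pow_nonneg (B.eps_pos hω).le k) hω.1.le)
      (by positivity)
  have hMs : ∀ ω ∈ Ioo 0 B.ω₁, ∀ y : ℝ, ∀ k : ℕ,
      0 ≤ eps g ω ^ k / ω * (1 + |y|) * B.slow ω y :=
    fun ω hω y k => mul_nonneg (hM ω hω y k) (B.slow_pos ω y).le
  have hM' : ∀ ω ∈ Ioo 0 B.ω₁, ∀ y : ℝ, 0 ≤ eps g ω / ω * (1 + |y|) * B.fast ω y := fun ω hω y =>
    mul_nonneg (by have := hM ω hω y 1; rwa [pow_one] at this) (B.fast_pos ω y).le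
  obtain ⟨CP, hCP, hPb⟩ := B.exists_iteratedDeriv_P_le' hN
  refine exists_const_forall (fun k a b hab h hk ω hω y => (h hk ω hω y).trans
    (mul_le_mul_of_nonneg_right hab (add_nonneg (hMs ω hω y _) (hM' ω hω y)))) fun k hk => ?_
  induction k using Nat.strong_induction_on with
  | _ k ih =>
    match k, hk, ih with
    | 0, _, _ => exact ⟨1, one_pos, fun h => absurd h (by norm_num)⟩
    | 1, _, _ =>
      refine ⟨B.K, by linarith, fun _ ω hω y => ?_⟩
      rw [iteratedDeriv_one, (B.hasDerivAt_Pd ω hω y).deriv]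
      refine (B.P₁d_le ω hω y).trans ?_
      have h1 := mul_nonneg (show 0 ≤ B.K by linarith) (hM' ω hω y)
      rw [slow] at *
      rw [pow_one]
      linarith
    | k + 2, hk, ih =>
      have hkN : k + 2 ≤ N := by omega
      have hG := B.unifBdd_forcing_d hN.1 hkN
      have hP := (B.unifBdd_P hN.1).of_le (m := k) (by omega)
      have hPd := (B.unifBdd_Pd hN.1 (by omega)).of_le (m := k) (by omega)
      obtain ⟨C, hC, hGb⟩ := hG.2 hN
      have hrec : ∀ ω ∈ Ioo 0 B.ω₁, ∀ y, |iteratedDeriv (k + 2) (B.Pd ω) y| ≤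
          4 * B.K ^ 2 * (eps g ω ^ 2 / ω) * |iteratedDeriv k (B.P ω) y|
          + B.α ω ^ 2 * |iteratedDeriv k (B.Pd ω) y|
          + C * (eps g ω / ω * (1 + |y|) * B.fast ω y) := by
        intro ω hω y
        have e : (fun y => (2 * B.α ω * B.αd ω + potD g (bfun g) (bth g) ω y / ω) * B.P ω y
            + (B.α ω ^ 2 + pot g (bfun g) ω y) * B.Pd ω y
            + (potD g (cfun g) (cth g) ω y / ω * B.D ω y + pot g (cfun g) ω y * B.Dd ω y)) =
            fun y => (2 * B.α ω * B.αd ω * B.P ω y + B.α ω ^ 2 * B.Pd ω y)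
            + (potD g (bfun g) (bth g) ω y / ω * B.P ω y + pot g (bfun g) ω y * B.Pd ω y
            + (potD g (cfun g) (cth g) ω y / ω * B.D ω y + pot g (cfun g) ω y * B.Dd ω y)) := by
          ext y; ring
        have d1 : ContDiffAt ℝ k (fun y => 2 * B.α ω * B.αd ω * B.P ω y) y :=
          (contDiff_const.mul (hP.1 ω hω)).contDiffAt
        have d2 : ContDiffAt ℝ k (fun y => B.α ω ^ 2 * B.Pd ω y) y :=
          (contDiff_const.mul (hPd.1 ω hω)).contDiffAt
        rw [iteratedDeriv_succ_eq_of_hasDerivAt (B.hasDerivAt_Pd ω hω),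
          iteratedDeriv_succ_eq_of_hasDerivAt (B.hasDerivAt_P₁d ω hω), e,
          iteratedDeriv_fun_add (d1.add d2) (hG.1 ω hω).contDiffAt,
          iteratedDeriv_fun_add d1 d2,
          iteratedDeriv_const_mul_field, iteratedDeriv_const_mul_field]
        refine (abs_add_le _ _).trans (add_le_add ((abs_add_le _ _).trans (add_le_add ?_ ?_))
          (hGb ω hω k le_rfl y))
        · rw [abs_mul]
          refine mul_le_mul_of_nonneg_right ?_ (abs_nonneg _)
          have h1 := abs_mul_le_of_le ((abs_of_pos (B.alpha_pos hω)).trans_le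
            (B.alpha_le_eps hω)) (B.alphad_le ω hω)
          rw [mul_assoc, abs_mul, abs_two]
          calc _ ≤ 2 * (2 * B.K * eps g ω * (B.K * (eps g ω / ω))) := by gcongr
            _ = _ := by ring
        · rw [abs_mul, abs_of_nonneg (sq_nonneg _)]
      have ha : ∀ ω ∈ Ioo 0 B.ω₁, B.α ω ^ 2 ≤ 4 * B.K ^ 2 * eps g ω ^ 2 := fun ω hω =>
        (pow_le_pow_left₀ (B.alpha_pos hω).le (B.alpha_le_eps hω) 2).trans (by
          apply le_of_eq; ring)
      have he2 : ∀ ω ∈ Ioo 0 B.ω₁, eps g ω ^ 2 ≤ 1 := fun ω hω =>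
        pow_le_one₀ (B.eps_pos hω).le (B.eps_le_one hω)
      rcases Nat.eq_zero_or_pos k with rfl | hk0
      · refine ⟨8 * B.K ^ 3 + 4 * B.K ^ 3 + C, by positivity, fun _ ω hω y =>
          (hrec ω hω y).trans ?_⟩
        rw [iteratedDeriv_zero, iteratedDeriv_zero, zero_add]
        have he := B.eps_pos hω
        have hw := hω.1
        have hs := B.slow_pos ω y
        have h1 : 4 * B.K ^ 2 * (eps g ω ^ 2 / ω) * |B.P ω y| ≤
            8 * B.K ^ 3 * (eps g ω ^ 2 / ω * (1 + |y|) * B.slow ω y) :=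
          calc _ ≤ 4 * B.K ^ 2 * (eps g ω ^ 2 / ω) * (2 * B.K * B.slow ω y) := by
                gcongr; exact B.P_le hω y
            _ = 8 * B.K ^ 3 * (eps g ω ^ 2 / ω * 1 * B.slow ω y) := by ring
            _ ≤ _ := by gcongr; linarith [abs_nonneg y]
        have h2 : B.α ω ^ 2 * |B.Pd ω y| ≤
            4 * B.K ^ 3 * (eps g ω ^ 2 / ω * (1 + |y|) * B.slow ω y) :=
          calc _ ≤ 4 * B.K ^ 2 * eps g ω ^ 2 * (B.K * (eps g ω / ω) * (1 + |y|) * B.slow ω y) :=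
                mul_le_mul (ha ω hω) (B.Pd_le ω hω y) (abs_nonneg _) (by positivity)
            _ = 4 * B.K ^ 3 * (eps g ω ^ 2 / ω * (1 + |y|) * B.slow ω y) * eps g ω := by ring
            _ ≤ _ := mul_le_of_le_one_right (by positivity) (B.eps_le_one hω)
        have h4 := mul_nonneg hC.le (hMs ω hω y 2)
        have h5 := mul_nonneg (show 0 ≤ B.K ^ 3 by positivity) (hM' ω hω y)
        linarith
      · obtain ⟨C', hC', h⟩ := ih k (by omega) (by omega)
        refine ⟨4 * B.K ^ 2 * CP + 4 * B.K ^ 2 * C' + C, by positivity, fun _ ω hω y =>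
          (hrec ω hω y).trans ?_⟩
        have he := B.eps_pos hω
        have hw := hω.1
        have hs := B.slow_pos ω y
        have hf := B.fast_pos ω y
        have hp := hPb k (by omega) hk0 ω hω y
        have h1 : 4 * B.K ^ 2 * (eps g ω ^ 2 / ω) * |iteratedDeriv k (B.P ω) y| ≤
            4 * B.K ^ 2 * CP * (eps g ω ^ (k + 2) / ω * (1 + |y|) * B.slow ω y
            + eps g ω / ω * (1 + |y|) * B.fast ω y) :=
          calc _ ≤ 4 * B.K ^ 2 * (eps g ω ^ 2 / ω) *
                (CP * (eps g ω ^ k * B.slow ω y + eps g ω * B.fast ω y)) := by gcongr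
            _ = 4 * B.K ^ 2 * CP * (eps g ω ^ (k + 2) / ω * 1 * B.slow ω y
              + eps g ω / ω * 1 * B.fast ω y * eps g ω ^ 2) := by ring
            _ ≤ 4 * B.K ^ 2 * CP * (eps g ω ^ (k + 2) / ω * (1 + |y|) * B.slow ω y
              + eps g ω / ω * (1 + |y|) * B.fast ω y * 1) := by
              have := abs_nonneg y
              gcongr
              · linarith
              · linarith
              · exact he2 ω hω
            _ = _ := by rw [mul_one]
        have h2 : B.α ω ^ 2 * |iteratedDeriv k (B.Pd ω) y| ≤
            4 * B.K ^ 2 * C' * (eps g ω ^ (k + 2) / ω * (1 + |y|) * B.slow ω y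
            + eps g ω / ω * (1 + |y|) * B.fast ω y) :=
          calc _ ≤ 4 * B.K ^ 2 * eps g ω ^ 2 * (C' * (eps g ω ^ k / ω * (1 + |y|) * B.slow ω y
                + eps g ω / ω * (1 + |y|) * B.fast ω y)) :=
                mul_le_mul (ha ω hω) (h hk0 ω hω y) (abs_nonneg _) (by positivity)
            _ = 4 * B.K ^ 2 * C' * (eps g ω ^ (k + 2) / ω * (1 + |y|) * B.slow ω y
              + eps g ω / ω * (1 + |y|) * B.fast ω y * eps g ω ^ 2) := by ring
            _ ≤ 4 * B.K ^ 2 * C' * (eps g ω ^ (k + 2) / ω * (1 + |y|) * B.slow ω y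
              + eps g ω / ω * (1 + |y|) * B.fast ω y * 1) := by
              gcongr
              exact he2 ω hω
            _ = _ := by rw [mul_one]
        have h4 := mul_nonneg hC.le (hMs ω hω y (k + 2))
        linarith

end EigenBranch

/-! ### The pairs `W` and `V` -/

/-- The sign that distinguishes `W₁ = P + D` (index `0`) from `W₂ = P - D` (index `1`). -/
def sg (j : Fin 2) : ℝ := if j = 0 then 1 else -1

theorem sg_zero : sg 0 = 1 := rfl

theorem sg_one : sg 1 = -1 := rfl

theorem abs_sg (j : Fin 2) : |sg j| = 1 := by
  rw [sg]; split_ifs <;> simp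

/-- The coefficient `φ` of `a⁺ = Q² φ(ωQ²)`. -/
def afun (g : ℝ → ℝ) (s : ℝ) : ℝ := gam g 0 s - 2 * gamI g s

/-- `s ∂_s afun`. -/
def ath (g : ℝ → ℝ) (s : ℝ) : ℝ := gam g 1 s - gam g 0 s - 2 * (gam g 0 s - 2 * gamI g s)

theorem hasDerivAt_afun {g : ℝ → ℝ} (h1 : HypH1 g) {s : ℝ} (hs : 0 < s) :
    HasDerivAt (afun g) (ath g s / s) s := by
  have a0 := hasDerivAt_gam (k := 0) (h1.contDiffOn_le (by norm_num)) hs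
  refine (a0.sub ((h1.hasDerivAt_gamI hs).const_mul 2)).congr_deriv ?_
  rw [ath]; push_cast; field_simp; ring

namespace SmallFreq

variable {g : ℝ → ℝ} {ω₀ ω : ℝ} (H : SmallFreq g ω₀) (hω : ω ∈ Ioo 0 ω₀)

include H hω

theorem aPlus_eq_pot (y : ℝ) : aPlus g ω y = pot g (afun g) ω y := H.aPlus_eq hω y

/-- The Riccati equation of `h = Q'/Q`. -/
theorem hasDerivAt_hf' (y : ℝ) :
    HasDerivAt (hf g ω) (hf g ω y ^ 2 - 1 - pot g (afun g) ω y) y := by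
  refine (H.hasDerivAt_hf hω y).congr_deriv ?_
  rw [H.hf_sq hω, pot, afun, bigGam']; ring

/-- `(a⁺)' = h(a⁺ - a⁻)`. -/
theorem hasDerivAt_aPlus (y : ℝ) :
    HasDerivAt (pot g (afun g) ω) (2 * hf g ω y * pot g (cfun g) ω y) y := by
  refine (H.hasDerivAt_pot hω (fun s hs => hasDerivAt_afun H.h1 hs) y).congr_deriv ?_
  have : (fun s => afun g s + ath g s) = cfun g := by
    ext s; rw [afun, ath, cfun]; ring
  rw [this]

theorem aMinus_eq_pot (y : ℝ) :
    aMinus g ω y = pot g (afun g) ω y - 2 * pot g (cfun g) ω y := by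
  rw [← H.aPlus_sub_aMinus hω, H.aPlus_eq_pot hω]; ring

/-- The potential of `L₊` in terms of `h`, `a⁺` and `a⁺ - a⁻`. -/
theorem opLPlus_eq (f : ℝ → ℝ) (y : ℝ) : opLPlus g ω f y = -iteratedDeriv 2 f y
    + (6 * hf g ω y ^ 2 - 5 - 5 * pot g (afun g) ω y - 2 * pot g (cfun g) ω y) * f y := by
  have hs := (H.sf_mem hω y).1.ne'
  have hw := hω.1.ne'
  rw [opLPlus, H.mul_solQ_sq hω, H.solQ_sq hω, H.hf_sq hω, pot, pot, afun, cfun, gam_one, gam_zero]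
  field_simp
  ring

theorem opLMinus_eq (f : ℝ → ℝ) (y : ℝ) : opLMinus g ω f y = -iteratedDeriv 2 f y
    + (2 * hf g ω y ^ 2 - 1 - pot g (afun g) ω y) * f y := by
  have hs := (H.sf_mem hω y).1.ne'
  have hw := hω.1.ne'
  rw [opLMinus, H.mul_solQ_sq hω, H.solQ_sq hω, H.hf_sq hω, pot, afun, gam_zero]
  field_simp
  ring

theorem opSStar_eq {f f' : ℝ → ℝ} (hf' : ∀ y, HasDerivAt f (f' y) y) (y : ℝ) :
    opSStar g ω f y = -(f' y + hf g ω y * f y) := by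
  have hq := (H.solQ_pos hω y).ne'
  have hd : HasDerivAt (fun z => solQ g ω z * f z) _ y := (H.hasDerivAt_solQ hω y).mul (hf' y)
  rw [opSStar, hd.deriv]
  field_simp
  ring

end SmallFreq

namespace EigenBranch

variable {g : ℝ → ℝ} (B : EigenBranch g) {ω : ℝ} {N n : ℕ}

/-- The eigenfunctions `W_j` of the pair `(M₊, M₋)`. -/
def W (j : Fin 2) (ω y : ℝ) : ℝ := B.P ω y + sg j * B.D ω y

/-- `∂_y W_j`. -/
def W' (j : Fin 2) (ω y : ℝ) : ℝ := B.P₁ ω y + sg j * B.D₁ ω y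

/-- `∂_ω W_j`. -/
def Wd (j : Fin 2) (ω y : ℝ) : ℝ := B.Pd ω y + sg j * B.Dd ω y

/-- `∂_ω ∂_y W_j`. -/
def W'd (j : Fin 2) (ω y : ℝ) : ℝ := B.P₁d ω y + sg j * B.D₁d ω y

/-- The eigenvalue `λ = 1 - α²`. -/
def lam (ω : ℝ) : ℝ := 1 - B.α ω ^ 2

/-- `V₁ = (S*)² W₁` (the entry `0` of the pair), written without second derivatives. -/
def V₀ (ω y : ℝ) : ℝ :=
  2 * hf g ω y ^ 2 * B.W 0 ω y + 2 * hf g ω y * B.W' 0 ω y - B.lam ω * B.W 1 ω y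

/-- `V₂ = λ⁻¹ L₊ V₁` (the entry `1` of the pair), written without higher derivatives. -/
def V₁ (ω y : ℝ) : ℝ :=
  2 * (1 + pot g (afun g) ω y) * B.W 1 ω y + 2 * hf g ω y * B.W' 1 ω y - B.lam ω * B.W 0 ω y

/-- `∂_y V₁`. -/
def V₀' (ω y : ℝ) : ℝ :=
  2 * hf g ω y * (2 * hf g ω y ^ 2 - 1 - pot g (afun g) ω y) * B.W 0 ω y
    + 2 * (2 * hf g ω y ^ 2 - 1 - pot g (afun g) ω y) * B.W' 0 ω y
    - 2 * hf g ω y * B.lam ω * B.W 1 ω y - B.lam ω * B.W' 1 ω y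

/-- `∂_y V₂`. -/
def V₁' (ω y : ℝ) : ℝ :=
  2 * hf g ω y * (1 + pot g (afun g) ω y) * B.W 1 ω y + 2 * hf g ω y ^ 2 * B.W' 1 ω y
    - 2 * hf g ω y * B.lam ω * B.W 0 ω y - B.lam ω * B.W' 0 ω y

/-- `∂_ω h`. -/
def hfd (_ : EigenBranch g) (ω y : ℝ) : ℝ :=
  sf g ω y / ω * bigGam' g (sf g ω y) * jf g ω y / ω

/-- `∂_ω V₁`. -/
def Vd₀ (ω y : ℝ) : ℝ :=
  4 * hf g ω y * B.hfd ω y * B.W 0 ω y + 2 * hf g ω y ^ 2 * B.Wd 0 ω y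
    + (2 * B.hfd ω y * B.W' 0 ω y + 2 * hf g ω y * B.W'd 0 ω y)
    - (-(2 * B.α ω * B.αd ω) * B.W 1 ω y + B.lam ω * B.Wd 1 ω y)

/-- `∂_ω V₂`. -/
def Vd₁ (ω y : ℝ) : ℝ :=
  2 * (potD g (afun g) (ath g) ω y / ω) * B.W 1 ω y
    + 2 * (1 + pot g (afun g) ω y) * B.Wd 1 ω y
    + (2 * B.hfd ω y * B.W' 1 ω y + 2 * hf g ω y * B.W'd 1 ω y)
    - (-(2 * B.α ω * B.αd ω) * B.W 0 ω y + B.lam ω * B.Wd 0 ω y)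

section

variable (hω : ω ∈ Ioo 0 B.ω₁)

include hω

theorem hasDerivAt_W (j : Fin 2) (y : ℝ) : HasDerivAt (B.W j ω) (B.W' j ω y) y :=
  (B.hasDerivAt_P ω hω y).add ((B.hasDerivAt_D ω hω y).const_mul _)

theorem hasDerivAt_W_omega (j : Fin 2) (y : ℝ) :
    HasDerivAt (fun w => B.W j w y) (B.Wd j ω y) ω :=
  (B.hasDerivAt_P_omega ω hω y).add ((B.hasDerivAt_D_omega ω hω y).const_mul _)

theorem hasDerivAt_W'_omega (j : Fin 2) (y : ℝ) :
    HasDerivAt (fun w => B.W' j w y) (B.W'd j ω y) ω :=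
  (B.hasDerivAt_P₁_omega ω hω y).add ((B.hasDerivAt_D₁_omega ω hω y).const_mul _)

theorem hasDerivAt_W'_zero (y : ℝ) : HasDerivAt (B.W' 0 ω)
    ((1 + pot g (afun g) ω y) * B.W 0 ω y - B.lam ω * B.W 1 ω y) y := by
  refine ((B.hasDerivAt_P₁ ω hω y).add ((B.hasDerivAt_D₁ ω hω y).const_mul _)).congr_deriv ?_
  rw [W, W, sg_zero, sg_one, lam, pot, pot, pot, afun, bfun, cfun]
  ring

theorem hasDerivAt_W'_one (y : ℝ) : HasDerivAt (B.W' 1 ω)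
    ((1 + pot g (afun g) ω y - 2 * pot g (cfun g) ω y) * B.W 1 ω y - B.lam ω * B.W 0 ω y) y := by
  refine ((B.hasDerivAt_P₁ ω hω y).add ((B.hasDerivAt_D₁ ω hω y).const_mul _)).congr_deriv ?_
  rw [W, W, sg_zero, sg_one, lam, pot, pot, pot, afun, bfun, cfun]
  ring

theorem lam_pos : 0 < B.lam ω := by
  have h1 := B.alpha_pos hω
  have h2 := B.alpha_le ω hω
  rw [lam]; nlinarith

theorem hasDerivAt_lam : HasDerivAt B.lam (-(2 * B.α ω * B.αd ω)) ω := by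
  refine (((B.hasDerivAt_alpha ω hω).pow 2).const_sub 1).congr_deriv ?_
  push_cast; ring

theorem hasDerivAt_V₀ (y : ℝ) : HasDerivAt (B.V₀ ω) (B.V₀' ω y) y := by
  have hh := B.H.hasDerivAt_hf' hω y
  have h1 := ((((hh.pow 2).const_mul 2).mul (B.hasDerivAt_W hω 0 y)).add
    ((hh.const_mul 2).mul (B.hasDerivAt_W'_zero hω y))).sub
    ((B.hasDerivAt_W hω 1 y).const_mul (B.lam ω))
  refine h1.congr_deriv ?_
  simp only [V₀', Pi.pow_apply]
  push_cast
  ring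

theorem hasDerivAt_V₁ (y : ℝ) : HasDerivAt (B.V₁ ω) (B.V₁' ω y) y := by
  have hh := B.H.hasDerivAt_hf' hω y
  have h1 := (((((B.H.hasDerivAt_aPlus hω y).const_add 1).const_mul 2).mul
    (B.hasDerivAt_W hω 1 y)).add ((hh.const_mul 2).mul (B.hasDerivAt_W'_one hω y))).sub
    ((B.hasDerivAt_W hω 0 y).const_mul (B.lam ω))
  refine h1.congr_deriv ?_
  rw [V₁']
  ring

/-- The equation `L₊V₁ = λV₂`. -/
theorem hasDerivAt_V₀' (y : ℝ) : HasDerivAt (B.V₀' ω)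
    ((6 * hf g ω y ^ 2 - 5 - 5 * pot g (afun g) ω y - 2 * pot g (cfun g) ω y) * B.V₀ ω y
      - B.lam ω * B.V₁ ω y) y := by
  have hh := B.H.hasDerivAt_hf' hω y
  have hq := (((hh.pow 2).const_mul 2).sub_const 1).sub (B.H.hasDerivAt_aPlus hω y)
  have h1 := (((((hh.const_mul 2).mul hq).mul (B.hasDerivAt_W hω 0 y)).add
    ((hq.const_mul 2).mul (B.hasDerivAt_W'_zero hω y))).sub
    (((hh.const_mul 2).mul_const (B.lam ω)).mul (B.hasDerivAt_W hω 1 y))).sub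
    ((B.hasDerivAt_W'_one hω y).const_mul (B.lam ω))
  refine h1.congr_deriv ?_
  simp only [V₀, V₁, Pi.pow_apply, Pi.mul_apply, Pi.sub_apply]
  push_cast
  ring

/-- The equation `L₋V₂ = λV₁`. -/
theorem hasDerivAt_V₁' (y : ℝ) : HasDerivAt (B.V₁' ω)
    ((2 * hf g ω y ^ 2 - 1 - pot g (afun g) ω y) * B.V₁ ω y - B.lam ω * B.V₀ ω y) y := by
  have hh := B.H.hasDerivAt_hf' hω y
  have h1 := (((((hh.const_mul 2).mul ((B.H.hasDerivAt_aPlus hω y).const_add 1)).mul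
    (B.hasDerivAt_W hω 1 y)).add (((hh.pow 2).const_mul 2).mul (B.hasDerivAt_W'_one hω y))).sub
    (((hh.const_mul 2).mul_const (B.lam ω)).mul (B.hasDerivAt_W hω 0 y))).sub
    ((B.hasDerivAt_W'_zero hω y).const_mul (B.lam ω))
  refine h1.congr_deriv ?_
  simp only [V₀, V₁, Pi.pow_apply, Pi.mul_apply]
  push_cast
  ring

theorem hasDerivAt_V₀_omega (y : ℝ) : HasDerivAt (fun w => B.V₀ w y) (B.Vd₀ ω y) ω := by
  have hh := B.H.hasDerivAt_hf_omega hω y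
  have h1 := ((((hh.pow 2).const_mul 2).mul (B.hasDerivAt_W_omega hω 0 y)).add
    ((hh.const_mul 2).mul (B.hasDerivAt_W'_omega hω 0 y))).sub
    ((B.hasDerivAt_lam hω).mul (B.hasDerivAt_W_omega hω 1 y))
  refine h1.congr_deriv ?_
  simp only [Vd₀, hfd, Pi.pow_apply]
  push_cast
  ring

theorem hasDerivAt_V₁_omega (y : ℝ) : HasDerivAt (fun w => B.V₁ w y) (B.Vd₁ ω y) ω := by
  have hh := B.H.hasDerivAt_hf_omega hω y
  have ha := B.H.hasDerivAt_pot_omega hω (fun s hs => hasDerivAt_afun B.H.h1 hs) y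
  have h1 := ((((ha.const_add 1).const_mul 2).mul (B.hasDerivAt_W_omega hω 1 y)).add
    ((hh.const_mul 2).mul (B.hasDerivAt_W'_omega hω 1 y))).sub
    ((B.hasDerivAt_lam hω).mul (B.hasDerivAt_W_omega hω 0 y))
  refine h1.congr_deriv ?_
  simp only [Vd₁, hfd]

/-- The spectral problems. -/
theorem spectral_W (y : ℝ) : opMPlus g ω (B.W 0 ω) y = B.lam ω * B.W 1 ω y ∧
    opMMinus g ω (B.W 1 ω) y = B.lam ω * B.W 0 ω y := by
  rw [opMPlus, opMMinus, iteratedDeriv_two_of_hasDerivAt (B.hasDerivAt_W hω 0)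
    (B.hasDerivAt_W'_zero hω), iteratedDeriv_two_of_hasDerivAt (B.hasDerivAt_W hω 1)
    (B.hasDerivAt_W'_one hω), B.H.aPlus_eq_pot hω, B.H.aMinus_eq_pot hω]
  constructor <;> ring

theorem V₀_eq_opSStar (y : ℝ) : B.V₀ ω y = opSStar g ω (opSStar g ω (B.W 0 ω)) y := by
  have e : opSStar g ω (B.W 0 ω) = fun y => -(B.W' 0 ω y + hf g ω y * B.W 0 ω y) :=
    funext fun y => B.H.opSStar_eq hω (B.hasDerivAt_W hω 0) y
  have hd : ∀ y, HasDerivAt (fun y => -(B.W' 0 ω y + hf g ω y * B.W 0 ω y))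
      (-((1 + pot g (afun g) ω y) * B.W 0 ω y - B.lam ω * B.W 1 ω y
        + ((hf g ω y ^ 2 - 1 - pot g (afun g) ω y) * B.W 0 ω y
          + hf g ω y * B.W' 0 ω y))) y := fun y =>
    ((B.hasDerivAt_W'_zero hω y).add
      ((B.H.hasDerivAt_hf' hω y).mul (B.hasDerivAt_W hω 0 y))).neg
  rw [e, B.H.opSStar_eq hω hd y, V₀]
  ring

theorem spectral_V (y : ℝ) : opLPlus g ω (B.V₀ ω) y = B.lam ω * B.V₁ ω y ∧
    opLMinus g ω (B.V₁ ω) y = B.lam ω * B.V₀ ω y := by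
  rw [B.H.opLPlus_eq hω, B.H.opLMinus_eq hω, iteratedDeriv_two_of_hasDerivAt (B.hasDerivAt_V₀ hω)
    (B.hasDerivAt_V₀' hω), iteratedDeriv_two_of_hasDerivAt (B.hasDerivAt_V₁ hω)
    (B.hasDerivAt_V₁' hω)]
  constructor <;> ring

end

/-! ### Uniform bounds for `W` and `V` -/

section

variable (hN : ContDiffOn ℝ N g (Ioi 0))

include hN

theorem unifBdd_W (j : Fin 2) : B.UB N (N + 1) (B.W j) B.slow :=
  (B.unifBdd_P hN).add (((B.unifBdd_D hN).const_mul _).weaken_one fun ω hω y =>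
    (mul_le_of_le_one_left (B.fast_pos ω y).le (B.eps_le_one hω)).trans (B.fast_le_slow hω y))

/-- As opposed to `P`, its derivative is of size `ε`, because `α` is. -/
theorem unifBdd_P₁ (hn : n ≤ N) : B.UB N n B.P₁ (fun ω y => eps g ω * B.slow ω y) := by
  have hb : ControlledUpTo g N → ∃ C > 0, ∀ ω ∈ Ioo 0 B.ω₁, ∀ y,
      |B.P₁ ω y| ≤ C * (eps g ω * B.slow ω y) := fun _ =>
    ⟨4 * B.K, by linarith [B.one_le], fun ω hω y => (B.P₁_le hω y).trans (mul_assoc _ _ _).le⟩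
  cases n with
  | zero => exact UnifBdd.zero_of ((B.unifBdd_PD hN hn).2.1.1 · · |>.continuous) hb
  | succ n =>
    have ha := B.unifBdd_alpha (N := N) (n := n)
    have h1 := (ha.mul_bdd (B.H.bdd_of_eps ha)).mul (B.unifBdd_PD hN (n := n) (by omega)).1
    refine UnifBdd.of_deriv B.hasDerivAt_P₁ hb ((h1.add ((B.unifBdd_forcing hN hn).weaken_one
      fun ω hω y => mul_le_mul_of_nonneg_left (B.fast_le_slow hω y) (B.eps_pos hω).le)).congr
      fun ω hω y => ?_)
    ring

theorem unifBdd_W' (hn : n ≤ N) (j : Fin 2) :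
    B.UB N n (B.W' j) (fun ω y => eps g ω * B.slow ω y) :=
  (B.unifBdd_P₁ hN hn).add (((B.unifBdd_PD hN hn).2.2.2.const_mul _).weaken_one
    fun _ hω y => mul_le_mul_of_nonneg_left (B.fast_le_slow hω y) (B.eps_pos hω).le)

/-- The deviation of `W_j` from its limit `1`. -/
theorem unifBdd_W_sub_one (j : Fin 2) :
    B.UB N (N + 1) (fun ω y => B.W j ω y - 1) (fun ω y => eps g ω * (1 + |y|)) := by
  have hK := B.one_le
  refine UnifBdd.of_deriv (fun ω hω y => (B.hasDerivAt_W hω j y).sub_const 1)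
    (fun _ => ⟨4 * B.K, by linarith, fun ω hω y => ?_⟩)
    ((B.unifBdd_W' hN le_rfl j).weaken_one fun ω hω y =>
      mul_le_mul_of_nonneg_left ((B.slow_le_one hω y).trans (by linarith [abs_nonneg y]))
        (B.eps_pos hω).le)
  have he := B.eps_pos hω
  have h1 := B.P_sub ω hω y
  have h2 := B.D_le ω hω y
  have h3 : 1 - B.α ω * |y| ≤ B.slow ω y := by
    have := Real.add_one_le_exp (-B.α ω * |y|)
    rw [slow]; linarith
  have h4 := B.slow_le_one hω y
  have h5 := (B.fast_le_slow hω y).trans h4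
  have h6 := mul_le_mul_of_nonneg_right (B.alpha_le_eps hω) (abs_nonneg y)
  have h7 : B.K * eps g ω * B.slow ω y ≤ B.K * eps g ω * 1 := by gcongr
  have h8 : B.K * eps g ω * B.fast ω y ≤ B.K * eps g ω * 1 := by gcongr
  have h9 : |sg j * B.D ω y| ≤ B.K * eps g ω * B.fast ω y := by
    rw [abs_mul, abs_sg, one_mul]; exact h2
  have h10 : 0 ≤ B.K * eps g ω * |y| := by positivity
  have e : B.W j ω y - 1 = (B.P ω y - B.slow ω y) + (B.slow ω y - 1) + sg j * B.D ω y := by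
    rw [W]; ring
  rw [e]
  refine (abs_add_le _ _).trans ((add_le_add (abs_add_le _ _) le_rfl).trans ?_)
  have h11 : |B.slow ω y - 1| ≤ B.α ω * |y| := by
    rw [abs_sub_comm, abs_of_nonneg (by linarith)]; linarith
  have h12 : |B.P ω y - B.slow ω y| ≤ B.K * eps g ω * B.slow ω y := h1
  have h13 : 0 ≤ B.K * eps g ω := by positivity
  have h14 : 4 * B.K * (eps g ω * (1 + |y|)) = 4 * (B.K * eps g ω) + 4 * (B.K * eps g ω * |y|) := by
    ring
  linarith

theorem unifBdd_Wd (h1 : 1 ≤ N) (j : Fin 2) :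
    B.UB N N (B.Wd j) (fun ω y => eps g ω / ω * (1 + |y|) * B.slow ω y) :=
  (B.unifBdd_Pd hN h1).add (((B.unifBdd_Dd hN h1).const_mul _).weaken_one fun ω hω y =>
    mul_le_mul_of_nonneg_left (B.fast_le_slow hω y)
      (mul_nonneg (div_nonneg (B.eps_pos hω).le hω.1.le) (by positivity)))

theorem unifBdd_W'd (hn : n + 1 ≤ N) (j : Fin 2) :
    B.UB N n (B.W'd j) (fun ω y => eps g ω / ω * (1 + |y|) * B.slow ω y) :=
  (B.unifBdd_PdDd hN hn).2.1.add (((B.unifBdd_PdDd hN hn).2.2.2.const_mul _).weaken_one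
    fun ω hω y => mul_le_mul_of_nonneg_left (B.fast_le_slow hω y)
      (mul_nonneg (div_nonneg (B.eps_pos hω).le hω.1.le) (by positivity)))

theorem unifBdd_a (hn : n ≤ N) : B.UB N n (pot g (afun g)) (fun ω y => eps g ω * wt y) :=
  B.H.unifBdd_pot hN hn ((B.H.unifBdd_gam hN (k := 0) hn).sub
    ((B.H.unifBdd_gamI hN hn).const_mul 2))

omit hN in
theorem bdd_of_eps_wt {F : ℝ → ℝ → ℝ} (h : B.UB N n F (fun ω y => eps g ω * wt y)) :
    B.UB N n F (fun _ _ => 1) :=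
  h.weaken_one fun _ hω y => mul_le_one₀ (B.eps_le_one hω) (wt_pos y).le (wt_le_one y)

omit hN in
theorem slow_of_eps {F : ℝ → ℝ → ℝ} (h : B.UB N n F (fun ω y => eps g ω * B.slow ω y)) :
    B.UB N n F B.slow :=
  h.weaken_one fun ω hω y => mul_le_of_le_one_left (B.slow_pos ω y).le (B.eps_le_one hω)

theorem unifBdd_h (hn : n ≤ N) : B.UB N n (hf g) (fun _ _ => 1) := B.H.unifBdd_hf hN hn

theorem unifBdd_h_sq (hn : n ≤ N) : B.UB N n (fun ω y => hf g ω y ^ 2) (fun _ _ => 1) :=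
  ((B.unifBdd_h hN hn).mul_bdd (B.unifBdd_h hN hn)).congr fun _ _ _ => sq _

omit hN in
theorem unifBdd_alpha_sq : B.UB N n (fun ω _ => B.α ω ^ 2) (fun ω _ => eps g ω) :=
  (B.unifBdd_alpha.mul_bdd (B.H.bdd_of_eps B.unifBdd_alpha)).congr fun _ _ _ => sq _

omit hN in
theorem unifBdd_lam : B.UB N n (fun ω _ => B.lam ω) (fun _ _ => 1) :=
  (UnifBdd.const_one 1).sub (B.H.bdd_of_eps B.unifBdd_alpha_sq)

theorem unifBdd_V₀ (hn : n ≤ N) : B.UB N n B.V₀ B.slow :=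
  ((((B.unifBdd_h_sq hN hn).const_mul 2).bdd_mul ((B.unifBdd_W hN 0).of_le (by omega))).add
    (((B.unifBdd_h hN hn).const_mul 2).bdd_mul (B.slow_of_eps (B.unifBdd_W' hN hn 0)))).sub
    (B.unifBdd_lam.bdd_mul ((B.unifBdd_W hN 1).of_le (by omega)))

theorem unifBdd_V₁ (hn : n ≤ N) : B.UB N n B.V₁ B.slow :=
  (((((UnifBdd.const_one 1).add (B.bdd_of_eps_wt (B.unifBdd_a hN hn))).const_mul 2).bdd_mul
    ((B.unifBdd_W hN 1).of_le (by omega))).add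
    (((B.unifBdd_h hN hn).const_mul 2).bdd_mul (B.slow_of_eps (B.unifBdd_W' hN hn 1)))).sub
    (B.unifBdd_lam.bdd_mul ((B.unifBdd_W hN 0).of_le (by omega)))

omit hN in
theorem unifBdd_tanh : B.UB N n (fun _ => Real.tanh) (fun _ _ => 1) := by
  have hb : ControlledUpTo g N → ∃ C > 0, ∀ ω ∈ Ioo 0 B.ω₁, ∀ y : ℝ, |Real.tanh y| ≤ C * 1 :=
    fun _ => ⟨1, one_pos, fun _ _ y => by rw [mul_one]; exact (Real.abs_tanh_lt_one y).le⟩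
  induction n with
  | zero =>
    exact UnifBdd.zero_of (fun _ _ => continuous_iff_continuousAt.2 fun y =>
      (hasDerivAt_tanh y).continuousAt) hb
  | succ n ih =>
    exact UnifBdd.of_deriv (fun _ _ y => hasDerivAt_tanh y) hb
      (((UnifBdd.const_one 1).sub (ih.mul_bdd ih)).congr fun _ _ _ => by rw [sq])

/-- The logarithmic derivative of `Q_ω` is close to that of `Q`. -/
theorem unifBdd_h_add_tanh (hn : n ≤ N) :
    B.UB N n (fun ω y => hf g ω y + Real.tanh y) (fun ω y => eps g ω * (1 + |y|)) := by
  have hb : ControlledUpTo g N → ∃ C > 0, ∀ ω ∈ Ioo 0 B.ω₁, ∀ y : ℝ,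
      |hf g ω y + Real.tanh y| ≤ C * (eps g ω * (1 + |y|)) := fun _ => ⟨6, by norm_num,
    fun ω hω y => (B.H.abs_hf_add_tanh_le hω y).trans (by linarith [B.eps_pos hω])⟩
  induction n with
  | zero => exact UnifBdd.zero_of (fun ω hω =>
      ((B.unifBdd_h hN hn).1 ω hω).continuous.add
        (continuous_iff_continuousAt.2 fun y => (hasDerivAt_tanh y).continuousAt)) hb
  | succ n ih =>
    have ih := ih (by omega)
    refine UnifBdd.of_deriv (fun ω hω y => (B.H.hasDerivAt_hf' hω y).add (hasDerivAt_tanh y)) hb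
      ((((B.unifBdd_h hN (n := n) (by omega)).sub B.unifBdd_tanh).bdd_mul ih).sub
        ((B.unifBdd_a hN (n := n) (by omega)).weaken_one fun ω hω y =>
          mul_le_mul_of_nonneg_left ((wt_le_one y).trans (by linarith [abs_nonneg y]))
          (B.eps_pos hω).le) |>.congr fun ω hω y => ?_)
    ring

omit hN in
theorem le_eps_one_add {F : ℝ → ℝ → ℝ} (h : B.UB N n F (fun ω y => eps g ω * B.slow ω y)) :
    B.UB N n F (fun ω y => eps g ω * (1 + |y|)) :=
  h.weaken_one fun ω hω y => mul_le_mul_of_nonneg_left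
    ((B.slow_le_one hω y).trans (by linarith [abs_nonneg y])) (B.eps_pos hω).le

theorem unifBdd_V₀_sub (hn : n ≤ N) :
    B.UB N n (fun ω y => B.V₀ ω y - (1 - cubicQ y ^ 2)) (fun ω y => eps g ω * (1 + |y|)) := by
  have h1 : ∀ ω ∈ Ioo 0 B.ω₁, ∀ y : ℝ, eps g ω ≤ eps g ω * (1 + |y|) := fun ω hω y =>
    le_mul_of_one_le_right (B.eps_pos hω).le (by linarith [abs_nonneg y])
  refine ((((((((B.unifBdd_h hN hn).sub B.unifBdd_tanh).const_mul 2).bdd_mul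
    (B.unifBdd_h_add_tanh hN hn)).add (((B.unifBdd_h_sq hN hn).const_mul 2).bdd_mul
    ((B.unifBdd_W_sub_one hN 0).of_le (by omega)))).add
    (((B.unifBdd_h hN hn).const_mul 2).bdd_mul (B.le_eps_one_add (B.unifBdd_W' hN hn 0)))).sub
    (B.unifBdd_lam.bdd_mul ((B.unifBdd_W_sub_one hN 1).of_le (by omega)))).add
    (B.unifBdd_alpha_sq.weaken_one h1)).congr fun ω hω y => ?_
  have hq : cubicQ y ^ 2 = 2 * (1 - Real.tanh y ^ 2) := by
    rw [one_sub_tanh_sq, cubicQ, div_pow, Real.sq_sqrt (by norm_num)]; ring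
  rw [hq, V₀, lam]
  ring

theorem unifBdd_V₁_sub (hn : n ≤ N) :
    B.UB N n (fun ω y => B.V₁ ω y - 1) (fun ω y => eps g ω * (1 + |y|)) := by
  have h1 : ∀ ω ∈ Ioo 0 B.ω₁, ∀ y : ℝ, eps g ω ≤ eps g ω * (1 + |y|) := fun ω hω y =>
    le_mul_of_one_le_right (B.eps_pos hω).le (by linarith [abs_nonneg y])
  have hW := (B.unifBdd_W hN 1).of_le (m := n) (by omega)
  refine (((((((B.unifBdd_W_sub_one hN 1).of_le (m := n) (by omega)).const_mul 2).add
    (((B.unifBdd_a hN hn).mul hW |>.const_mul 2).weaken_one fun ω hω y => ?_)).add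
    (((B.unifBdd_h hN hn).const_mul 2).bdd_mul (B.le_eps_one_add (B.unifBdd_W' hN hn 1)))).sub
    (B.unifBdd_lam.bdd_mul ((B.unifBdd_W_sub_one hN 0).of_le (by omega)))).add
    (B.unifBdd_alpha_sq.weaken_one h1)).congr fun ω hω y => ?_
  · rw [mul_assoc]
    exact mul_le_mul_of_nonneg_left ((mul_le_one₀ (wt_le_one y) (B.slow_pos ω y).le
      (B.slow_le_one hω y)).trans (by linarith [abs_nonneg y])) (B.eps_pos hω).le
  · rw [V₁, lam]
    ring

theorem unifBdd_hfd (hn : n ≤ N) : B.UB N n B.hfd (fun ω y => 1 / ω * (1 + |y|)) := by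
  have hw : B.UB N n (fun ω _ => 1 / ω) (fun ω _ => 1 / ω) :=
    UnifBdd.const fun _ => ⟨1, one_pos, fun ω hω => by
      rw [abs_of_pos (one_div_pos.2 hω.1), one_mul]⟩
  refine (hw.mul ((((B.H.unifBdd_sf hN hn).weaken_one fun _ _ y => wt_le_one y).bdd_mul
    (B.H.unifBdd_bigGam' hN hn)).bdd_mul (B.H.unifBdd_jf hN hn))).congr fun ω hω y => ?_
  rw [hfd]; ring

theorem unifBdd_Vd (hn : n + 1 ≤ N) :
    B.UB N n B.Vd₀ (fun ω y => 1 / ω * (1 + |y|) * B.slow ω y) ∧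
    B.UB N n B.Vd₁ (fun ω y => 1 / ω * (1 + |y|) * B.slow ω y) := by
  have hn0 : n ≤ N := by omega
  have hh := B.unifBdd_h hN hn0
  have hd := B.unifBdd_hfd hN hn0
  have hW := fun j => (B.unifBdd_W hN j).of_le (m := n) (by omega)
  have hW' := fun j => B.slow_of_eps (B.unifBdd_W' hN hn0 j)
  have hw : ∀ ω ∈ Ioo 0 B.ω₁, ∀ y : ℝ, 0 ≤ 1 / ω * (1 + |y|) := fun ω hω y =>
    mul_nonneg (one_div_pos.2 hω.1).le (by positivity)
  have he : ∀ ω ∈ Ioo 0 B.ω₁, eps g ω / ω ≤ 1 / ω := fun ω hω =>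
    div_le_div_of_nonneg_right (B.eps_le_one hω) hω.1.le
  have hwk : ∀ ω ∈ Ioo 0 B.ω₁, ∀ y : ℝ, eps g ω / ω * (1 + |y|) * B.slow ω y ≤
      1 / ω * (1 + |y|) * B.slow ω y := fun ω hω y =>
    mul_le_mul_of_nonneg_right (mul_le_mul_of_nonneg_right (he ω hω) (by positivity))
      (B.slow_pos ω y).le
  have hWd := fun j => ((B.unifBdd_Wd hN (by omega) j).of_le (m := n) hn0).weaken_one hwk
  have hW'd := fun j => (B.unifBdd_W'd hN hn j).weaken_one hwk
  have haa := ((B.H.bdd_of_eps (B.unifBdd_alpha (N := N) (n := n))).const_mul 2).bdd_mul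
    (B.unifBdd_alphad (N := N) (n := n))
  have haa1 := haa.neg.weaken_one (M' := fun ω y => 1 / ω * (1 + |y|)) fun ω hω y =>
    (he ω hω).trans (le_mul_of_one_le_right (one_div_pos.2 hω.1).le (by linarith [abs_nonneg y]))
  have ha := B.unifBdd_a hN hn0
  have had := (B.H.unifBdd_potD hN (n := n) hn0 (φ := afun g) (φθ := ath g)
    ((B.H.unifBdd_gam hN (k := 0) (by omega)).sub ((B.H.unifBdd_gamI hN (by omega)).const_mul 2))
    (((B.H.unifBdd_gam hN (k := 1) (by omega)).sub (B.H.unifBdd_gam hN (k := 0) (by omega))).sub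
      (((B.H.unifBdd_gam hN (k := 0) (by omega)).sub
        ((B.H.unifBdd_gamI hN (by omega)).const_mul 2)).const_mul 2))).weaken_one
    (M' := fun ω y => 1 / ω * (1 + |y|)) fun ω hω y =>
      (mul_le_of_le_one_right (mul_nonneg (div_nonneg (B.eps_pos hω).le hω.1.le) (by positivity))
        (wt_le_one y)).trans (mul_le_mul_of_nonneg_right (he ω hω) (by positivity))
  constructor
  · exact (((((hh.const_mul 4).bdd_mul hd).mul (hW 0)).add
      (((B.unifBdd_h_sq hN hn0).const_mul 2).bdd_mul (hWd 0))).add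
      (((hd.const_mul 2).mul (hW' 0)).add ((hh.const_mul 2).bdd_mul (hW'd 0)))).sub
      ((haa1.mul (hW 1)).add (B.unifBdd_lam.bdd_mul (hWd 1))) |>.congr fun ω hω y => by
        rw [Vd₀]
  · exact ((((had.const_mul 2).mul (hW 1)).add
      ((((UnifBdd.const_one 1).add (B.bdd_of_eps_wt ha)).const_mul 2).bdd_mul (hWd 1))).add
      (((hd.const_mul 2).mul (hW' 1)).add ((hh.const_mul 2).bdd_mul (hW'd 1)))).sub
      ((haa1.mul (hW 0)).add (B.unifBdd_lam.bdd_mul (hWd 0))) |>.congr fun ω hω y => by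
        rw [Vd₁]

end

end EigenBranch

/-! ### Decay and asymptotics -/

theorem wt_le_exp (y : ℝ) : wt y ≤ Real.exp (-|y|) :=
  Real.exp_le_exp.2 (by linarith [abs_nonneg y])

theorem integral_exp_neg_mul_abs {c : ℝ} (hc : 0 < c) :
    ∫ y : ℝ, Real.exp (-c * |y|) = 2 / c := by
  rw [integral_comp_abs (f := fun y => Real.exp (-c * y)), integral_exp_mul_Ioi (neg_lt_zero.2 hc)]
  simp only [mul_zero, Real.exp_zero]
  field_simp

/-- A continuous function that is close to `e^{-2a|y|}` is integrable, with integral close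
to `1/a`. -/
theorem integrable_and_abs_integral_sub_le {F : ℝ → ℝ} (hF : Continuous F) {a C e : ℝ} (ha : 0 < a)
    (h : ∀ y, |F y - Real.exp (-(2 * a) * |y|)| ≤
      C * (e * Real.exp (-(2 * a) * |y|) + Real.exp (-|y|))) :
    Integrable F ∧ |(∫ y, F y) - 1 / a| ≤ C * (e / a + 2) := by
  have h1 : Integrable fun y : ℝ => Real.exp (-(2 * a) * |y|) :=
    integrable_exp_neg_mul_abs (by linarith)
  have h2 : Integrable fun y : ℝ => Real.exp (-|y|) := by
    simpa using integrable_exp_neg_mul_abs one_pos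
  have h3 : Integrable fun y : ℝ => C * (e * Real.exp (-(2 * a) * |y|) + Real.exp (-|y|)) :=
    ((h1.const_mul e).add h2).const_mul C
  have h4 : Integrable fun y => F y - Real.exp (-(2 * a) * |y|) :=
    h3.mono' (by fun_prop) (.of_forall h)
  have hFi : Integrable F := (h4.add h1).congr (.of_forall fun y => by simp)
  refine ⟨hFi, ?_⟩
  have e1 : ∫ y : ℝ, Real.exp (-(2 * a) * |y|) = 1 / a := by
    rw [integral_exp_neg_mul_abs (by linarith)]; field_simp
  have e2 : ∫ y : ℝ, Real.exp (-|y|) = 2 := by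
    simpa using integral_exp_neg_mul_abs one_pos
  rw [← e1, ← integral_sub hFi h1]
  refine (norm_integral_le_of_norm_le (f := fun y => F y - Real.exp (-(2 * a) * |y|)) h3
    (.of_forall h)).trans_eq ?_
  rw [integral_const_mul, integral_add (h1.const_mul e) h2, integral_const_mul, e1, e2]
  ring

namespace EigenBranch

variable {g : ℝ → ℝ} (B : EigenBranch g) {ω : ℝ}

include B in
theorem contDiffOn_four : ContDiffOn ℝ (4 : ℕ) g (Ioi 0) := B.H.h1.controlledUpTo_four.1

include B in
theorem controlled_four : ControlledUpTo g 4 := B.H.h1.controlledUpTo_four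

theorem unifBdd_one_sub_h_sq : B.UB 4 0 (fun ω y => 1 - hf g ω y ^ 2) (fun _ y => wt y) := by
  have hN := B.contDiffOn_four
  refine ((B.H.unifBdd_sf hN (n := 0) (by omega)).mul_bdd ((UnifBdd.const_one (1 / 2)).add
    (B.H.bdd_of_eps (B.H.unifBdd_gamI hN (n := 0) (by omega))))).congr fun ω hω y => ?_
  rw [B.H.hf_sq hω]
  ring

/-- One factor `α` is bounded by `ε`, the other one by `I`. -/
theorem unifBdd_alpha_sq_sharp : B.UB 4 0 (fun ω _ => B.α ω ^ 2)
    (fun ω _ => eps g ω * intI g ω) := by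
  have hK := B.one_le
  refine UnifBdd.const fun _ => ⟨4 * B.K ^ 2, by positivity, fun ω hω => ?_⟩
  have h0 := (B.alpha_pos hω).le
  have h1 := mul_le_mul (B.alpha_le_eps hω) (B.alpha_le_intI hω) h0
    (h0.trans (B.alpha_le_eps hω))
  rw [abs_of_nonneg (by positivity)]
  linarith

theorem unifBdd_D₁ : B.UB 4 0 B.D₁ (fun ω y => eps g ω * B.fast ω y) :=
  (B.unifBdd_PD B.contDiffOn_four (n := 0) (by omega)).2.2.2

theorem eps_fast_le_exp (hω : ω ∈ Ioo 0 B.ω₁) (y : ℝ) :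
    eps g ω * B.fast ω y ≤ Real.exp (-|y|) :=
  (mul_le_of_le_one_left (B.fast_pos ω y).le (B.eps_le_one hω)).trans (B.fast_le_exp hω y)

theorem eps_wt_le_exp (hω : ω ∈ Ioo 0 B.ω₁) (y : ℝ) : eps g ω * wt y ≤ Real.exp (-|y|) :=
  (mul_le_of_le_one_left (wt_pos y).le (B.eps_le_one hω)).trans (wt_le_exp y)

theorem bdd_of_slow {F : ℝ → ℝ → ℝ} (h : B.UB 4 0 F B.slow) : B.UB 4 0 F (fun _ _ => 1) :=
  h.weaken_one fun _ hω y => B.slow_le_one hω y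

/-- The first derivatives of `V₁, V₂`: at the leading order `∂_y V₁ = 2h(2h² - 2)W₁`, which is
localized, and all other terms are `O(ε e^{-α|y|})`. -/
theorem unifBdd_V' : B.UB 4 0 B.V₀' (fun ω y => eps g ω * B.slow ω y + Real.exp (-|y|)) ∧
    B.UB 4 0 B.V₁' (fun ω y => eps g ω * B.slow ω y + Real.exp (-|y|)) := by
  have hN := B.contDiffOn_four
  have hh := B.unifBdd_h hN (n := 0) (by omega)
  have hh2 := B.unifBdd_h_sq hN (n := 0) (by omega)
  have ha := B.unifBdd_a hN (n := 0) (by omega)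
  have hW := fun j => (B.unifBdd_W hN j).of_le (m := 0) (by omega)
  have hW1 := fun j => B.bdd_of_slow (hW j)
  have hW' := fun j => B.unifBdd_W' hN (n := 0) (by omega) j
  have hl : B.UB 4 0 (fun ω _ => B.lam ω) (fun _ _ => 1) := B.unifBdd_lam
  have hal : B.UB 4 0 (fun ω _ => B.α ω ^ 2) (fun ω _ => eps g ω) := B.unifBdd_alpha_sq
  have hD : B.UB 4 0 B.D (fun ω y => eps g ω * B.slow ω y) :=
    ((B.unifBdd_D hN).of_le (m := 0) (by omega)).weaken_one fun ω hω y =>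
      mul_le_mul_of_nonneg_left (B.fast_le_slow hω y) (B.eps_pos hω).le
  have hloc : ∀ {F : ℝ → ℝ → ℝ}, B.UB 4 0 F (fun _ y => wt y) →
      B.UB 4 0 F (fun ω y => eps g ω * B.slow ω y + Real.exp (-|y|)) := fun h =>
    h.weaken_one fun ω hω y => (wt_le_exp y).trans (le_add_of_nonneg_left
      (mul_nonneg (B.eps_pos hω).le (B.slow_pos ω y).le))
  have hsl : ∀ {F : ℝ → ℝ → ℝ}, B.UB 4 0 F (fun ω y => eps g ω * B.slow ω y) →
      B.UB 4 0 F (fun ω y => eps g ω * B.slow ω y + Real.exp (-|y|)) := fun h =>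
    h.weaken_one fun ω hω y => le_add_of_nonneg_right (Real.exp_pos _).le
  have ha1 : B.UB 4 0 (pot g (afun g)) (fun _ y => wt y) := ha.weaken_one fun ω hω y =>
    mul_le_of_le_one_left (wt_pos y).le (B.eps_le_one hω)
  have ha0 := B.bdd_of_eps_wt ha
  have hq := ((hh2.const_mul 2).sub (UnifBdd.const_one 1)).sub ha0
  constructor
  · refine ((hloc ((hh.const_mul 2).bdd_mul
      (((B.unifBdd_one_sub_h_sq.const_mul (-2)).sub ha1).mul_bdd (hW1 0)))).add
      (hsl ((((hh.const_mul 2).bdd_mul ((hD.const_mul 2).add (hal.mul (hW 1)))).add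
        ((hq.const_mul 2).bdd_mul (hW' 0))).sub (hl.bdd_mul (hW' 1))))).congr fun ω hω y => ?_
    simp only [V₀', W, W', sg_zero, sg_one, lam]
    ring
  · refine ((hloc ((hh.const_mul 2).bdd_mul (ha1.mul_bdd (hW1 1)))).add
      (hsl ((((hh.const_mul 2).bdd_mul ((hD.const_mul (-2)).add (hal.mul (hW 0)))).add
        ((hh2.const_mul 2).bdd_mul (hW' 1))).sub (hl.bdd_mul (hW' 0))))).congr fun ω hω y => ?_
    simp only [V₁', W, W', sg_zero, sg_one, lam]
    ring

/-- The second derivatives of `V₁, V₂`. The terms without decay at the rate `1` carry a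
factor `α²`, which is of the order `ε I`. -/
theorem unifBdd_V'' : B.UB 4 0 (fun ω y => (6 * hf g ω y ^ 2 - 5 - 5 * pot g (afun g) ω y
      - 2 * pot g (cfun g) ω y) * B.V₀ ω y - B.lam ω * B.V₁ ω y)
      (fun ω y => eps g ω * intI g ω * B.slow ω y + Real.exp (-|y|)) ∧
    B.UB 4 0 (fun ω y => (2 * hf g ω y ^ 2 - 1 - pot g (afun g) ω y) * B.V₁ ω y
      - B.lam ω * B.V₀ ω y)
      (fun ω y => eps g ω * intI g ω * B.slow ω y + Real.exp (-|y|)) := by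
  have hN := B.contDiffOn_four
  have hh := B.unifBdd_h hN (n := 0) (by omega)
  have hW := fun j => (B.unifBdd_W hN j).of_le (m := 0) (by omega)
  have hW1 := fun j => B.bdd_of_slow (hW j)
  have hW' := fun j => B.slow_of_eps (B.unifBdd_W' hN (n := 0) (by omega) j)
  have hV₀ := B.bdd_of_slow (B.unifBdd_V₀ hN (n := 0) (by omega))
  have hV₁ := B.bdd_of_slow (B.unifBdd_V₁ hN (n := 0) (by omega))
  have hl : B.UB 4 0 (fun ω _ => B.lam ω) (fun _ _ => 1) := B.unifBdd_lam
  have hal := B.unifBdd_alpha_sq_sharp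
  have hal1 : B.UB 4 0 (fun ω _ => 1 + B.α ω ^ 2) (fun _ _ => 1) :=
    (UnifBdd.const_one 1).add (B.H.bdd_of_eps B.unifBdd_alpha_sq)
  have hloc : ∀ {F : ℝ → ℝ → ℝ}, B.UB 4 0 F (fun _ y => Real.exp (-|y|)) →
      B.UB 4 0 F (fun ω y => eps g ω * intI g ω * B.slow ω y + Real.exp (-|y|)) := fun h =>
    h.weaken_one fun ω hω y => le_add_of_nonneg_left
      (mul_nonneg (mul_nonneg (B.eps_pos hω).le (B.intI_pos hω).le) (B.slow_pos ω y).le)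
  have hsl : ∀ {F : ℝ → ℝ → ℝ}, B.UB 4 0 F (fun ω y => eps g ω * intI g ω * B.slow ω y) →
      B.UB 4 0 F (fun ω y => eps g ω * intI g ω * B.slow ω y + Real.exp (-|y|)) := fun h =>
    h.weaken_one fun ω hω y => le_add_of_nonneg_right (Real.exp_pos _).le
  have ha := (B.unifBdd_a hN (n := 0) (by omega)).weaken_one fun ω hω y => B.eps_wt_le_exp hω y
  have hc := (B.unifBdd_c hN (n := 0) (by omega)).weaken_one fun ω hω y => B.eps_wt_le_exp hω y
  have hk := B.unifBdd_one_sub_h_sq.weaken_one fun ω hω y => wt_le_exp y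
  have hD := ((B.unifBdd_D hN).of_le (m := 0) (by omega)).weaken_one
    fun ω hω y => B.eps_fast_le_exp hω y
  have hD₁ := B.unifBdd_D₁.weaken_one fun ω hω y => B.eps_fast_le_exp hω y
  constructor
  · refine ((hloc (((((((hk.const_mul (-6)).sub (ha.const_mul 5)).sub (hc.const_mul 2)).mul_bdd
      hV₀).sub ((hk.const_mul 2).mul_bdd (hW1 0))).add ((hl.const_mul 6).bdd_mul hD)).sub
      ((hl.const_mul 2).bdd_mul (ha.mul_bdd (hW1 1))) |>.add
      ((hh.const_mul 4).bdd_mul hD₁))).add (hsl ((hal.mul (hal1.bdd_mul (hW 0))).add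
      (hal.mul ((hh.const_mul 2).bdd_mul (hW' 1)))))).congr fun ω hω y => ?_
    simp only [V₀, V₁, W, W', sg_zero, sg_one, lam]
    ring
  · refine ((hloc (((((((hk.const_mul (-2)).sub ha).mul_bdd hV₁).add
      ((hl.const_mul 2).bdd_mul (hk.mul_bdd (hW1 0)))).sub ((hl.const_mul 6).bdd_mul hD)).add
      ((ha.const_mul 2).mul_bdd (hW1 1))).sub
      ((hh.const_mul 4).bdd_mul hD₁))).add (hsl ((hal.mul (hal1.bdd_mul (hW 1))).add
      (hal.mul ((hh.const_mul 2).bdd_mul (hW' 0)))))).congr fun ω hω y => ?_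
    simp only [V₀, V₁, W, W', sg_zero, sg_one, lam]
    ring

theorem unifBdd_slow : B.UB 4 0 B.slow B.slow :=
  UnifBdd.zero_of (fun ω _ => by unfold slow; fun_prop) fun _ => ⟨1, one_pos, fun ω _ y => by
    rw [one_mul, abs_of_pos (B.slow_pos ω y)]⟩

/-- For `W` the limit profile is `e^{-α|y|}`, with a relative error of size `ε`. -/
theorem unifBdd_W_sub_slow (j : Fin 2) :
    B.UB 4 0 (fun ω y => B.W j ω y - B.slow ω y) (fun ω y => eps g ω * B.slow ω y) := by
  have hN := B.contDiffOn_four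
  have hP : B.UB 4 0 (fun ω y => B.P ω y - B.slow ω y) (fun ω y => eps g ω * B.slow ω y) :=
    UnifBdd.zero_of (fun ω hω => (((B.unifBdd_P hN).of_le (m := 0) (by omega)).sub
      B.unifBdd_slow).1 ω hω |>.continuous) fun _ => ⟨B.K, by linarith [B.one_le], fun ω hω y =>
        (B.P_sub ω hω y).trans_eq (mul_assoc _ _ _)⟩
  refine (hP.add ((((B.unifBdd_D hN).of_le (m := 0) (by omega)).const_mul (sg j)).weaken_one
    fun ω hω y => mul_le_mul_of_nonneg_left (B.fast_le_slow hω y) (B.eps_pos hω).le)).congr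
    fun ω hω y => ?_
  rw [W]
  ring

theorem cubicQ_sq (y : ℝ) : cubicQ y ^ 2 = 2 * (1 - Real.tanh y ^ 2) := by
  rw [one_sub_tanh_sq, cubicQ, div_pow, Real.sq_sqrt (by norm_num)]
  ring

theorem unifBdd_V_sub_slow :
    B.UB 4 0 (fun ω y => B.V₀ ω y - (1 - cubicQ y ^ 2) * B.slow ω y)
      (fun ω y => eps g ω * B.slow ω y) ∧
    B.UB 4 0 (fun ω y => B.V₁ ω y - B.slow ω y) (fun ω y => eps g ω * B.slow ω y) := by
  have hN := B.contDiffOn_four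
  have hh := B.unifBdd_h hN (n := 0) (by omega)
  have ht : B.UB 4 0 (fun _ => Real.tanh) (fun _ _ => 1) := B.unifBdd_tanh
  have hht : B.UB 4 0 (fun ω y => hf g ω y ^ 2 - Real.tanh y ^ 2) (fun ω _ => eps g ω) :=
    UnifBdd.zero_of (fun ω hω => ((hh.1 ω hω).continuous.pow 2).sub
      ((ht.1 ω hω).continuous.pow 2)) fun _ => ⟨48, by norm_num, fun ω hω y =>
        B.H.abs_hf_sq_sub_le hω y⟩
  have hW := fun j => (B.unifBdd_W hN j).of_le (m := 0) (by omega)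
  have hW' := fun j => B.unifBdd_W' hN (n := 0) (by omega) j
  have hs := B.unifBdd_W_sub_slow
  have hal : B.UB 4 0 (fun ω _ => B.α ω ^ 2) (fun ω _ => eps g ω) := B.unifBdd_alpha_sq
  have ha : B.UB 4 0 (pot g (afun g)) (fun ω _ => eps g ω) :=
    (B.unifBdd_a hN (n := 0) (by omega)).weaken_one fun ω hω y =>
      mul_le_of_le_one_right (B.eps_pos hω).le (wt_le_one y)
  constructor
  · refine ((((((hht.const_mul 2).mul (hW 0)).add
      (((ht.mul_bdd ht).const_mul 2).bdd_mul (hs 0))).add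
      ((hh.const_mul 2).bdd_mul (hW' 0))).sub (hs 1)).add (hal.mul (hW 1))).congr fun ω hω y => ?_
    simp only [V₀, cubicQ_sq, lam]
    ring
  · refine ((((((hs 1).const_mul 2).add ((ha.const_mul 2).mul (hW 1))).add
      ((hh.const_mul 2).bdd_mul (hW' 1))).sub (hs 0)).add (hal.mul (hW 0))).congr fun ω hω y => ?_
    simp only [V₁, lam]
    ring

theorem slow_sq (ω y : ℝ) : B.slow ω y * B.slow ω y = Real.exp (-(2 * B.α ω) * |y|) := by
  rw [slow, ← Real.exp_add]
  congr 1
  ring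

theorem unifBdd_products :
    B.UB 4 0 (fun ω y => B.W 0 ω y * B.W 1 ω y - B.slow ω y * B.slow ω y)
      (fun ω y => eps g ω * (B.slow ω y * B.slow ω y) + Real.exp (-|y|)) ∧
    B.UB 4 0 (fun ω y => B.V₀ ω y * B.V₁ ω y - B.slow ω y * B.slow ω y)
      (fun ω y => eps g ω * (B.slow ω y * B.slow ω y) + Real.exp (-|y|)) := by
  have hN := B.contDiffOn_four
  have hW := fun j => (B.unifBdd_W hN j).of_le (m := 0) (by omega)
  have hs := B.unifBdd_W_sub_slow
  have h0 := B.unifBdd_slow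
  have hV₁ := B.unifBdd_V₁ hN (n := 0) (by omega)
  have ht : B.UB 4 0 (fun _ => Real.tanh) (fun _ _ => 1) := B.unifBdd_tanh
  have hsl : ∀ {F : ℝ → ℝ → ℝ}, B.UB 4 0 F (fun ω y => eps g ω * B.slow ω y * B.slow ω y) →
      B.UB 4 0 F (fun ω y => eps g ω * (B.slow ω y * B.slow ω y) + Real.exp (-|y|)) := fun h =>
    h.weaken_one fun ω hω y => (mul_assoc _ _ _).le.trans
      (le_add_of_nonneg_right (Real.exp_pos _).le)
  have hQ : B.UB 4 0 (fun _ y => 1 - Real.tanh y ^ 2) (fun _ y => Real.exp (-|y|)) :=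
    UnifBdd.zero_of (fun ω hω => continuous_const.sub ((ht.1 ω hω).continuous.pow 2))
      fun _ => ⟨4, by norm_num, fun ω hω y => by
        rw [one_sub_tanh_sq, abs_of_pos (by have := Real.cosh_pos y; positivity)]
        refine (one_div_cosh_sq_le y).trans (mul_le_mul_of_nonneg_left (Real.exp_le_exp.2 ?_)
          (by norm_num))
        linarith [abs_nonneg y]⟩
  have hQ1 : B.UB 4 0 (fun _ y => 1 - 2 * (1 - Real.tanh y ^ 2)) (fun _ _ => 1) :=
    (UnifBdd.const_one 1).sub ((hQ.const_mul 2).weaken_one fun _ _ y =>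
      Real.exp_le_one_iff.2 (neg_nonpos.2 (abs_nonneg y)))
  have h00 := B.bdd_of_slow h0
  have hloc : ∀ {F : ℝ → ℝ → ℝ}, B.UB 4 0 F (fun _ y => Real.exp (-|y|)) →
      B.UB 4 0 F (fun ω y => eps g ω * (B.slow ω y * B.slow ω y) + Real.exp (-|y|)) := fun h =>
    h.weaken_one fun ω hω y => le_add_of_nonneg_left
      (mul_nonneg (B.eps_pos hω).le (mul_self_nonneg _))
  constructor
  · refine (hsl (((hs 0).mul (hW 1)).add ((hs 1).mul h0))).congr fun ω hω y => ?_
    ring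
  · refine ((hsl ((B.unifBdd_V_sub_slow.1.mul hV₁).add
      ((hQ1.bdd_mul B.unifBdd_V_sub_slow.2).mul h0))).sub
      (hloc (((hQ.const_mul 2).mul_bdd h00).mul_bdd h00))).congr fun ω hω y => ?_
    rw [cubicQ_sq]
    ring

/-- The masses `∫ W₁W₂` and `∫ V₁V₂`, which are `1/α` up to `O(ϱ/I)`. -/
theorem exists_integral_le : ∃ C > 0, ∀ ω ∈ Ioo 0 B.ω₁,
    Integrable (fun y => B.W 0 ω y * B.W 1 ω y) ∧ Integrable (fun y => B.V₀ ω y * B.V₁ ω y) ∧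
    |(∫ y, B.W 0 ω y * B.W 1 ω y) - 1 / B.α ω| + |(∫ y, B.V₀ ω y * B.V₁ ω y) - 1 / B.α ω| ≤
      C * (rho g ω / intI g ω) := by
  have hN := B.contDiffOn_four
  obtain ⟨C₁, hC₁, h1⟩ := B.unifBdd_products.1.le B.controlled_four
  obtain ⟨C₂, hC₂, h2⟩ := B.unifBdd_products.2.le B.controlled_four
  have hK := B.one_le
  refine ⟨(C₁ + C₂) * (8 * B.K + 2 * B.K ^ 2), by positivity, fun ω hω => ?_⟩
  have hW := fun j => ((B.unifBdd_W hN j).1 ω hω).continuous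
  have hV₀ := ((B.unifBdd_V₀ hN (n := 0) (by omega)).1 ω hω).continuous
  have hV₁ := ((B.unifBdd_V₁ hN (n := 0) (by omega)).1 ω hω).continuous
  obtain ⟨i1, e1⟩ := integrable_and_abs_integral_sub_le ((hW 0).mul (hW 1)) (B.alpha_pos hω)
    fun y => by rw [← B.slow_sq]; exact h1 ω hω y
  obtain ⟨i2, e2⟩ := integrable_and_abs_integral_sub_le (hV₀.mul hV₁) (B.alpha_pos hω)
    fun y => by rw [← B.slow_sq]; exact h2 ω hω y
  refine ⟨i1, i2, (add_le_add e1 e2).trans ?_⟩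
  have he := B.eps_pos hω
  have hI := B.intI_pos hω
  have ha := B.alpha_pos hω
  set r := eps g ω / intI g ω with hr
  have hrK : 1 ≤ B.K * r := by
    rw [hr, mul_div_assoc', le_div_iff₀ hI, one_mul]
    exact B.intI_le ω hω
  have hr0 : 0 < r := div_pos he hI
  have h3 : eps g ω / B.α ω ≤ 8 * r := by
    rw [hr, mul_div_assoc', div_le_div_iff₀ ha hI]
    nlinarith [B.le_alpha ω hω]
  have h4 : rho g ω / intI g ω = r ^ 2 := by
    rw [rho, hr]; field_simp
  rw [h4, ← add_mul, mul_assoc]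
  refine mul_le_mul_of_nonneg_left ?_ (by positivity)
  nlinarith [mul_le_mul_of_nonneg_right hrK hr0.le, mul_le_mul hrK hrK zero_le_one (by linarith)]

end EigenBranch

/-! ### Properties of the eigenfunctions in terms of `ε`, `ϱ` and `I` -/

theorem exists_const_forall_fin_two {q : Fin 2 → ℝ → Prop} (hq : ∀ j a b, a ≤ b → q j a → q j b)
    (h : ∀ j, ∃ C > 0, q j C) : ∃ C > 0, ∀ j, q j C := by
  obtain ⟨C, hC, h0⟩ := h 0
  obtain ⟨C', hC', h1⟩ := h 1
  exact ⟨max C C', lt_max_of_lt_left hC, Fin.forall_fin_two.2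
    ⟨hq _ _ _ (le_max_left _ _) h0, hq _ _ _ (le_max_right _ _) h1⟩⟩

theorem UnifBdd.exists_const_forall {Ω : Set ℝ} {p : Prop} {n : ℕ} {F : Fin 2 → ℝ → ℝ → ℝ}
    {M : ℝ → ℝ → ℝ} (h : ∀ j, UnifBdd Ω p n (F j) M) (hp : p) : ∃ C > 0, ∀ j, ∀ ω ∈ Ω, ∀ k ≤ n,
      ∀ y, |iteratedDeriv k (F j ω) y| ≤ C * M ω y := by
  obtain ⟨C, hC, h0⟩ := (h 0).2 hp
  obtain ⟨C', hC', h1⟩ := (h 1).2 hp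
  have hM : ∀ ω ∈ Ω, ∀ y, 0 ≤ M ω y := fun ω hω y =>
    nonneg_of_mul_nonneg_right ((abs_nonneg _).trans (h0 ω hω 0 (Nat.zero_le _) y)) hC
  refine ⟨max C C', lt_max_of_lt_left hC, Fin.forall_fin_two.2
    ⟨fun ω hω k hk y => (h0 ω hω k hk y).trans ?_, fun ω hω k hk y => (h1 ω hω k hk y).trans ?_⟩⟩
  · exact mul_le_mul_of_nonneg_right (le_max_left _ _) (hM ω hω y)
  · exact mul_le_mul_of_nonneg_right (le_max_right _ _) (hM ω hω y)

namespace EigenBranch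

variable {g : ℝ → ℝ} (B : EigenBranch g) {ω : ℝ} {N n : ℕ}

section

variable (hω : ω ∈ Ioo 0 B.ω₁)

include hω

theorem rho_mul_intI : rho g ω * intI g ω = eps g ω ^ 2 :=
  div_mul_cancel₀ _ (B.intI_pos hω).ne'

theorem rho_pos : 0 < rho g ω := div_pos (pow_pos (B.eps_pos hω) 2) (B.intI_pos hω)

theorem eps_le_rho : eps g ω ≤ B.K * rho g ω := by
  rw [rho, mul_div_assoc', le_div_iff₀ (B.intI_pos hω)]
  nlinarith [B.intI_le ω hω, B.eps_pos hω]

theorem one_le_rho_div : 1 ≤ B.K ^ 2 * (rho g ω / intI g ω) := by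
  have hI := B.intI_pos hω
  rw [mul_div_assoc', le_div_iff₀ hI, one_mul]
  nlinarith [B.intI_le ω hω, B.eps_le_rho hω, B.one_le]

theorem dOmega_W (j : Fin 2) : dOmega (B.W j) ω = B.Wd j ω :=
  funext fun y => (B.hasDerivAt_W_omega hω j y).deriv

theorem abs_alpha_sub_le :
    |B.α ω - intI g ω / 4| ≤ intI g ω / 4 * (4 * B.K * rho g ω) := by
  have h := B.alpha_sub ω hω
  rw [← B.rho_mul_intI hω] at h
  linarith

theorem abs_omega_mul_alphad_le : |ω * B.αd ω| ≤ B.K * eps g ω := by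
  have hw := hω.1
  rw [abs_mul, abs_of_pos hw]
  refine (mul_le_mul_of_nonneg_left (B.alphad_le ω hω) hw.le).trans_eq ?_
  field_simp

theorem omega_mul_abs_alphad_sub_le :
    ω * |B.αd ω - 1 / 4 * deriv (intI g) ω| ≤ B.K * eps g ω ^ 2 := by
  have hw := hω.1
  have h := B.alphad_sub ω hω
  rw [div_eq_inv_mul, ← one_div] at h
  refine (mul_le_mul_of_nonneg_left h hw.le).trans_eq ?_
  field_simp

theorem iteratedDeriv_W (hN : ContDiffOn ℝ N g (Ioi 0)) (j : Fin 2) {k : ℕ} (hk : k ≤ N + 1)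
    (y : ℝ) : iteratedDeriv k (B.W j ω) y =
      iteratedDeriv k (B.P ω) y + iteratedDeriv k (fun y => sg j * B.D ω y) y := by
  have hk' : (k : WithTop ℕ∞) ≤ (N + 1 : ℕ) := by exact_mod_cast hk
  exact iteratedDeriv_fun_add (((B.unifBdd_P hN).1 ω hω).of_le hk').contDiffAt
    ((contDiff_const.mul ((B.unifBdd_D hN).1 ω hω)).of_le hk').contDiffAt

theorem iteratedDeriv_Wd (hN : ContDiffOn ℝ N g (Ioi 0)) (h1 : 1 ≤ N) (j : Fin 2) {k : ℕ}
    (hk : k ≤ N) (y : ℝ) : iteratedDeriv k (B.Wd j ω) y =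
      iteratedDeriv k (B.Pd ω) y + iteratedDeriv k (fun y => sg j * B.Dd ω y) y := by
  have hk' : (k : WithTop ℕ∞) ≤ N := by exact_mod_cast hk
  exact iteratedDeriv_fun_add (((B.unifBdd_Pd hN h1).1 ω hω).of_le hk').contDiffAt
    ((contDiff_const.mul ((B.unifBdd_Dd hN h1).1 ω hω)).of_le hk').contDiffAt

end

/-- The pair `V₁, V₂`. -/
def V (j : Fin 2) : ℝ → ℝ → ℝ := if j = 0 then B.V₀ else B.V₁

/-- The deviations of `V₁, V₂` from their limits `1 - Q²` and `1`. -/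
def R (j : Fin 2) : ℝ → ℝ → ℝ :=
  if j = 0 then fun ω y => B.V₀ ω y - (1 - cubicQ y ^ 2) else fun ω y => B.V₁ ω y - 1

/-- `∂_ω V_j`. -/
def Vd (j : Fin 2) : ℝ → ℝ → ℝ := if j = 0 then B.Vd₀ else B.Vd₁

theorem dOmega_V (hω : ω ∈ Ioo 0 B.ω₁) : ∀ j, dOmega (B.V j) ω = B.Vd j ω :=
  Fin.forall_fin_two.2 ⟨funext fun y => (B.hasDerivAt_V₀_omega hω y).deriv,
    funext fun y => (B.hasDerivAt_V₁_omega hω y).deriv⟩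

theorem unifBdd_V (hN : ContDiffOn ℝ N g (Ioi 0)) (hn : n ≤ N) :
    ∀ j, B.UB N n (B.V j) B.slow :=
  Fin.forall_fin_two.2 ⟨B.unifBdd_V₀ hN hn, B.unifBdd_V₁ hN hn⟩

theorem unifBdd_R (hN : ContDiffOn ℝ N g (Ioi 0)) (hn : n ≤ N) :
    ∀ j, B.UB N n (B.R j) (fun ω y => eps g ω * (1 + |y|)) :=
  Fin.forall_fin_two.2 ⟨B.unifBdd_V₀_sub hN hn, B.unifBdd_V₁_sub hN hn⟩

theorem unifBdd_dOmega_V (hN : ContDiffOn ℝ N g (Ioi 0)) (hn : n + 1 ≤ N) :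
    ∀ j, B.UB N n (B.Vd j) (fun ω y => 1 / ω * (1 + |y|) * B.slow ω y) :=
  Fin.forall_fin_two.2 ⟨(B.unifBdd_Vd hN hn).1, (B.unifBdd_Vd hN hn).2⟩

/-- Decay of `V₁, V₂` and of their first two derivatives. -/
theorem exists_iteratedDeriv_V_le : ∃ C > 0, ∀ j, ∀ ω ∈ Ioo 0 B.ω₁, ∀ y, ∀ k ∈ Icc 1 2,
    |iteratedDeriv k (B.V j ω) y| ≤
      C * (eps g ω * intI g ω ^ (k - 1) * B.slow ω y + Real.exp (-|y|)) := by
  have hp := B.controlled_four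
  have key : ∀ {F F' F'' : ℝ → ℝ → ℝ}, (∀ ω ∈ Ioo 0 B.ω₁, ∀ y, HasDerivAt (F ω) (F' ω y) y) →
      (∀ ω ∈ Ioo 0 B.ω₁, ∀ y, HasDerivAt (F' ω) (F'' ω y) y) →
      B.UB 4 0 F' (fun ω y => eps g ω * B.slow ω y + Real.exp (-|y|)) →
      B.UB 4 0 F'' (fun ω y => eps g ω * intI g ω * B.slow ω y + Real.exp (-|y|)) →
      ∃ C > 0, ∀ ω ∈ Ioo 0 B.ω₁, ∀ y, ∀ k ∈ Icc 1 2, |iteratedDeriv k (F ω) y| ≤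
        C * (eps g ω * intI g ω ^ (k - 1) * B.slow ω y + Real.exp (-|y|)) := by
    intro F F' F'' h1 h2 b1 b2
    obtain ⟨C, hC, b1⟩ := b1.le hp
    obtain ⟨C', hC', b2⟩ := b2.le hp
    refine ⟨max C C', lt_max_of_lt_left hC, fun ω hω y k hk => ?_⟩
    have hs := B.slow_pos ω y
    have he := B.eps_pos hω
    have hI := B.intI_pos hω
    obtain rfl | rfl : k = 1 ∨ k = 2 := by have := hk.1; have := hk.2; omega
    · rw [iteratedDeriv_one, (h1 ω hω y).deriv, Nat.sub_self, pow_zero, mul_one]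
      exact (b1 ω hω y).trans (mul_le_mul_of_nonneg_right (le_max_left _ _) (by positivity))
    · rw [iteratedDeriv_two_of_hasDerivAt (h1 ω hω) (h2 ω hω),
        show intI g ω ^ (2 - 1) = intI g ω by simp]
      exact (b2 ω hω y).trans (mul_le_mul_of_nonneg_right (le_max_right _ _) (by positivity))
  refine exists_const_forall_fin_two (fun j a b hab h ω hω y k hk => (h ω hω y k hk).trans ?_)
    (Fin.forall_fin_two.2 ⟨key (fun ω hω => B.hasDerivAt_V₀ hω) (fun ω hω => B.hasDerivAt_V₀' hω)
      B.unifBdd_V'.1 B.unifBdd_V''.1, key (fun ω hω => B.hasDerivAt_V₁ hω)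
      (fun ω hω => B.hasDerivAt_V₁' hω) B.unifBdd_V'.2 B.unifBdd_V''.2⟩)
  have hs := B.slow_pos ω y
  have he := B.eps_pos hω
  have hI := B.intI_pos hω
  exact mul_le_mul_of_nonneg_right hab (by positivity)

/-- Decay of the derivatives of `W_j` and of the difference `W₁ - W₂`. -/
theorem exists_iteratedDeriv_W_le (hN : ControlledUpTo g N) : ∃ C > 0, ∀ ω ∈ Ioo 0 B.ω₁, ∀ y,
    (∀ j, ∀ k ∈ Icc 1 (N + 1), |iteratedDeriv k (B.W j ω) y| ≤
      C * (eps g ω * intI g ω ^ (k - 1) * B.slow ω y + eps g ω * B.fast ω y)) ∧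
    ∀ k ≤ N + 1, |iteratedDeriv k (fun z => B.W 0 ω z - B.W 1 ω z) y| ≤
      C * eps g ω * B.fast ω y := by
  obtain ⟨C₁, hC₁, h1⟩ := B.exists_iteratedDeriv_P_le hN
  obtain ⟨C₂, hC₂, h2⟩ := UnifBdd.exists_const_forall
    (fun j => (B.unifBdd_D hN.1).const_mul (sg j)) hN
  obtain ⟨C₃, hC₃, h3⟩ := (((B.unifBdd_D hN.1).const_mul 2).congr
    (F' := fun ω y => B.W 0 ω y - B.W 1 ω y) fun ω hω y => by
      rw [W, W, sg_zero, sg_one]; ring).2 hN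
  refine ⟨C₁ + C₂ + C₃, by positivity, fun ω hω y => ⟨fun j k hk => ?_, fun k hk => ?_⟩⟩
  all_goals
    have hs := B.slow_pos ω y
    have hf := B.fast_pos ω y
    have he := B.eps_pos hω
    have hI := B.intI_pos hω
  · rw [B.iteratedDeriv_W hω hN.1 j hk.2]
    refine (abs_add_le _ _).trans ((add_le_add (h1 k hk.2 hk.1 ω hω y)
      (h2 j ω hω k hk.2 y)).trans ?_)
    have e1 : 0 ≤ eps g ω * intI g ω ^ (k - 1) * B.slow ω y := by positivity
    have e2 : 0 ≤ eps g ω * B.fast ω y := by positivity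
    nlinarith [mul_nonneg hC₂.le e1, mul_nonneg hC₃.le e1, mul_nonneg hC₃.le e2]
  · refine (h3 ω hω k hk y).trans ?_
    rw [mul_assoc]
    exact mul_le_mul_of_nonneg_right (by linarith) (by positivity)

theorem exists_sub_slow_le : ∃ C > 0, ∀ ω ∈ Ioo 0 B.ω₁, ∀ j y, |B.W j ω y - B.slow ω y|
    + |B.V₀ ω y - (1 - cubicQ y ^ 2) * B.slow ω y| + |B.V₁ ω y - B.slow ω y| ≤
      C * rho g ω * B.slow ω y := by
  obtain ⟨C₁, hC₁, h1⟩ := UnifBdd.exists_const_forall B.unifBdd_W_sub_slow B.controlled_four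
  obtain ⟨C₂, hC₂, h2⟩ := B.unifBdd_V_sub_slow.1.le B.controlled_four
  obtain ⟨C₃, hC₃, h3⟩ := B.unifBdd_V_sub_slow.2.le B.controlled_four
  have hK := B.one_le
  refine ⟨(C₁ + C₂ + C₃) * B.K, by positivity, fun ω hω j y => ?_⟩
  have h1' := h1 j ω hω 0 le_rfl y
  rw [iteratedDeriv_zero] at h1'
  have h4 : eps g ω * B.slow ω y ≤ B.K * rho g ω * B.slow ω y :=
    mul_le_mul_of_nonneg_right (B.eps_le_rho hω) (B.slow_pos ω y).le
  have h5 := mul_le_mul_of_nonneg_left h4 (show 0 ≤ C₁ + C₂ + C₃ by positivity)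
  linarith [h2 ω hω y, h3 ω hω y]

theorem abs_deriv_W_add_le (hω : ω ∈ Ioo 0 B.ω₁) (j : Fin 2) {y : ℝ} (hy : 0 < y) :
    |deriv (B.W j ω) y + B.α ω * Real.exp (-B.α ω * y)| ≤
      B.K * rho g ω * intI g ω * Real.exp (-B.α ω * y)
        + 2 * B.K * eps g ω * Real.exp (-kappa (B.α ω) * y) := by
  rw [(B.hasDerivAt_W hω j y).deriv, W', mul_assoc B.K, B.rho_mul_intI hω, add_right_comm]
  have h1 := B.D₁_le ω hω y
  rw [abs_of_pos hy] at h1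
  refine (abs_add_le _ _).trans ((add_le_add (B.P₁_add ω hω y hy.le) ?_).trans_eq
    (b := _ + B.K * eps g ω * Real.exp (-kappa (B.α ω) * y)) (by ring))
  rwa [abs_mul, abs_sg, one_mul]

/-- Since `ε² ≤ ϱ I` and `I ≤ K ε`, the factor `ε ϱ / I` is not smaller than a multiple of `ε`. -/
theorem eps_div_le (hω : ω ∈ Ioo 0 B.ω₁) :
    eps g ω / ω ≤ B.K ^ 2 * (eps g ω * rho g ω / (ω * intI g ω)) := by
  have h1 := mul_le_mul_of_nonneg_left (B.one_le_rho_div hω)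
    (div_nonneg (B.eps_pos hω).le hω.1.le)
  have := (B.intI_pos hω).ne'
  have := hω.1.ne'
  calc eps g ω / ω = eps g ω / ω * 1 := (mul_one _).symm
    _ ≤ _ := h1
    _ = _ := by field_simp

theorem exists_dOmega_W_le : ∃ C > 0, ∀ ω ∈ Ioo 0 B.ω₁, ∀ j y, |dOmega (B.W j) ω y| ≤
    C * (eps g ω * rho g ω / (ω * intI g ω)) * (1 + |y|) * B.slow ω y := by
  obtain ⟨C, hC, h⟩ := UnifBdd.exists_const_forall
    (fun j => B.unifBdd_Wd B.contDiffOn_four (by norm_num) j) B.controlled_four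
  have hK := B.one_le
  refine ⟨C * B.K ^ 2, by positivity, fun ω hω j y => ?_⟩
  have h1 := h j ω hω 0 (by norm_num) y
  rw [iteratedDeriv_zero, ← B.dOmega_W hω] at h1
  refine h1.trans ?_
  have h2 := mul_le_mul_of_nonneg_right (mul_le_mul_of_nonneg_right (mul_le_mul_of_nonneg_left
    (B.eps_div_le hω) hC.le) (show 0 ≤ 1 + |y| by positivity)) (B.slow_pos ω y).le
  linarith

theorem exists_dOmega_V_le : ∃ C > 0, ∀ ω ∈ Ioo 0 B.ω₁, ∀ j y,
    |dOmega (B.V j) ω y| + |deriv (dOmega (B.V j) ω) y| ≤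
      C / ω * (eps g ω * rho g ω / intI g ω + 1) * (1 + |y|) * B.slow ω y := by
  obtain ⟨C, hC, h⟩ := UnifBdd.exists_const_forall
    (B.unifBdd_dOmega_V B.contDiffOn_four (n := 1) (by norm_num)) B.controlled_four
  refine ⟨2 * C, by positivity, fun ω hω j y => ?_⟩
  have h1 := h j ω hω 0 (by norm_num) y
  have h2 := h j ω hω 1 (by norm_num) y
  rw [iteratedDeriv_zero] at h1
  rw [iteratedDeriv_one] at h2
  rw [B.dOmega_V hω]
  have hs := B.slow_pos ω y
  have hw := hω.1
  have hr := B.rho_pos hω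
  have he := B.eps_pos hω
  have hI := B.intI_pos hω
  refine (add_le_add h1 h2).trans ?_
  have e : 2 * C / ω * (eps g ω * rho g ω / intI g ω + 1) * (1 + |y|) * B.slow ω y =
      2 * C / ω * (eps g ω * rho g ω / intI g ω) * (1 + |y|) * B.slow ω y
      + (C * (1 / ω * (1 + |y|) * B.slow ω y) + C * (1 / ω * (1 + |y|) * B.slow ω y)) := by ring
  rw [e]
  exact le_add_of_nonneg_left (by positivity)

theorem exists_iteratedDeriv_dOmega_W_le (hN : ControlledUpTo g N) (h1 : 1 ≤ N) :
    ∃ C > 0, ∀ ω ∈ Ioo 0 B.ω₁, ∀ j y, ∀ k ∈ Icc 1 N,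
      |iteratedDeriv k (dOmega (B.W j) ω) y| ≤ C * (eps g ω ^ k / ω) * (1 + |y|) * B.slow ω y
        + C * (eps g ω / ω) * (1 + |y|) * B.fast ω y ∧
      |iteratedDeriv k (dOmega (B.W j) ω) y| ≤
        C * (eps g ω / ω) * (1 + |y|) * B.slow ω y := by
  obtain ⟨C₁, hC₁, b1⟩ := B.exists_iteratedDeriv_Pd_le hN
  obtain ⟨C₂, hC₂, b2⟩ := UnifBdd.exists_const_forall
    (fun j => (B.unifBdd_Dd hN.1 h1).const_mul (sg j)) hN
  obtain ⟨C₃, hC₃, b3⟩ := UnifBdd.exists_const_forall (B.unifBdd_Wd hN.1 h1) hN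
  refine ⟨C₁ + C₂ + C₃, by positivity, fun ω hω j y k hk => ?_⟩
  rw [B.dOmega_W hω]
  have hw := hω.1
  have hs := B.slow_pos ω y
  have hf := B.fast_pos ω y
  have he := B.eps_pos hω
  constructor
  · rw [B.iteratedDeriv_Wd hω hN.1 h1 j hk.2]
    refine (abs_add_le _ _).trans ((add_le_add (b1 k hk.2 hk.1 ω hω y)
      (b2 j ω hω k hk.2 y)).trans ?_)
    have e1 : 0 ≤ (C₂ + C₃) * (eps g ω ^ k / ω * (1 + |y|) * B.slow ω y) := by positivity
    have e2 : 0 ≤ C₃ * (eps g ω / ω * (1 + |y|) * B.fast ω y) := by positivity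
    linarith
  · refine (b3 j ω hω k hk.2 y).trans ?_
    have e1 : 0 ≤ (C₁ + C₂) * (eps g ω / ω * (1 + |y|) * B.slow ω y) := by positivity
    linarith

end EigenBranch

end

end InternalMode

theorem proposition2 (g : ℝ → ℝ) (h1 : HypH1 g) (h2 : HypH2 g) :
    ∃ (ω₁ : ℝ) (α : ℝ → ℝ) (W V S Wt R Vt : Fin 2 → ℝ → ℝ → ℝ),
      0 < ω₁ ∧ ContDiffOn ℝ 1 α (Ioo 0 ω₁) ∧
      (∀ ω ∈ Ioo 0 ω₁, 0 < α ω ∧ α ω < 1) ∧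
      -- regularity in `y` (the index `0` stands for `j = 1`, the index `1` for `j = 2`)
      (∀ n : ℕ, ContDiffOn ℝ n g (Ioi 0) → ∀ ω ∈ Ioo 0 ω₁, ∀ j,
        ContDiff ℝ (n + 1 : ℕ) (W j ω) ∧ ContDiff ℝ (n + 1 : ℕ) (S j ω) ∧
        ContDiff ℝ (n + 1 : ℕ) (Wt j ω) ∧ ContDiff ℝ n (dOmega (W j) ω)) ∧
      (∀ ω ∈ Ioo 0 ω₁, ∀ j, ContDiff ℝ 2 (V j ω) ∧ ContDiff ℝ 4 (R j ω) ∧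
        ContDiff ℝ 2 (Vt j ω) ∧ ContDiff ℝ 1 (dOmega (V j) ω)) ∧
      -- differentiability in `ω`
      (∀ ω ∈ Ioo 0 ω₁, DifferentiableAt ℝ (intI g) ω ∧
        ∀ j y, DifferentiableAt ℝ (fun w => W j w y) ω ∧
          DifferentiableAt ℝ (fun w => V j w y) ω) ∧
      -- expansion of the eigenvalue
      (∃ C > 0, ∀ ω ∈ Ioo 0 ω₁,
        |α ω - intI g ω / 4| ≤ intI g ω / 4 * (C * rho g ω)) ∧
      -- solutions to the spectral problems, with `λ = 1 - α²`
      (∀ ω ∈ Ioo 0 ω₁, ∀ y,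
        opMPlus g ω (W 0 ω) y = (1 - α ω ^ 2) * W 1 ω y ∧
        opMMinus g ω (W 1 ω) y = (1 - α ω ^ 2) * W 0 ω y ∧
        V 0 ω y = opSStar g ω (opSStar g ω (W 0 ω)) y ∧
        V 1 ω y = (1 - α ω ^ 2)⁻¹ * opLPlus g ω (V 0 ω) y ∧
        opLPlus g ω (V 0 ω) y = (1 - α ω ^ 2) * V 1 ω y ∧
        opLMinus g ω (V 1 ω) y = (1 - α ω ^ 2) * V 0 ω y) ∧
      -- expansion of the eigenfunctions
      (∀ ω ∈ Ioo 0 ω₁, ∀ y,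
        (∀ j, W j ω y = 1 + S j ω y + Wt j ω y) ∧
        V 0 ω y = 1 - cubicQ y ^ 2 + R 0 ω y + Vt 0 ω y ∧
        V 1 ω y = 1 + R 1 ω y + Vt 1 ω y) ∧
      (∃ C > 0, ∀ ω ∈ Ioo 0 ω₁, ∀ j y,
        (∀ k ≤ 4, |iteratedDeriv k (R j ω) y| ≤ C * eps g ω * (1 + |y|)) ∧
        (∀ k ≤ 2, |iteratedDeriv k (Vt j ω) y| ≤ C * eps g ω ^ 2 * (1 + y ^ 2))) ∧
      (∀ N ≥ 4, ControlledUpTo g N → ∃ C > 0, ∀ ω ∈ Ioo 0 ω₁, ∀ j y, ∀ k ≤ N + 1,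
        |iteratedDeriv k (S j ω) y| ≤ C * eps g ω * (1 + |y|) ∧
        |iteratedDeriv k (Wt j ω) y| ≤ C * eps g ω ^ 2 * (1 + y ^ 2)) ∧
      -- decay properties of the eigenfunctions
      (∃ C > 0, ∀ ω ∈ Ioo 0 ω₁, ∀ j y,
        |W j ω y| ≤ C * Real.exp (-α ω * |y|) ∧
        |V j ω y| ≤ C * Real.exp (-α ω * |y|) ∧
        (∀ k ∈ Icc 1 2, |iteratedDeriv k (V j ω) y| ≤
          C * (eps g ω * intI g ω ^ (k - 1) * Real.exp (-α ω * |y|) + Real.exp (-|y|)))) ∧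
      (∀ N ≥ 4, ControlledUpTo g N → ∃ C > 0, ∀ ω ∈ Ioo 0 ω₁, ∀ y,
        (∀ j, ∀ k ∈ Icc 1 (N + 1), |iteratedDeriv k (W j ω) y| ≤
          C * (eps g ω * intI g ω ^ (k - 1) * Real.exp (-α ω * |y|)
            + eps g ω * Real.exp (-kappa (α ω) * |y|))) ∧
        (∀ k ≤ N + 1, |iteratedDeriv k (fun z => W 0 ω z - W 1 ω z) y| ≤
          C * eps g ω * Real.exp (-kappa (α ω) * |y|))) ∧
      -- asymptotics of the eigenfunctions
      (∃ C > 0, ∀ ω ∈ Ioo 0 ω₁,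
        (∀ j y, |W j ω y - Real.exp (-α ω * |y|)|
            + |V 0 ω y - (1 - cubicQ y ^ 2) * Real.exp (-α ω * |y|)|
            + |V 1 ω y - Real.exp (-α ω * |y|)| ≤ C * rho g ω * Real.exp (-α ω * |y|)) ∧
        (∀ j, ∀ y > 0, |deriv (W j ω) y + α ω * Real.exp (-α ω * y)| ≤
          C * rho g ω * intI g ω * Real.exp (-α ω * y)
            + C * eps g ω * Real.exp (-kappa (α ω) * y)) ∧
        Integrable (fun y => W 0 ω y * W 1 ω y) ∧
        Integrable (fun y => V 0 ω y * V 1 ω y) ∧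
        |(∫ y, W 0 ω y * W 1 ω y) - 1 / α ω| + |(∫ y, V 0 ω y * V 1 ω y) - 1 / α ω| ≤
          C * (rho g ω / intI g ω)) ∧
      -- derivatives with respect to `ω`
      (∃ C > 0, ∀ ω ∈ Ioo 0 ω₁,
        |ω * deriv α ω| ≤ C * eps g ω ∧
        ω * |deriv α ω - 1 / 4 * deriv (intI g) ω| ≤ C * eps g ω ^ 2 ∧
        ∀ j y,
          |dOmega (W j) ω y| ≤
            C * (eps g ω * rho g ω / (ω * intI g ω)) * (1 + |y|) * Real.exp (-α ω * |y|)
              + C * (eps g ω / ω) * (1 + |y|) * Real.exp (-kappa (α ω) * |y|) ∧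
          |dOmega (W j) ω y| ≤
            C * (eps g ω * rho g ω / (ω * intI g ω)) * (1 + |y|) * Real.exp (-α ω * |y|) ∧
          |dOmega (V j) ω y| + |deriv (dOmega (V j) ω) y| ≤
            C / ω * (eps g ω * rho g ω / intI g ω + 1) * (1 + |y|)
              * Real.exp (-α ω * |y|)) ∧
      (∀ N ≥ 4, ControlledUpTo g N → ∃ C > 0, ∀ ω ∈ Ioo 0 ω₁, ∀ j y, ∀ k ∈ Icc 1 N,
        |iteratedDeriv k (dOmega (W j) ω) y| ≤
          C * (eps g ω ^ k / ω) * (1 + |y|) * Real.exp (-α ω * |y|)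
            + C * (eps g ω / ω) * (1 + |y|) * Real.exp (-kappa (α ω) * |y|) ∧
        |iteratedDeriv k (dOmega (W j) ω) y| ≤
          C * (eps g ω / ω) * (1 + |y|) * Real.exp (-α ω * |y|)) := by
  obtain ⟨B⟩ := exists_eigenBranch h1 h2
  have hK := B.one_le
  have hp := B.controlled_four
  have hN := hp.1
  -- all regularity statements follow from the one of order `max n 5`
  have hmax : ∀ n : ℕ, ContDiffOn ℝ n g (Ioi 0) → ContDiffOn ℝ (max n 5 : ℕ) g (Ioi 0) := by
    intro n hn
    rcases max_choice n 5 with h | h <;> rw [h]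
    exacts [hn, h1.contDiffOn_pos]
  have hz : ∀ k y, iteratedDeriv k (fun _ : ℝ => (0 : ℝ)) y = 0 := fun k y => by
    rw [iteratedDeriv_const, ite_self]
  refine ⟨B.ω₁, B.α, B.W, B.V, fun j ω y => B.W j ω y - 1, fun _ _ _ => 0, B.R, fun _ _ _ => 0,
    B.H.pos, ?_, fun ω hω => ⟨B.alpha_pos hω, (B.alpha_le ω hω).trans_lt (by norm_num)⟩,
    fun n hn ω hω j => ?_, fun ω hω j => ?_, fun ω hω => ?_, ?_, fun ω hω y => ?_,
    fun ω hω y => ?_, ?_, fun N _ hN' => ?_, ?_, fun N _ hN' => ?_, ?_, ?_, fun N hN4 hN' => ?_⟩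
  · -- `α` is of class `C¹`
    rw [contDiffOn_one_iff_derivWithin isOpen_Ioo.uniqueDiffOn]
    refine ⟨fun ω hω => (B.hasDerivAt_alpha ω hω).differentiableAt.differentiableWithinAt,
      B.continuousOn_alphad.congr fun ω hω => ?_⟩
    rw [derivWithin_of_isOpen isOpen_Ioo hω, (B.hasDerivAt_alpha ω hω).deriv]
  · have h5 := hmax n hn
    have hW : ContDiff ℝ (n + 1 : ℕ) (B.W j ω) :=
      (B.unifBdd_W h5 j).of_le (by omega) |>.1 ω hω
    rw [B.dOmega_W hω]
    exact ⟨hW, hW.sub contDiff_const, contDiff_const,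
      ((B.unifBdd_Wd h5 (by omega) j).of_le (by omega)).1 ω hω⟩
  · rw [B.dOmega_V hω]
    exact ⟨(B.unifBdd_V hN (n := 2) (by norm_num) j).1 ω hω,
      (B.unifBdd_R hN (n := 4) le_rfl j).1 ω hω, contDiff_const,
      by exact_mod_cast (B.unifBdd_dOmega_V hN (n := 1) (by norm_num) j).1 ω hω⟩
  · refine ⟨(B.H.hasDerivAt_intI hω).differentiableAt, Fin.forall_fin_two.2 ⟨fun y => ?_,
      fun y => ?_⟩⟩
    exacts [⟨(B.hasDerivAt_W_omega hω 0 y).differentiableAt,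
        (B.hasDerivAt_V₀_omega hω y).differentiableAt⟩,
      ⟨(B.hasDerivAt_W_omega hω 1 y).differentiableAt,
        (B.hasDerivAt_V₁_omega hω y).differentiableAt⟩]
  · exact ⟨4 * B.K, by positivity, fun ω hω => B.abs_alpha_sub_le hω⟩
  · have hV := B.spectral_V hω y
    refine ⟨(B.spectral_W hω y).1, (B.spectral_W hω y).2, B.V₀_eq_opSStar hω y, ?_, hV⟩
    refine (eq_inv_mul_iff_mul_eq₀ (B.lam_pos hω).ne').2 hV.1.symm
  · refine ⟨fun j => by ring, ?_, ?_⟩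
    · change B.V₀ ω y = 1 - cubicQ y ^ 2 + (B.V₀ ω y - (1 - cubicQ y ^ 2)) + 0
      ring
    · change B.V₁ ω y = 1 + (B.V₁ ω y - 1) + 0
      ring
  · obtain ⟨C, hC, h⟩ := UnifBdd.exists_const_forall (B.unifBdd_R hN le_rfl) hp
    refine ⟨C, hC, fun ω hω j y => ⟨fun k hk => (h j ω hω k hk y).trans_eq (mul_assoc _ _ _).symm,
      fun k _ => ?_⟩⟩
    rw [hz, abs_zero]
    positivity
  · obtain ⟨C, hC, h⟩ := UnifBdd.exists_const_forall (B.unifBdd_W_sub_one hN'.1) hN'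
    refine ⟨C, hC, fun ω hω j y k hk => ⟨(h j ω hω k hk y).trans_eq (mul_assoc _ _ _).symm, ?_⟩⟩
    rw [hz, abs_zero]
    positivity
  · obtain ⟨C₁, hC₁, b1⟩ := UnifBdd.exists_const_forall (B.unifBdd_W hN) hp
    obtain ⟨C₂, hC₂, b2⟩ := UnifBdd.exists_const_forall (B.unifBdd_V hN le_rfl) hp
    obtain ⟨C₃, hC₃, b3⟩ := B.exists_iteratedDeriv_V_le
    refine ⟨C₁ + C₂ + C₃, by positivity, fun ω hω j y => ⟨?_, ?_, fun k hk => ?_⟩⟩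
    all_goals
      have hs := B.slow_pos ω y
      have he := B.eps_pos hω
      have hI := B.intI_pos hω
    · have := b1 j ω hω 0 (Nat.zero_le _) y
      rw [iteratedDeriv_zero] at this
      exact this.trans (mul_le_mul_of_nonneg_right (by linarith) hs.le)
    · have := b2 j ω hω 0 (Nat.zero_le _) y
      rw [iteratedDeriv_zero] at this
      exact this.trans (mul_le_mul_of_nonneg_right (by linarith) hs.le)
    · refine (b3 j ω hω y k hk).trans (mul_le_mul_of_nonneg_right (by linarith) ?_)
      positivity
  · exact B.exists_iteratedDeriv_W_le hN'
  · obtain ⟨C₁, hC₁, b1⟩ := B.exists_sub_slow_le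
    obtain ⟨C₂, hC₂, b2⟩ := B.exists_integral_le
    refine ⟨C₁ + 2 * B.K + C₂, by positivity, fun ω hω => ?_⟩
    have hr := B.rho_pos hω
    have he := B.eps_pos hω
    have hI := B.intI_pos hω
    refine ⟨fun j y => (b1 ω hω j y).trans ?_, fun j y hy =>
      (B.abs_deriv_W_add_le hω j hy).trans ?_, (b2 ω hω).1, (b2 ω hω).2.1,
      (b2 ω hω).2.2.trans ?_⟩
    · exact mul_le_mul_of_nonneg_right (mul_le_mul_of_nonneg_right (by linarith) hr.le)
        (B.slow_pos ω y).le
    · gcongr <;> linarith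
    · exact mul_le_mul_of_nonneg_right (by linarith) (by positivity)
  · obtain ⟨C₁, hC₁, b1⟩ := B.exists_dOmega_W_le
    obtain ⟨C₂, hC₂, b2⟩ := B.exists_dOmega_V_le
    refine ⟨B.K + C₁ + C₂, by positivity, fun ω hω => ?_⟩
    have hr := B.rho_pos hω
    have he := B.eps_pos hω
    have hI := B.intI_pos hω
    have hw := hω.1
    rw [(B.hasDerivAt_alpha ω hω).deriv]
    refine ⟨(B.abs_omega_mul_alphad_le hω).trans ?_,
      (B.omega_mul_abs_alphad_sub_le hω).trans ?_, fun j y => ?_⟩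
    · exact mul_le_mul_of_nonneg_right (by linarith) he.le
    · exact mul_le_mul_of_nonneg_right (by linarith) (by positivity)
    · have hW : |dOmega (B.W j) ω y| ≤ (B.K + C₁ + C₂) * (eps g ω * rho g ω / (ω * intI g ω)) *
          (1 + |y|) * Real.exp (-B.α ω * |y|) := by
        refine (b1 ω hω j y).trans ?_
        rw [EigenBranch.slow]
        gcongr
        linarith
      refine ⟨hW.trans (le_add_of_nonneg_right (by positivity)), hW, (b2 ω hω j y).trans ?_⟩
      rw [EigenBranch.slow]
      gcongr
      linarith
  · exact B.exists_iteratedDeriv_dOmega_W_le hN' (by omega)
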